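/- **Setting.** Let $P$ be a closed simplicial surface embedded in $\mathbb R^3$: a finite geometric simplicial complex in which the faces at every vertex form a cycle of triangles, and in which no two distinct triangles sharing an edge are coplanar. Let $v$ be a vertex of $P$, and let $v_1,\dots,v_n$ ($n\ge 3$, indices mod $n$) be its neighbours in one of the two cyclic orders, so that the triangles of $P$ at $v$ are $f_k=vv_kv_{k+1}$; the chosen cyclic order is the orientation of the star of $v$. Let $\alpha_k=\angle v_kvv_{k+1}$ and $$K(v)=2\pi-\sum_{k=1}^n\alpha_k ,\qquad \mathbf n_k=\frac{(v_k-v)\times(v_{k+1}-v)}{\|(v_k-v)\times(v_{k+1}-v)\|}\in S^2 .$$ The Gauss image $g(v)$ is the oriented closed spherical polygon formed by the shorter great circle arcs from $\mathbf n_k$ to $\mathbf n_{k+1}$. **Winding numbers.** Consider all embedded oriented vertex stars $S$: an apex with $n\ge3$ distinct neighbours in cyclic order such that the $n$ triangles are nondegenerate and any two of them meet only in their common vertex or edge (adjacent triangles may be coplanar). Gauss images $g(S)$ are defined as above. A winding number assigns to every such $S$ and every $\xi\in S^2\setminus g(S)$ an integer $w(g(S),\xi)$ such that 1. $w(g(S),\cdot)$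 is constant on each connected component of $S^2\setminus g(S)$; 2. $w(g(S),\xi)$ decreases by $1$ for each arc of $g(S)$ that $\xi$ crosses from left to right, and increases by $1$ for each arc crossed from right to left (for transversal crossings away from the vertices of $g(S)$); 3. $w(g(S),\xi)$ does not change under continuous deformations of $S$ through embedded stars with the same number of triangles, as long as $\xi$ never lies on $g(S)$; 4. if the star determines the boundary of a convex cone, then $w(g(S),\xi)=1$ whenever the component of $S^2\setminus g(S)$ containing $\xi$ has area less than $2\pi$, and $w(g(S),\xi)=0$ whenever that component has area larger than $2\pi$. **Theorem.** There is exactly one winding number $w$ with these properties. For every $P$ and $v$ as above, and either orientation of the star of $v$, the function $w(g(v),\cdot)$ is integrable on $S^2\setminus g(v)$ with respect to the surface measure, and the discrete Gaussian curvature equals the algebraic area of the Gauss image: $$K(v)=2\pi-\sum_{f\sim v}\alpha_f(v)=\int_{S^2\setminus g(v)}w(g(v),\xi)\,d\xi .$$ -/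

import Mathlib

open MeasureTheory Topology

namespace PolyhedralSurface

noncomputable section

/-- Euclidean three-space. -/
abbrev E3 : Type := EuclideanSpace ℝ (Fin 3)

/-- The unit sphere in Euclidean three-space, as a set of vectors. -/
abbrev unitSphere : Set E3 := Metric.sphere (0 : E3) 1

/-- The standard surface measure of the unit sphere (of total mass `4π`). -/
abbrev sphereArea : Measure (Metric.sphere (0 : E3) 1) := (volume : Measure E3).toSphere

/-- The vector product of Euclidean three-space. -/
def cross (a b : E3) : E3 := WithLp.toLp 2 (crossProduct a.ofLp b.ofLp)

/-- The shorter great circle arc between two unit vectors `a ≠ -b` (a single point if `a = b`):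
the unit vectors in the convex cone spanned by `a` and `b`. -/
def greatArc (a b : E3) : Set E3 :=
  {ξ | ‖ξ‖ = 1 ∧ ∃ s t : ℝ, 0 ≤ s ∧ 0 ≤ t ∧ ξ = s • a + t • b}

/-! ### Embedded vertex stars -/

/-- An embedded polyhedral vertex star with `n` triangles: an apex together with its neighbours in
cyclic order (the indices live in `Fin n`, where `k + 1` is the cyclic successor of `k`), such that
the triangles `apex, nbr k, nbr (k + 1)` are nondegenerate and any two of them meet only in
their common vertex or their common edge. The cyclic order is an orientation of the star.
Triangles that share an edge are allowed to be coplanar (but they do not overlap), because this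
happens during deformations. -/
structure EmbeddedStar (n : ℕ) [NeZero n] where
  apex : E3
  nbr : Fin n → E3
  three_le : 3 ≤ n
  nbr_injective : Function.Injective nbr
  indep : ∀ k, AffineIndependent ℝ ![apex, nbr k, nbr (k + 1)]
  inter_subset : ∀ j k,
    convexHull ℝ {apex, nbr j, nbr (j + 1)} ∩ convexHull ℝ {apex, nbr k, nbr (k + 1)} ⊆
      convexHull ℝ (({apex, nbr j, nbr (j + 1)} : Set E3) ∩ {apex, nbr k, nbr (k + 1)})

namespace EmbeddedStar

variable {n : ℕ} [NeZero n] (S : EmbeddedStar n)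

/-- The discrete Gaussian curvature of a star: `2π` minus the sum of the angles at the apex. -/
def angleDeficit : ℝ :=
  2 * Real.pi - ∑ k, EuclideanGeometry.angle (S.nbr k) S.apex (S.nbr (k + 1))

/-- The unit normal of the `k`-th triangle, on the side from which `apex, nbr k, nbr (k + 1)` run
counterclockwise. -/
def normal (k : Fin n) : E3 :=
  ‖cross (S.nbr k - S.apex) (S.nbr (k + 1) - S.apex)‖⁻¹ •
    cross (S.nbr k - S.apex) (S.nbr (k + 1) - S.apex)

/-- The `k`-th arc of the Gauss image, running from the `k`-th to the next normal. -/
def arc (k : Fin n) : Set E3 := greatArc (S.normal k) (S.normal (k + 1))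

/-- The (trace of the) Gauss image of the star, a closed spherical polygon. -/
def gaussImage : Set E3 := ⋃ k, S.arc k

/-- The union of the cones from the apex over the triangles of the star. -/
def cone : Set E3 :=
  ⋃ k, {x | ∃ s t : ℝ, 0 ≤ s ∧ 0 ≤ t ∧
    x = S.apex + s • (S.nbr k - S.apex) + t • (S.nbr (k + 1) - S.apex)}

/-- The apex is a convex corner: the star determines the boundary of a convex cone. -/
def IsConvex : Prop := ∃ C : Set E3, Convex ℝ C ∧ frontier C = S.cone

/-- The connected component of `ξ` in the complement of the Gauss image in the sphere. -/
def component (ξ : E3) : Set E3 := connectedComponentIn (unitSphere \ S.gaussImage) ξ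

/-- The area of the component of the complement of the Gauss image that contains `ξ`. -/
def componentArea (ξ : E3) : ENNReal :=
  sphereArea {η : Metric.sphere (0 : E3) 1 | (η : E3) ∈ S.component ξ}

open Classical in
/-- The signed number of arcs of the Gauss image, counted with multiplicity, which one crosses from
right to left when passing through the point `p` of the sphere in the tangent direction `u`. The
left side of an arc from `a` to `b` is the side into which `a × b` points. -/
def crossingNumber (p u : E3) : ℤ :=
  ∑ k, if p ∈ S.arc k then
    ((SignType.sign (inner ℝ u (cross (S.normal k) (S.normal (k + 1)))) : SignType) : ℤ) else 0

end EmbeddedStar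

/-- The defining properties of the winding numbers `w n S ξ` of the Gauss images of embedded
vertex stars `S` around unit vectors `ξ` that do not lie on the Gauss image. (The values of `w` at
all other `ξ` are irrelevant.) -/
structure IsWindingNumber (w : ∀ (n : ℕ) [NeZero n], EmbeddedStar n → E3 → ℤ) : Prop where
  /-- The winding number is constant on the connected components of the complement. -/
  const_on_components : ∀ (n : ℕ) [NeZero n] (S : EmbeddedStar n) (ξ η : E3),
    ξ ∈ unitSphere \ S.gaussImage → η ∈ S.component ξ → w n S η = w n S ξ
  /-- It decreases by one for every arc that is crossed from left to right, and so increases by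
  one for every arc crossed from right to left. Here the crossing takes place at a point `p` that is
  not a vertex of the Gauss image, along the great circle through `p` in a direction `u`
  transversal to the arcs through `p`. -/
  crossing : ∀ (n : ℕ) [NeZero n] (S : EmbeddedStar n) (p u : E3),
    ‖p‖ = 1 → ‖u‖ = 1 → inner ℝ p u = 0 → (∀ k, p ≠ S.normal k) →
    (∀ k, p ∈ S.arc k → inner ℝ u (cross (S.normal k) (S.normal (k + 1))) ≠ 0) →
    ∀ᶠ t : ℝ in 𝓝[>] 0,
      w n S (Real.cos t • p + Real.sin t • u) =
        w n S (Real.cos t • p - Real.sin t • u) + S.crossingNumber p u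
  /-- It is invariant under continuous deformations during which `ξ` never lies on the Gauss
  image. -/
  deformation : ∀ (n : ℕ) [NeZero n] (S : unitInterval → EmbeddedStar n),
    Continuous (fun t => (S t).apex) → (∀ k, Continuous fun t => (S t).nbr k) →
    ∀ ξ ∈ unitSphere, (∀ t, ξ ∉ (S t).gaussImage) → w n (S 0) ξ = w n (S 1) ξ
  /-- For a convex corner, it is `1` on the component of area less than `2π` and `0` on the
  component of area larger than `2π`. -/
  convex : ∀ (n : ℕ) [NeZero n] (S : EmbeddedStar n), S.IsConvex →
    ∀ ξ ∈ unitSphere \ S.gaussImage,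
      (S.componentArea ξ < ENNReal.ofReal (2 * Real.pi) → w n S ξ = 1) ∧
      (ENNReal.ofReal (2 * Real.pi) < S.componentArea ξ → w n S ξ = 0)

/-- The algebraic area of a Gauss image: the integral of the winding number over the sphere (minus
the Gauss image, where the winding number is not defined; this is a null set). -/
def algebraicArea (w : ∀ (n : ℕ) [NeZero n], EmbeddedStar n → E3 → ℤ)
    {n : ℕ} [NeZero n] (S : EmbeddedStar n) : ℝ :=
  ∫ ξ in {ξ : Metric.sphere (0 : E3) 1 | (ξ : E3) ∉ S.gaussImage}, (w n S ξ : ℝ) ∂sphereArea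

/-! ### Closed simplicial surfaces -/

/-- `r` lists the neighbours of the vertex `v` of `P` in a cyclic order such that the faces of `P`
at `v` are exactly `{v}`, the edges `{v, r k}` and the triangles `{v, r k, r (k + 1)}`. -/
structure IsVertexCycle (P : Geometry.SimplicialComplex ℝ E3) (v : E3) {n : ℕ} [NeZero n]
    (r : Fin n → E3) : Prop where
  three_le : 3 ≤ n
  injective : Function.Injective r
  ne_apex : ∀ k, r k ≠ v
  mem_faces_iff : ∀ s : Finset E3, v ∈ s →
    (s ∈ P.faces ↔ (s : Set E3) = {v} ∨ (∃ k, (s : Set E3) = {v, r k}) ∨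
      ∃ k, (s : Set E3) = {v, r k, r (k + 1)})

/-- `P` is a closed simplicial surface embedded in Euclidean three-space: a finite geometric
simplicial complex in which the faces at every vertex form a cycle of triangles, and in which no two
distinct triangles that share an edge are coplanar. -/
structure IsClosedSimplicialSurface (P : Geometry.SimplicialComplex ℝ E3) : Prop where
  finite : P.faces.Finite
  exists_cycle : ∀ v ∈ P.vertices, ∃ (n : ℕ) (_ : NeZero n) (r : Fin n → E3), IsVertexCycle P v r
  not_coplanar : ∀ f ∈ P.faces, ∀ g ∈ P.faces, f.card = 3 → g.card = 3 → f ≠ g →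
    ((f : Set E3) ∩ g).ncard = 2 → ¬ Coplanar ℝ ((f : Set E3) ∪ g)

theorem IsVertexCycle.triangle_mem {P : Geometry.SimplicialComplex ℝ E3} {v : E3} {n : ℕ}
    [NeZero n] {r : Fin n → E3} (h : IsVertexCycle P v r) (k : Fin n) (s : Finset E3)
    (hs : (s : Set E3) = {v, r k, r (k + 1)}) : s ∈ P.faces := by
  have hv : v ∈ s := by
    rw [← Finset.mem_coe, hs]
    exact Set.mem_insert _ _
  exact (h.mem_faces_iff s hv).2 (Or.inr (Or.inr ⟨k, hs⟩))

theorem IsVertexCycle.affineIndependent {P : Geometry.SimplicialComplex ℝ E3} {v : E3} {n : ℕ}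
    [NeZero n] {r : Fin n → E3} (h : IsVertexCycle P v r) (k : Fin n) :
    AffineIndependent ℝ ![v, r k, r (k + 1)] := by
  classical
  have hk : k ≠ k + 1 := by
    have := h.three_le
    obtain ⟨m, rfl⟩ : ∃ m, n = m + 2 := ⟨n - 2, by omega⟩
    intro e
    exact one_ne_zero (left_eq_add.1 e)
  have hr : r k ≠ r (k + 1) := fun e => hk (h.injective e)
  have h1 := h.ne_apex k
  have h2 := h.ne_apex (k + 1)
  generalize hb : r k = b at *
  generalize hc : r (k + 1) = c at *
  have hf : ({v, b, c} : Finset E3) ∈ P.faces := h.triangle_mem k _ (by simp [hb, hc])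
  have hinj : Function.Injective ![v, b, c] := by
    intro i j hij
    fin_cases i <;> fin_cases j <;> first | rfl | (exfalso; simp_all [eq_comm])
  have hmem : ∀ i, ![v, b, c] i ∈ ({v, b, c} : Finset E3) := by
    intro i
    fin_cases i <;> simp
  exact (P.indep hf).comp_embedding
    ⟨fun i => (⟨![v, b, c] i, hmem i⟩ : ({v, b, c} : Finset E3)),
      fun i j e => hinj (congrArg Subtype.val e)⟩

/-- The star of a vertex of an embedded surface, oriented by the cyclic order `r` of the
neighbours. -/
def IsVertexCycle.star {P : Geometry.SimplicialComplex ℝ E3} {v : E3} {n : ℕ} [NeZero n]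
    {r : Fin n → E3} (h : IsVertexCycle P v r) : EmbeddedStar n where
  apex := v
  nbr := r
  three_le := h.three_le
  nbr_injective := h.injective
  indep := h.affineIndependent
  inter_subset j k := by
    classical
    simpa using P.inter_subset_convexHull
      (h.triangle_mem j {v, r j, r (j + 1)} (by simp))
      (h.triangle_mem k {v, r k, r (k + 1)} (by simp))

end

end PolyhedralSurface

/-! The proof rests on an explicit formula for the winding number. The argument of `solid z a b` is
half the signed area of the spherical triangle with vertices `z`, `a`, `b`. Seen from a base point,
the Gauss image with vertices N_k is a fan of such triangles, and `wind` is (2π - Σ α_k - A(x)) /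
4π, where A(x) = 2 Σ arg solid(-x, N_k, N_{k+1}).

The arc from N_k to N_{k+1} lies in the plane orthogonal to the edge between the two faces. This
edge is parallel along the arc, and at a vertex of the Gauss image one edge turns into the next by
the angle of the face. Hence the holonomy of the Gauss image is governed by the angle sum.
`prod_solid_sq_mul_prod_turn` states this modulo 2π as an algebraic identity, so that 2 `wind` is an
integer. Off the Gauss image `wind` is continuous in the point and in the star, hence locally
constant; the branch cut of the argument makes it jump by one at each arc.

The integral needs no computation of areas. Reflection in the plane of two normals conjugates the
number `solid`, so every argument integrates to zero over the sphere (`integral_arg_solid`). Only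
the constant (2π - Σ α_k) / 4π survives, and the sphere has area 4π.

It remains to show that `wind` is an integer, that it has the right values at convex corners, and
that winding numbers are unique. The first and the last follow from `exists_convex_eq`: a quantity
without jumps that is invariant under deformations is determined by its values at convex corners. It
is applied to the fractional part of `wind` and to the difference of two winding numbers. On a
single star such a quantity is constant, since generic points are joined by great circles that avoid
the vertices of the Gauss image. And every embedded star can be deformed, with its number of
triangles, to the boundary of a convex cone (`IsStar.exists_joinedIn_convex`).

This deformation is found by induction. In general position the edge directions form a simple
spherical polygon, and it has an ear. The tip of the ear is pushed into the plane of its neighbours;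
there it merely subdivides a face, and it is carried along while the smaller star is deformed. Ears
are found by cutting along chords. The two sides of the polygon are level sets of an area function.
On a sphere one side may have no convex corner; therefore a vector z is added to the vertices such
that together they meet every open half-space. One of the two sides does not contain z, and that
side has a convex corner.

At a convex corner the normals may be assumed to point inwards. Projecting the edges along an inner
axis c gives a planar star of angle sum 2π, so that `wind` vanishes at -c, and then on every
hemisphere that is opposite to a vector on the inner side of all faces. Crossing one arc shows that
it equals 1 in the interior of the dual cone. -/

namespace PolyhedralSurface

noncomputable section

/-! ### Vector algebra in coordinates -/

/-- The determinant of three vectors of Euclidean three-space. -/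
def det3 (a b c : E3) : ℝ :=
  a 0 * (b 1 * c 2 - b 2 * c 1) - a 1 * (b 0 * c 2 - b 2 * c 0) + a 2 * (b 0 * c 1 - b 1 * c 0)

theorem inner_eq_coords (x y : E3) : inner ℝ x y = x 0 * y 0 + x 1 * y 1 + x 2 * y 2 := by
  simp [PiLp.inner_apply, Fin.sum_univ_three, mul_comm]

theorem norm_sq_eq_coords (x : E3) : ‖x‖ ^ 2 = x 0 ^ 2 + x 1 ^ 2 + x 2 ^ 2 := by
  rw [← real_inner_self_eq_norm_sq, inner_eq_coords]; ring

@[simp] theorem cross_apply_zero (a b : E3) : cross a b 0 = a 1 * b 2 - a 2 * b 1 := by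
  simp [cross, crossProduct]

@[simp] theorem cross_apply_one (a b : E3) : cross a b 1 = a 2 * b 0 - a 0 * b 2 := by
  simp [cross, crossProduct]

@[simp] theorem cross_apply_two (a b : E3) : cross a b 2 = a 0 * b 1 - a 1 * b 0 := by
  simp [cross, crossProduct]

theorem ext_coords {x y : E3} (h0 : x 0 = y 0) (h1 : x 1 = y 1) (h2 : x 2 = y 2) : x = y := by
  ext i; fin_cases i <;> assumption

theorem inner_cross (a b c : E3) : inner ℝ a (cross b c) = det3 a b c := by
  rw [inner_eq_coords, det3]; simp; ring

theorem det3_rotate (a b c : E3) : det3 a b c = det3 b c a := by simp only [det3]; ring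

theorem det3_swap (a b c : E3) : det3 a b c = -det3 b a c := by simp only [det3]; ring

theorem det3_swap_right (a b c : E3) : det3 a b c = -det3 a c b := by simp only [det3]; ring

@[simp] theorem det3_self_left (a b : E3) : det3 a a b = 0 := by simp only [det3]; ring

@[simp] theorem det3_self_right (a b : E3) : det3 a b b = 0 := by simp only [det3]; ring

@[simp] theorem det3_self_outer (a b : E3) : det3 a b a = 0 := by simp only [det3]; ring

theorem det3_add_right (a b x y : E3) : det3 a b (x + y) = det3 a b x + det3 a b y := by
  simp only [det3, PiLp.add_apply]; ring

theorem det3_smul_right (a b x : E3) (s : ℝ) : det3 a b (s • x) = s * det3 a b x := by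
  simp only [det3, PiLp.smul_apply, smul_eq_mul]; ring

theorem det3_add_mid (a b x y : E3) : det3 a (x + y) b = det3 a x b + det3 a y b := by
  simp only [det3, PiLp.add_apply]; ring

theorem det3_smul_mid (a b x : E3) (s : ℝ) : det3 a (s • x) b = s * det3 a x b := by
  simp only [det3, PiLp.smul_apply, smul_eq_mul]; ring

theorem det3_add_left (a b x y : E3) : det3 (x + y) a b = det3 x a b + det3 y a b := by
  simp only [det3, PiLp.add_apply]; ring

theorem det3_smul_left (a b x : E3) (s : ℝ) : det3 (s • x) a b = s * det3 x a b := by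
  simp only [det3, PiLp.smul_apply, smul_eq_mul]; ring

theorem det3_neg_left (a b x : E3) : det3 (-x) a b = -det3 x a b := by
  simp only [det3, PiLp.neg_apply]; ring

theorem det3_neg_right (a b x : E3) : det3 a b (-x) = -det3 a b x := by
  simp only [det3, PiLp.neg_apply]; ring

@[fun_prop] theorem Continuous.det3 {X : Type*} [TopologicalSpace X] {f g h : X → E3}
    (hf : Continuous f) (hg : Continuous g) (hh : Continuous h) :
    Continuous fun x => det3 (f x) (g x) (h x) := by
  unfold PolyhedralSurface.det3; fun_prop

@[fun_prop] theorem Continuous.cross {X : Type*} [TopologicalSpace X] {f g : X → E3}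
    (hf : Continuous f) (hg : Continuous g) : Continuous fun x => cross (f x) (g x) := by
  have : (fun x => PolyhedralSurface.cross (f x) (g x)) = fun x => WithLp.toLp 2
      (fun i => ![f x 1 * g x 2 - f x 2 * g x 1, f x 2 * g x 0 - f x 0 * g x 2,
        f x 0 * g x 1 - f x 1 * g x 0] i) := by
    funext x
    refine ext_coords ?_ ?_ ?_ <;> simp
  rw [this]
  refine (PiLp.continuous_toLp 2 _).comp (continuous_pi fun i => ?_)
  fin_cases i <;> simp <;> fun_prop

theorem cramer (a b c x : E3) :
    det3 a b c • x = det3 x b c • a + det3 a x c • b + det3 a b x • c := by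
  refine ext_coords ?_ ?_ ?_ <;> simp [det3] <;> ring

theorem exists_coords {a b c : E3} (h : det3 a b c ≠ 0) (x : E3) :
    x = (det3 x b c / det3 a b c) • a + (det3 a x c / det3 a b c) • b +
      (det3 a b x / det3 a b c) • c := by
  have := cramer a b c x
  have h2 : x = (det3 a b c)⁻¹ • (det3 a b c • x) := by rw [smul_smul, inv_mul_cancel₀ h, one_smul]
  rw [h2]; nth_rewrite 1 [this]
  simp only [smul_add, smul_smul, ← h2]
  congr 2 <;> ring_nf

theorem cross_self_eq_zero (a : E3) : cross a a = 0 := by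
  refine ext_coords ?_ ?_ ?_ <;> simp <;> ring

theorem cross_swap (a b : E3) : cross a b = -cross b a := by
  refine ext_coords ?_ ?_ ?_ <;> simp <;> ring

theorem cross_smul_smul (a b : E3) (s t : ℝ) : cross (s • a) (t • b) = (s * t) • cross a b := by
  refine ext_coords ?_ ?_ ?_ <;> simp <;> ring

theorem inner_cross_left (a b : E3) : inner ℝ a (cross a b) = 0 := by
  rw [inner_cross]; simp

theorem inner_cross_right (a b : E3) : inner ℝ b (cross a b) = 0 := by
  rw [inner_cross]; simp

/-- The identity of Lagrange. -/
theorem norm_cross_sq (a b : E3) : ‖cross a b‖ ^ 2 = ‖a‖ ^ 2 * ‖b‖ ^ 2 - inner ℝ a b ^ 2 := by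
  rw [norm_sq_eq_coords, norm_sq_eq_coords, norm_sq_eq_coords, inner_eq_coords]; simp; ring

theorem cross_cross (a b c d : E3) :
    cross (cross a b) (cross c d) = det3 a b d • c - det3 a b c • d := by
  refine ext_coords ?_ ?_ ?_ <;> simp [det3] <;> ring

/-- A vector in the plane of two independent vectors is a combination of them. -/
theorem exists_combination {a b x : E3} (h : cross a b ≠ 0) (hx : det3 a b x = 0) :
    ∃ s t : ℝ, x = s • a + t • b := by
  set n := cross a b with hn
  have hd : det3 a b n = ‖n‖ ^ 2 := by
    rw [← det3_rotate, ← inner_cross, ← hn, real_inner_self_eq_norm_sq]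
  have hd0 : det3 a b n ≠ 0 := by rw [hd]; positivity
  have := exists_coords hd0 x
  rw [hx] at this
  exact ⟨_, _, by simpa using this⟩

theorem cross_ne_zero_left {a b : E3} (h : cross a b ≠ 0) : a ≠ 0 := by
  rintro rfl; apply h; refine ext_coords ?_ ?_ ?_ <;> simp

theorem cross_ne_zero_right {a b : E3} (h : cross a b ≠ 0) : b ≠ 0 := by
  rintro rfl; apply h; refine ext_coords ?_ ?_ ?_ <;> simp

theorem eq_zero_of_combination {a b : E3} (h : cross a b ≠ 0) {s t : ℝ}
    (he : s • a + t • b = 0) : s = 0 ∧ t = 0 := by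
  have h1 : cross (s • a + t • b) b = s • cross a b := by
    refine ext_coords ?_ ?_ ?_ <;> simp <;> ring
  have h2 : cross a (s • a + t • b) = t • cross a b := by
    refine ext_coords ?_ ?_ ?_ <;> simp <;> ring
  have z1 : cross 0 b = 0 := by refine ext_coords ?_ ?_ ?_ <;> simp
  have z2 : cross a 0 = 0 := by refine ext_coords ?_ ?_ ?_ <;> simp
  rw [he, z1] at h1; rw [he, z2] at h2
  exact ⟨(smul_eq_zero.1 h1.symm).resolve_right h, (smul_eq_zero.1 h2.symm).resolve_right h⟩

theorem cross_ne_zero_of_det3 {a b c : E3} (h : det3 a b c ≠ 0) : cross a b ≠ 0 := by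
  intro h0; apply h; rw [← det3_rotate, ← inner_cross, h0, inner_zero_right]

/-- If the vector product vanishes, the second vector is a multiple of the first one. -/
theorem exists_smul_of_cross_eq_zero {a b : E3} (ha : a ≠ 0) (h : cross a b = 0) :
    b = (inner ℝ a b / ‖a‖ ^ 2) • a := by
  have h0 : ‖a‖ ^ 2 ≠ 0 := by positivity
  have c0 := congrArg (fun v : E3 => v 0) h
  have c1 := congrArg (fun v : E3 => v 1) h
  have c2 := congrArg (fun v : E3 => v 2) h
  simp at c0 c1 c2
  refine ext_coords ?_ ?_ ?_ <;>
    · simp only [PiLp.smul_apply, smul_eq_mul]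
      field_simp
      rw [norm_sq_eq_coords, inner_eq_coords]
      first
        | linear_combination (-(a 1)) * c2 + a 2 * c1
        | linear_combination (a 0) * c2 - a 2 * c0
        | linear_combination (-(a 0)) * c1 + a 1 * c0

/-! ### The solid angle of a spherical triangle -/

/-- A complex number whose argument is half the signed area of the spherical triangle with the
vertices `z`, `a`, `b` (up to normalization). -/
def solid (z a b : E3) : ℂ :=
  ⟨‖z‖ * ‖a‖ * ‖b‖ + inner ℝ z a * ‖b‖ + inner ℝ a b * ‖z‖ + inner ℝ b z * ‖a‖, det3 z a b⟩

/-- Rescaling the vectors by positive factors does not change the argument, so normals of faces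
never have to be normalized. -/
theorem solid_smul {r s t : ℝ} (hr : 0 ≤ r) (hs : 0 ≤ s) (ht : 0 ≤ t) (z a b : E3) :
    solid (r • z) (s • a) (t • b) = ((r * s * t : ℝ) : ℂ) * solid z a b := by
  apply Complex.ext
  · simp only [solid, norm_smul, real_inner_smul_left, real_inner_smul_right, Real.norm_eq_abs,
      abs_of_nonneg hr, abs_of_nonneg hs, abs_of_nonneg ht, Complex.re_ofReal_mul]
    ring
  · simp only [solid, det3_smul_left, det3_smul_mid, det3_smul_right, Complex.im_ofReal_mul]
    ring

@[fun_prop] theorem Continuous.solid {X : Type*} [TopologicalSpace X] {f g h : X → E3}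
    (hf : Continuous f) (hg : Continuous g) (hh : Continuous h) :
    Continuous fun x => solid (f x) (g x) (h x) := by
  have : (fun x => PolyhedralSurface.solid (f x) (g x) (h x)) = fun x => Complex.equivRealProdCLM.symm
      (‖f x‖ * ‖g x‖ * ‖h x‖ + inner ℝ (f x) (g x) * ‖h x‖ + inner ℝ (g x) (h x) * ‖f x‖ +
        inner ℝ (h x) (f x) * ‖g x‖, PolyhedralSurface.det3 (f x) (g x) (h x)) := by
    funext x; apply Complex.ext <;> simp [PolyhedralSurface.solid]
  rw [this]
  refine Complex.equivRealProdCLM.symm.continuous.comp ?_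
  fun_prop

/-- The convex cone spanned by two vectors. -/
def sector (a b : E3) : Set E3 := {x | ∃ s t : ℝ, 0 ≤ s ∧ 0 ≤ t ∧ x = s • a + t • b}

/-- A nonpositive real value forces coplanarity. If `a` and `b` are parallel, they are equal, and so
is `x`; otherwise `x` is a combination of them and the sign of the real part makes both coefficients
nonnegative. -/
theorem solid_mem_slitPlane_of_unit {a b x : E3} (ha : ‖a‖ = 1) (hb : ‖b‖ = 1) (hx : ‖x‖ = 1)
    (hab : 0 < 1 + inner ℝ a b) (h : x ∉ sector a b) :
    solid (-x) a b ∈ Complex.slitPlane := by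
  rw [Complex.mem_slitPlane_iff]
  by_contra! hc
  obtain ⟨hre, him⟩ := hc
  simp only [solid, norm_neg, ha, hb, hx, inner_neg_left, inner_neg_right, det3_neg_left] at hre him
  have him : det3 a b x = 0 := by rw [← det3_rotate]; linarith
  apply h
  by_cases hc0 : cross a b = 0
  · have hl := norm_cross_sq a b
    rw [hc0, ha, hb] at hl
    have hi : inner ℝ a b = 1 := by
      have : (1 - inner ℝ a b) * (1 + inner ℝ a b) = 0 := by simp at hl; linarith
      rcases mul_eq_zero.1 this with h | h <;> linarith
    have hba : a = b := (inner_eq_one_iff_of_norm_eq_one (𝕜 := ℝ) ha hb).1 hi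
    subst hba
    have hle : 1 ≤ inner ℝ x a := by
      rw [real_inner_comm] at hre; rw [hi, real_inner_comm] at hre
      have := real_inner_comm x a; linarith
    have hle2 : inner ℝ x a ≤ 1 := by
      have := real_inner_le_norm x a; rwa [hx, ha, one_mul] at this
    have : x = a := (inner_eq_one_iff_of_norm_eq_one (𝕜 := ℝ) hx ha).1 (le_antisymm hle2 hle)
    exact ⟨1, 0, zero_le_one, le_rfl, by simp [this]⟩
  · obtain ⟨s, t, rfl⟩ := exists_combination hc0 him
    set c := inner ℝ a b with hcdef
    have haa : inner ℝ a a = (1 : ℝ) := by rw [real_inner_self_eq_norm_sq, ha]; norm_num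
    have hbb : inner ℝ b b = (1 : ℝ) := by rw [real_inner_self_eq_norm_sq, hb]; norm_num
    have hba : inner ℝ b a = c := by rw [real_inner_comm]
    have hn : s ^ 2 + t ^ 2 + 2 * s * t * c = 1 := by
      have := real_inner_self_eq_norm_sq (s • a + t • b)
      rw [hx] at this
      simp only [inner_add_left, inner_add_right, real_inner_smul_left, real_inner_smul_right, haa,
        hbb, hba, ← hcdef] at this
      linarith
    have hre' : 1 + c ≤ (s + t) * (1 + c) := by
      simp only [inner_add_left, inner_add_right, real_inner_smul_left, real_inner_smul_right, haa,
        hbb, hba] at hre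
      linarith
    -- The real part factors as (1 - (s + t)) (1 + c). Comparing (s + t)² ≥ 1 with the norm equation
    -- gives 2st(1 - c) ≥ 0, so the coefficients do not have opposite signs, and their sum is
    -- positive.
    have hst : 1 ≤ s + t := by
      by_contra! hlt; nlinarith
    have hc1 : c < 1 := by
      have hl := norm_cross_sq a b
      rw [ha, hb, ← hcdef] at hl
      have : 0 < ‖cross a b‖ ^ 2 := by positivity
      nlinarith
    have hst2 : 0 ≤ s * t := by
      by_contra! hlt; nlinarith
    have hs : 0 ≤ s := by
      by_contra! hlt; nlinarith
    have ht : 0 ≤ t := by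
      by_contra! hlt; nlinarith
    exact ⟨s, t, hs, ht, rfl⟩

theorem smul_mem_sector_iff {a b x : E3} {r s t : ℝ} (hr : 0 < r) (hs : 0 < s) (ht : 0 < t) :
    r • x ∈ sector (s • a) (t • b) ↔ x ∈ sector a b := by
  constructor
  · rintro ⟨p, q, hp, hq, h⟩
    refine ⟨r⁻¹ * (p * s), r⁻¹ * (q * t), by positivity, by positivity, ?_⟩
    have h2 : x = r⁻¹ • (r • x) := by rw [smul_smul, inv_mul_cancel₀ hr.ne', one_smul]
    rw [h2, h]
    module
  · rintro ⟨p, q, hp, hq, h⟩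
    refine ⟨r * p * s⁻¹, r * q * t⁻¹, by positivity, by positivity, ?_⟩
    rw [h, smul_smul, smul_smul, smul_add, smul_smul, smul_smul]
    congr 2 <;> field_simp

theorem norm_normalize {a : E3} (ha : a ≠ 0) : ‖(‖a‖⁻¹ : ℝ) • a‖ = 1 := by
  rw [norm_smul, norm_inv, norm_norm, inv_mul_cancel₀ (norm_ne_zero_iff.2 ha)]

theorem ofReal_mul_mem_slitPlane {r : ℝ} (hr : 0 < r) {q : ℂ} (h : (r : ℂ) * q ∈ Complex.slitPlane) :
    q ∈ Complex.slitPlane := by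
  rw [Complex.mem_slitPlane_iff] at h ⊢
  rw [Complex.re_ofReal_mul, Complex.im_ofReal_mul] at h
  rcases h with h | h
  · exact Or.inl (by by_contra! hc; nlinarith)
  · exact Or.inr (right_ne_zero_of_mul h)

/-- The solid angle is a continuous function except when a side of the triangle contains the
antipode of the opposite vertex. -/
theorem solid_mem_slitPlane {a b x : E3} (ha : a ≠ 0) (hb : b ≠ 0) (hx : x ≠ 0)
    (hab : 0 < ‖a‖ * ‖b‖ + inner ℝ a b) (h : x ∉ sector a b) :
    solid (-x) a b ∈ Complex.slitPlane := by
  have pa : 0 < ‖a‖⁻¹ := by positivity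
  have pb : 0 < ‖b‖⁻¹ := by positivity
  have px : 0 < ‖x‖⁻¹ := by positivity
  have key := solid_mem_slitPlane_of_unit (norm_normalize ha) (norm_normalize hb) (norm_normalize hx)
    (by
      rw [real_inner_smul_left, real_inner_smul_right]
      have : 1 + ‖a‖⁻¹ * (‖b‖⁻¹ * inner ℝ a b) = ‖a‖⁻¹ * ‖b‖⁻¹ * (‖a‖ * ‖b‖ + inner ℝ a b) := by
        field_simp
      rw [this]; positivity)
    (by rwa [smul_mem_sector_iff px pa pb])
  rw [← smul_neg, solid_smul px.le pa.le pb.le] at key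
  exact ofReal_mul_mem_slitPlane (by positivity) key

/-- On the open arc between `a` and `b`, the solid angle has a branch cut. -/
theorem solid_re_neg {a b : E3} (h : cross a b ≠ 0) {s t : ℝ} (hs : 0 < s) (ht : 0 < t) :
    (solid (-(s • a + t • b)) a b).re < 0 := by
  have ha := cross_ne_zero_left h
  have hb := cross_ne_zero_right h
  have pa : 0 < ‖a‖ := norm_pos_iff.2 ha
  have pb : 0 < ‖b‖ := norm_pos_iff.2 hb
  have hl := norm_cross_sq a b
  have hp : 0 < ‖cross a b‖ ^ 2 := by positivity
  set c := inner ℝ a b with hcdef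
  have hba : inner ℝ b a = c := by rw [real_inner_comm]
  have habs : |c| < ‖a‖ * ‖b‖ := by
    apply abs_lt_of_sq_lt_sq _ (by positivity)
    nlinarith
  obtain ⟨hc1, hc2⟩ := abs_lt.1 habs
  set x := s • a + t • b with hx
  have hxn : ‖x‖ ^ 2 = s ^ 2 * ‖a‖ ^ 2 + t ^ 2 * ‖b‖ ^ 2 + 2 * s * t * c := by
    rw [← real_inner_self_eq_norm_sq, ← real_inner_self_eq_norm_sq, ← real_inner_self_eq_norm_sq, hx]
    simp only [inner_add_left, inner_add_right, real_inner_smul_left, real_inner_smul_right,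
      hba, ← hcdef]
    ring
  have hlt : ‖x‖ < s * ‖a‖ + t * ‖b‖ := by
    apply lt_of_pow_lt_pow_left₀ 2 (by positivity)
    rw [hxn]
    have : 0 < s * t := by positivity
    nlinarith
  simp only [solid, norm_neg, inner_neg_left, inner_neg_right]
  have h1 : inner ℝ x a = s * ‖a‖ ^ 2 + t * c := by
    rw [hx]
    simp only [inner_add_left, real_inner_smul_left, real_inner_self_eq_norm_sq, hba]
  have h2 : inner ℝ b x = s * c + t * ‖b‖ ^ 2 := by
    rw [hx]
    simp only [inner_add_right, real_inner_smul_right, real_inner_self_eq_norm_sq, hba]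
  rw [h1, h2]
  -- With this factorization the sign is the strict triangle inequality for `s • a + t • b`.
  have : ‖x‖ * ‖a‖ * ‖b‖ + -(s * ‖a‖ ^ 2 + t * c) * ‖b‖ + c * ‖x‖ + -(s * c + t * ‖b‖ ^ 2) * ‖a‖
      = (‖x‖ - (s * ‖a‖ + t * ‖b‖)) * (‖a‖ * ‖b‖ + c) := by ring
  rw [this]
  exact mul_neg_of_neg_of_pos (by linarith) (by linarith)

theorem solid_im (z a b : E3) : (solid z a b).im = det3 z a b := rfl

end

end PolyhedralSurface

namespace PolyhedralSurface

noncomputable section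

/-! ### Holonomy: the total solid angle modulo `2π` -/

open ComplexConjugate

/-- Completes `z` to a positively oriented orthonormal frame. Only coordinate formulas for the two
products are recorded, because the part of a vector orthogonal to `z` is treated as one complex
number from here on. -/
theorem exists_frame {z : E3} (hz : ‖z‖ = 1) : ∃ e₁ e₂ : E3,
    (∀ x y : E3, inner ℝ x y = inner ℝ x e₁ * inner ℝ y e₁ + inner ℝ x e₂ * inner ℝ y e₂ +
      inner ℝ x z * inner ℝ y z) ∧
    (∀ x y : E3, inner ℝ (cross x y) e₁ = inner ℝ x e₂ * inner ℝ y z - inner ℝ x z * inner ℝ y e₂) ∧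
    (∀ x y : E3, inner ℝ (cross x y) e₂ = inner ℝ x z * inner ℝ y e₁ - inner ℝ x e₁ * inner ℝ y z) ∧
    (∀ x y : E3, inner ℝ (cross x y) z =
      inner ℝ x e₁ * inner ℝ y e₂ - inner ℝ x e₂ * inner ℝ y e₁) := by
  have hz2 : z 0 ^ 2 + z 1 ^ 2 + z 2 ^ 2 = 1 := by rw [← norm_sq_eq_coords, hz]; norm_num
  obtain ⟨u, hu0, huz⟩ : ∃ u : E3, u ≠ 0 ∧ inner ℝ u z = 0 := by
    by_cases h : z 0 = 0 ∧ z 1 = 0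
    · refine ⟨WithLp.toLp 2 ![1, 0, 0], fun h0 => ?_, ?_⟩
      · have := congrArg (fun v : E3 => v 0) h0
        simp at this
      · rw [inner_eq_coords]; simp [h.1]
    · refine ⟨WithLp.toLp 2 ![-z 1, z 0, 0], fun h0 => h ⟨?_, ?_⟩, ?_⟩
      · have := congrArg (fun v : E3 => v 1) h0
        simpa using this
      · have := congrArg (fun v : E3 => v 0) h0
        simpa using this
      · rw [inner_eq_coords]; simp; ring
  set e : E3 := (‖u‖⁻¹ : ℝ) • u with he
  have hen : ‖e‖ = 1 := norm_normalize hu0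
  have hez : inner ℝ e z = 0 := by rw [he, real_inner_smul_left, huz, mul_zero]
  have hee : e 0 ^ 2 + e 1 ^ 2 + e 2 ^ 2 = 1 := by rw [← norm_sq_eq_coords, hen]; norm_num
  rw [inner_eq_coords] at hez
  set f := cross z e with hf
  have hd : det3 e f z = 1 := by
    have : det3 e f z = (z 0 ^ 2 + z 1 ^ 2 + z 2 ^ 2) * (e 0 ^ 2 + e 1 ^ 2 + e 2 ^ 2) -
        (e 0 * z 0 + e 1 * z 1 + e 2 * z 2) ^ 2 := by simp [det3, hf]; ring
    rw [this, hz2, hee, hez]; norm_num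
  have ex : ∀ x : E3, x = inner ℝ x e • e + inner ℝ x f • f + inner ℝ x z • z := by
    intro x
    have h1 : det3 x f z = inner ℝ x e := by
      have : det3 x f z = (z 0 ^ 2 + z 1 ^ 2 + z 2 ^ 2) * inner ℝ x e -
        (e 0 * z 0 + e 1 * z 1 + e 2 * z 2) * inner ℝ x z := by
          rw [inner_eq_coords, inner_eq_coords]; simp [det3, hf]; ring
      rw [this, hz2, hez]; ring
    have h2 : det3 e x z = inner ℝ x f := by
      rw [hf, inner_cross, ← det3_rotate, ← det3_rotate]
    have h3 : det3 e f x = inner ℝ x z := by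
      have : det3 e f x = (e 0 ^ 2 + e 1 ^ 2 + e 2 ^ 2) * inner ℝ x z -
        (e 0 * z 0 + e 1 * z 1 + e 2 * z 2) * inner ℝ x e := by
          rw [inner_eq_coords, inner_eq_coords]; simp [det3, hf]; ring
      rw [this, hee, hez]; ring
    have := exists_coords (by rw [hd]; norm_num) x (a := e) (b := f) (c := z)
    rw [hd, h1, h2, h3] at this
    simpa using this
  have hdet : ∀ x y w : E3, det3 x y w =
      inner ℝ x e * (inner ℝ y f * inner ℝ w z - inner ℝ y z * inner ℝ w f)
      - inner ℝ x f * (inner ℝ y e * inner ℝ w z - inner ℝ y z * inner ℝ w e)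
      + inner ℝ x z * (inner ℝ y e * inner ℝ w f - inner ℝ y f * inner ℝ w e) := by
    intro x y w
    have p1 : det3 e z f = -1 := by rw [det3_swap_right, hd]
    have p2 : det3 f e z = -1 := by rw [det3_swap, hd]
    have p3 : det3 f z e = 1 := by rw [← det3_rotate, hd]
    have p4 : det3 z e f = 1 := by rw [det3_rotate, hd]
    have p5 : det3 z f e = -1 := by rw [det3_swap_right, p4]
    conv_lhs => rw [ex x, ex y, ex w]
    simp only [det3_add_left, det3_add_mid, det3_add_right, det3_smul_left, det3_smul_mid,
      det3_smul_right, det3_self_left, det3_self_right, det3_self_outer, hd, p1, p2, p3, p4, p5]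
    ring
  have nee : inner ℝ e e = (1 : ℝ) := by rw [inner_eq_coords]; linarith
  have nzz : inner ℝ z z = (1 : ℝ) := by rw [inner_eq_coords]; linarith
  have nez : inner ℝ e z = (0 : ℝ) := by rw [inner_eq_coords]; linarith
  have nze : inner ℝ z e = (0 : ℝ) := by rw [real_inner_comm]; exact nez
  have nef : inner ℝ e f = (0 : ℝ) := inner_cross_right z e
  have nfe : inner ℝ f e = (0 : ℝ) := by rw [real_inner_comm]; exact nef
  have nzf : inner ℝ z f = (0 : ℝ) := inner_cross_left z e
  have nfz : inner ℝ f z = (0 : ℝ) := by rw [real_inner_comm]; exact nzf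
  have nff : inner ℝ f f = (1 : ℝ) := by
    rw [real_inner_self_eq_norm_sq, hf, norm_cross_sq, hz, hen, nze]; norm_num
  refine ⟨e, f, ?_, ?_, ?_, ?_⟩ <;> intro x y
  · conv_lhs => rw [ex x, ex y]
    simp only [inner_add_left, inner_add_right, real_inner_smul_left, real_inner_smul_right, nee,
      nff, nzz, nez, nze, nef, nfe, nzf, nfz]
    ring
  all_goals
    rw [real_inner_comm, inner_cross, hdet]
    simp only [nee, nff, nzz, nez, nze, nef, nfe, nzf, nfz]
    ring

/-- The transport of the tangent vector `c` at `n` to the point `z` along a great circle, in the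
coordinates given by `e₁` and `e₂`. -/
def transport (e₁ e₂ z n c : E3) : ℂ :=
  ((‖n‖ + inner ℝ n z : ℝ) : ℂ) * ⟨inner ℝ c e₁, inner ℝ c e₂⟩ -
    ((inner ℝ c z : ℝ) : ℂ) * ⟨inner ℝ n e₁, inner ℝ n e₂⟩

/-- Here `m` stands for ‖n‖ + ⟨n, z⟩, `ν` and `γ` are the parts of the normal and of the edge
orthogonal to `z`, `νb` and `γb` their conjugates, and `c` is the component of the edge along `z`.
The hypotheses encode that the edge is orthogonal to both normals. -/
theorem transport_identity {R : Type*} [CommRing R] {m m' ν νb ν' νb' γ γb c : R}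
    (h : c * (ν * νb) = m * (γb * ν + γ * νb) + c * m ^ 2)
    (h' : c * (ν' * νb') = m' * (γb * ν' + γ * νb') + c * m' ^ 2) :
    (m * m' + νb * ν') * (m * γ - c * ν) * (m' * γb - c * νb') =
      (m * m' + ν * νb') * (m * m' * (γ * γb + c ^ 2)) := by
  linear_combination (c * (ν * νb) - m * γ * νb) * h' +
    ((m' * (γb * ν' + γ * νb') + c * m' ^ 2) - m' * γb * ν') * h

/-- The vector `c` is normal to the great circle through `n` and `n'`, hence parallel along the arc
between them. Its transports to `z` from the two ends differ by the holonomy of the triangle, that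
is, by its area, which is twice the argument of `solid`. -/
theorem solid_mul_transport {e₁ e₂ z : E3} (hz : ‖z‖ = 1)
    (hi : ∀ x y : E3, inner ℝ x y = inner ℝ x e₁ * inner ℝ y e₁ + inner ℝ x e₂ * inner ℝ y e₂ +
      inner ℝ x z * inner ℝ y z)
    (hx : ∀ x y : E3, inner ℝ (cross x y) z =
      inner ℝ x e₁ * inner ℝ y e₂ - inner ℝ x e₂ * inner ℝ y e₁)
    {n n' c : E3} (hn : inner ℝ c n = 0) (hn' : inner ℝ c n' = 0) :
    solid z n n' * transport e₁ e₂ z n c * conj (transport e₁ e₂ z n' c) =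
      conj (solid z n n') *
        (((‖n‖ + inner ℝ n z) * (‖n'‖ + inner ℝ n' z) * ‖c‖ ^ 2 : ℝ) : ℂ) := by
  have hs : solid z n n' = ((‖n‖ + inner ℝ n z : ℝ) : ℂ) * ((‖n'‖ + inner ℝ n' z : ℝ) : ℂ) +
      conj (⟨inner ℝ n e₁, inner ℝ n e₂⟩ : ℂ) * ⟨inner ℝ n' e₁, inner ℝ n' e₂⟩ := by
    apply Complex.ext
    · simp only [solid, hz, Complex.add_re, Complex.mul_re, Complex.ofReal_re, Complex.ofReal_im,
        Complex.conj_re, Complex.conj_im]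
      rw [hi n n', real_inner_comm n z]
      ring
    · simp only [solid, Complex.add_im, Complex.mul_im, Complex.ofReal_re, Complex.ofReal_im,
        Complex.conj_re, Complex.conj_im]
      rw [← inner_cross, real_inner_comm, hx]
      ring
  have key : ∀ n : E3, inner ℝ c n = 0 →
      ((inner ℝ c z : ℝ) : ℂ) * ((⟨inner ℝ n e₁, inner ℝ n e₂⟩ : ℂ) *
        conj (⟨inner ℝ n e₁, inner ℝ n e₂⟩ : ℂ)) =
      ((‖n‖ + inner ℝ n z : ℝ) : ℂ) * (conj (⟨inner ℝ c e₁, inner ℝ c e₂⟩ : ℂ) *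
        ⟨inner ℝ n e₁, inner ℝ n e₂⟩ + ⟨inner ℝ c e₁, inner ℝ c e₂⟩ *
        conj (⟨inner ℝ n e₁, inner ℝ n e₂⟩ : ℂ)) +
        ((inner ℝ c z : ℝ) : ℂ) * ((‖n‖ + inner ℝ n z : ℝ) : ℂ) ^ 2 := by
    intro n hn
    have h1 := hi n n
    rw [real_inner_self_eq_norm_sq] at h1
    rw [hi] at hn
    have e1 : ∀ x y : E3, (conj (⟨inner ℝ x e₁, inner ℝ x e₂⟩ : ℂ) * ⟨inner ℝ y e₁, inner ℝ y e₂⟩ +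
        ⟨inner ℝ x e₁, inner ℝ x e₂⟩ * conj (⟨inner ℝ y e₁, inner ℝ y e₂⟩ : ℂ)) =
        ((2 * (inner ℝ x e₁ * inner ℝ y e₁ + inner ℝ x e₂ * inner ℝ y e₂) : ℝ) : ℂ) := by
      intro x y
      apply Complex.ext <;> simp <;> ring
    rw [e1, Complex.mul_conj, Complex.normSq_apply]
    norm_cast
    linear_combination (-inner ℝ c z) * h1 - 2 * (‖n‖ + inner ℝ n z) * hn
  have hc : ((‖c‖ ^ 2 : ℝ) : ℂ) = (⟨inner ℝ c e₁, inner ℝ c e₂⟩ : ℂ) *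
      conj (⟨inner ℝ c e₁, inner ℝ c e₂⟩ : ℂ) + ((inner ℝ c z : ℝ) : ℂ) ^ 2 := by
    rw [Complex.mul_conj, Complex.normSq_apply, ← real_inner_self_eq_norm_sq, hi]
    push_cast; ring
  have := transport_identity (key n hn) (key n' hn')
  rw [Complex.ofReal_mul _ (‖c‖ ^ 2), hc, hs]
  simp only [transport, map_sub, map_mul, map_add, Complex.conj_conj, Complex.conj_ofReal,
    Complex.ofReal_mul]
  linear_combination this

/-- Transport turns a rotation of tangent vectors at `n` into multiplication by a complex number. To
see this, write `c'` in terms of `c` and `n × c`, and note that the transport of `n × c` is i‖n‖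
times that of `c`. -/
theorem transport_rotate {e₁ e₂ z : E3}
    (hi : ∀ x y : E3, inner ℝ x y = inner ℝ x e₁ * inner ℝ y e₁ + inner ℝ x e₂ * inner ℝ y e₂ +
      inner ℝ x z * inner ℝ y z)
    (h1 : ∀ x y : E3, inner ℝ (cross x y) e₁ =
      inner ℝ x e₂ * inner ℝ y z - inner ℝ x z * inner ℝ y e₂)
    (h2 : ∀ x y : E3, inner ℝ (cross x y) e₂ =
      inner ℝ x z * inner ℝ y e₁ - inner ℝ x e₁ * inner ℝ y z)
    (h3 : ∀ x y : E3, inner ℝ (cross x y) z =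
      inner ℝ x e₁ * inner ℝ y e₂ - inner ℝ x e₂ * inner ℝ y e₁)
    {n c c' : E3} (hn : n ≠ 0) (hc : inner ℝ c n = 0) (hc' : inner ℝ c' n = 0) :
    ((‖c‖ ^ 2 : ℝ) : ℂ) * transport e₁ e₂ z n c' =
      ⟨inner ℝ c c', det3 n c c' / ‖n‖⟩ * transport e₁ e₂ z n c := by
  have hN : ‖n‖ ≠ 0 := norm_ne_zero_iff.2 hn
  have key : (‖n‖ ^ 2 * ‖c‖ ^ 2) • c' =
      (‖n‖ ^ 2 * inner ℝ c c') • c + det3 n c c' • cross n c := by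
    have := cramer n c (cross n c) c'
    have a1 : det3 n c (cross n c) = ‖n‖ ^ 2 * ‖c‖ ^ 2 := by
      rw [← det3_rotate, ← inner_cross, real_inner_self_eq_norm_sq, norm_cross_sq, real_inner_comm,
        hc]; ring
    have a2 : det3 c' c (cross n c) = inner ℝ c' n * inner ℝ c c - inner ℝ c c' * inner ℝ c n := by
      simp only [inner_eq_coords, det3]; simp; ring
    have a3 : det3 n c' (cross n c) = inner ℝ n n * inner ℝ c c' - inner ℝ c n * inner ℝ c' n := by
      simp only [inner_eq_coords, det3]; simp; ring
    rw [a1, a2, a3, hc, hc', real_inner_self_eq_norm_sq] at this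
    rw [this]; simp
  have hlin : ∀ (p r : ℝ) (x y : E3), transport e₁ e₂ z n (p • x + r • y) =
      p * transport e₁ e₂ z n x + r * transport e₁ e₂ z n y := by
    intro p r x y
    apply Complex.ext <;>
      simp [transport, inner_add_left, real_inner_smul_left] <;> ring
  have hlin1 : ∀ (p : ℝ) (x : E3), transport e₁ e₂ z n (p • x) = p * transport e₁ e₂ z n x := by
    intro p x
    simpa using hlin p 0 x 0
  have hrot : transport e₁ e₂ z n (cross n c) = Complex.I * ‖n‖ * transport e₁ e₂ z n c := by
    have b1 := hi n n
    rw [real_inner_self_eq_norm_sq] at b1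
    have b2 := hc
    rw [hi] at b2
    apply Complex.ext
    · simp [transport, h1, h2, h3]
      linear_combination (inner ℝ c e₂) * b1 + inner ℝ n e₂ * b2
    · simp [transport, h1, h2, h3]
      linear_combination (-inner ℝ c e₁) * b1 - inner ℝ n e₁ * b2
  have := congrArg (transport e₁ e₂ z n) key
  rw [hlin, hlin1, hrot] at this
  have hu : (⟨inner ℝ c c', det3 n c c' / ‖n‖⟩ : ℂ) =
      (inner ℝ c c' : ℝ) + ((det3 n c c' / ‖n‖ : ℝ) : ℂ) * Complex.I := by
    apply Complex.ext <;> simp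
  rw [hu]
  have hN' : (‖n‖ : ℂ) ≠ 0 := by exact_mod_cast hN
  push_cast at this ⊢
  field_simp
  apply mul_left_cancel₀ hN'
  linear_combination this

/-- The rotation from `c k` to `c (k + 1)` in the plane orthogonal to `n (k + 1)`. -/
def turn {N : ℕ} [NeZero N] (n c : Fin N → E3) (k : Fin N) : ℂ :=
  ⟨inner ℝ (c k) (c (k + 1)), det3 (n (k + 1)) (c k) (c (k + 1)) / ‖n (k + 1)‖⟩

/-- Up to a positive factor, the product of the squares of the `solid z (n k) (n (k + 1))` does not
depend on `z`. -/
theorem prod_solid_sq_mul_prod_turn {N : ℕ} [NeZero N] {n c : Fin N → E3} (hn : ∀ k, n k ≠ 0)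
    (hc : ∀ k, c k ≠ 0) (h1 : ∀ k, inner ℝ (c k) (n k) = 0)
    (h2 : ∀ k, inner ℝ (c k) (n (k + 1)) = 0) {z : E3} (hz : ‖z‖ = 1)
    (hs : ∀ k, solid z (n k) (n (k + 1)) ≠ 0) :
    ∃ r : ℝ, 0 < r ∧ (∏ k, solid z (n k) (n (k + 1)) ^ 2) * ∏ k, turn n c k = r := by
  obtain ⟨e₁, e₂, hi, x1, x2, x3⟩ := exists_frame hz
  have hm0 : ∀ k, 0 ≤ ‖n k‖ + inner ℝ (n k) z := by
    intro k
    have := neg_le_of_abs_le (abs_real_inner_le_norm (n k) z)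
    rw [hz] at this; linarith
  have edge := fun k => solid_mul_transport hz hi x3 (h1 k) (h2 k)
  -- A vanishing factor means that `n k` is opposite to `z`. Then its part orthogonal to `z`
  -- vanishes as well, and with it `solid`, which is excluded.
  have hdeg : ∀ k, ‖n k‖ + inner ℝ (n k) z = 0 → inner ℝ (n k) e₁ = 0 ∧ inner ℝ (n k) e₂ = 0 := by
    intro k hk
    have := hi (n k) (n k)
    rw [real_inner_self_eq_norm_sq] at this
    have e : inner ℝ (n k) z = -‖n k‖ := by linarith
    rw [e] at this
    constructor <;> nlinarith [sq_nonneg (inner ℝ (n k) e₁), sq_nonneg (inner ℝ (n k) e₂)]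
  have hsf : ∀ k, solid z (n k) (n (k + 1)) =
      ((‖n k‖ + inner ℝ (n k) z : ℝ) : ℂ) * ((‖n (k + 1)‖ + inner ℝ (n (k + 1)) z : ℝ) : ℂ) +
      conj (⟨inner ℝ (n k) e₁, inner ℝ (n k) e₂⟩ : ℂ) *
        ⟨inner ℝ (n (k + 1)) e₁, inner ℝ (n (k + 1)) e₂⟩ := by
    intro k
    apply Complex.ext
    · simp only [solid, hz, Complex.add_re, Complex.mul_re, Complex.ofReal_re, Complex.ofReal_im,
        Complex.conj_re, Complex.conj_im]
      rw [hi (n k) (n (k + 1)), real_inner_comm (n k) z]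
      ring
    · simp only [solid, Complex.add_im, Complex.mul_im, Complex.ofReal_re, Complex.ofReal_im,
        Complex.conj_re, Complex.conj_im]
      rw [← inner_cross, real_inner_comm, x3]
      ring
  have hm : ∀ k, 0 < ‖n k‖ + inner ℝ (n k) z := by
    intro k
    refine lt_of_le_of_ne (hm0 k) (fun h => hs k ?_)
    obtain ⟨p1, p2⟩ := hdeg k h.symm
    rw [hsf, ← h, p1, p2]
    have : (⟨0, 0⟩ : ℂ) = 0 := rfl
    simp [this]
  set X : E3 → E3 → ℂ := transport e₁ e₂ z with hX
  set r : Fin N → ℝ := fun k => ‖solid z (n k) (n (k + 1))‖ ^ 2 *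
    ((‖n k‖ + inner ℝ (n k) z) * (‖n (k + 1)‖ + inner ℝ (n (k + 1)) z) * ‖c k‖ ^ 2) with hr
  have hrpos : ∀ k, 0 < r k := by
    intro k
    have := norm_pos_iff.2 (hs k)
    have := norm_pos_iff.2 (hc k)
    have := hm k
    have := hm (k + 1)
    positivity
  have edge2 : ∀ k, solid z (n k) (n (k + 1)) ^ 2 * (X (n k) (c k) * conj (X (n (k + 1)) (c k))) =
      (r k : ℂ) := by
    intro k
    have e := edge k
    have : (r k : ℂ) = solid z (n k) (n (k + 1)) * (conj (solid z (n k) (n (k + 1))) *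
        (((‖n k‖ + inner ℝ (n k) z) * (‖n (k + 1)‖ + inner ℝ (n (k + 1)) z) * ‖c k‖ ^ 2 : ℝ) : ℂ)) := by
      rw [← mul_assoc, Complex.mul_conj, Complex.normSq_eq_norm_sq, ← Complex.ofReal_mul]
    rw [this, ← e]; ring
  have vert := fun k => transport_rotate hi x1 x2 x3 (hn (k + 1)) (h2 k) (h1 (k + 1))
  -- The identities along the arcs relate `A` to the conjugate of `B`, and the rotations at the
  -- vertices relate `A` to `B`. Eliminating `A` leaves `B * conj B`, a positive number, so that `z`
  -- only enters through positive factors.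
  set A := ∏ k, X (n k) (c k)
  set B := ∏ k, X (n (k + 1)) (c k)
  have E : (∏ k, solid z (n k) (n (k + 1)) ^ 2) * (A * conj B) = ((∏ k, r k : ℝ) : ℂ) := by
    rw [map_prod, ← Finset.prod_mul_distrib, ← Finset.prod_mul_distrib, Complex.ofReal_prod]
    exact Finset.prod_congr rfl fun k _ => edge2 k
  have V : ((∏ k, ‖c k‖ ^ 2 : ℝ) : ℂ) * A = (∏ k, turn n c k) * B := by
    have : A = ∏ k, X (n (k + 1)) (c (k + 1)) :=
      (Equiv.prod_comp (Equiv.addRight (1 : Fin N)) fun k => X (n k) (c k)).symm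
    rw [this, Complex.ofReal_prod, ← Finset.prod_mul_distrib, ← Finset.prod_mul_distrib]
    exact Finset.prod_congr rfl fun k _ => vert k
  have hR : 0 < ∏ k, r k := Finset.prod_pos fun k _ => hrpos k
  have hC : 0 < ∏ k, ‖c k‖ ^ 2 := Finset.prod_pos fun k _ => by
    have := norm_pos_iff.2 (hc k); positivity
  have hB : B ≠ 0 := by
    intro h
    rw [h, map_zero, mul_zero, mul_zero] at E
    exact hR.ne (by exact_mod_cast E)
  have hB2 : 0 < ‖B‖ ^ 2 := by have := norm_pos_iff.2 hB; positivity
  have hBB : B * conj B = ((‖B‖ ^ 2 : ℝ) : ℂ) := by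
    rw [Complex.mul_conj, Complex.normSq_eq_norm_sq]
  generalize (∏ k, solid z (n k) (n (k + 1)) ^ 2) = S at *
  generalize (∏ k, turn n c k) = T at *
  generalize (∏ k, r k) = R at *
  generalize (∏ k, ‖c k‖ ^ 2) = C at *
  clear_value A B
  refine ⟨R * C / ‖B‖ ^ 2, div_pos (mul_pos hR hC) hB2, ?_⟩
  rw [Complex.ofReal_div, Complex.ofReal_mul, ← E, ← hBB, eq_div_iff (by
    rw [hBB]; exact_mod_cast hB2.ne')]
  linear_combination (-S * conj B) * V

/-- Modulo `2π`, the total solid angle does not depend on the base point. -/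
theorem exists_int_sum_arg_solid {N : ℕ} [NeZero N] {n c : Fin N → E3} (hn : ∀ k, n k ≠ 0)
    (hc : ∀ k, c k ≠ 0) (h1 : ∀ k, inner ℝ (c k) (n k) = 0)
    (h2 : ∀ k, inner ℝ (c k) (n (k + 1)) = 0) {z : E3} (hz : z ≠ 0)
    (hs : ∀ k, solid z (n k) (n (k + 1)) ≠ 0) :
    ∃ j : ℤ, 2 * ∑ k, (solid z (n k) (n (k + 1))).arg + ∑ k, (turn n c k).arg = 2 * Real.pi * j := by
  have pz : 0 < ‖z‖⁻¹ := by positivity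
  have hsc : ∀ k, solid ((‖z‖⁻¹ : ℝ) • z) (n k) (n (k + 1)) =
      ((‖z‖⁻¹ : ℝ) : ℂ) * solid z (n k) (n (k + 1)) := by
    intro k
    have := solid_smul pz.le zero_le_one zero_le_one z (n k) (n (k + 1))
    simpa using this
  have harg : ∀ k, (solid ((‖z‖⁻¹ : ℝ) • z) (n k) (n (k + 1))).arg =
      (solid z (n k) (n (k + 1))).arg := by
    intro k; rw [hsc, Complex.arg_real_mul _ pz]
  obtain ⟨r, hr, h⟩ := prod_solid_sq_mul_prod_turn hn hc h1 h2 (norm_normalize hz) (by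
    intro k; rw [hsc]; exact mul_ne_zero (by exact_mod_cast pz.ne') (hs k))
  set q : Fin N → ℂ := fun k => solid ((‖z‖⁻¹ : ℝ) • z) (n k) (n (k + 1)) with hq
  have e1 : ∏ k, q k ^ 2 = ((∏ k, ‖q k‖ ^ 2 : ℝ) : ℂ) *
      Complex.exp (((2 * ∑ k, (q k).arg : ℝ) : ℂ) * Complex.I) := by
    rw [Complex.ofReal_mul, Complex.ofReal_sum, Finset.mul_sum, Finset.sum_mul, Complex.exp_sum,
      Complex.ofReal_prod, ← Finset.prod_mul_distrib]
    refine Finset.prod_congr rfl fun k _ => ?_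
    conv_lhs => rw [← Complex.norm_mul_exp_arg_mul_I (q k)]
    rw [mul_pow, ← Complex.exp_nat_mul]
    push_cast; ring_nf
  have e2 : ∏ k, turn n c k = ((∏ k, ‖turn n c k‖ : ℝ) : ℂ) *
      Complex.exp (((∑ k, (turn n c k).arg : ℝ) : ℂ) * Complex.I) := by
    rw [Complex.ofReal_sum, Finset.sum_mul, Complex.exp_sum, Complex.ofReal_prod,
      ← Finset.prod_mul_distrib]
    refine Finset.prod_congr rfl fun k _ => ?_
    conv_lhs => rw [← Complex.norm_mul_exp_arg_mul_I (turn n c k)]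
  rw [e1, e2] at h
  set ρ := (∏ k, ‖q k‖ ^ 2) * ∏ k, ‖turn n c k‖ with hρ
  set φ := 2 * ∑ k, (q k).arg + ∑ k, (turn n c k).arg with hφ
  have h' : (ρ : ℂ) * Complex.exp ((φ : ℂ) * Complex.I) = r := by
    rw [← h, hρ, hφ]; push_cast; rw [add_mul, Complex.exp_add]; ring
  have hρ0 : 0 ≤ ρ := by positivity
  have hρr : ρ = r := by
    have := congrArg norm h'
    rw [norm_mul, Complex.norm_exp_ofReal_mul_I, mul_one, Complex.norm_real, Complex.norm_real,
      Real.norm_eq_abs, Real.norm_eq_abs, abs_of_nonneg hρ0, abs_of_pos hr] at this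
    exact this
  have hexp : Complex.exp ((φ : ℂ) * Complex.I) = 1 := by
    rw [hρr] at h'
    have : (r : ℂ) ≠ 0 := by exact_mod_cast hr.ne'
    exact mul_left_cancel₀ this (by rw [h', mul_one])
  obtain ⟨j, hj⟩ := Complex.exp_eq_one_iff.1 hexp
  refine ⟨j, ?_⟩
  have : φ = 2 * Real.pi * j := by
    have h3 : (φ : ℂ) = ((2 * Real.pi * j : ℝ) : ℂ) := by
      apply mul_right_cancel₀ Complex.I_ne_zero
      rw [hj]; push_cast; ring
    exact_mod_cast h3
  rw [← this, hφ]
  simp only [hq, harg]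

end

end PolyhedralSurface

namespace PolyhedralSurface

noncomputable section

/-! ### The winding function of a closed chain of great circle arcs -/

open Filter

theorem eventually_eq_of_tendsto_int {α : Type*} {F : Filter α} {f : α → ℝ} {m : ℤ}
    (h : Tendsto f F (𝓝 m)) (hf : ∀ᶠ x in F, ∃ j : ℤ, f x = j) : ∀ᶠ x in F, f x = m := by
  have := h.eventually (Metric.ball_mem_nhds (m : ℝ) one_pos)
  filter_upwards [this, hf] with x hx hj
  obtain ⟨j, hj⟩ := hj
  rw [Real.dist_eq, hj] at hx
  have : |j - m| < 1 := by exact_mod_cast hx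
  have : j - m = 0 := Int.abs_lt_one_iff.1 this
  rw [hj]; exact_mod_cast sub_eq_zero.1 this

theorem mem_sector_comm {a b x : E3} : x ∈ sector a b ↔ x ∈ sector b a := by
  constructor <;> rintro ⟨s, t, hs, ht, rfl⟩ <;> exact ⟨t, s, ht, hs, add_comm _ _⟩

/-- At a point inside the arc `solid` is a negative real number. The side from which the point is
approached decides the sign of the imaginary part, hence whether the argument tends to -π or to π.
All jumps come from here. -/
theorem tendsto_arg_solid_left {a b p : E3} (h : cross a b ≠ 0) {s t : ℝ} (hs : 0 < s) (ht : 0 < t)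
    (hp : p = s • a + t • b) {α : Type*} {F : Filter α} {f : α → E3} (hf : Tendsto f F (𝓝 p))
    (hd : ∀ᶠ x in F, 0 < det3 (f x) a b) :
    Tendsto (fun x => (solid (-f x) a b).arg) F (𝓝 (-Real.pi)) := by
  have hre : (solid (-p) a b).re < 0 := by rw [hp]; exact solid_re_neg h hs ht
  have him : (solid (-p) a b).im = 0 := by
    rw [solid_im, hp]
    simp [det3_neg_left, det3_add_left, det3_smul_left]
  refine (Complex.tendsto_arg_nhdsWithin_im_neg_of_re_neg_of_im_zero hre him).comp ?_
  refine tendsto_nhdsWithin_iff.2 ⟨?_, ?_⟩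
  · have : Continuous fun y => solid (-y) a b := by fun_prop
    exact (this.tendsto p).comp hf
  · filter_upwards [hd] with x hx
    simp only [solid_im, det3_neg_left]; linarith

theorem tendsto_arg_solid_right {a b p : E3} (h : cross a b ≠ 0) {s t : ℝ} (hs : 0 < s) (ht : 0 < t)
    (hp : p = s • a + t • b) {α : Type*} {F : Filter α} {f : α → E3} (hf : Tendsto f F (𝓝 p))
    (hd : ∀ᶠ x in F, det3 (f x) a b < 0) :
    Tendsto (fun x => (solid (-f x) a b).arg) F (𝓝 Real.pi) := by
  have hre : (solid (-p) a b).re < 0 := by rw [hp]; exact solid_re_neg h hs ht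
  have him : (solid (-p) a b).im = 0 := by
    rw [solid_im, hp]
    simp [det3_neg_left, det3_add_left, det3_smul_left]
  refine (Complex.tendsto_arg_nhdsWithin_im_nonneg_of_re_neg_of_im_zero hre him).comp ?_
  refine tendsto_nhdsWithin_iff.2 ⟨?_, ?_⟩
  · have : Continuous fun y => solid (-y) a b := by fun_prop
    exact (this.tendsto p).comp hf
  · filter_upwards [hd] with x hx
    simp only [solid_im, det3_neg_left]; linarith

variable {n : ℕ} [NeZero n]

/-- The (unnormalized) normal vectors of the faces of the cone over a closed polygon. -/
def nrm (a : Fin n → E3) (k : Fin n) : E3 := cross (a k) (a (k + 1))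

/-- A closed polygon such that the cone over it is immersed along its edges: its faces are
nondegenerate, and successive faces do not overlap. -/
structure Immersed (a : Fin n → E3) : Prop where
  cross_ne : ∀ k, nrm a k ≠ 0
  fold : ∀ k, 0 < ‖nrm a k‖ * ‖nrm a (k + 1)‖ + inner ℝ (nrm a k) (nrm a (k + 1))

/-- The sum of the angles of the faces. -/
def angleSum (a : Fin n → E3) : ℝ := ∑ k, InnerProductGeometry.angle (a k) (a (k + 1))

/-- The winding number of the Gauss image, as a real number. -/
def wind (a : Fin n → E3) (x : E3) : ℝ :=
  (2 * Real.pi - angleSum a - 2 * ∑ k, (solid (-x) (nrm a k) (nrm a (k + 1))).arg) / (4 * Real.pi)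

theorem arg_turn {a b : E3} (h : cross a b ≠ 0) :
    Complex.arg ⟨inner ℝ a b, det3 (cross a b) a b / ‖cross a b‖⟩ =
      InnerProductGeometry.angle a b := by
  have ha := norm_pos_iff.2 (cross_ne_zero_left h)
  have hb := norm_pos_iff.2 (cross_ne_zero_right h)
  have hn := norm_pos_iff.2 h
  have hd : det3 (cross a b) a b = ‖cross a b‖ ^ 2 := by
    rw [← inner_cross, real_inner_self_eq_norm_sq]
  have hsin : ‖a‖ * ‖b‖ * Real.sin (InnerProductGeometry.angle a b) = ‖cross a b‖ := by
    have h1 : 0 ≤ Real.sin (InnerProductGeometry.angle a b) :=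
      Real.sin_nonneg_of_nonneg_of_le_pi (InnerProductGeometry.angle_nonneg _ _)
        (InnerProductGeometry.angle_le_pi _ _)
    have h2 := InnerProductGeometry.cos_angle_mul_norm_mul_norm a b
    have h3 := norm_cross_sq a b
    rw [← h2] at h3
    have h4 := Real.sin_sq_add_cos_sq (InnerProductGeometry.angle a b)
    apply (sq_eq_sq₀ (by positivity) hn.le).1
    rw [h3]
    linear_combination (‖a‖ ^ 2 * ‖b‖ ^ 2) * h4
  have : (⟨inner ℝ a b, det3 (cross a b) a b / ‖cross a b‖⟩ : ℂ) = ((‖a‖ * ‖b‖ : ℝ) : ℂ) *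
      (Complex.cos (InnerProductGeometry.angle a b) +
        Complex.sin (InnerProductGeometry.angle a b) * Complex.I) := by
    rw [← Complex.ofReal_cos, ← Complex.ofReal_sin]
    apply Complex.ext
    · have := InnerProductGeometry.cos_angle_mul_norm_mul_norm a b
      simp only [Complex.add_re, Complex.ofReal_im, Complex.mul_re, Complex.ofReal_re,
        Complex.I_re, Complex.I_im]
      linarith
    · simp only [hd, Complex.add_im, Complex.ofReal_im, Complex.mul_im,
        Complex.ofReal_re, Complex.I_re, Complex.I_im]
      field_simp
      rw [pow_two] at hd
      linarith
  rw [this, Complex.arg_mul_cos_add_sin_mul_I (by positivity)]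
  exact ⟨by linarith [InnerProductGeometry.angle_nonneg a b, Real.pi_pos],
    InnerProductGeometry.angle_le_pi _ _⟩

/-- The edge `a (k + 1)` is orthogonal to both adjacent normals, and it is rotated into the next
edge by the angle of the face between them; so the rotations at the vertices add up to the angle
sum. The holonomy is only known modulo 2π, which accounts for the factor 2. -/
theorem exists_int_wind {a : Fin n → E3} (ha : ∀ k, nrm a k ≠ 0) {x : E3} (hx : x ≠ 0)
    (hs : ∀ k, solid (-x) (nrm a k) (nrm a (k + 1)) ≠ 0) : ∃ j : ℤ, 2 * wind a x = j := by
  have h1 : ∀ k, inner ℝ (a (k + 1)) (nrm a k) = 0 := fun k => inner_cross_right _ _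
  have h2 : ∀ k, inner ℝ (a (k + 1)) (nrm a (k + 1)) = 0 := fun k => inner_cross_left _ _
  have h3 : ∀ k, a (k + 1) ≠ 0 := fun k => cross_ne_zero_right (ha k)
  obtain ⟨j, hj⟩ := exists_int_sum_arg_solid (n := nrm a) (c := fun k => a (k + 1)) ha h3 h1 h2
    (neg_ne_zero.2 hx) hs
  have : ∑ k, (turn (nrm a) (fun k => a (k + 1)) k).arg = angleSum a := by
    refine Eq.trans (Finset.sum_congr rfl fun k _ => arg_turn (ha (k + 1))) ?_
    exact Equiv.sum_comp (Equiv.addRight (1 : Fin n))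
      fun k => InnerProductGeometry.angle (a k) (a (k + 1))
  rw [this] at hj
  refine ⟨1 - j, ?_⟩
  have hp := Real.pi_pos
  rw [wind]; push_cast
  field_simp
  linear_combination (-2) * hj

theorem continuous_nrm (k : Fin n) : Continuous fun a : Fin n → E3 => nrm a k := by
  unfold nrm; fun_prop

theorem continuousAt_angleSum {a : Fin n → E3} (ha : ∀ k, nrm a k ≠ 0) :
    ContinuousAt (angleSum (n := n)) a := by
  refine tendsto_finsetSum _ fun k _ => ?_
  have := InnerProductGeometry.continuousAt_angle (x := (a k, a (k + 1)))
    (cross_ne_zero_left (ha k)) (cross_ne_zero_right (ha k))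
  exact this.comp (f := fun b : Fin n → E3 => (b k, b (k + 1))) (by fun_prop)

/-- The winding number is locally constant, also with respect to the polygon. -/
theorem eventually_wind_eq {a : Fin n → E3} (ha : Immersed a) {x : E3} (hx : x ≠ 0)
    (h : ∀ k, x ∉ sector (nrm a k) (nrm a (k + 1))) :
    ∀ᶠ p : (Fin n → E3) × E3 in 𝓝 (a, x), wind p.1 p.2 = wind a x := by
  have hsl := fun k => solid_mem_slitPlane (ha.cross_ne k) (ha.cross_ne (k + 1)) hx (ha.fold k) (h k)
  have hcs : ∀ k, Continuous fun p : (Fin n → E3) × E3 =>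
      solid (-p.2) (nrm p.1 k) (nrm p.1 (k + 1)) := by
    intro k
    have h1 := (continuous_nrm k).comp (continuous_fst (X := Fin n → E3) (Y := E3))
    have h2 := (continuous_nrm (k + 1)).comp (continuous_fst (X := Fin n → E3) (Y := E3))
    exact Continuous.solid continuous_snd.neg h1 h2
  have hcont : ContinuousAt (fun p : (Fin n → E3) × E3 => 2 * wind p.1 p.2) (a, x) := by
    unfold wind
    refine ContinuousAt.mul continuousAt_const (ContinuousAt.div_const (ContinuousAt.sub
      (ContinuousAt.sub continuousAt_const ?_) (ContinuousAt.mul continuousAt_const ?_)) _)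
    · exact (continuousAt_angleSum ha.cross_ne).comp
        (f := fun p : (Fin n → E3) × E3 => p.1) (x := (a, x)) continuousAt_fst
    · refine tendsto_finsetSum _ fun k _ => ?_
      exact (Complex.continuousAt_arg (hsl k)).comp
        (f := fun p : (Fin n → E3) × E3 => solid (-p.2) (nrm p.1 k) (nrm p.1 (k + 1))) (x := (a, x))
        (hcs k).continuousAt
  obtain ⟨j, hj⟩ := exists_int_wind ha.cross_ne hx fun k => Complex.slitPlane_ne_zero (hsl k)
  have e1 : ∀ᶠ p : (Fin n → E3) × E3 in 𝓝 (a, x), ∀ k,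
      solid (-p.2) (nrm p.1 k) (nrm p.1 (k + 1)) ≠ 0 := by
    rw [eventually_all]
    exact fun k => (hcs k).continuousAt.eventually_ne (Complex.slitPlane_ne_zero (hsl k))
  have e2 : ∀ᶠ p : (Fin n → E3) × E3 in 𝓝 (a, x), ∀ k, nrm p.1 k ≠ 0 := by
    rw [eventually_all]
    exact fun k => ((continuous_nrm k).comp continuous_fst).continuousAt.eventually_ne (ha.cross_ne k)
  have e3 : ∀ᶠ p : (Fin n → E3) × E3 in 𝓝 (a, x), p.2 ≠ 0 :=
    continuous_snd.continuousAt.eventually_ne hx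
  have hcont' : Tendsto (fun p : (Fin n → E3) × E3 => 2 * wind p.1 p.2) (𝓝 (a, x)) (𝓝 (j : ℝ)) := by
    rw [← hj]; exact hcont
  filter_upwards [eventually_eq_of_tendsto_int hcont' (by
    filter_upwards [e1, e2, e3] with p h1 h2 h3 using exists_int_wind h2 h3 h1)] with p hp
  linarith

/-- How the winding number changes when one crosses the Gauss image. -/
theorem eventually_wind_crossing {a : Fin n → E3} (ha : Immersed a) {p u : E3} (hp : p ≠ 0)
    (hns : ∀ k, ∀ s : ℝ, 0 ≤ s → p ≠ s • nrm a k)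
    (htr : ∀ k, p ∈ sector (nrm a k) (nrm a (k + 1)) →
      det3 u (nrm a k) (nrm a (k + 1)) ≠ 0) [DecidablePred fun k =>
        p ∈ sector (nrm a k) (nrm a (k + 1))] :
    ∀ᶠ t : ℝ in 𝓝[>] 0, wind a (Real.cos t • p + Real.sin t • u) =
      wind a (Real.cos t • p - Real.sin t • u) +
        ((∑ k, if p ∈ sector (nrm a k) (nrm a (k + 1)) then
          ((SignType.sign (det3 u (nrm a k) (nrm a (k + 1))) : SignType) : ℤ) else 0 : ℤ) : ℝ) := by
  set f : ℝ → E3 := fun t => Real.cos t • p + Real.sin t • u with hf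
  set g : ℝ → E3 := fun t => Real.cos t • p - Real.sin t • u with hg
  have hf0 : Tendsto f (𝓝[>] 0) (𝓝 p) := by
    have : Continuous f := by fun_prop
    have := this.tendsto 0
    simp only [hf, Real.cos_zero, one_smul, Real.sin_zero, zero_smul, add_zero] at this
    exact this.mono_left nhdsWithin_le_nhds
  have hg0 : Tendsto g (𝓝[>] 0) (𝓝 p) := by
    have : Continuous g := by fun_prop
    have := this.tendsto 0
    simp only [hg, Real.cos_zero, one_smul, Real.sin_zero, zero_smul, sub_zero] at this
    exact this.mono_left nhdsWithin_le_nhds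
  have hsin : ∀ᶠ t : ℝ in 𝓝[>] 0, 0 < Real.sin t := by
    have : Set.Ioo (0 : ℝ) Real.pi ∈ 𝓝[>] (0 : ℝ) := Ioo_mem_nhdsGT Real.pi_pos
    filter_upwards [this] with t ht using Real.sin_pos_of_mem_Ioo ht
  set σ : Fin n → ℤ := fun k => if p ∈ sector (nrm a k) (nrm a (k + 1)) then
      ((SignType.sign (det3 u (nrm a k) (nrm a (k + 1))) : SignType) : ℤ) else 0 with hσ
  have hcomb : ∀ k, p ∈ sector (nrm a k) (nrm a (k + 1)) → ∃ s t : ℝ, 0 < s ∧ 0 < t ∧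
      p = s • nrm a k + t • nrm a (k + 1) ∧ cross (nrm a k) (nrm a (k + 1)) ≠ 0 := by
    intro k hk
    have hc : cross (nrm a k) (nrm a (k + 1)) ≠ 0 := by
      intro h0
      exact htr k hk (by rw [← inner_cross, h0, inner_zero_right])
    obtain ⟨s, t, hs, ht, he⟩ := hk
    refine ⟨s, t, lt_of_le_of_ne hs ?_, lt_of_le_of_ne ht ?_, he, hc⟩
    · rintro rfl; exact hns (k + 1) t ht (by simpa using he)
    · rintro rfl; exact hns k s hs (by simpa using he)
  have hdf : ∀ k, p ∈ sector (nrm a k) (nrm a (k + 1)) → ∀ t,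
      det3 (f t) (nrm a k) (nrm a (k + 1)) = Real.sin t * det3 u (nrm a k) (nrm a (k + 1)) ∧
      det3 (g t) (nrm a k) (nrm a (k + 1)) = -(Real.sin t * det3 u (nrm a k) (nrm a (k + 1))) := by
    intro k hk t
    obtain ⟨s, r, -, -, he, -⟩ := hcomb k hk
    have h0 : det3 p (nrm a k) (nrm a (k + 1)) = 0 := by
      rw [he]; simp [det3_add_left, det3_smul_left]
    simp [hf, hg, sub_eq_add_neg, det3_add_left, det3_smul_left, det3_neg_left, h0]
  -- The argument for an arc through `p` drops by 2π when one passes to the left side of the arc and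
  -- rises by 2π in the other direction; for all other arcs it is continuous at `p`.
  have hterm : ∀ k, Tendsto (fun t => (solid (-g t) (nrm a k) (nrm a (k + 1))).arg -
      (solid (-f t) (nrm a k) (nrm a (k + 1))).arg) (𝓝[>] 0) (𝓝 (2 * Real.pi * σ k)) := by
    intro k
    by_cases hk : p ∈ sector (nrm a k) (nrm a (k + 1))
    · obtain ⟨s, r, hs, hr, he, hc⟩ := hcomb k hk
      rcases lt_or_gt_of_ne (htr k hk) with hneg | hpos
      · have h1 := tendsto_arg_solid_left hc hs hr he hg0 (by
          filter_upwards [hsin] with t ht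
          rw [(hdf k hk t).2]; nlinarith)
        have h2 := tendsto_arg_solid_right hc hs hr he hf0 (by
          filter_upwards [hsin] with t ht
          rw [(hdf k hk t).1]; nlinarith)
        convert h1.sub h2 using 2
        simp only [hσ, if_pos hk, sign_neg hneg, SignType.coe_neg_one]
        push_cast; ring
      · have h1 := tendsto_arg_solid_right hc hs hr he hg0 (by
          filter_upwards [hsin] with t ht
          rw [(hdf k hk t).2]; nlinarith)
        have h2 := tendsto_arg_solid_left hc hs hr he hf0 (by
          filter_upwards [hsin] with t ht
          rw [(hdf k hk t).1]; nlinarith)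
        convert h1.sub h2 using 2
        simp only [hσ, if_pos hk, sign_pos hpos, SignType.coe_one]
        push_cast; ring
    · have hsl := solid_mem_slitPlane (ha.cross_ne k) (ha.cross_ne (k + 1)) hp (ha.fold k) hk
      have hcs : Continuous fun y => solid (-y) (nrm a k) (nrm a (k + 1)) := by fun_prop
      have h1 := ((Complex.continuousAt_arg hsl).tendsto.comp (hcs.tendsto p))
      have := (h1.comp hg0).sub (h1.comp hf0)
      simp only [sub_self] at this
      simpa [hσ, if_neg hk] using this
  have hsum : Tendsto (fun t => 2 * wind a (f t) - 2 * wind a (g t)) (𝓝[>] 0)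
      (𝓝 ((2 * ∑ k, σ k : ℤ) : ℝ)) := by
    have := (tendsto_finsetSum Finset.univ fun k _ => hterm k).div_const Real.pi
    have h2 : (∑ k, 2 * Real.pi * (σ k : ℝ)) / Real.pi = ((2 * ∑ k, σ k : ℤ) : ℝ) := by
      rw [← Finset.mul_sum]; push_cast; field_simp
    rw [h2] at this
    refine this.congr fun t => ?_
    simp only [wind, Finset.sum_sub_distrib]
    field_simp; ring
  -- Close to `p` the determinants for the arcs through `p` do not vanish, and the other arcs are
  -- out of reach; so `2 * wind` is an integer on both sides.
  have hne : ∀ (h : ℝ → E3), Tendsto h (𝓝[>] 0) (𝓝 p) → (∀ k, p ∈ sector (nrm a k) (nrm a (k + 1)) →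
      ∀ᶠ t in 𝓝[>] 0, det3 (h t) (nrm a k) (nrm a (k + 1)) ≠ 0) →
      ∀ᶠ t in 𝓝[>] 0, ∃ j : ℤ, 2 * wind a (h t) = j := by
    intro h hh hd
    have e1 : ∀ᶠ t in 𝓝[>] 0, ∀ k, solid (-h t) (nrm a k) (nrm a (k + 1)) ≠ 0 := by
      rw [eventually_all]
      intro k
      by_cases hk : p ∈ sector (nrm a k) (nrm a (k + 1))
      · filter_upwards [hd k hk] with t ht h0
        have := congrArg Complex.im h0
        rw [solid_im, det3_neg_left, Complex.zero_im, neg_eq_zero] at this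
        exact ht this
      · have hsl := solid_mem_slitPlane (ha.cross_ne k) (ha.cross_ne (k + 1)) hp (ha.fold k) hk
        have hcs : Continuous fun y => solid (-y) (nrm a k) (nrm a (k + 1)) := by fun_prop
        exact hh.eventually (hcs.continuousAt.eventually_ne (Complex.slitPlane_ne_zero hsl))
    filter_upwards [e1, hh.eventually_ne hp] with t h1 h2 using exists_int_wind ha.cross_ne h2 h1
  have hi1 := hne f hf0 fun k hk => by
    filter_upwards [hsin] with t ht
    rw [(hdf k hk t).1]; exact mul_ne_zero ht.ne' (htr k hk)
  have hi2 := hne g hg0 fun k hk => by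
    filter_upwards [hsin] with t ht
    rw [(hdf k hk t).2]; exact neg_ne_zero.2 (mul_ne_zero ht.ne' (htr k hk))
  filter_upwards [eventually_eq_of_tendsto_int hsum (by
    filter_upwards [hi1, hi2] with t h1 h2
    obtain ⟨i, hi⟩ := h1
    obtain ⟨j, hj⟩ := h2
    exact ⟨i - j, by rw [hi, hj]; push_cast; ring⟩)] with t ht
  push_cast at ht ⊢
  linarith

end

end PolyhedralSurface

namespace PolyhedralSurface

noncomputable section

/-! ### Embedded stars as closed polygons of directions -/

open Filter

variable {n : ℕ} [NeZero n]

/-- The directions of the edges of an embedded star with apex at the origin. -/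
structure IsStar (a : Fin n → E3) : Prop where
  three_le : 3 ≤ n
  inj : Function.Injective a
  cross_ne : ∀ k, cross (a k) (a (k + 1)) ≠ 0
  fold : ∀ k, ∀ s t r : ℝ, 0 < s → 0 < t → s • a k + r • a (k + 1) ≠ t • a (k + 1 + 1)
  disj : ∀ j k, a j ≠ a k → a j ≠ a (k + 1) → a (j + 1) ≠ a k → a (j + 1) ≠ a (k + 1) →
    ∀ x, x ∈ sector (a j) (a (j + 1)) → x ∈ sector (a k) (a (k + 1)) → x = 0

/-- Both conditions say that the normals of the two faces are not opposite, that is, that the second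
face is not folded back over the first. -/
theorem fold_iff {a b c : E3} (h : cross a b ≠ 0) (h' : cross b c ≠ 0) :
    (∀ s t r : ℝ, 0 < s → 0 < t → s • a + r • b ≠ t • c) ↔
      0 < ‖cross a b‖ * ‖cross b c‖ + inner ℝ (cross a b) (cross b c) := by
  have p1 := norm_pos_iff.2 h
  have p2 := norm_pos_iff.2 h'
  constructor
  · intro hf
    by_contra! hle
    have hz : ‖cross b c‖ • cross a b + ‖cross a b‖ • cross b c = 0 := by
      rw [← norm_eq_zero, ← sq_eq_zero_iff, ← real_inner_self_eq_norm_sq]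
      apply le_antisymm _ (real_inner_self_nonneg)
      have e1 := real_inner_self_eq_norm_sq (cross a b)
      have e2 := real_inner_self_eq_norm_sq (cross b c)
      have hcomm := real_inner_comm (cross a b) (cross b c)
      simp only [inner_add_left, inner_add_right, real_inner_smul_left, real_inner_smul_right]
      rw [e1, e2, hcomm]
      have : 0 ≤ ‖cross a b‖ * ‖cross b c‖ := by positivity
      nlinarith
    have hb := cross_ne_zero_left h'
    have hcr : cross b (‖cross a b‖ • c + (-‖cross b c‖) • a) = 0 := by
      rw [← hz]
      refine ext_coords ?_ ?_ ?_ <;> simp <;> ring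
    have := exists_smul_of_cross_eq_zero hb hcr
    set r := inner ℝ b (‖cross a b‖ • c + (-‖cross b c‖) • a) / ‖b‖ ^ 2
    refine hf ‖cross b c‖ ‖cross a b‖ r p2 p1 ?_
    rw [← this]; module
  · intro hpos s t r hs ht he
    have hc : c = (s / t) • a + (r / t) • b := by
      have : c = t⁻¹ • (t • c) := by rw [smul_smul, inv_mul_cancel₀ ht.ne', one_smul]
      rw [this, ← he]; module
    have hcr : cross b c = (-(s / t)) • cross a b := by
      rw [hc]; refine ext_coords ?_ ?_ ?_ <;> simp <;> ring
    rw [hcr, norm_smul, real_inner_smul_right, real_inner_self_eq_norm_sq, Real.norm_eq_abs, abs_neg,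
      abs_of_pos (div_pos hs ht)] at hpos
    nlinarith

theorem IsStar.immersed {a : Fin n → E3} (h : IsStar a) : Immersed a :=
  ⟨h.cross_ne, fun k => (fold_iff (h.cross_ne k) (h.cross_ne (k + 1))).1 (h.fold k)⟩

theorem mem_convexHull_triangle_iff {p a b x : E3} :
    p + x ∈ convexHull ℝ ({p, p + a, p + b} : Set E3) ↔
      ∃ s t : ℝ, 0 ≤ s ∧ 0 ≤ t ∧ s + t ≤ 1 ∧ x = s • a + t • b := by
  have : ({p, p + a, p + b} : Set E3) = insert p {p + a, p + b} := rfl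
  rw [this, convexHull_insert ⟨_, Set.mem_insert _ _⟩, convexHull_pair]
  simp only [convexJoin_singleton_left, Set.mem_iUnion, segment_eq_image]
  constructor
  · rintro ⟨y, ⟨θ, ⟨h0, h1⟩, rfl⟩, ⟨τ, ⟨t0, t1⟩, he⟩⟩
    refine ⟨τ * (1 - θ), τ * θ, by nlinarith, by positivity, by nlinarith, ?_⟩
    have : x = (1 - τ) • p + τ • ((1 - θ) • (p + a) + θ • (p + b)) - p := by
      simp only at he; rw [he]; abel
    rw [this]; module
  · rintro ⟨s, t, hs, ht, hst, rfl⟩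
    rcases eq_or_lt_of_le (add_nonneg hs ht) with h0 | h0
    · have h1 : s = 0 := by linarith
      have h2 : t = 0 := by linarith
      refine ⟨p + a, ⟨0, by simp, by simp⟩, 0, by simp, ?_⟩
      simp [h1, h2]
    · refine ⟨_, ⟨t / (s + t), ⟨by positivity, ?_⟩, rfl⟩, s + t, ⟨h0.le, hst⟩, ?_⟩
      · rw [div_le_one h0]; linarith
      · have e1 : (s + t) * (1 - t / (s + t)) = s := by field_simp; ring
        have e2 : (s + t) * (t / (s + t)) = t := by field_simp
        simp only [smul_add, smul_smul, e1, e2]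
        have e3 : s • p + s • a + (t • p + t • b) = (s + t) • p + (s • a + t • b) := by module
        rw [e3]; module

/-- The embedded star with given apex and directions. -/
def IsStar.toEmbedded {a : Fin n → E3} (h : IsStar a) (p : E3) : EmbeddedStar n where
  apex := p
  nbr k := p + a k
  three_le := h.three_le
  nbr_injective j k hjk := h.inj (add_left_cancel hjk)
  indep k := by
    rw [affineIndependent_iff_linearIndependent_vsub ℝ _ (0 : Fin 3)]
    have : LinearIndependent ℝ ![a k, a (k + 1)] := by
      rw [LinearIndependent.pair_iff]
      intro s t hst
      exact eq_zero_of_combination (h.cross_ne k) hst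
    have e : (fun i : {i : Fin 3 // i ≠ 0} => (![p, p + a k, p + a (k + 1)] i -ᵥ
        ![p, p + a k, p + a (k + 1)] 0 : E3)) =
        ![a k, a (k + 1)] ∘ (fun i : {i : Fin 3 // i ≠ 0} => (i : Fin 3).pred i.2) := by
      funext ⟨i, hi⟩
      fin_cases i
      · simp at hi
      · simp
      · simp [Fin.pred]
    rw [e]
    refine this.comp _ fun i j hij => ?_
    exact Subtype.ext (Fin.pred_inj.1 hij)
  inter_subset j k := by
    rintro x ⟨hj, hk⟩
    obtain ⟨y, rfl⟩ : ∃ y, x = p + y := ⟨x - p, by abel⟩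
    obtain ⟨s, t, hs, ht, hst, hy⟩ := mem_convexHull_triangle_iff.1 hj
    obtain ⟨s', t', hs', ht', hst', hy'⟩ := mem_convexHull_triangle_iff.1 hk
    -- For neighbouring triangles the coefficient of `a j` must vanish, by independence or by the
    -- fold condition; what remains is a point of the common edge.
    have key : ∀ (j : Fin n) (s t s' t' : ℝ), 0 ≤ s → 0 ≤ t → s + t ≤ 1 → 0 ≤ s' → 0 ≤ t' →
        y = s • a j + t • a (j + 1) → y = s' • a (j + 1) + t' • a (j + 1 + 1) →
        p + y ∈ convexHull ℝ (({p, p + a j, p + a (j + 1)} : Set E3) ∩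
          {p, p + a (j + 1), p + a (j + 1 + 1)}) := by
      intro j s t s' t' hs ht hst hs' ht' hy hy'
      have hs0 : s = 0 := by
        by_contra hs0
        have hspos : 0 < s := lt_of_le_of_ne hs (Ne.symm hs0)
        rcases eq_or_lt_of_le ht' with h0 | h0
        · have : s • a j + (t - s') • a (j + 1) = 0 := by
            have := hy.symm.trans hy'
            rw [← h0, zero_smul, add_zero] at this
            rw [sub_smul, ← add_sub_assoc, this, sub_self]
          exact hs0 (eq_zero_of_combination (h.cross_ne j) this).1
        · refine h.fold j s t' (t - s') hspos h0 ?_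
          have := hy.symm.trans hy'
          rw [sub_smul, ← add_sub_assoc, this]; abel
      subst hs0
      have hseg : p + y ∈ segment ℝ p (p + a (j + 1)) := by
        rw [segment_eq_image]
        refine ⟨t, ⟨ht, by linarith⟩, ?_⟩
        simp only [hy]; module
      refine segment_subset_convexHull ?_ ?_ hseg <;> simp
    by_cases hjk : j = k
    · subst hjk; rwa [Set.inter_self]
    by_cases h1 : k = j + 1
    · subst h1
      exact key j s t s' t' hs ht hst hs' ht' hy hy'
    by_cases h2 : j = k + 1
    · subst h2
      rw [Set.inter_comm]
      exact key k s' t' s t hs' ht' hst' hs ht hy' hy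
    have hy0 : y = 0 := by
      refine h.disj j k (fun e => hjk (h.inj e)) (fun e => h2 (h.inj e))
        (fun e => h1 (h.inj e).symm) (fun e => hjk (add_right_cancel (h.inj e))) y
        ⟨s, t, hs, ht, hy⟩ ⟨s', t', hs', ht', hy'⟩
    rw [hy0, add_zero]
    exact subset_convexHull ℝ _ (by simp)

namespace EmbeddedStar

variable (S : EmbeddedStar n)

/-- The directions of the edges of an embedded star. -/
def dir (k : Fin n) : E3 := S.nbr k - S.apex

theorem nbr_eq (k : Fin n) : S.nbr k = S.apex + S.dir k := by simp [dir]

theorem cross_dir_ne (k : Fin n) : cross (S.dir k) (S.dir (k + 1)) ≠ 0 := by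
  intro h0
  have hi := S.indep k
  rw [affineIndependent_iff_linearIndependent_vsub ℝ _ (0 : Fin 3)] at hi
  have hi2 := hi.comp (fun i : Fin 2 => (⟨i.succ, Fin.succ_ne_zero i⟩ : {i : Fin 3 // i ≠ 0}))
    (fun i j hij => by simpa using hij)
  have e : ((fun i : {i : Fin 3 // i ≠ 0} => (![S.apex, S.nbr k, S.nbr (k + 1)] i -ᵥ
        ![S.apex, S.nbr k, S.nbr (k + 1)] 0 : E3)) ∘
        (fun i : Fin 2 => (⟨i.succ, Fin.succ_ne_zero i⟩ : {i : Fin 3 // i ≠ 0}))) =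
      ![S.dir k, S.dir (k + 1)] := by
    funext i
    fin_cases i <;> rfl
  rw [e] at hi2
  have h1 : S.dir k ≠ 0 := hi2.ne_zero 0
  have := exists_smul_of_cross_eq_zero h1 h0
  rw [LinearIndependent.pair_iff] at hi2
  have := hi2 (inner ℝ (S.dir k) (S.dir (k + 1)) / ‖S.dir k‖ ^ 2) (-1) (by rw [← this]; simp)
  linarith [this.2]

theorem dir_ne_zero (k : Fin n) : S.dir k ≠ 0 := cross_ne_zero_left (S.cross_dir_ne k)

theorem dir_injective : Function.Injective S.dir := fun j k h =>
  S.nbr_injective (by rw [nbr_eq, nbr_eq, h])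

/-- Sectors are unbounded and triangles are not, so a common point is scaled down until its
coefficients are admissible in both triangles. -/
theorem exists_small_mem {j k : Fin n} {x : E3} (hj : x ∈ sector (S.dir j) (S.dir (j + 1)))
    (hk : x ∈ sector (S.dir k) (S.dir (k + 1))) : ∃ ε : ℝ, 0 < ε ∧ S.apex + ε • x ∈
      convexHull ℝ (({S.apex, S.nbr j, S.nbr (j + 1)} : Set E3) ∩
        {S.apex, S.nbr k, S.nbr (k + 1)}) := by
  obtain ⟨s, t, hs, ht, hy⟩ := hj
  obtain ⟨s', t', hs', ht', hy'⟩ := hk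
  have hpos : 0 < 1 + s + t + s' + t' := by positivity
  refine ⟨(1 + s + t + s' + t')⁻¹, by positivity, S.inter_subset j k ⟨?_, ?_⟩⟩
  · rw [nbr_eq, nbr_eq, mem_convexHull_triangle_iff]
    refine ⟨(1 + s + t + s' + t')⁻¹ * s, (1 + s + t + s' + t')⁻¹ * t, by positivity, by positivity,
      ?_, ?_⟩
    · rw [← mul_add, inv_mul_le_iff₀ hpos]; linarith
    · rw [hy]; module
  · rw [nbr_eq, nbr_eq, mem_convexHull_triangle_iff]
    refine ⟨(1 + s + t + s' + t')⁻¹ * s', (1 + s + t + s' + t')⁻¹ * t', by positivity, by positivity,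
      ?_, ?_⟩
    · rw [← mul_add, inv_mul_le_iff₀ hpos]; linarith
    · rw [hy']; module

theorem add_two_ne (hn : 3 ≤ n) (k : Fin n) : k + 1 + 1 ≠ k := by
  obtain ⟨m, rfl⟩ : ∃ m, n = m + 3 := ⟨n - 3, by omega⟩
  intro h
  rw [add_assoc] at h
  have := congrArg Fin.val (left_eq_add.1 h.symm)
  simp only [Fin.val_add, Fin.val_one, Fin.val_zero] at this
  rw [Nat.mod_eq_of_lt (by omega)] at this
  omega

theorem add_one_ne (hn : 3 ≤ n) (k : Fin n) : k + 1 ≠ k := by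
  obtain ⟨m, rfl⟩ : ∃ m, n = m + 3 := ⟨n - 3, by omega⟩
  intro h
  exact one_ne_zero (left_eq_add.1 h.symm)

theorem isStar_dir : IsStar S.dir where
  three_le := S.three_le
  inj := S.dir_injective
  cross_ne := S.cross_dir_ne
  fold k s t r hs ht he := by
    -- The coefficient `r` may be negative. Adding `R` times the common edge to both sides gives a
    -- point of both sectors that is not on the common edge.
    set R := max 0 (-r) with hR
    have hR0 : 0 ≤ R := le_max_left _ _
    have hR1 : 0 ≤ r + R := by have := le_max_right 0 (-r); linarith
    obtain ⟨ε, hε, hx⟩ := S.exists_small_mem (j := k) (k := k + 1)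
      (x := s • S.dir k + (r + R) • S.dir (k + 1)) ⟨s, r + R, hs.le, hR1, rfl⟩
      ⟨R, t, hR0, ht.le, by rw [← he]; module⟩
    have hsub : (({S.apex, S.nbr k, S.nbr (k + 1)} : Set E3) ∩
        {S.apex, S.nbr (k + 1), S.nbr (k + 1 + 1)}) ⊆ {S.apex, S.nbr (k + 1)} := by
      rintro y ⟨h1, h2⟩
      simp only [Set.mem_insert_iff, Set.mem_singleton_iff] at h1 h2 ⊢
      rcases h1 with h1 | h1 | h1
      · exact Or.inl h1
      · rcases h2 with h2 | h2 | h2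
        · exact Or.inl h2
        · exact Or.inr h2
        · exact absurd (S.nbr_injective (h1.symm.trans h2)) (add_two_ne S.three_le k).symm
      · exact Or.inr h1
    have := convexHull_mono hsub hx
    rw [convexHull_pair, segment_eq_image, nbr_eq] at this
    obtain ⟨τ, -, hτ⟩ := this
    simp only at hτ
    have h0 : (ε * s) • S.dir k + (ε * (r + R) - τ) • S.dir (k + 1) = 0 := by
      have h2 : ε • (s • S.dir k + (r + R) • S.dir (k + 1)) = τ • S.dir (k + 1) := by
        have : ε • (s • S.dir k + (r + R) • S.dir (k + 1)) =
          (1 - τ) • S.apex + τ • (S.apex + S.dir (k + 1)) - S.apex := by rw [hτ]; abel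
        rw [this]; module
      rw [sub_smul, ← add_sub_assoc, sub_eq_zero, ← h2]; module
    have := (eq_zero_of_combination (S.cross_dir_ne k) h0).1
    nlinarith
  disj j k h1 h2 h3 h4 x hj hk := by
    obtain ⟨ε, hε, hx⟩ := S.exists_small_mem hj hk
    have hsub : (({S.apex, S.nbr j, S.nbr (j + 1)} : Set E3) ∩
        {S.apex, S.nbr k, S.nbr (k + 1)}) ⊆ {S.apex} := by
      have key : ∀ i l : Fin n, S.dir i ≠ S.dir l → S.nbr i ≠ S.nbr l := fun i l h e =>
        h (by rw [dir, dir, e])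
      rintro y ⟨e1, e2⟩
      simp only [Set.mem_insert_iff, Set.mem_singleton_iff] at e1 e2 ⊢
      rcases e1 with e1 | e1 | e1
      · exact e1
      · rcases e2 with e2 | e2 | e2
        · exact e2
        · exact absurd (e1.symm.trans e2) (key _ _ h1)
        · exact absurd (e1.symm.trans e2) (key _ _ h2)
      · rcases e2 with e2 | e2 | e2
        · exact e2
        · exact absurd (e1.symm.trans e2) (key _ _ h3)
        · exact absurd (e1.symm.trans e2) (key _ _ h4)
    have := convexHull_mono hsub hx
    rw [convexHull_singleton, Set.mem_singleton_iff, add_eq_left] at this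
    exact (smul_eq_zero.1 this).resolve_left hε.ne'

theorem angleDeficit_eq : S.angleDeficit = 2 * Real.pi - angleSum S.dir := rfl

theorem normal_eq (k : Fin n) : S.normal k = (‖nrm S.dir k‖⁻¹ : ℝ) • nrm S.dir k := rfl

theorem norm_nrm_pos (k : Fin n) : 0 < ‖nrm S.dir k‖ := norm_pos_iff.2 (S.cross_dir_ne k)

theorem mem_arc_iff {k : Fin n} {x : E3} :
    x ∈ S.arc k ↔ ‖x‖ = 1 ∧ x ∈ sector (nrm S.dir k) (nrm S.dir (k + 1)) := by
  have h := smul_mem_sector_iff (x := x) (a := nrm S.dir k) (b := nrm S.dir (k + 1)) one_pos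
    (inv_pos.2 (S.norm_nrm_pos k)) (inv_pos.2 (S.norm_nrm_pos (k + 1)))
  rw [one_smul, ← normal_eq, ← normal_eq] at h
  rw [← h]
  rfl

theorem mem_gaussImage_iff {x : E3} :
    x ∈ S.gaussImage ↔ ‖x‖ = 1 ∧ ∃ k, x ∈ sector (nrm S.dir k) (nrm S.dir (k + 1)) := by
  simp only [gaussImage, Set.mem_iUnion, mem_arc_iff, exists_and_left]

theorem ext' {S T : EmbeddedStar n} (h1 : S.apex = T.apex) (h2 : S.nbr = T.nbr) : S = T := by
  cases S; cases T; simp only at h1 h2; subst h1; subst h2; rfl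

theorem dir_toEmbedded {a : Fin n → E3} (h : IsStar a) (p : E3) : (h.toEmbedded p).dir = a := by
  funext k; simp [dir, IsStar.toEmbedded]

end EmbeddedStar

end

end PolyhedralSurface

namespace PolyhedralSurface

noncomputable section

open Filter

/-! ### Simple closed spherical polygons -/

/-- The target is given the discrete topology, in which local constancy is continuity. Most
connectedness arguments below use this form. -/
theorem eq_of_locally_eq {X β : Type*} [TopologicalSpace X] {s : Set X} (hs : IsPreconnected s)
    {f : X → β} (h : ∀ x ∈ s, ∀ᶠ y in 𝓝 x, f y = f x) {x y : X} (hx : x ∈ s) (hy : y ∈ s) :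
    f x = f y := by
  let _ : TopologicalSpace β := ⊥
  have : DiscreteTopology β := ⟨rfl⟩
  refine hs.constant (fun z hz => ?_) hx hy
  refine ContinuousAt.continuousWithinAt ?_
  exact (continuousAt_const (y := f z)).congr ((h z hz).mono fun _ e => e.symm)

/-- A description by closed conditions without the coefficients, whence `isClosed_sector`. -/
theorem mem_sector_iff {a b : E3} (h : cross a b ≠ 0) {x : E3} :
    x ∈ sector a b ↔ det3 a b x = 0 ∧ 0 ≤ inner ℝ (cross x b) (cross a b) ∧
      0 ≤ inner ℝ (cross a x) (cross a b) := by
  have h0 : 0 < ‖cross a b‖ ^ 2 := by positivity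
  have key : ∀ s t : ℝ, inner ℝ (cross (s • a + t • b) b) (cross a b) = s * ‖cross a b‖ ^ 2 ∧
      inner ℝ (cross a (s • a + t • b)) (cross a b) = t * ‖cross a b‖ ^ 2 := by
    intro s t
    rw [← real_inner_self_eq_norm_sq, ← real_inner_smul_left, ← real_inner_smul_left]
    constructor <;> congr 1 <;> refine ext_coords ?_ ?_ ?_ <;> simp <;> ring
  constructor
  · rintro ⟨s, t, hs, ht, rfl⟩
    rw [(key s t).1, (key s t).2]
    refine ⟨by simp [det3_add_right, det3_smul_right], by positivity, by positivity⟩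
  · rintro ⟨h1, h2, h3⟩
    obtain ⟨s, t, rfl⟩ := exists_combination h h1
    rw [(key s t).1] at h2
    rw [(key s t).2] at h3
    exact ⟨s, t, nonneg_of_mul_nonneg_left h2 h0, nonneg_of_mul_nonneg_left h3 h0, rfl⟩

theorem isClosed_sector {a b : E3} (h : cross a b ≠ 0) : IsClosed (sector a b) := by
  have : sector a b = {x | det3 a b x = 0} ∩ ({x | 0 ≤ inner ℝ (cross x b) (cross a b)} ∩
      {x | 0 ≤ inner ℝ (cross a x) (cross a b)}) := by
    ext x; exact mem_sector_iff h
  rw [this]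
  refine (isClosed_eq (by fun_prop) continuous_const).inter
    ((isClosed_le continuous_const (by fun_prop)).inter (isClosed_le continuous_const (by fun_prop)))

theorem norm_mul_add_inner_pos {a b : E3} (h : cross a b ≠ 0) : 0 < ‖a‖ * ‖b‖ + inner ℝ a b := by
  have h1 := norm_cross_sq a b
  have h2 : 0 < ‖cross a b‖ ^ 2 := by positivity
  have h3 : |inner ℝ a b| < ‖a‖ * ‖b‖ := by
    refine abs_lt_of_sq_lt_sq ?_ (by positivity)
    nlinarith
  linarith [(abs_lt.1 h3).1]

/-- A simple closed spherical polygon with `m` vertices in general position. -/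
structure SimplePoly (m : ℕ) (q : ℤ → E3) : Prop where
  three_le : 3 ≤ m
  per : ∀ i, q (i + m) = q i
  inj : ∀ i j, q i = q j → (m : ℤ) ∣ j - i
  gen : ∀ i j k, q i ≠ q j → q j ≠ q k → q i ≠ q k → det3 (q i) (q j) (q k) ≠ 0
  disj : ∀ i j, q i ≠ q j → q i ≠ q (j + 1) → q (i + 1) ≠ q j → q (i + 1) ≠ q (j + 1) →
    ∀ x, x ∈ sector (q i) (q (i + 1)) → x ∈ sector (q j) (q (j + 1)) → x = 0

/-- The cone over a spherical polygon. -/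
def trace (q : ℤ → E3) : Set E3 := ⋃ i, sector (q i) (q (i + 1))

theorem mem_trace {q : ℤ → E3} {x : E3} : x ∈ trace q ↔ ∃ i, x ∈ sector (q i) (q (i + 1)) :=
  Set.mem_iUnion

theorem sector_zero_mem (a b : E3) : (0 : E3) ∈ sector a b := ⟨0, 0, le_rfl, le_rfl, by simp⟩

theorem zero_mem_trace (q : ℤ → E3) : (0 : E3) ∈ trace q :=
  mem_trace.2 ⟨0, sector_zero_mem _ _⟩

namespace SimplePoly

variable {m : ℕ} {q : ℤ → E3} (hq : SimplePoly m q)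

include hq

theorem per_mul (i k : ℤ) : q (i + k * m) = q i := by
  induction k using Int.induction_on with
  | zero => simp
  | succ k ih =>
    rw [← ih, ← hq.per (i + k * m)]; congr 1; ring
  | pred k ih =>
    rw [← ih, ← hq.per (i + (-(k : ℤ) - 1) * m)]; congr 1; ring

theorem eq_iff {i j : ℤ} : q i = q j ↔ (m : ℤ) ∣ j - i := by
  refine ⟨hq.inj i j, ?_⟩
  rintro ⟨k, hk⟩
  rw [← hq.per_mul i k]; congr 1; linarith

theorem eq_add {i j : ℤ} (h : q i = q j) (k : ℤ) : q (i + k) = q (j + k) := by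
  rw [hq.eq_iff] at h ⊢; simpa using h

theorem ne_of_lt {i j : ℤ} (h1 : i < j) (h2 : j < i + m) : q i ≠ q j := by
  rw [Ne, hq.eq_iff]
  intro h
  have := Int.le_of_dvd (by linarith) h
  linarith

theorem ne_one (i : ℤ) : q i ≠ q (i + 1) := by
  have := hq.three_le
  exact hq.ne_of_lt (by linarith) (by omega)

theorem ne_two (i : ℤ) : q i ≠ q (i + 1 + 1) := by
  have := hq.three_le
  exact hq.ne_of_lt (by linarith) (by omega)

theorem det_ne (i : ℤ) : det3 (q i) (q (i + 1)) (q (i + 1 + 1)) ≠ 0 :=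
  hq.gen _ _ _ (hq.ne_one _) (hq.ne_one _) (hq.ne_two _)

theorem cross_ne (i : ℤ) : cross (q i) (q (i + 1)) ≠ 0 := cross_ne_zero_of_det3 (hq.det_ne i)

theorem vertex_ne_zero (i : ℤ) : q i ≠ 0 := cross_ne_zero_left (hq.cross_ne i)

theorem cross_ne' {i j : ℤ} (h : q i ≠ q j) : cross (q i) (q j) ≠ 0 := by
  by_cases h1 : q (i + 1) = q j
  · rw [← h1]; exact hq.cross_ne i
  · exact cross_ne_zero_of_det3 (hq.gen i j (i + 1) h (Ne.symm h1) (hq.ne_one i))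

/-- An interior point of an edge lies on no other edge. -/
theorem edge_unique {i j : ℤ} {s t : ℝ} (hs : 0 < s) (ht : 0 < t)
    (h : s • q i + t • q (i + 1) ∈ sector (q j) (q (j + 1))) : q j = q i := by
  by_contra hne
  have hne1 : q (i + 1) ≠ q (j + 1) := by
    intro h
    have := hq.eq_add h (-1)
    simp only [add_neg_cancel_right] at this
    exact hne this.symm
  have hmem : s • q i + t • q (i + 1) ∈ sector (q i) (q (i + 1)) := ⟨s, t, hs.le, ht.le, rfl⟩
  -- If the two edges share an endpoint, the common point would make three successive vertices
  -- linearly dependent.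
  by_cases h2 : q i = q (j + 1)
  · obtain ⟨s', t', hs', ht', he⟩ := h
    have hd : det3 (q j) (q (j + 1)) (s • q i + t • q (i + 1)) = 0 := by
      rw [he]; simp [det3_add_right, det3_smul_right]
    rw [h2, hq.eq_add h2 1] at hd
    simp only [det3_add_right, det3_smul_right, det3_self_right, mul_zero, zero_add] at hd
    exact hq.det_ne j ((mul_eq_zero.1 hd).resolve_left ht.ne')
  · by_cases h3 : q (i + 1) = q j
    · obtain ⟨s', t', hs', ht', he⟩ := h
      have hd : det3 (s • q i + t • q (i + 1)) (q j) (q (j + 1)) = 0 := by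
        rw [he]; simp [det3_add_left, det3_smul_left]
      rw [← h3, ← hq.eq_add h3 1] at hd
      simp only [det3_add_left, det3_smul_left, det3_self_left, mul_zero, add_zero] at hd
      exact hq.det_ne i ((mul_eq_zero.1 hd).resolve_left hs.ne')
    · have h0 := hq.disj i j (Ne.symm hne) h2 h3 hne1 _ hmem h
      exact hs.ne' (eq_zero_of_combination (hq.cross_ne i) h0).1

/-- A vertex lies on the adjacent edges only. -/
theorem vertex_unique {i j : ℤ} {r : ℝ} (hr : 0 < r)
    (h : r • q i ∈ sector (q j) (q (j + 1))) : q i = q j ∨ q i = q (j + 1) := by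
  by_contra! hne
  have hi : r • q i ∈ sector (q i) (q (i + 1)) := ⟨r, 0, hr.le, le_rfl, by simp⟩
  have hpos : r • q i ≠ 0 := smul_ne_zero hr.ne' (hq.vertex_ne_zero i)
  obtain ⟨s, t, hs, ht, he⟩ := h
  have hd : det3 (q j) (q (j + 1)) (q i) = 0 := by
    have : det3 (q j) (q (j + 1)) (r • q i) = 0 := by
      rw [he]; simp [det3_add_right, det3_smul_right]
    rw [det3_smul_right] at this
    exact (mul_eq_zero.1 this).resolve_left hr.ne'
  exact hq.gen _ _ _ (hq.ne_one j) (Ne.symm hne.2) (Ne.symm hne.1) hd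

theorem exists_fin (i : ℤ) : ∃ k : Fin m, q i = q (k : ℤ) ∧ q (i + 1) = q ((k : ℤ) + 1) := by
  have hm : (0 : ℤ) < m := by have := hq.three_le; omega
  have h0 := Int.emod_nonneg i hm.ne'
  have h1 := Int.emod_lt_of_pos i hm
  have h2 : q i = q (i % m) := by
    rw [hq.eq_iff, Int.emod_def]
    exact ⟨-(i / m), by ring⟩
  refine ⟨⟨(i % m).toNat, by omega⟩, ?_, ?_⟩
  · simp only [Int.toNat_of_nonneg h0]; exact h2
  · simp only [Int.toNat_of_nonneg h0]; exact hq.eq_add h2 1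

/-- Near a point there are only the edges through this point. -/
theorem eventually_mem_sector (x : E3) :
    ∀ᶠ y in 𝓝 x, ∀ i, y ∈ sector (q i) (q (i + 1)) → x ∈ sector (q i) (q (i + 1)) := by
  have : ∀ k : Fin m, ∀ᶠ y in 𝓝 x, y ∈ sector (q (k : ℤ)) (q ((k : ℤ) + 1)) →
      x ∈ sector (q (k : ℤ)) (q ((k : ℤ) + 1)) := by
    intro k
    by_cases hx : x ∈ sector (q (k : ℤ)) (q ((k : ℤ) + 1))
    · exact Eventually.of_forall fun _ _ => hx
    · filter_upwards [(isClosed_sector (hq.cross_ne k)).isOpen_compl.mem_nhds hx] with y hy h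
      exact absurd h hy
  filter_upwards [eventually_all.2 this] with y hy i hi
  obtain ⟨k, h1, h2⟩ := hq.exists_fin i
  rw [h1, h2] at hi ⊢
  exact hy k hi

theorem eventually_notMem_trace {x : E3} (hx : x ∉ trace q) : ∀ᶠ y in 𝓝 x, y ∉ trace q := by
  filter_upwards [hq.eventually_mem_sector x] with y hy h
  obtain ⟨i, hi⟩ := mem_trace.1 h
  exact hx (mem_trace.2 ⟨i, hy i hi⟩)

end SimplePoly

/-- Minus half of the oriented area of a polygon, seen from the point `x`. -/
def halfArea (m : ℕ) (q : ℤ → E3) (x : E3) : ℝ :=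
  ∑ k : Fin m, (solid (-x) (q (k : ℤ)) (q ((k : ℤ) + 1))).arg

namespace SimplePoly

variable {m : ℕ} {q : ℤ → E3} (hq : SimplePoly m q)

include hq

theorem edge_slitPlane {x : E3} (i : ℤ) (hx : x ≠ 0) (h : x ∉ sector (q i) (q (i + 1))) :
    solid (-x) (q i) (q (i + 1)) ∈ Complex.slitPlane :=
  solid_mem_slitPlane (hq.vertex_ne_zero i) (hq.vertex_ne_zero _) hx
    (norm_mul_add_inner_pos (hq.cross_ne i)) h

theorem ne_zero_of_notMem_trace {x : E3} (hx : x ∉ trace q) : x ≠ 0 := by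
  rintro rfl; exact hx (zero_mem_trace q)

/-- Holonomy again: the vertices are the `q k`, and the transported vectors are the normals `q k × q
(k + 1)` of the edges. The identity concerns twice the half area modulo 2π, so the differences are
multiples of π. -/
theorem exists_int_halfArea {x y : E3} (hx : x ∉ trace q) (hy : y ∉ trace q) :
    ∃ j : ℤ, halfArea m q x = halfArea m q y + Real.pi * j := by
  have : NeZero m := ⟨by have := hq.three_le; omega⟩
  set n : Fin m → E3 := fun k => q (k : ℤ) with hn
  have hsucc : ∀ k : Fin m, n (k + 1) = q ((k : ℤ) + 1) := by
    intro k
    obtain ⟨l, rfl⟩ : ∃ l, m = l + 1 := ⟨m - 1, by have := hq.three_le; omega⟩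
    simp only [hn]
    rw [hq.eq_iff, Fin.val_add_one]
    split_ifs with h
    · rw [h]; simp
    · simp
  have key : ∀ {x}, x ∉ trace q → ∃ j : ℤ, 2 * halfArea m q x +
      ∑ k, (turn n (fun k => cross (n k) (n (k + 1))) k).arg = 2 * Real.pi * j := by
    intro x hx
    obtain ⟨j, hj⟩ := exists_int_sum_arg_solid (n := n) (c := fun k => cross (n k) (n (k + 1)))
      (fun k => hq.vertex_ne_zero k) (fun k => by rw [hsucc]; exact hq.cross_ne k)
      (fun k => by rw [real_inner_comm]; exact inner_cross_left _ _)
      (fun k => by rw [real_inner_comm]; exact inner_cross_right _ _)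
      (z := -x) (neg_ne_zero.2 (hq.ne_zero_of_notMem_trace hx)) (fun k => by
        rw [hsucc]
        exact Complex.slitPlane_ne_zero (hq.edge_slitPlane k (hq.ne_zero_of_notMem_trace hx)
          fun h => hx (mem_trace.2 ⟨k, h⟩)))
    refine ⟨j, ?_⟩
    rw [← hj]
    congr 2
    unfold halfArea
    exact Finset.sum_congr rfl fun k _ => by rw [hsucc]
  obtain ⟨j, hj⟩ := key hx
  obtain ⟨l, hl⟩ := key hy
  refine ⟨j - l, ?_⟩
  push_cast
  linarith

theorem continuousAt_arg_solid {x : E3} (i : ℤ) (hx : x ≠ 0) (h : x ∉ sector (q i) (q (i + 1))) :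
    ContinuousAt (fun y => (solid (-y) (q i) (q (i + 1))).arg) x := by
  have h1 := Complex.continuousAt_arg (hq.edge_slitPlane i hx h)
  have h2 : Continuous fun y : E3 => solid (-y) (q i) (q (i + 1)) :=
    Continuous.solid continuous_neg continuous_const continuous_const
  exact ContinuousAt.comp (f := fun y : E3 => solid (-y) (q i) (q (i + 1))) h1 h2.continuousAt

theorem eventually_halfArea_eq {x : E3} (hx : x ∉ trace q) :
    ∀ᶠ y in 𝓝 x, halfArea m q y = halfArea m q x := by
  have hc : ContinuousAt (halfArea m q) x := by
    refine tendsto_finsetSum _ fun k _ => ?_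
    exact hq.continuousAt_arg_solid k (hq.ne_zero_of_notMem_trace hx)
      fun h => hx (mem_trace.2 ⟨k, h⟩)
  have ht : Tendsto (fun y => (halfArea m q y - halfArea m q x) / Real.pi) (𝓝 x)
      (𝓝 ((0 : ℤ) : ℝ)) := by
    have := (hc.tendsto.sub_const (halfArea m q x)).div_const Real.pi
    simpa using this
  have := eventually_eq_of_tendsto_int ht (by
    filter_upwards [hq.eventually_notMem_trace hx] with y hy
    obtain ⟨j, hj⟩ := hq.exists_int_halfArea hy hx
    exact ⟨j, by rw [hj]; field_simp; ring⟩)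
  filter_upwards [this] with y hy
  rw [Int.cast_zero, div_eq_zero_iff] at hy
  exact sub_eq_zero.1 (hy.resolve_right Real.pi_ne_zero)

/-- Across an edge the area jumps. -/
theorem exists_edge_value (i : ℤ) {s t : ℝ} (hs : 0 < s) (ht : 0 < t) :
    ∃ u, ∀ᶠ y in 𝓝 (s • q i + t • q (i + 1)),
      (0 < det3 (q i) (q (i + 1)) y → halfArea m q y = u) ∧
      (det3 (q i) (q (i + 1)) y < 0 → halfArea m q y = u + 2 * Real.pi) := by
  set p := s • q i + t • q (i + 1) with hp
  have hp0 : p ≠ 0 := fun h => hs.ne' (eq_zero_of_combination (hq.cross_ne i) h).1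
  have hdp : det3 (q i) (q (i + 1)) p = 0 := by
    rw [hp]; simp [det3_add_right, det3_smul_right]
  obtain ⟨ε, hε, hB⟩ := Metric.eventually_nhds_iff_ball.1 (hq.eventually_mem_sector p)
  set nv := cross (q i) (q (i + 1)) with hnv
  have hdn : det3 (q i) (q (i + 1)) nv = ‖nv‖ ^ 2 := by
    rw [← det3_rotate, ← inner_cross, ← hnv, real_inner_self_eq_norm_sq]
  have hnn : 0 < ‖nv‖ ^ 2 := by have := hq.cross_ne i; positivity
  have hoff : ∀ y ∈ Metric.ball p ε, det3 (q i) (q (i + 1)) y ≠ 0 → y ∉ trace q := by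
    intro y hy hd h
    obtain ⟨j, hj⟩ := mem_trace.1 h
    have e := hq.edge_unique hs ht (hB y hy j hj)
    rw [e, hq.eq_add e 1] at hj
    exact hd ((mem_sector_iff (hq.cross_ne i)).1 hj).1
  have hlin : ∀ τ : ℝ, det3 (q i) (q (i + 1)) (p + τ • nv) = τ * ‖nv‖ ^ 2 := by
    intro τ; rw [det3_add_right, det3_smul_right, hdp, hdn, zero_add]
  obtain ⟨k, hk1, hk2⟩ := hq.exists_fin i
  set c := ∑ l ∈ Finset.univ.erase k, (solid (-p) (q (l : ℤ)) (q ((l : ℤ) + 1))).arg with hc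
  -- Only the term of this edge jumps at `p`; the others are continuous there.
  have hsplit : ∀ y, halfArea m q y = (solid (-y) (q i) (q (i + 1))).arg +
      ∑ l ∈ Finset.univ.erase k, (solid (-y) (q (l : ℤ)) (q ((l : ℤ) + 1))).arg := by
    intro y
    rw [halfArea, ← Finset.add_sum_erase _ _ (Finset.mem_univ k), hk1, hk2]
  have hrest : Tendsto (fun y => ∑ l ∈ Finset.univ.erase k,
      (solid (-y) (q (l : ℤ)) (q ((l : ℤ) + 1))).arg) (𝓝 p) (𝓝 c) := by
    refine tendsto_finsetSum _ fun l hl => ?_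
    refine hq.continuousAt_arg_solid l hp0 fun h => ?_
    have e := hq.edge_unique hs ht h
    rw [hk1, hq.eq_iff] at e
    have h1 := (Finset.mem_erase.1 hl).1
    apply h1
    have b1 := l.2
    have b2 := k.2
    obtain ⟨r, hr⟩ := e
    have hr0 : r = 0 := by
      by_contra hr0
      have : (1 : ℤ) ≤ |r| := Int.one_le_abs hr0
      have h3 : |(k : ℤ) - l| = m * |r| := by rw [hr, abs_mul]; simp
      have h4 : |(k : ℤ) - l| < m := by rw [abs_lt]; omega
      nlinarith
    rw [hr0, mul_zero] at hr
    exact Fin.ext (by omega)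
  have hconst : ∀ S : Set E3, Convex ℝ S →
      (∀ y ∈ S, y ∈ Metric.ball p ε ∧ det3 (q i) (q (i + 1)) y ≠ 0) →
      ∀ x ∈ S, ∀ y ∈ S, halfArea m q x = halfArea m q y := by
    intro S hS h x hx y hy
    exact eq_of_locally_eq hS.isPreconnected
      (fun z hz => hq.eventually_halfArea_eq (hoff z (h z hz).1 (h z hz).2)) hx hy
  have hlincv : IsLinearMap ℝ (fun y => det3 (q i) (q (i + 1)) y) :=
    ⟨fun x y => det3_add_right _ _ _ _, fun r x => by
      rw [det3_smul_right, smul_eq_mul]⟩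
  have hcp : Convex ℝ (Metric.ball p ε ∩ {y | 0 < det3 (q i) (q (i + 1)) y}) :=
    (convex_ball _ _).inter (convex_halfSpace_gt hlincv 0)
  have hcm : Convex ℝ (Metric.ball p ε ∩ {y | det3 (q i) (q (i + 1)) y < 0}) :=
    (convex_ball _ _).inter (convex_halfSpace_lt hlincv 0)
  have hpath : ∀ σ : ℝ, Tendsto (fun τ : ℝ => p + (σ * τ) • nv) (𝓝[>] 0) (𝓝 p) := by
    intro σ
    have : Continuous fun τ : ℝ => p + (σ * τ) • nv := by fun_prop
    have := this.tendsto 0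
    simp only [mul_zero, zero_smul, add_zero] at this
    exact this.mono_left nhdsWithin_le_nhds
  have hpos : ∀ᶠ τ : ℝ in 𝓝[>] 0, 0 < τ := self_mem_nhdsWithin
  -- The critical argument tends to -π from the left and to π from the right, so the values are `c -
  -- π` and `c + π`. Each side of the small ball is convex and hence carries a single value.
  refine ⟨c - Real.pi, ?_⟩
  filter_upwards [Metric.ball_mem_nhds p hε] with y hy
  constructor
  · intro hd
    have h1 : Tendsto (fun τ : ℝ => halfArea m q (p + (1 * τ) • nv)) (𝓝[>] 0)
        (𝓝 (-Real.pi + c)) := by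
      simp only [hsplit]
      refine Tendsto.add (tendsto_arg_solid_left (hq.cross_ne i) hs ht hp (hpath 1) ?_)
        (hrest.comp (hpath 1))
      filter_upwards [hpos] with τ hτ
      rw [det3_rotate, hlin]; positivity
    have h2 : ∀ᶠ τ : ℝ in 𝓝[>] 0, halfArea m q (p + (1 * τ) • nv) = halfArea m q y := by
      filter_upwards [hpos, (hpath 1) (Metric.ball_mem_nhds p hε)] with τ hτ hb
      refine hconst _ hcp (fun z hz => ⟨hz.1, hz.2.ne'⟩) _ ⟨hb, ?_⟩ _ ⟨hy, hd⟩
      simp only [Set.mem_ofPred_eq]; rw [hlin]; positivity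
    have h3 := tendsto_nhds_unique (tendsto_const_nhds.congr' (h2.mono fun _ e => e.symm)) h1
    linarith
  · intro hd
    have h1 : Tendsto (fun τ : ℝ => halfArea m q (p + ((-1) * τ) • nv)) (𝓝[>] 0)
        (𝓝 (Real.pi + c)) := by
      simp only [hsplit]
      refine Tendsto.add (tendsto_arg_solid_right (hq.cross_ne i) hs ht hp (hpath (-1)) ?_)
        (hrest.comp (hpath (-1)))
      filter_upwards [hpos] with τ hτ
      rw [det3_rotate, hlin]; nlinarith
    have h2 : ∀ᶠ τ : ℝ in 𝓝[>] 0, halfArea m q (p + ((-1) * τ) • nv) = halfArea m q y := by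
      filter_upwards [hpos, (hpath (-1)) (Metric.ball_mem_nhds p hε)] with τ hτ hb
      refine hconst _ hcm (fun z hz => ⟨hz.1, hz.2.ne⟩) _ ⟨hb, ?_⟩ _ ⟨hy, hd⟩
      simp only [Set.mem_ofPred_eq]; rw [hlin]; nlinarith
    have h3 := tendsto_nhds_unique (tendsto_const_nhds.congr' (h2.mono fun _ e => e.symm)) h1
    linarith

end SimplePoly

end

end PolyhedralSurface

/-! ### Corners of a polygon, and its two sides -/

namespace PolyhedralSurface

noncomputable section

open Filter

/-- The points near the ray of `b` on the left of the polygonal path `a, b, c`. -/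
def CornerLeft (a b c y : E3) : Prop :=
  (0 < det3 a b c ∧ 0 < det3 a b y ∧ 0 < det3 b c y) ∨
    (det3 a b c < 0 ∧ (0 < det3 a b y ∨ 0 < det3 b c y))

theorem det3_reverse (a b c : E3) : det3 c b a = -det3 a b c := by simp only [det3]; ring

theorem det3_mem_sector_left {a b c y : E3} (h : y ∈ sector a b) :
    det3 a b y = 0 ∧ ∃ s, 0 ≤ s ∧ det3 b c y = s * det3 a b c := by
  obtain ⟨s, t, hs, ht, rfl⟩ := h
  refine ⟨by simp [det3_add_right, det3_smul_right], s, hs, ?_⟩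
  simp [det3_add_right, det3_smul_right, ← det3_rotate a b c]

theorem det3_mem_sector_right {a b c y : E3} (h : y ∈ sector b c) :
    det3 b c y = 0 ∧ ∃ s, 0 ≤ s ∧ det3 a b y = s * det3 a b c := by
  obtain ⟨s, t, hs, ht, rfl⟩ := h
  refine ⟨by simp [det3_add_right, det3_smul_right], t, ht, ?_⟩
  simp [det3_add_right, det3_smul_right]

/-- Near the ray of `b`, a point in the plane of an edge and not on the other side of the other
edge lies on the first edge. -/
theorem eventually_corner_boundary {a b c : E3} (hD : 0 < det3 a b c) {r : ℝ} (hr : 0 < r) :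
    ∀ᶠ y in 𝓝 (r • b),
      (det3 a b y = 0 → 0 ≤ det3 b c y → y ∈ sector a b) ∧
      (det3 b c y = 0 → 0 ≤ det3 a b y → y ∈ sector b c) := by
  have hc : Continuous fun y => det3 a y c := by fun_prop
  have h0 : 0 < det3 a (r • b) c := by rw [det3_smul_mid]; positivity
  filter_upwards [hc.tendsto (r • b) (lt_mem_nhds h0)] with y hy
  have hy : 0 < det3 a y c := hy
  have hco := exists_coords hD.ne' y
  have e1 : det3 y b c = det3 b c y := det3_rotate _ _ _
  rw [e1] at hco
  constructor
  · intro h1 h2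
    rw [h1, zero_div, zero_smul, add_zero] at hco
    exact ⟨_, _, by positivity, by positivity, hco⟩
  · intro h1 h2
    rw [h1, zero_div, zero_smul, zero_add] at hco
    exact ⟨_, _, by positivity, by positivity, hco⟩

/-- Off the two edges, reversing the path exchanges the sides. A reflex corner becomes a convex one
when read backwards, so only convex corners need to be treated. -/
theorem eventually_cornerLeft_swap {a b c : E3} (hD : det3 a b c ≠ 0) {r : ℝ} (hr : 0 < r) :
    ∀ᶠ y in 𝓝 (r • b), y ∉ sector a b → y ∉ sector b c →
      (CornerLeft c b a y ↔ ¬ CornerLeft a b c y) := by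
  have main : ∀ {a b c : E3}, 0 < det3 a b c → ∀ᶠ y in 𝓝 (r • b), y ∉ sector a b →
      y ∉ sector b c → (CornerLeft c b a y ↔ ¬ CornerLeft a b c y) := by
    intro a b c hD
    filter_upwards [eventually_corner_boundary hD hr] with y hy h1 h2
    have e1 := det3_reverse a b c
    have e2 := det3_swap a b y
    have e3 := det3_swap b c y
    have n1 : ¬ (det3 a b y = 0 ∧ 0 ≤ det3 b c y) := fun h => h1 (hy.1 h.1 h.2)
    have n2 : ¬ (det3 b c y = 0 ∧ 0 ≤ det3 a b y) := fun h => h2 (hy.2 h.1 h.2)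
    simp only [CornerLeft, e1]
    constructor
    · rintro (⟨h, -⟩ | ⟨-, h | h⟩) (⟨-, h4, h5⟩ | ⟨h4, -⟩) <;> linarith
    · intro h
      right
      refine ⟨by linarith, ?_⟩
      by_contra! h3
      apply h
      left
      refine ⟨hD, ?_, ?_⟩
      · refine lt_of_le_of_ne (by linarith) fun h0 => n1 ⟨h0.symm, by linarith⟩
      · refine lt_of_le_of_ne (by linarith) fun h0 => n2 ⟨h0.symm, by linarith⟩
  rcases hD.lt_or_gt with h | h
  · filter_upwards [main (a := c) (b := b) (c := a) (by rw [det3_reverse]; linarith)] with y hy h1 h2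
    have := hy (fun h => h2 (mem_sector_comm.1 h)) (fun h => h1 (mem_sector_comm.1 h))
    rw [this, not_not]
  · exact main h

theorem isLinearMap_det3 (a b : E3) : IsLinearMap ℝ fun y => det3 a b y :=
  ⟨fun x y => det3_add_right _ _ _ _, fun r x => by rw [det3_smul_right, smul_eq_mul]⟩

theorem convex_det3_pos (a b : E3) : Convex ℝ {y | 0 < det3 a b y} :=
  convex_halfSpace_gt (isLinearMap_det3 a b) 0

theorem convex_det3_neg (a b : E3) : Convex ℝ {y | det3 a b y < 0} :=
  convex_halfSpace_lt (isLinearMap_det3 a b) 0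

theorem tendsto_add_smul (p v : E3) (σ : ℝ) :
    Tendsto (fun τ : ℝ => p + (σ * τ) • v) (𝓝[>] 0) (𝓝 p) := by
  have : Continuous fun τ : ℝ => p + (σ * τ) • v := by fun_prop
  have := this.tendsto 0
  simp only [mul_zero, zero_smul, add_zero] at this
  exact this.mono_left nhdsWithin_le_nhds

theorem eventually_pos_nhdsGT : ∀ᶠ τ : ℝ in 𝓝[>] 0, 0 < τ := self_mem_nhdsWithin

/-- A function that is locally constant off the two edges at a corner takes only one value on each
side. -/
theorem exists_corner_values {β : Type*} {f : E3 → β} {a b c : E3} (hD : det3 a b c ≠ 0) {r ε : ℝ}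
    (hr : 0 < r) (hε : 0 < ε) (hf : ∀ y ∈ Metric.ball (r • b) ε, y ∉ sector a b → y ∉ sector b c →
      ∀ᶠ z in 𝓝 y, f z = f y) :
    ∃ u v, ∀ᶠ y in 𝓝 (r • b), y ∉ sector a b → y ∉ sector b c →
      (CornerLeft a b c y → f y = u) ∧ (¬ CornerLeft a b c y → f y = v) := by
  have main : ∀ {a b c : E3}, 0 < det3 a b c → (∀ y ∈ Metric.ball (r • b) ε, y ∉ sector a b →
      y ∉ sector b c → ∀ᶠ z in 𝓝 y, f z = f y) →
      ∃ u v, ∀ᶠ y in 𝓝 (r • b), y ∉ sector a b → y ∉ sector b c →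
      (CornerLeft a b c y → f y = u) ∧ (¬ CornerLeft a b c y → f y = v) := by
    intro a b c hD hf
    have hB : ∀ {S : Set E3}, Convex ℝ S → (∀ y ∈ S, y ∈ Metric.ball (r • b) ε ∧
        y ∉ sector a b ∧ y ∉ sector b c) → ∀ x ∈ S, ∀ y ∈ S, f x = f y := fun {S} hS h x hx y hy =>
      eq_of_locally_eq hS.isPreconnected (fun z hz => hf z (h z hz).1 (h z hz).2.1 (h z hz).2.2) hx hy
    have hc1 : Convex ℝ (Metric.ball (r • b) ε ∩ ({y | 0 < det3 a b y} ∩ {y | 0 < det3 b c y})) :=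
      (convex_ball _ _).inter ((convex_det3_pos a b).inter (convex_det3_pos b c))
    have hc2 : Convex ℝ (Metric.ball (r • b) ε ∩ {y | det3 a b y < 0}) :=
      (convex_ball _ _).inter (convex_det3_neg a b)
    have hc3 : Convex ℝ (Metric.ball (r • b) ε ∩ {y | det3 b c y < 0}) :=
      (convex_ball _ _).inter (convex_det3_neg b c)
    have k1 := hB hc1 fun y hy => ⟨hy.1, fun h => by
      have := (det3_mem_sector_left (c := c) h).1; have := hy.2.1; simp only [Set.mem_ofPred_eq] at this
      linarith, fun h => by
      have := (det3_mem_sector_right (a := a) h).1; have := hy.2.2; simp only [Set.mem_ofPred_eq] at this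
      linarith⟩
    have k2 := hB hc2 fun y hy => ⟨hy.1, fun h => by
      have := (det3_mem_sector_left (c := c) h).1; have := hy.2; simp only [Set.mem_ofPred_eq] at this
      linarith, fun h => by
      obtain ⟨-, s, hs, e⟩ := det3_mem_sector_right (a := a) h
      have := hy.2; simp only [Set.mem_ofPred_eq] at this
      have := mul_nonneg hs hD.le; linarith⟩
    have k3 := hB hc3 fun y hy => ⟨hy.1, fun h => by
      obtain ⟨-, s, hs, e⟩ := det3_mem_sector_left (c := c) h
      have := hy.2; simp only [Set.mem_ofPred_eq] at this
      have := mul_nonneg hs hD.le; linarith, fun h => by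
      have := (det3_mem_sector_right (a := a) h).1; have := hy.2; simp only [Set.mem_ofPred_eq] at this
      linarith⟩
    -- The test points `r • b ± τ • (a + c)` lie in the angle of the corner and in the opposite
    -- angle. The complement of the angle is covered by two convex half-balls, both of which contain
    -- the second test point.
    obtain ⟨τ, hτ, hb1, hb2⟩ := (eventually_pos_nhdsGT.and
      (((tendsto_add_smul (r • b) (a + c) 1).eventually (Metric.eventually_nhds_iff_ball.2
        ⟨ε, hε, fun _ h => h⟩)).and ((tendsto_add_smul (r • b) (a + c) (-1)).eventually
        (Metric.eventually_nhds_iff_ball.2 ⟨ε, hε, fun _ h => h⟩)))).exists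
    have d1 : ∀ σ : ℝ, det3 a b (r • b + σ • (a + c)) = σ * det3 a b c := by
      intro σ; simp [det3_add_right, det3_smul_right]
    have d2 : ∀ σ : ℝ, det3 b c (r • b + σ • (a + c)) = σ * det3 a b c := by
      intro σ; simp [det3_add_right, det3_smul_right, det3_rotate a b c]
    refine ⟨f (r • b + (1 * τ) • (a + c)), f (r • b + ((-1) * τ) • (a + c)), ?_⟩
    filter_upwards [Metric.ball_mem_nhds _ hε, eventually_corner_boundary hD hr] with y hy hyb h1 h2
    have n1 : ¬ (det3 a b y = 0 ∧ 0 ≤ det3 b c y) := fun h => h1 (hyb.1 h.1 h.2)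
    have n2 : ¬ (det3 b c y = 0 ∧ 0 ≤ det3 a b y) := fun h => h2 (hyb.2 h.1 h.2)
    have w1 : ((-1) * τ) * det3 a b c < 0 := by nlinarith
    constructor
    · rintro (⟨-, h3, h4⟩ | ⟨h3, -⟩)
      · refine k1 _ ⟨hy, h3, h4⟩ _ ⟨hb1, ?_, ?_⟩ <;> simp only [Set.mem_ofPred_eq]
        · rw [d1]; positivity
        · rw [d2]; positivity
      · linarith
    · intro hn
      have : det3 a b y < 0 ∨ det3 b c y < 0 := by
        by_contra! h3
        refine hn (Or.inl ⟨hD, ?_, ?_⟩)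
        · exact lt_of_le_of_ne h3.1 fun h0 => n1 ⟨h0.symm, h3.2⟩
        · exact lt_of_le_of_ne h3.2 fun h0 => n2 ⟨h0.symm, h3.1⟩
      rcases this with h3 | h3
      · refine k2 _ ⟨hy, h3⟩ _ ⟨hb2, ?_⟩
        simp only [Set.mem_ofPred_eq]; rw [d1]; exact w1
      · refine k3 _ ⟨hy, h3⟩ _ ⟨hb2, ?_⟩
        simp only [Set.mem_ofPred_eq]; rw [d2]; exact w1
  rcases hD.lt_or_gt with h | h
  · obtain ⟨u, v, huv⟩ := main (a := c) (b := b) (c := a) (by rw [det3_reverse]; linarith)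
      (fun y hy h1 h2 => hf y hy (fun h => h2 (mem_sector_comm.1 h))
        (fun h => h1 (mem_sector_comm.1 h)))
    refine ⟨v, u, ?_⟩
    filter_upwards [huv, eventually_cornerLeft_swap hD hr] with y hy hs h1 h2
    have := hy (fun h => h2 (mem_sector_comm.1 h)) (fun h => h1 (mem_sector_comm.1 h))
    have hs := hs h1 h2
    exact ⟨fun h => this.2 (by rw [hs, not_not]; exact h), fun h => this.1 (hs.2 h)⟩
  · exact main h hf

/-- In a plane there are points near which a linear function takes both signs. -/
theorem frequently_det3 {a b p : E3} (h : cross a b ≠ 0) (hp : det3 a b p = 0) {P : E3 → Prop}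
    (hP : ∀ᶠ y in 𝓝 p, P y) :
    (∃ y, 0 < det3 a b y ∧ P y) ∧ ∃ y, det3 a b y < 0 ∧ P y := by
  have hdn : det3 a b (cross a b) = ‖cross a b‖ ^ 2 := by
    rw [← det3_rotate, ← inner_cross, real_inner_self_eq_norm_sq]
  have hlin : ∀ τ : ℝ, det3 a b (p + τ • cross a b) = τ * ‖cross a b‖ ^ 2 := by
    intro τ; rw [det3_add_right, det3_smul_right, hp, hdn, zero_add]
  have hnn : 0 < ‖cross a b‖ ^ 2 := by positivity
  constructor
  · obtain ⟨τ, hτ, h1⟩ := (eventually_pos_nhdsGT.and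
      ((tendsto_add_smul p (cross a b) 1).eventually hP)).exists
    exact ⟨_, by rw [hlin]; positivity, h1⟩
  · obtain ⟨τ, hτ, h1⟩ := (eventually_pos_nhdsGT.and
      ((tendsto_add_smul p (cross a b) (-1)).eventually hP)).exists
    exact ⟨_, by rw [hlin]; nlinarith, h1⟩

namespace SimplePoly

variable {m : ℕ} {q : ℤ → E3} (hq : SimplePoly m q)

include hq

/-- The local values agree where neighbourhoods overlap, and the pairs of positive coefficients form
a connected set; so one value serves the whole open edge. -/
theorem exists_edge_value' (i : ℤ) : ∃ u, ∀ s t : ℝ, 0 < s → 0 < t →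
    ∀ᶠ y in 𝓝 (s • q i + t • q (i + 1)),
      (0 < det3 (q i) (q (i + 1)) y → halfArea m q y = u) ∧
      (det3 (q i) (q (i + 1)) y < 0 → halfArea m q y = u + 2 * Real.pi) := by
  choose! u hu using fun (x : ℝ × ℝ) (hx : 0 < x.1 ∧ 0 < x.2) =>
    hq.exists_edge_value i hx.1 hx.2
  have hcv : Convex ℝ {x : ℝ × ℝ | 0 < x.1 ∧ 0 < x.2} :=
    (convex_halfSpace_gt (f := Prod.fst) ⟨fun _ _ => rfl, fun _ _ => rfl⟩ (0 : ℝ)).inter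
      (convex_halfSpace_gt (f := Prod.snd) ⟨fun _ _ => rfl, fun _ _ => rfl⟩ (0 : ℝ))
  have hop : IsOpen {x : ℝ × ℝ | 0 < x.1 ∧ 0 < x.2} :=
    (isOpen_lt continuous_const continuous_fst).inter (isOpen_lt continuous_const continuous_snd)
  have hcont : Continuous fun x : ℝ × ℝ => x.1 • q i + x.2 • q (i + 1) := by fun_prop
  have hconst : ∀ x ∈ {x : ℝ × ℝ | 0 < x.1 ∧ 0 < x.2}, ∀ y ∈ {x : ℝ × ℝ | 0 < x.1 ∧ 0 < x.2},
      u x = u y := by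
    intro x hx y hy
    refine eq_of_locally_eq hcv.isPreconnected (fun z hz => ?_) hx hy
    filter_upwards [(hcont.tendsto z).eventually (hu z hz).eventually_nhds, hop.mem_nhds hz]
      with w hw hwpos
    obtain ⟨y, hy, h1, h2⟩ := (frequently_det3 (hq.cross_ne i)
      (by simp [det3_add_right, det3_smul_right]) (hw.and (hu w hwpos))).1
    rw [← h1.1 hy, ← h2.1 hy]
  refine ⟨u (1, 1), fun s t hs ht => ?_⟩
  rw [hconst (1, 1) ⟨one_pos, one_pos⟩ (s, t) ⟨hs, ht⟩]
  exact hu (s, t) ⟨hs, ht⟩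

/-- Near the corner the half area takes one value on each side of the path. Both edges see these
values close to the corner, so successive edges have the same value on their left. -/
theorem corner_values (i : ℤ) {u u' : ℝ}
    (h : ∀ s t : ℝ, 0 < s → 0 < t → ∀ᶠ y in 𝓝 (s • q i + t • q (i + 1)),
      (0 < det3 (q i) (q (i + 1)) y → halfArea m q y = u) ∧
      (det3 (q i) (q (i + 1)) y < 0 → halfArea m q y = u + 2 * Real.pi))
    (h' : ∀ s t : ℝ, 0 < s → 0 < t → ∀ᶠ y in 𝓝 (s • q (i + 1) + t • q (i + 1 + 1)),
      (0 < det3 (q (i + 1)) (q (i + 1 + 1)) y → halfArea m q y = u') ∧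
      (det3 (q (i + 1)) (q (i + 1 + 1)) y < 0 → halfArea m q y = u' + 2 * Real.pi)) :
    u' = u ∧ ∀ r : ℝ, 0 < r → ∀ᶠ y in 𝓝 (r • q (i + 1)), y ∉ trace q →
      (CornerLeft (q i) (q (i + 1)) (q (i + 1 + 1)) y → halfArea m q y = u) ∧
      (¬ CornerLeft (q i) (q (i + 1)) (q (i + 1 + 1)) y → halfArea m q y = u + 2 * Real.pi) := by
  have hD := hq.det_ne i
  have key : ∀ r : ℝ, 0 < r → u' = u ∧ ∀ᶠ y in 𝓝 (r • q (i + 1)), y ∉ trace q →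
      (CornerLeft (q i) (q (i + 1)) (q (i + 1 + 1)) y → halfArea m q y = u) ∧
      (¬ CornerLeft (q i) (q (i + 1)) (q (i + 1 + 1)) y → halfArea m q y = u + 2 * Real.pi) := by
    intro r hr
    obtain ⟨ε, hε, hB⟩ := Metric.eventually_nhds_iff_ball.1
      (hq.eventually_mem_sector (r • q (i + 1)))
    have hoff : ∀ y ∈ Metric.ball (r • q (i + 1)) ε, y ∉ sector (q i) (q (i + 1)) →
        y ∉ sector (q (i + 1)) (q (i + 1 + 1)) → y ∉ trace q := by
      intro y hy h1 h2 h3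
      obtain ⟨j, hj⟩ := mem_trace.1 h3
      rcases hq.vertex_unique hr (hB y hy j hj) with e | e
      · rw [← e, ← hq.eq_add e 1] at hj
        exact h2 hj
      · have e2 := hq.eq_add e (-1)
        simp only [add_neg_cancel_right] at e2
        rw [← e, ← e2] at hj
        exact h1 hj
    obtain ⟨u₀, v₀, h₀⟩ := exists_corner_values hD hr hε
      (fun y hy h1 h2 => hq.eventually_halfArea_eq (hoff y hy h1 h2))
    have h₁ := h₀.eventually_nhds
    -- Compare at a point of the first edge close to the corner, where the left of the edge
    -- coincides with the left of the path.
    have m1 : u = u₀ ∧ u + 2 * Real.pi = v₀ := by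
      obtain ⟨τ, hτ, hp⟩ := (eventually_pos_nhdsGT.and
        ((tendsto_add_smul (r • q (i + 1)) (q i) 1).eventually h₁)).exists
      rw [one_mul, add_comm (r • q (i + 1))] at hp
      have hd : det3 (q (i + 1)) (q (i + 1 + 1)) (τ • q i + r • q (i + 1)) =
          τ * det3 (q i) (q (i + 1)) (q (i + 1 + 1)) := by
        simp [det3_add_right, det3_smul_right, ← det3_rotate (q i)]
      have hcs : Continuous fun y => det3 (q (i + 1)) (q (i + 1 + 1)) y *
          det3 (q i) (q (i + 1)) (q (i + 1 + 1)) := by fun_prop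
      have hs := hcs.tendsto (τ • q i + r • q (i + 1))
      rw [hd] at hs
      have hpp : 0 < τ * det3 (q i) (q (i + 1)) (q (i + 1 + 1)) *
          det3 (q i) (q (i + 1)) (q (i + 1 + 1)) := by
        rw [mul_assoc]; exact mul_pos hτ (mul_self_pos.2 hD)
      have hev := (h τ r hτ hr).and (hp.and (hs.eventually (lt_mem_nhds hpp)))
      obtain ⟨⟨y, hy, e1, e2, e3⟩, ⟨z, hz, f1, f2, f3⟩⟩ := frequently_det3 (hq.cross_ne i)
        (by simp [det3_add_right, det3_smul_right]) hev
      have g1 : y ∉ sector (q i) (q (i + 1)) := fun h => hy.ne'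
        (det3_mem_sector_left (c := 0) h).1
      have g2 : y ∉ sector (q (i + 1)) (q (i + 1 + 1)) := fun h =>
        (left_ne_zero_of_mul e3.ne') (det3_mem_sector_right (a := 0) h).1
      have g3 : z ∉ sector (q i) (q (i + 1)) := fun h => hz.ne
        (det3_mem_sector_left (c := 0) h).1
      have g4 : z ∉ sector (q (i + 1)) (q (i + 1 + 1)) := fun h =>
        (left_ne_zero_of_mul f3.ne') (det3_mem_sector_right (a := 0) h).1
      constructor
      · rw [← e1.1 hy]
        refine (e2 g1 g2).1 ?_
        rcases hD.lt_or_gt with hD | hD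
        · exact Or.inr ⟨hD, Or.inl hy⟩
        · exact Or.inl ⟨hD, hy, by nlinarith⟩
      · rw [← f1.2 hz]
        refine (f2 g3 g4).2 ?_
        rintro (⟨k1, k2, k3⟩ | ⟨k1, k2 | k2⟩) <;> nlinarith
    have m2 : u' = u₀ := by
      obtain ⟨τ, hτ, hp⟩ := (eventually_pos_nhdsGT.and
        ((tendsto_add_smul (r • q (i + 1)) (q (i + 1 + 1)) 1).eventually h₁)).exists
      rw [one_mul] at hp
      have hd : det3 (q i) (q (i + 1)) (r • q (i + 1) + τ • q (i + 1 + 1)) =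
          τ * det3 (q i) (q (i + 1)) (q (i + 1 + 1)) := by
        simp [det3_add_right, det3_smul_right]
      have hcs : Continuous fun y => det3 (q i) (q (i + 1)) y *
          det3 (q i) (q (i + 1)) (q (i + 1 + 1)) := by fun_prop
      have hs := hcs.tendsto (r • q (i + 1) + τ • q (i + 1 + 1))
      rw [hd] at hs
      have hpp : 0 < τ * det3 (q i) (q (i + 1)) (q (i + 1 + 1)) *
          det3 (q i) (q (i + 1)) (q (i + 1 + 1)) := by
        rw [mul_assoc]; exact mul_pos hτ (mul_self_pos.2 hD)
      have hev := (h' r τ hr hτ).and (hp.and (hs.eventually (lt_mem_nhds hpp)))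
      obtain ⟨y, hy, e1, e2, e3⟩ := (frequently_det3 (hq.cross_ne (i + 1))
        (by simp [det3_add_right, det3_smul_right]) hev).1
      have g1 : y ∉ sector (q i) (q (i + 1)) := fun h =>
        (left_ne_zero_of_mul e3.ne') (det3_mem_sector_left (c := 0) h).1
      have g2 : y ∉ sector (q (i + 1)) (q (i + 1 + 1)) := fun h => hy.ne'
        (det3_mem_sector_right (a := 0) h).1
      rw [← e1.1 hy]
      refine (e2 g1 g2).1 ?_
      rcases hD.lt_or_gt with hD | hD
      · exact Or.inr ⟨hD, Or.inr hy⟩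
      · exact Or.inl ⟨hD, by nlinarith, hy⟩
    refine ⟨m2.trans m1.1.symm, ?_⟩
    filter_upwards [h₀] with y hy hyt
    rw [m1.1, ← m1.1, m1.2, m1.1]
    exact hy (fun h => hyt (mem_trace.2 ⟨i, h⟩)) (fun h => hyt (mem_trace.2 ⟨i + 1, h⟩))
  exact ⟨(key 1 one_pos).1, fun r hr => (key r hr).2⟩

theorem exists_side_values : ∃ u, (∀ i, ∀ s t : ℝ, 0 < s → 0 < t →
    ∀ᶠ y in 𝓝 (s • q i + t • q (i + 1)),
      (0 < det3 (q i) (q (i + 1)) y → halfArea m q y = u) ∧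
      (det3 (q i) (q (i + 1)) y < 0 → halfArea m q y = u + 2 * Real.pi)) ∧
    ∀ i, ∀ r : ℝ, 0 < r → ∀ᶠ y in 𝓝 (r • q (i + 1)), y ∉ trace q →
      (CornerLeft (q i) (q (i + 1)) (q (i + 1 + 1)) y → halfArea m q y = u) ∧
      (¬ CornerLeft (q i) (q (i + 1)) (q (i + 1 + 1)) y → halfArea m q y = u + 2 * Real.pi) := by
  choose u hu using hq.exists_edge_value'
  have hs : ∀ i, u (i + 1) = u i := fun i => (hq.corner_values i (hu i) (hu (i + 1))).1
  have hall : ∀ i, u i = u 0 := by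
    intro i
    induction i using Int.induction_on with
    | zero => rfl
    | succ k ih => rw [hs, ih]
    | pred k ih => rw [← hs, sub_add_cancel, ih]
  refine ⟨u 0, fun i => ?_, fun i => ?_⟩
  · rw [← hall i]; exact hu i
  · rw [← hall i]; exact (hq.corner_values i (hu i) (hu (i + 1))).2

end SimplePoly

/-- `L` is the left side of the polygon `q`. -/
structure IsLeft (q : ℤ → E3) (L : Set E3) : Prop where
  disj : ∀ x ∈ L, x ∉ trace q
  loc : ∀ x, x ∉ trace q → ∀ᶠ y in 𝓝 x, (y ∈ L ↔ x ∈ L)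
  edge : ∀ i, ∀ s t : ℝ, 0 < s → 0 < t → ∀ᶠ y in 𝓝 (s • q i + t • q (i + 1)),
    (y ∈ L ↔ 0 < det3 (q i) (q (i + 1)) y)
  vert : ∀ i, ∀ r : ℝ, 0 < r → ∀ᶠ y in 𝓝 (r • q (i + 1)), y ∉ trace q →
    (y ∈ L ↔ CornerLeft (q i) (q (i + 1)) (q (i + 1 + 1)) y)

theorem eventually_mem_sector_of_det3 {a b : E3} (h : cross a b ≠ 0) {s t : ℝ} (hs : 0 < s)
    (ht : 0 < t) : ∀ᶠ y in 𝓝 (s • a + t • b), det3 a b y = 0 → y ∈ sector a b := by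
  have h0 : 0 < ‖cross a b‖ ^ 2 := by positivity
  have e1 : inner ℝ (cross (s • a + t • b) b) (cross a b) = s * ‖cross a b‖ ^ 2 := by
    rw [← real_inner_self_eq_norm_sq, ← real_inner_smul_left]
    congr 1; refine ext_coords ?_ ?_ ?_ <;> simp <;> ring
  have e2 : inner ℝ (cross a (s • a + t • b)) (cross a b) = t * ‖cross a b‖ ^ 2 := by
    rw [← real_inner_self_eq_norm_sq, ← real_inner_smul_left]
    congr 1; refine ext_coords ?_ ?_ ?_ <;> simp <;> ring
  have c1 : Continuous fun y => inner ℝ (cross y b) (cross a b) := by fun_prop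
  have c2 : Continuous fun y => inner ℝ (cross a y) (cross a b) := by fun_prop
  filter_upwards [(c1.tendsto (s • a + t • b)).eventually (lt_mem_nhds (a := 0) (by rw [e1]; positivity)),
    (c2.tendsto (s • a + t • b)).eventually (lt_mem_nhds (a := 0) (by rw [e2]; positivity))]
    with y h1 h2 hd
  exact (mem_sector_iff h).2 ⟨hd, h1.le, h2.le⟩

/-- The sides are the level sets of the half area for the two values that occur along the polygon.
No Jordan curve theorem is involved: whether these sets are connected or exhaust the complement
plays no role. -/
theorem SimplePoly.exists_isLeft {m : ℕ} {q : ℤ → E3} (hq : SimplePoly m q) :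
    ∃ L R, IsLeft q L ∧ IsLeft (fun i => q (-i)) R ∧ Disjoint L R := by
  obtain ⟨u, hu, hv⟩ := hq.exists_side_values
  have hpi := Real.pi_pos
  have hrev : trace (fun i => q (-i)) = trace q := by
    ext x
    simp only [mem_trace]
    constructor
    · rintro ⟨i, hi⟩
      refine ⟨-(i + 1), mem_sector_comm.1 ?_⟩
      rwa [neg_add, neg_add_cancel_right, ← neg_add]
    · rintro ⟨i, hi⟩
      refine ⟨-(i + 1), mem_sector_comm.1 ?_⟩
      have e1 : -(-(i + 1)) = i + 1 := by ring
      have e2 : -(-(i + 1) + 1) = i := by ring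
      rwa [e1, e2]
  refine ⟨{x | x ∉ trace q ∧ halfArea m q x = u}, {x | x ∉ trace q ∧
    halfArea m q x = u + 2 * Real.pi}, ⟨fun x hx => hx.1, ?_, ?_, ?_⟩,
    ⟨fun x hx => by rw [hrev]; exact hx.1, ?_, ?_, ?_⟩, ?_⟩
  · intro x hx
    filter_upwards [hq.eventually_notMem_trace hx, hq.eventually_halfArea_eq hx] with y h1 h2
    simp [h1, h2, hx]
  · intro i s t hs ht
    filter_upwards [hu i s t hs ht, eventually_mem_sector_of_det3 (hq.cross_ne i) hs ht,
      hq.eventually_mem_sector (s • q i + t • q (i + 1))] with y h1 h2 h3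
    constructor
    · rintro ⟨h4, h5⟩
      rcases lt_trichotomy (det3 (q i) (q (i + 1)) y) 0 with h | h | h
      · linarith [h1.2 h]
      · exact absurd (mem_trace.2 ⟨i, h2 h⟩) h4
      · exact h
    · intro h
      refine ⟨fun h4 => ?_, h1.1 h⟩
      obtain ⟨j, hj⟩ := mem_trace.1 h4
      have e := hq.edge_unique hs ht (h3 j hj)
      rw [e, hq.eq_add e 1] at hj
      exact h.ne' (det3_mem_sector_left (c := 0) hj).1
  · intro i r hr
    filter_upwards [hv i r hr] with y hy hyt
    have := hy hyt
    constructor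
    · rintro ⟨-, h⟩
      by_contra hn
      linarith [this.2 hn]
    · intro h; exact ⟨hyt, this.1 h⟩
  · intro x hx
    rw [hrev] at hx
    filter_upwards [hq.eventually_notMem_trace hx, hq.eventually_halfArea_eq hx] with y h1 h2
    simp [h1, h2, hx]
  · intro i s t hs ht
    obtain ⟨j, rfl⟩ : ∃ j, i = -(j + 1) := ⟨-(i + 1), by ring⟩
    have e1 : -(-(j + 1)) = j + 1 := by ring
    have e2 : -(-(j + 1) + 1) = j := by ring
    simp only [e1, e2]
    rw [add_comm (s • q (j + 1))]
    filter_upwards [hu j t s ht hs, eventually_mem_sector_of_det3 (hq.cross_ne j) ht hs,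
      hq.eventually_mem_sector (t • q j + s • q (j + 1))] with y h1 h2 h3
    have hsw := det3_swap (q j) (q (j + 1)) y
    change (y ∉ trace q ∧ halfArea m q y = u + 2 * Real.pi) ↔ _
    constructor
    · rintro ⟨h4, h5⟩
      rcases lt_trichotomy (det3 (q j) (q (j + 1)) y) 0 with h | h | h
      · linarith
      · exact absurd (mem_trace.2 ⟨j, h2 h⟩) h4
      · linarith [h1.1 h]
    · intro h
      refine ⟨fun h4 => ?_, h1.2 (by linarith)⟩
      obtain ⟨l, hl⟩ := mem_trace.1 h4
      have e := hq.edge_unique ht hs (h3 l hl)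
      rw [e, hq.eq_add e 1] at hl
      have := (det3_mem_sector_left (c := 0) hl).1
      linarith
  · intro i r hr
    obtain ⟨j, rfl⟩ : ∃ j, i = -(j + 1 + 1) := ⟨-(i + 1 + 1), by ring⟩
    have e1 : -(-(j + 1 + 1)) = j + 1 + 1 := by ring
    have e2 : -(-(j + 1 + 1) + 1) = j + 1 := by ring
    have e3 : -(-(j + 1 + 1) + 1 + 1) = j := by ring
    simp only [e1, e2, e3, hrev]
    filter_upwards [hv j r hr, eventually_cornerLeft_swap (hq.det_ne j) hr] with y hy hsw hyt
    have := hy hyt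
    have hsw := hsw (fun h => hyt (mem_trace.2 ⟨_, h⟩)) (fun h => hyt (mem_trace.2 ⟨_, h⟩))
    rw [hsw]
    change (y ∉ trace q ∧ halfArea m q y = u + 2 * Real.pi) ↔ _
    constructor
    · rintro ⟨-, h⟩ hn
      linarith [this.1 hn]
    · intro h; exact ⟨hyt, this.2 h⟩
  · rw [Set.disjoint_left]
    rintro x ⟨-, h1⟩ ⟨-, h2⟩
    linarith

end

end PolyhedralSurface

namespace PolyhedralSurface

noncomputable section

open Filter

/-! ### Triangles at the corners of a polygon -/

/-- The interior of the cone spanned by three vectors. -/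
def openCone (a b c : E3) : Set E3 :=
  {x | ∃ r s t : ℝ, 0 < r ∧ 0 < s ∧ 0 < t ∧ x = r • a + s • b + t • c}

theorem mem_openCone_iff {a b c x : E3} (h : det3 a b c ≠ 0) :
    x ∈ openCone a b c ↔
      0 < det3 x b c / det3 a b c ∧ 0 < det3 a x c / det3 a b c ∧ 0 < det3 a b x / det3 a b c := by
  constructor
  · rintro ⟨r, s, t, hr, hs, ht, rfl⟩
    simp only [det3_add_left, det3_smul_left, det3_add_mid, det3_smul_mid, det3_add_right,
      det3_smul_right, det3_self_left, det3_self_right, det3_self_outer, mul_zero, add_zero,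
      zero_add, mul_div_assoc, div_self h, mul_one]
    exact ⟨hr, hs, ht⟩
  · rintro ⟨h1, h2, h3⟩
    exact ⟨_, _, _, h1, h2, h3, exists_coords h x⟩

theorem convex_openCone (a b c : E3) : Convex ℝ (openCone a b c) := by
  rintro x ⟨r, s, t, hr, hs, ht, rfl⟩ y ⟨r', s', t', hr', hs', ht', rfl⟩ u v hu hv huv
  have key : ∀ {p p' : ℝ}, 0 < p → 0 < p' → 0 < u * p + v * p' := by
    intro p p' hp hp'
    rcases eq_or_lt_of_le hu with h | h
    · have : v = 1 := by linarith
      rw [← h, this]; linarith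
    · have := mul_pos h hp
      have := mul_nonneg hv hp'.le
      linarith
  exact ⟨_, _, _, key hr hr', key hs hs', key ht ht', by module⟩

theorem convex_openSector (a b : E3) :
    Convex ℝ {x | ∃ s t : ℝ, 0 < s ∧ 0 < t ∧ x = s • a + t • b} := by
  rintro x ⟨r, s, hr, hs, rfl⟩ y ⟨r', s', hr', hs', rfl⟩ u v hu hv huv
  have key : ∀ {p p' : ℝ}, 0 < p → 0 < p' → 0 < u * p + v * p' := by
    intro p p' hp hp'
    rcases eq_or_lt_of_le hu with h | h
    · have : v = 1 := by linarith
      rw [← h, this]; linarith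
    · have := mul_pos h hp
      have := mul_nonneg hv hp'.le
      linarith
  exact ⟨_, _, key hr hr', key hs hs', by module⟩

/-- The first point where a segment leaves the positive octant. -/
theorem exists_exit {x y z x' y' z' : ℝ} (hx : 0 < x) (hy : 0 < y) (hz : 0 < z)
    (h : ¬ (0 < x' ∧ 0 < y' ∧ 0 < z')) : ∃ s, 0 < s ∧ s ≤ 1 ∧ 0 ≤ (1 - s) * x + s * x' ∧
      0 ≤ (1 - s) * y + s * y' ∧ 0 ≤ (1 - s) * z + s * z' ∧ ((1 - s) * x + s * x' = 0 ∨
        (1 - s) * y + s * y' = 0 ∨ (1 - s) * z + s * z' = 0) := by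
  set f : ℝ → ℝ := fun s => min ((1 - s) * x + s * x') (min ((1 - s) * y + s * y')
    ((1 - s) * z + s * z')) with hf
  have hc : ContinuousOn f (Set.Icc 0 1) := by
    apply Continuous.continuousOn; simp only [hf]; fun_prop
  have h0 : 0 < f 0 := by simp [hf, hx, hy, hz]
  have h1 : f 1 ≤ 0 := by
    simp only [hf]
    by_contra! hlt
    simp only [lt_min_iff] at hlt
    apply h
    simpa using hlt
  obtain ⟨s, hs, he⟩ := intermediate_value_Icc' zero_le_one hc ⟨h1, h0.le⟩
  have hs0 : s ≠ 0 := by rintro rfl; linarith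
  have hle : 0 ≤ f s := he.ge
  simp only [hf, le_min_iff] at hle
  refine ⟨s, lt_of_le_of_ne hs.1 hs0.symm, hs.2, hle.1, hle.2.1, hle.2.2, ?_⟩
  simp only [hf] at he
  rcases min_choice ((1 - s) * x + s * x') (min ((1 - s) * y + s * y') ((1 - s) * z + s * z'))
    with h | h
  · left; rwa [h] at he
  · rw [h] at he
    rcases min_choice ((1 - s) * y + s * y') ((1 - s) * z + s * z') with h | h
    · right; left; rwa [h] at he
    · right; right; rwa [h] at he

theorem IsLeft.iff_of_preconnected {q : ℤ → E3} {L S : Set E3} (hL : IsLeft q L)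
    (hS : IsPreconnected S) (hoff : ∀ x ∈ S, x ∉ trace q) {x y : E3} (hx : x ∈ S) (hy : y ∈ S) :
    x ∈ L ↔ y ∈ L :=
  iff_of_eq (eq_of_locally_eq (f := fun z => z ∈ L) hS
    (fun z hz => (hL.loc z (hoff z hz)).mono fun _ h => propext h) hx hy)

namespace SimplePoly

variable {m : ℕ} {q : ℤ → E3} (hq : SimplePoly m q)

include hq

/-- If a triangle cut off at a corner contains no vertices, then the polygon does not enter it. -/
theorem notMem_trace_of_openCone {i : ℤ} {σ μ σ' μ' : ℝ} (hσ : 0 < σ) (hμ : 0 ≤ μ) (hσ' : 0 < σ')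
    (hμ' : 0 ≤ μ') (hv : ∀ j, q j ∉ openCone (σ • q i + μ • q (i + 1)) (q (i + 1))
      (σ' • q (i + 1 + 1) + μ' • q (i + 1))) {x : E3}
    (hx : x ∈ openCone (σ • q i + μ • q (i + 1)) (q (i + 1))
      (σ' • q (i + 1 + 1) + μ' • q (i + 1))) : x ∉ trace q := by
  intro htr
  obtain ⟨j, hj⟩ := mem_trace.1 htr
  set a := q i
  set b := q (i + 1)
  set c := q (i + 1 + 1)
  have hD : det3 a b c ≠ 0 := hq.det_ne i
  set a' := σ • a + μ • b with ha'
  set c' := σ' • c + μ' • b with hc'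
  have hD' : det3 a' b c' = σ * σ' * det3 a b c := by
    simp [ha', hc', det3_add_left, det3_smul_left, det3_add_right, det3_smul_right]; ring
  have hDn : det3 a' b c' ≠ 0 := by rw [hD']; positivity
  set A : E3 → ℝ := fun y => det3 y b c' / det3 a' b c' with hA
  set B : E3 → ℝ := fun y => det3 a' y c' / det3 a' b c' with hB
  set C : E3 → ℝ := fun y => det3 a' b y / det3 a' b c' with hC
  have hAl : ∀ s t : ℝ, ∀ y z, A (s • y + t • z) = s * A y + t * A z := by
    intro s t y z; simp only [hA, det3_add_left, det3_smul_left]; ring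
  have hBl : ∀ s t : ℝ, ∀ y z, B (s • y + t • z) = s * B y + t * B z := by
    intro s t y z; simp only [hB, det3_add_mid, det3_smul_mid]; ring
  have hCl : ∀ s t : ℝ, ∀ y z, C (s • y + t • z) = s * C y + t * C z := by
    intro s t y z; simp only [hC, det3_add_right, det3_smul_right]; ring
  have hmem : ∀ y, y ∈ openCone a' b c' ↔ 0 < A y ∧ 0 < B y ∧ 0 < C y := fun y =>
    mem_openCone_iff hDn
  have hco : ∀ y, y = A y • a' + B y • b + C y • c' := fun y => exists_coords hDn y
  obtain ⟨hxA, hxB, hxC⟩ := (hmem x).1 hx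
  have hBa : B a = -μ / σ := by
    have h1 : B a' = σ * B a + μ * B b := hBl _ _ _ _
    have h2 : B a' = 0 := by simp [hB]
    have h3 : B b = 1 := by simp [hB, div_self hDn]
    rw [h2, h3] at h1
    field_simp; linarith
  have hBc : B c = -μ' / σ' := by
    have h1 : B c' = σ' * B c + μ' * B b := hBl _ _ _ _
    have h2 : B c' = 0 := by simp [hB]
    have h3 : B b = 1 := by simp [hB, div_self hDn]
    rw [h2, h3] at h1
    field_simp; linarith
  have hBa0 : B a ≤ 0 := by rw [hBa]; exact div_nonpos_of_nonpos_of_nonneg (by linarith) hσ.le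
  have hBc0 : B c ≤ 0 := by rw [hBc]; exact div_nonpos_of_nonpos_of_nonneg (by linarith) hσ'.le
  have hAbc : ∀ {y}, y ∈ sector b c → A y = 0 := by
    rintro y ⟨s, t, -, -, rfl⟩
    simp [hA, hc', det3_add_left, det3_smul_left, det3_add_right, det3_smul_right]
  have hCab : ∀ {y}, y ∈ sector a b → C y = 0 := by
    rintro y ⟨s, t, -, -, rfl⟩
    simp [hC, ha', det3_add_left, det3_smul_left, det3_add_right, det3_smul_right]
  have hj1 : q j ≠ b := by
    intro e
    rw [hq.eq_add e 1, e] at hj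
    exact hxA.ne' (hAbc hj)
  have hj2 : q j ≠ a := by
    intro e
    rw [hq.eq_add e 1, e] at hj
    exact hxC.ne' (hCab hj)
  have hj3 : q (j + 1) ≠ b := by
    intro e
    have := hq.eq_add e (-1)
    simp only [add_neg_cancel_right] at this
    exact hj2 this
  -- Walk along the edge from `x` towards an endpoint `e` until the triangle is left. By simplicity
  -- the exit is not through the sides that lie on the polygon, so `B ≤ 0` there. Since `B` is
  -- linear and positive at `x`, it is nonpositive at `e`. This holds for both endpoints, which is
  -- incompatible with `B x > 0`.
  have key : ∀ e, (∀ s : ℝ, 0 < s → s ≤ 1 → (1 - s) • x + s • e ∈ sector (q j) (q (j + 1))) →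
      e ∉ openCone a' b c' → B e ≤ 0 := by
    intro e hse he
    rw [hmem] at he
    obtain ⟨s, hs0, hs1, h1, h2, h3, h4⟩ := exists_exit hxA hxB hxC he
    have hy := hse s hs0 hs1
    rw [← hAl] at h1 h4
    rw [← hBl] at h2 h4
    rw [← hCl] at h3 h4
    set y := (1 - s) • x + s • e with hyd
    have hy0 : B y ≤ 0 := by
      rcases h4 with h4 | h4 | h4
      · have e1 : y = (B y + C y * μ') • b + (C y * σ') • c := by
          conv_lhs => rw [hco y, h4]
          rw [hc']; module
        rcases eq_or_lt_of_le h3 with h | h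
        · rw [← h, zero_mul, zero_mul, add_zero, zero_smul, add_zero] at e1
          rcases eq_or_lt_of_le h2 with h' | h'
          · exact h'.ge
          · rw [e1] at hy
            rcases hq.vertex_unique h' hy with e | e
            · exact absurd e.symm hj1
            · exact absurd e.symm hj3
        · by_cases h' : 0 < B y + C y * μ'
          · rw [e1] at hy
            exact absurd (hq.edge_unique h' (by positivity) hy) hj1
          · have := mul_nonneg h3 hμ'
            linarith
      · exact h4.le
      · have e1 : y = (A y * σ) • a + (B y + A y * μ) • b := by
          conv_lhs => rw [hco y, h4]
          rw [ha']; module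
        rcases eq_or_lt_of_le h1 with h | h
        · rw [← h, zero_mul, zero_mul, add_zero, zero_smul, zero_add] at e1
          rcases eq_or_lt_of_le h2 with h' | h'
          · exact h'.ge
          · rw [e1] at hy
            rcases hq.vertex_unique h' hy with e | e
            · exact absurd e.symm hj1
            · exact absurd e.symm hj3
        · by_cases h' : 0 < B y + A y * μ
          · rw [e1] at hy
            exact absurd (hq.edge_unique (by positivity) h' hy) hj2
          · have := mul_nonneg h1 hμ
            linarith
    have e2 : B y = (1 - s) * B x + s * B e := hBl _ _ _ _
    have : 0 ≤ (1 - s) * B x := mul_nonneg (by linarith) hxB.le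
    by_contra! hlt
    have := mul_pos hs0 hlt
    linarith
  obtain ⟨s, t, hs, ht, he⟩ := hj
  have k1 := key (q j) (fun u hu hu1 => ⟨(1 - u) * s + u, (1 - u) * t, by nlinarith, by nlinarith,
    by rw [he]; module⟩) (hv j)
  have k2 := key (q (j + 1)) (fun u hu hu1 => ⟨(1 - u) * s, (1 - u) * t + u, by nlinarith,
    by nlinarith, by rw [he]; module⟩) (hv (j + 1))
  have : B x = s * B (q j) + t * B (q (j + 1)) := by rw [he]; exact hBl _ _ _ _
  have := mul_nonneg hs (neg_nonneg.2 k1)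
  have := mul_nonneg ht (neg_nonneg.2 k2)
  linarith

/-- An empty triangle at a convex corner lies in the left side. -/
theorem openCone_subset {L : Set E3} (hL : IsLeft q L) {i : ℤ}
    (hD : 0 < det3 (q i) (q (i + 1)) (q (i + 1 + 1)))
    {σ μ σ' μ' : ℝ} (hσ : 0 < σ) (hμ : 0 ≤ μ) (hσ' : 0 < σ')
    (hμ' : 0 ≤ μ') (hv : ∀ j, q j ∉ openCone (σ • q i + μ • q (i + 1)) (q (i + 1))
      (σ' • q (i + 1 + 1) + μ' • q (i + 1))) :
    openCone (σ • q i + μ • q (i + 1)) (q (i + 1)) (σ' • q (i + 1 + 1) + μ' • q (i + 1)) ⊆ L := by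
  -- A point of the triangle just to the left of the edge that starts at `q i` belongs to `L`. The
  -- triangle is connected and off the polygon, so all of it does.
  obtain ⟨τ, hτ, h⟩ := (eventually_pos_nhdsGT.and
    ((tendsto_add_smul (σ • q i + (μ + 1) • q (i + 1)) (σ' • q (i + 1 + 1) + μ' • q (i + 1))
      1).eventually (hL.edge i σ (μ + 1) hσ (by positivity)))).exists
  rw [one_mul] at h
  have hd : det3 (q i) (q (i + 1)) (σ • q i + (μ + 1) • q (i + 1) +
      τ • (σ' • q (i + 1 + 1) + μ' • q (i + 1))) =
      τ * σ' * det3 (q i) (q (i + 1)) (q (i + 1 + 1)) := by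
    simp [det3_add_right, det3_smul_right]; ring
  have hy := h.2 (by rw [hd]; positivity)
  intro x hx
  refine (hL.iff_of_preconnected (convex_openCone _ _ _).isPreconnected
    (fun z hz => hq.notMem_trace_of_openCone hσ hμ hσ' hμ' hv hz) hx ?_).2 hy
  exact ⟨1, 1, τ, one_pos, one_pos, hτ, by module⟩

/-- At a convex corner with an empty triangle, the third side is a chord. -/
theorem chord_of_empty {L : Set E3} (hm : 4 ≤ m) (hL : IsLeft q L) {i : ℤ}
    (hD : 0 < det3 (q i) (q (i + 1)) (q (i + 1 + 1)))
    (hv : ∀ j, q j ∉ openCone (q i) (q (i + 1)) (q (i + 1 + 1))) {s t : ℝ} (hs : 0 < s)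
    (ht : 0 < t) : s • q i + t • q (i + 1 + 1) ∈ L := by
  have hsub := hq.openCone_subset hL hD (σ := 1) (μ := 0) (σ' := 1) (μ' := 0) one_pos le_rfl one_pos
    le_rfl (by simpa using hv)
  simp only [one_smul, zero_smul, add_zero] at hsub
  set a := q i
  set b := q (i + 1)
  set c := q (i + 1 + 1)
  have hac : a ≠ c := hq.ne_two i
  have hcr : cross a c ≠ 0 := hq.cross_ne' hac
  set y := s • a + t • c with hy
  have hyoff : y ∉ trace q := by
    intro h
    obtain ⟨j, hj⟩ := mem_trace.1 h
    have hdy : det3 a y c = 0 := by simp [hy, det3_add_mid, det3_smul_mid]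
    have hz : ∀ k, det3 a (q k) c = 0 → q k = a ∨ q k = c := by
      intro k hk
      by_contra! hn
      exact hq.gen i k (i + 1 + 1) (Ne.symm hn.1) hn.2 hac hk
    have hvert : ∀ k, ∀ r : ℝ, y ≠ r • q k := by
      intro k r he
      have : det3 a (q k) c = 0 := by
        rw [he, det3_smul_mid] at hdy
        refine (mul_eq_zero.1 hdy).resolve_left ?_
        rintro rfl
        rw [zero_smul] at he
        exact hs.ne' (eq_zero_of_combination hcr he).1
      rcases hz k this with e | e
      · have h0 : (s - r) • a + t • c = 0 := by
          rw [sub_smul, ← add_sub_right_comm, ← hy, he, e, sub_self]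
        exact ht.ne' (eq_zero_of_combination hcr h0).2
      · have h0 : s • a + (t - r) • c = 0 := by
          rw [sub_smul, ← add_sub_assoc, ← hy, he, e, sub_self]
        exact hs.ne' (eq_zero_of_combination hcr h0).1
    obtain ⟨u, v, hu, hv', he⟩ := hj
    have hu : 0 < u := lt_of_le_of_ne hu fun h0 => hvert (j + 1) v (by
      rw [he, ← h0, zero_smul, zero_add])
    have hv' : 0 < v := lt_of_le_of_ne hv' fun h0 => hvert j u (by
      rw [he, ← h0, zero_smul, add_zero])
    -- An endpoint of edge `j` on the inner side of the third side would make the edge enter the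
    -- empty triangle. So neither endpoint is on the inner side; as `y` is in the plane of the third
    -- side, both endpoints are, hence they are `a` or `c`. For `m ≥ 4` these are not adjacent.
    have hfin : ∀ k, (∀ ε : ℝ, 0 < ε → y + ε • q k ∈ sector (q j) (q (j + 1))) →
        det3 a (q k) c ≤ 0 := by
      intro k hk
      by_contra! hpos
      have e1 : ∀ ε : ℝ, det3 (y + ε • q k) b c = s * det3 a b c + ε * det3 (q k) b c := by
        intro ε
        simp [hy, det3_add_left, det3_smul_left]
      have e2 : ∀ ε : ℝ, det3 a (y + ε • q k) c = ε * det3 a (q k) c := by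
        intro ε
        rw [det3_add_mid, hdy, det3_smul_mid, zero_add]
      have e3 : ∀ ε : ℝ, det3 a b (y + ε • q k) = t * det3 a b c + ε * det3 a b (q k) := by
        intro ε
        simp [hy, det3_add_right, det3_smul_right]
      have c1 : Continuous fun ε : ℝ => s * det3 a b c + ε * det3 (q k) b c := by fun_prop
      have c3 : Continuous fun ε : ℝ => t * det3 a b c + ε * det3 a b (q k) := by fun_prop
      have t1 := (c1.tendsto 0).eventually (lt_mem_nhds (a := 0) (by
        simp only [zero_mul, add_zero]; positivity))
      have t3 := (c3.tendsto 0).eventually (lt_mem_nhds (a := 0) (by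
        simp only [zero_mul, add_zero]; positivity))
      obtain ⟨ε, hε, h1, h3⟩ := (eventually_pos_nhdsGT.and
        ((t1.and t3).filter_mono nhdsWithin_le_nhds)).exists
      have hin : y + ε • q k ∈ openCone a b c := by
        rw [mem_openCone_iff hD.ne', e1, e2, e3]
        exact ⟨div_pos h1 hD, div_pos (mul_pos hε hpos) hD, div_pos h3 hD⟩
      exact hL.disj _ (hsub hin) (mem_trace.2 ⟨j, hk ε hε⟩)
    have f1 := hfin j fun ε hε => ⟨u + ε, v, by linarith, hv'.le, by rw [he]; module⟩
    have f2 := hfin (j + 1) fun ε hε => ⟨u, v + ε, hu.le, by linarith, by rw [he]; module⟩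
    have hsum : u * det3 a (q j) c + v * det3 a (q (j + 1)) c = 0 := by
      rw [← hdy, he, det3_add_mid, det3_smul_mid, det3_smul_mid]
    have g1 : det3 a (q j) c = 0 := by
      have := mul_nonneg hv'.le (neg_nonneg.2 f2)
      have h3 : 0 ≤ u * det3 a (q j) c := by linarith
      exact le_antisymm f1 (nonneg_of_mul_nonneg_right h3 hu)
    have g2 : det3 a (q (j + 1)) c = 0 := by
      rw [g1, mul_zero, zero_add] at hsum
      exact (mul_eq_zero.1 hsum).resolve_left hv'.ne'
    rcases hz _ g1 with e | e
    · rcases hz _ g2 with e' | e'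
      · exact hq.ne_one j (e.trans e'.symm)
      · exact hq.ne_one (i + 1) ((hq.eq_add e 1).symm.trans e')
    · have h5 := hq.eq_add e 1
      rcases hz _ g2 with e' | e'
      · exact hq.ne_of_lt (i := i) (j := i + 1 + 1 + 1) (by linarith) (by omega)
          (e'.symm.trans h5)
      · exact hq.ne_one j (e.trans e'.symm)
  obtain ⟨τ, hτ, h⟩ := (eventually_pos_nhdsGT.and
    ((tendsto_add_smul y b 1).eventually (hL.loc y hyoff))).exists
  rw [one_mul] at h
  exact h.1 (hsub ⟨s, τ, t, hs, hτ, ht, by rw [hy]; module⟩)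

/-- At a convex corner with a nonempty triangle, there is a chord from the tip. -/
theorem exists_chord {L : Set E3} (hL : IsLeft q L) {i : ℤ}
    (hD : 0 < det3 (q i) (q (i + 1)) (q (i + 1 + 1)))
    (hv : ∃ j, q j ∈ openCone (q i) (q (i + 1)) (q (i + 1 + 1))) :
    ∃ j, q j ∈ openCone (q i) (q (i + 1)) (q (i + 1 + 1)) ∧
      ∀ s t : ℝ, 0 < s → 0 < t → s • q (i + 1) + t • q j ∈ L := by
  classical
  set a := q i with ha
  set b := q (i + 1) with hb
  set c := q (i + 1 + 1) with hc
  -- In the coordinates (r, s, t) of the triangle this is (r + t) / s. The vertex that minimizes it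
  -- is the first one met by a plane that turns away from the tip `b`.
  set ρ : E3 → ℝ := fun y => (det3 y b c + det3 a b y) / det3 a y c with hρ
  obtain ⟨j₀, hj₀⟩ := hv
  obtain ⟨k₀, hk₀, -⟩ := hq.exists_fin j₀
  obtain ⟨k, hk, hmin⟩ := Finset.exists_min_image
    (Finset.univ.filter fun k : Fin m => q (k : ℤ) ∈ openCone a b c) (fun k => ρ (q (k : ℤ)))
    ⟨k₀, by rw [Finset.mem_filter]; exact ⟨Finset.mem_univ _, hk₀ ▸ hj₀⟩⟩
  have hkT := (Finset.mem_filter.1 hk).2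
  have hkT' := hkT
  obtain ⟨α, β, γ, hα, hβ, hγ, he⟩ := hkT'
  have hαγ : 0 < α + γ := by positivity
  refine ⟨k, hkT, ?_⟩
  have hcoef : ∀ r s t : ℝ, ρ (r • a + s • b + t • c) = (r + t) / s := by
    intro r s t
    have h1 : det3 (r • a + s • b + t • c) b c = r * det3 a b c := by
      simp [det3_add_left, det3_smul_left]
    have h2 : det3 a (r • a + s • b + t • c) c = s * det3 a b c := by
      simp [det3_add_mid, det3_smul_mid]
    have h3 : det3 a b (r • a + s • b + t • c) = t * det3 a b c := by
      simp [det3_add_right, det3_smul_right]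
    simp only [hρ, h1, h2, h3]
    rw [← add_mul, mul_div_mul_right _ _ hD.ne']
  -- The triangle cut off by that plane. Its two new corners have the same `ρ` as the chosen vertex,
  -- and they add up to it, so the vertex is on the third side. A vertex inside would have a smaller
  -- `ρ`.
  have hempty : ∀ j, q j ∉ openCone (α • a + (β * α / (α + γ)) • b) b
      (γ • c + (β * γ / (α + γ)) • b) := by
    rintro j ⟨r, s, t, hr, hs, ht, hej⟩
    have hej' : q j = (r * α) • a + (s + (r * α + t * γ) * (β / (α + γ))) • b + (t * γ) • c := by
      rw [hej]
      have e1 : r * (β * α / (α + γ)) + t * (β * γ / (α + γ)) =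
          (r * α + t * γ) * (β / (α + γ)) := by ring
      have e2 : s + (r * α + t * γ) * (β / (α + γ)) =
          r * (β * α / (α + γ)) + s + t * (β * γ / (α + γ)) := by rw [← e1]; ring
      rw [e2]; module
    have hrt : 0 < r * α + t * γ := by positivity
    obtain ⟨l, hl, -⟩ := hq.exists_fin j
    have hmem : q (l : ℤ) ∈ openCone a b c := by
      rw [← hl]
      exact ⟨_, _, _, by positivity, by positivity, by positivity, hej'⟩
    have := hmin l (Finset.mem_filter.2 ⟨Finset.mem_univ _, hmem⟩)
    rw [← hl, hej', he, hcoef, hcoef, div_le_div_iff₀ hβ (by positivity)] at this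
    have e3 : (α + γ) * (s + (r * α + t * γ) * (β / (α + γ))) =
        (α + γ) * s + (r * α + t * γ) * β := by field_simp
    have := mul_pos hαγ hs
    linarith
  have hsub := hq.openCone_subset hL hD hα (by positivity) hγ (by positivity) hempty
  intro s t hs ht
  refine hsub ⟨t, s, t, ht, hs, ht, ?_⟩
  rw [he]
  have e1 : β * α / (α + γ) + β * γ / (α + γ) = β := by field_simp
  have e2 : t * β = t * (β * α / (α + γ)) + t * (β * γ / (α + γ)) := by rw [← mul_add, e1]
  have e3 : s • b + t • (α • a + β • b + γ • c) = (t * α) • a + (s + t * β) • b + (t * γ) • c := by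
    module
  rw [e3, e2]; module

end SimplePoly

end

end PolyhedralSurface

namespace PolyhedralSurface

noncomputable section

open Filter

/-! ### Cutting a polygon along a chord -/

/-- The polygon with the vertices `q 0, …, q j`. -/
def cut (q : ℤ → E3) (j : ℕ) : ℤ → E3 := fun i => q (i % (j + 1 : ℕ))

theorem cut_eq {q : ℤ → E3} {j : ℕ} {r : ℤ} (h0 : 0 ≤ r) (h1 : r ≤ j) : cut q j r = q r := by
  unfold cut; rw [Int.emod_eq_of_lt h0 (by push_cast; linarith)]

theorem cut_add {q : ℤ → E3} {j : ℕ} (i k : ℤ) : cut q j (i + k) = cut q j (i % (j + 1 : ℕ) + k) := by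
  unfold cut; rw [Int.emod_add_emod]

theorem cut_last {q : ℤ → E3} {j : ℕ} : cut q j (j + 1) = q 0 := by
  unfold cut; congr 1; push_cast; exact Int.emod_self

theorem cut_edge (q : ℤ → E3) (j : ℕ) (i : ℤ) :
    (∃ r : ℤ, 0 ≤ r ∧ r < j ∧ cut q j i = q r ∧ cut q j (i + 1) = q (r + 1)) ∨
      (cut q j i = q j ∧ cut q j (i + 1) = q 0) := by
  have h0 := Int.emod_nonneg i (b := (j + 1 : ℕ)) (by positivity)
  have h1 := Int.emod_lt_of_pos i (b := (j + 1 : ℕ)) (by positivity)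
  have e0 : cut q j i = q (i % (j + 1 : ℕ)) := rfl
  have e1 := cut_add (q := q) (j := j) i 1
  rw [e0, e1]
  generalize i % ((j + 1 : ℕ) : ℤ) = r at h0 h1
  push_cast at h1
  rcases eq_or_ne r j with rfl | hr
  · exact Or.inr ⟨rfl, cut_last⟩
  · left
    refine ⟨r, h0, by omega, rfl, cut_eq (by omega) (by omega)⟩

theorem cut_corner (q : ℤ → E3) {j : ℕ} (hj : 1 ≤ j) (i : ℤ) :
    (∃ r : ℤ, 0 ≤ r ∧ r + 2 ≤ j ∧ cut q j i = q r ∧ cut q j (i + 1) = q (r + 1) ∧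
      cut q j (i + 1 + 1) = q (r + 1 + 1)) ∨
      (cut q j i = q (j - 1) ∧ cut q j (i + 1) = q j ∧ cut q j (i + 1 + 1) = q 0) ∨
      (cut q j i = q j ∧ cut q j (i + 1) = q 0 ∧ cut q j (i + 1 + 1) = q 1) := by
  have h0 := Int.emod_nonneg i (b := (j + 1 : ℕ)) (by positivity)
  have h1 := Int.emod_lt_of_pos i (b := (j + 1 : ℕ)) (by positivity)
  have e0 : cut q j i = q (i % (j + 1 : ℕ)) := rfl
  have e1 := cut_add (q := q) (j := j) i 1
  have e2 := cut_add (q := q) (j := j) i (1 + 1)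
  rw [← add_assoc] at e2
  rw [e0, e1, e2]
  generalize i % ((j + 1 : ℕ) : ℤ) = r at h0 h1
  push_cast at h1
  rcases eq_or_ne r j with rfl | hr
  · refine Or.inr (Or.inr ⟨rfl, cut_last, ?_⟩)
    have : ((j : ℤ) + (1 + 1)) = ((j : ℤ) + 1) + 1 := by ring
    rw [this, cut_add]
    have : ((j : ℤ) + 1) % (j + 1 : ℕ) = 0 := by push_cast; exact Int.emod_self
    rw [this, zero_add]
    exact cut_eq (by omega) (by omega)
  · rcases eq_or_ne r (j - 1) with rfl | hr'
    · refine Or.inr (Or.inl ⟨rfl, ?_, ?_⟩)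
      · rw [sub_add_cancel]; exact cut_eq (by omega) le_rfl
      · have : ((j : ℤ) - 1 + (1 + 1)) = (j : ℤ) + 1 := by ring
        rw [this]; exact cut_last
    · left
      refine ⟨r, h0, by omega, rfl, cut_eq (by omega) (by omega), ?_⟩
      rw [add_assoc]; exact cut_eq (by omega) (by omega)

/-- The chord from `d` replaces the incoming edge. As `d` lies in the left angle of `a, b, c`, the
left angle of `d, b, c` is a part of it. The proof chases signs in a Plücker relation. -/
theorem CornerLeft.of_cut_left {a b c d y : E3} (h : CornerLeft a b c d) (h' : CornerLeft d b c y) :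
    CornerLeft a b c y := by
  have hid : det3 d b c * det3 a b y = det3 b c y * det3 a b d + det3 a b c * det3 d b y := by
    simp only [det3]; ring
  have e1 : det3 b c d = det3 d b c := (det3_rotate d b c).symm
  unfold CornerLeft at *
  rw [e1] at h
  generalize det3 d b c = cd at *
  generalize det3 a b y = ya at *
  generalize det3 b c y = cy at *
  generalize det3 a b d = da at *
  generalize det3 a b c = ca at *
  generalize det3 d b y = yd at *
  rcases h with ⟨h1, h2, h3⟩ | ⟨h1, h2⟩
  · rcases h' with ⟨h4, h5, h6⟩ | ⟨h4, -⟩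
    · refine Or.inl ⟨h1, ?_, h6⟩
      have : 0 < cd * ya := by rw [hid]; positivity
      exact pos_of_mul_pos_right this h3.le
    · linarith
  · refine Or.inr ⟨h1, ?_⟩
    by_contra! hn
    rcases h' with ⟨h4, h5, h6⟩ | ⟨h4, h5⟩
    · linarith
    · have h5 : 0 < yd := by rcases h5 with h | h <;> linarith
      have h2 : 0 < da := by rcases h2 with h | h <;> linarith
      nlinarith [mul_pos h5 (neg_pos.2 h1), mul_nonneg (neg_nonneg.2 h4.le) (neg_nonneg.2 hn.1),
        mul_nonneg h2.le (neg_nonneg.2 hn.2)]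

/-- The same at the other end of the chord, where it replaces the outgoing edge. -/
theorem CornerLeft.of_cut_right {a b c d y : E3} (h : CornerLeft a b c d)
    (h' : CornerLeft a b d y) : CornerLeft a b c y := by
  have hid : det3 b c d * det3 a b y = det3 b c y * det3 a b d - det3 a b c * det3 b d y := by
    simp only [det3]; ring
  unfold CornerLeft at *
  generalize det3 b c d = cd at *
  generalize det3 a b y = ya at *
  generalize det3 b c y = cy at *
  generalize det3 a b d = da at *
  generalize det3 a b c = ca at *
  generalize det3 b d y = dy at *
  rcases h with ⟨h1, h2, h3⟩ | ⟨h1, h2⟩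
  · rcases h' with ⟨h4, h5, h6⟩ | ⟨h4, -⟩
    · refine Or.inl ⟨h1, h5, ?_⟩
      have : 0 < cy * da := by nlinarith [mul_pos h3 h5, mul_pos h1 h6]
      exact pos_of_mul_pos_left this h4.le
    · linarith
  · refine Or.inr ⟨h1, ?_⟩
    by_contra! hn
    rcases h' with ⟨h4, h5, h6⟩ | ⟨h4, h5⟩
    · linarith
    · have h5 : 0 < dy := by rcases h5 with h | h <;> linarith
      have h2 : 0 < cd := by rcases h2 with h | h <;> linarith
      nlinarith [mul_pos h5 (neg_pos.2 h1), mul_nonneg (neg_nonneg.2 h4.le) (neg_nonneg.2 hn.2),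
        mul_nonneg h2.le (neg_nonneg.2 hn.1)]

theorem not_cornerLeft_self (a b c : E3) : ¬ CornerLeft a b c c := by
  rintro (⟨-, -, h⟩ | ⟨h1, h | h⟩)
  · simp at h
  · linarith
  · simp at h

theorem trace_shift (q : ℤ → E3) (k : ℤ) : trace (fun i => q (i + k)) = trace q := by
  ext x
  simp only [mem_trace]
  constructor
  · rintro ⟨i, hi⟩
    refine ⟨i + k, ?_⟩
    rwa [add_right_comm] at hi
  · rintro ⟨i, hi⟩
    refine ⟨i - k, ?_⟩
    have e1 : i - k + k = i := by ring
    have e2 : i - k + 1 + k = i + 1 := by ring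
    rwa [e1, e2]

theorem IsLeft.shift {q : ℤ → E3} {L : Set E3} (hL : IsLeft q L) (k : ℤ) :
    IsLeft (fun i => q (i + k)) L where
  disj := by rw [trace_shift]; exact hL.disj
  loc := by rw [trace_shift]; exact hL.loc
  edge i := by
    have := hL.edge (i + k)
    rwa [add_right_comm] at this
  vert i := by
    have := hL.vert (i + k)
    rw [trace_shift]
    have e1 : i + k + 1 = i + 1 + k := by ring
    have e2 : i + 1 + k + 1 = i + 1 + 1 + k := by ring
    rwa [e1, e2] at this

namespace SimplePoly

variable {m : ℕ} {q : ℤ → E3} (hq : SimplePoly m q)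

include hq

theorem shift (k : ℤ) : SimplePoly m (fun i => q (i + k)) where
  three_le := hq.three_le
  per i := by rw [add_right_comm]; exact hq.per _
  inj i j h := by simpa using hq.inj _ _ h
  gen i j l := hq.gen _ _ _
  disj i j := by
    have := hq.disj (i + k) (j + k)
    rwa [add_right_comm i, add_right_comm j] at this

theorem reverse : SimplePoly m (fun i => q (-i)) where
  three_le := hq.three_le
  per i := by
    rw [← hq.per (-(i + m))]; congr 1; ring
  inj i j h := by
    have := hq.inj _ _ h
    have e : -j - -i = -(j - i) := by ring
    rwa [e, dvd_neg] at this
  gen i j l := hq.gen _ _ _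
  disj i j h1 h2 h3 h4 x hx hx' := by
    have := hq.disj (-(i + 1)) (-(j + 1))
    have e1 : -(i + 1) + 1 = -i := by ring
    have e2 : -(j + 1) + 1 = -j := by ring
    rw [e1, e2] at this
    exact this h4 h3 h2 h1 x (mem_sector_comm.1 hx) (mem_sector_comm.1 hx')

variable {L : Set E3} (hL : IsLeft q L) {j : ℕ} (hj : 2 ≤ j) (hjm : j + 2 ≤ m)
  (hch : ∀ s t : ℝ, 0 < s → 0 < t → s • q 0 + t • q j ∈ L)

include hL hj hjm hch

/-- The interior of the chord is in `L`, hence off the polygon. So the chord can meet an edge only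
at an endpoint of the chord, and vertices lie on adjacent edges only. -/
theorem simplePoly_cut : SimplePoly (j + 1) (cut q j) where
  three_le := by omega
  per i := by unfold cut; rw [Int.add_emod_right]
  inj i k h := by
    have b1 := Int.emod_nonneg i (b := (j + 1 : ℕ)) (by positivity)
    have b2 := Int.emod_lt_of_pos i (b := (j + 1 : ℕ)) (by positivity)
    have b3 := Int.emod_nonneg k (b := (j + 1 : ℕ)) (by positivity)
    have b4 := Int.emod_lt_of_pos k (b := (j + 1 : ℕ)) (by positivity)
    have h : q (i % (j + 1 : ℕ)) = q (k % (j + 1 : ℕ)) := h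
    have : i % (j + 1 : ℕ) = k % (j + 1 : ℕ) := by
      rcases lt_trichotomy (i % (j + 1 : ℕ)) (k % (j + 1 : ℕ)) with h' | h' | h'
      · exact absurd h (hq.ne_of_lt h' (by omega))
      · exact h'
      · exact absurd h.symm (hq.ne_of_lt h' (by omega))
    exact Int.ModEq.dvd this
  gen i k l := hq.gen _ _ _
  disj := by
    have hvert : ∀ r : ℤ, q r ≠ q j → q r ≠ q 0 → q (r + 1) ≠ q j → q (r + 1) ≠ q 0 →
        ∀ x, x ∈ sector (q j) (q 0) → x ∈ sector (q r) (q (r + 1)) → x = 0 := by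
      rintro r h1 h2 h3 h4 x ⟨t, s, ht, hs, rfl⟩ hx
      rcases eq_or_lt_of_le ht with rfl | ht
      · rcases eq_or_lt_of_le hs with rfl | hs
        · simp
        · rw [zero_smul, zero_add] at hx
          rcases hq.vertex_unique hs hx with e | e
          · exact absurd e.symm h2
          · exact absurd e.symm h4
      · rcases eq_or_lt_of_le hs with rfl | hs
        · rw [zero_smul, add_zero] at hx
          rcases hq.vertex_unique ht hx with e | e
          · exact absurd e.symm h1
          · exact absurd e.symm h3
        · rw [add_comm (t • q j)] at hx
          exact absurd (mem_trace.2 ⟨r, hx⟩) (hL.disj _ (hch s t hs ht))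
    intro i k h1 h2 h3 h4 x hx hx'
    rcases cut_edge q j i with ⟨r, -, -, e1, e2⟩ | ⟨e1, e2⟩ <;>
      rcases cut_edge q j k with ⟨r', -, -, e3, e4⟩ | ⟨e3, e4⟩ <;>
      rw [e1, e2] at hx <;> rw [e3, e4] at hx' <;> rw [e1, e3] at h1 <;> rw [e1, e4] at h2 <;>
      rw [e2, e3] at h3 <;> rw [e2, e4] at h4
    · exact hq.disj r r' h1 h2 h3 h4 x hx hx'
    · exact hvert r h1 h2 h3 h4 x hx' hx
    · exact hvert r' (Ne.symm h1) (Ne.symm h3) (Ne.symm h2) (Ne.symm h4) x hx hx'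
    · exact absurd rfl h1

/-- The chord starts into the left side. -/
theorem cornerLeft_chord : CornerLeft (q (-1)) (q 0) (q 1) (q j) ∧
    CornerLeft (q (j - 1)) (q j) (q (j + 1)) (q 0) := by
  have key : ∀ i : ℤ, ∀ d, (∀ s t : ℝ, 0 < s → 0 < t → s • q (i + 1) + t • d ∈ L) →
      CornerLeft (q i) (q (i + 1)) (q (i + 1 + 1)) d := by
    intro i d hd
    obtain ⟨τ, hτ, h⟩ := (eventually_pos_nhdsGT.and
      ((tendsto_add_smul ((1 : ℝ) • q (i + 1)) d 1).eventually (hL.vert i 1 one_pos))).exists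
    rw [one_mul] at h
    have hin := hd 1 τ one_pos hτ
    have := (h (hL.disj _ hin)).1 hin
    unfold CornerLeft at this ⊢
    simp only [det3_add_right, det3_smul_right, det3_self_right, det3_self_outer, mul_zero,
      zero_add] at this
    simpa [hτ, mul_pos_iff_of_pos_left] using this
  constructor
  · exact key (-1) (q j) hch
  · have := key (j - 1) (q 0) (fun s t hs ht => by
      rw [sub_add_cancel, add_comm]; exact hch t s ht hs)
    rwa [sub_add_cancel] at this

theorem trace_cut {x : E3} : x ∈ trace (cut q j) ↔
    (∃ r : ℤ, 0 ≤ r ∧ r < j ∧ x ∈ sector (q r) (q (r + 1))) ∨ x ∈ sector (q j) (q 0) := by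
  rw [mem_trace]
  constructor
  · rintro ⟨i, hi⟩
    rcases cut_edge q j i with ⟨r, h1, h2, e1, e2⟩ | ⟨e1, e2⟩ <;> rw [e1, e2] at hi
    · exact Or.inl ⟨r, h1, h2, hi⟩
    · exact Or.inr hi
  · rintro (⟨r, h1, h2, hx⟩ | hx)
    · refine ⟨r, ?_⟩
      rwa [cut_eq h1 h2.le, cut_eq (by omega) (by omega)]
    · refine ⟨j, ?_⟩
      rwa [cut_last, cut_eq (by omega) le_rfl]

/-- The rest of the polygon, from `q j` on, avoids the retained edges by simplicity and the chord
because the chord is in `L`. The condition on `s` and `t` leaves out `q j` and `q m = q 0`, which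
belong to both parts. -/
theorem notMem_trace_cut {k : ℤ} (hk : j ≤ k) (hkm : k < m) {s t : ℝ} (hs : 0 ≤ s) (ht : 0 ≤ t)
    (hst : (0 < s ∧ 0 < t) ∨ (0 < s ∧ t = 0 ∧ j < k)) :
    s • q k + t • q (k + 1) ∉ trace (cut q j) := by
  have hne : ∀ r : ℤ, 0 ≤ r → r < j → q r ≠ q k := fun r h0 h1 =>
    hq.ne_of_lt (by omega) (by omega)
  intro h
  have hmem : s • q k + t • q (k + 1) ∈ sector (q k) (q (k + 1)) := ⟨s, t, hs, ht, rfl⟩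
  rw [hq.trace_cut hL hj hjm hch] at h
  rcases hst with ⟨hs, ht⟩ | ⟨hs, rfl, hjk⟩
  · have hedge : ∀ r : ℤ, 0 ≤ r → r < j → s • q k + t • q (k + 1) ∉ sector (q r) (q (r + 1)) :=
      fun r h0 h1 hx => hne r h0 h1 (hq.edge_unique hs ht hx)
    rcases h with ⟨r, h0, h1, hx⟩ | hx
    · exact hedge r h0 h1 hx
    · rcases hx with ⟨u, v, hu, hv, he⟩
      rcases eq_or_lt_of_le hv with h0 | hv0
      · apply hedge (j - 1) (by omega) (by omega)
        rw [sub_add_cancel, he, ← h0, zero_smul, add_zero]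
        exact ⟨0, u, le_rfl, hu, by simp⟩
      · rcases eq_or_lt_of_le hu with h0 | hu0
        · apply hedge 0 le_rfl (by omega)
          rw [he, ← h0, zero_smul, zero_add]
          exact ⟨v, 0, hv, le_rfl, by simp⟩
        · refine hL.disj _ (hch v u hv0 hu0) (mem_trace.2 ⟨k, ?_⟩)
          rw [add_comm (v • q 0), ← he]; exact hmem
  · rw [zero_smul, add_zero] at h
    rcases h with ⟨r, h0, h1, hx⟩ | hx
    · rcases hq.vertex_unique hs hx with e | e
      · exact hne r h0 h1 e.symm
      · exact hq.ne_of_lt (i := r + 1) (j := k) (by omega) (by omega) e.symm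
    · rcases hx with ⟨u, v, hu, hv, he⟩
      rcases eq_or_lt_of_le hv with h0 | hv0
      · have h2 : s • q k ∈ sector (q j) (q (j + 1)) := by
          rw [he, ← h0, zero_smul, add_zero]; exact ⟨u, 0, hu, le_rfl, by simp⟩
        have h3 : s • q k ∈ sector (q (j - 1)) (q (j - 1 + 1)) := by
          rw [sub_add_cancel, he, ← h0, zero_smul, add_zero]; exact ⟨0, u, le_rfl, hu, by simp⟩
        rcases hq.vertex_unique hs h3 with e | e
        · exact hne _ (by omega) (by omega) e.symm
        · rw [sub_add_cancel] at e
          exact hq.ne_of_lt hjk (by omega) e.symm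
      · rcases eq_or_lt_of_le hu with h0 | hu0
        · have h2 : s • q k ∈ sector (q 0) (q (0 + 1)) := by
            rw [he, ← h0, zero_smul, zero_add]; exact ⟨v, 0, hv, le_rfl, by simp⟩
          rcases hq.vertex_unique hs h2 with e | e
          · exact hne _ (by omega) (by omega) e.symm
          · exact hq.ne_of_lt (i := 0 + 1) (j := k) (by omega) (by omega) e.symm
        · refine hL.disj _ (hch v u hv0 hu0) (mem_trace.2 ⟨k, ?_⟩)
          rw [add_comm (v • q 0), ← he]; exact ⟨s, 0, hs.le, le_rfl, by simp⟩

/-- The rest of the polygon does not lie on the left of the polygon that is cut off. -/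
theorem notMem_left_cut {L' : Set E3} (hL' : IsLeft (cut q j) L') {k : ℤ} (hk : j ≤ k)
    (hkm : k < m) : (∀ s t : ℝ, 0 < s → 0 < t → s • q k + t • q (k + 1) ∉ L') ∧
      (j < k → ∀ r : ℝ, 0 < r → r • q k ∉ L') := by
  -- Not being in `L'` propagates along the rest of the polygon: within an open edge, from an edge
  -- to its end, and from a vertex to the next edge.
  have hP : ∀ k : ℤ, j ≤ k → k < m → (∃ s t : ℝ, 0 < s ∧ 0 < t ∧ s • q k + t • q (k + 1) ∉ L') →
      ∀ s t : ℝ, 0 < s → 0 < t → s • q k + t • q (k + 1) ∉ L' := by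
    rintro k hk hkm ⟨s', t', hs', ht', h⟩ s t hs ht
    rwa [hL'.iff_of_preconnected (convex_openSector (q k) (q (k + 1))).isPreconnected
      (y := s' • q k + t' • q (k + 1)) ?_ ⟨s, t, hs, ht, rfl⟩ ⟨s', t', hs', ht', rfl⟩]
    rintro x ⟨u, v, hu, hv, rfl⟩
    exact hq.notMem_trace_cut hL hj hjm hch hk hkm hu.le hv.le (Or.inl ⟨hu, hv⟩)
  have hV : ∀ k : ℤ, j < k → k < m → (∀ s t : ℝ, 0 < s → 0 < t →
      s • q (k - 1) + t • q (k - 1 + 1) ∉ L') → ∀ r : ℝ, 0 < r → r • q k ∉ L' := by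
    intro k hk hkm h r hr
    have hoff := hq.notMem_trace_cut hL hj hjm hch hk.le hkm hr.le le_rfl (Or.inr ⟨hr, rfl, hk⟩)
    rw [zero_smul, add_zero] at hoff
    obtain ⟨τ, hτ, h1⟩ := (eventually_pos_nhdsGT.and
      ((tendsto_add_smul (r • q k) (q (k - 1)) 1).eventually (hL'.loc _ hoff))).exists
    rw [one_mul] at h1
    rw [← h1, add_comm]
    have := h τ r hτ hr
    rwa [sub_add_cancel] at this
  have hVP : ∀ k : ℤ, j < k → k < m → (∀ r : ℝ, 0 < r → r • q k ∉ L') →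
      ∀ s t : ℝ, 0 < s → 0 < t → s • q k + t • q (k + 1) ∉ L' := by
    intro k hk hkm h
    apply hP k hk.le hkm
    have hoff := hq.notMem_trace_cut hL hj hjm hch hk.le hkm one_pos.le le_rfl
      (Or.inr ⟨one_pos, rfl, hk⟩)
    rw [zero_smul, add_zero] at hoff
    obtain ⟨τ, hτ, h1⟩ := (eventually_pos_nhdsGT.and
      ((tendsto_add_smul ((1 : ℝ) • q k) (q (k + 1)) 1).eventually (hL'.loc _ hoff))).exists
    rw [one_mul] at h1
    exact ⟨1, τ, one_pos, hτ, by rw [h1]; exact h 1 one_pos⟩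
  -- The propagation starts at `q j`. If the edge to `q (j + 1)` were on the left of the corner
  -- formed with the chord, then by `of_cut_right` it would be on its own left.
  have h0 : ∀ s t : ℝ, 0 < s → 0 < t → s • q j + t • q (j + 1) ∉ L' := by
    apply hP j le_rfl (by omega)
    have hv := hL'.vert (j - 1) 1 one_pos
    have e0 : cut q j (j - 1) = q (j - 1) := cut_eq (by omega) (by omega)
    have e1 : cut q j (j - 1 + 1) = q j := by rw [sub_add_cancel]; exact cut_eq (by omega) le_rfl
    have e2 : cut q j (j - 1 + 1 + 1) = q 0 := by rw [sub_add_cancel]; exact cut_last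
    rw [e0, e1, e2] at hv
    obtain ⟨τ, hτ, h1⟩ := (eventually_pos_nhdsGT.and
      ((tendsto_add_smul ((1 : ℝ) • q j) (q (j + 1)) 1).eventually hv)).exists
    rw [one_mul] at h1
    refine ⟨1, τ, one_pos, hτ, ?_⟩
    rw [h1 (hq.notMem_trace_cut hL hj hjm hch le_rfl (by omega) one_pos.le hτ.le
      (Or.inl ⟨one_pos, hτ⟩))]
    intro h2
    have h3 : CornerLeft (q (j - 1)) (q j) (q 0) (q (j + 1)) := by
      unfold CornerLeft at h2 ⊢
      simp only [det3_add_right, det3_smul_right, det3_self_right, det3_self_outer, mul_zero,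
        zero_add] at h2
      simpa [hτ, mul_pos_iff_of_pos_left] using h2
    exact not_cornerLeft_self _ _ _
      ((hq.cornerLeft_chord hL hj hjm hch).2.of_cut_right h3)
  have hall : ∀ l : ℕ, (j : ℤ) + l < m → ∀ s t : ℝ, 0 < s → 0 < t →
      s • q (j + l) + t • q (j + l + 1) ∉ L' := by
    intro l
    induction l with
    | zero => simpa using fun _ => h0
    | succ l ih =>
      intro hl
      have ih := ih (by push_cast at hl; omega)
      refine hVP _ (by push_cast; omega) hl (hV _ (by push_cast; omega) hl ?_)
      have e : (j : ℤ) + ((l + 1 : ℕ) : ℤ) - 1 = j + l := by push_cast; ring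
      rw [e]; exact ih
  obtain ⟨l, rfl⟩ : ∃ l : ℕ, k = j + l := ⟨(k - j).toNat, by omega⟩
  refine ⟨hall l hkm, fun hjk => hV _ hjk hkm ?_⟩
  obtain ⟨l', rfl⟩ : ∃ l', l = l' + 1 := ⟨l - 1, by omega⟩
  have e : (j : ℤ) + ((l' + 1 : ℕ) : ℤ) - 1 = j + l' := by push_cast; ring
  rw [e]
  exact hall l' (by omega)

theorem vertex_notMem_left_cut {L' : Set E3} (hL' : IsLeft (cut q j) L') (k : ℤ) : q k ∉ L' := by
  obtain ⟨l, hl, -⟩ := hq.exists_fin k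
  rw [hl]
  have hlm := l.2
  rcases le_or_gt (l : ℕ) j with h | h
  · intro h2
    refine hL'.disj _ h2 ?_
    rw [hq.trace_cut hL hj hjm hch]
    rcases h.lt_or_eq with h | h
    · exact Or.inl ⟨l, by omega, by omega, 1, 0, zero_le_one, le_rfl, by simp⟩
    · right
      rw [h]; exact ⟨1, 0, zero_le_one, le_rfl, by simp⟩
  · have := (hq.notMem_left_cut hL hj hjm hch hL' (k := l) (by omega) (by omega)).2
      (by omega) 1 one_pos
    rwa [one_smul] at this

/-- The left side of the polygon that is cut off is contained in the left side. -/
theorem left_cut_subset {L' : Set E3} (hL' : IsLeft (cut q j) L') {x : E3} (hx : x ∈ L') :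
    x ∈ L ∨ x ∈ trace q := by
  by_contra! hn
  have hoff' := hL'.disj
  -- The points of `L'` that are neither in `L` nor on the polygon form an open and closed subset of
  -- the punctured space. The latter is connected and the subset misses `q 0`, so it is empty.
  have hloc : ∀ x ∈ ({0}ᶜ : Set E3), ∀ᶠ y in 𝓝 x, (y ∈ L' ∧ y ∉ L ∧ y ∉ trace q) =
      (x ∈ L' ∧ x ∉ L ∧ x ∉ trace q) := by
    intro x hx0
    by_cases hxt : x ∈ trace q
    · suffices h : ∀ᶠ y in 𝓝 x, y ∉ trace q → y ∈ L' → y ∈ L by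
        filter_upwards [h] with y hy
        refine propext ⟨fun h => absurd (hy h.2.2 h.1) h.2.1, fun h => absurd hxt h.2.2⟩
      have hout : x ∉ trace (cut q j) → x ∉ L' → ∀ᶠ y in 𝓝 x, y ∉ trace q → y ∈ L' → y ∈ L := by
        intro h1 h2
        filter_upwards [hL'.loc x h1] with y hy _ h
        exact absurd (hy.1 h) h2
      have hvert : ∀ (k : Fin m) (r : ℝ), 0 < r → x = r • q (k : ℤ) →
          ∀ᶠ y in 𝓝 x, y ∉ trace q → y ∈ L' → y ∈ L := by
        rintro k r hr rfl
        have hkm := k.2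
        have hLk := hL.vert ((k : ℤ) - 1) r hr
        have hLk' := hL'.vert ((k : ℤ) - 1) r hr
        simp only [sub_add_cancel] at hLk hLk'
        obtain ⟨hc1, hc2⟩ := hq.cornerLeft_chord hL hj hjm hch
        rcases lt_trichotomy (k : ℕ) j with h | h | h
        · rcases Nat.eq_zero_or_pos (k : ℕ) with h0 | h0
          · have e0 : ((k : ℕ) : ℤ) = 0 := by omega
            rw [e0] at hLk hLk' ⊢
            have e1 : cut q j (0 - 1) = q j := by
              unfold cut; congr 1
              rw [Int.emod_def]
              have : ((0 : ℤ) - 1) / ((j + 1 : ℕ) : ℤ) = -1 := by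
                rw [Int.ediv_eq_iff_of_pos (by positivity)]; push_cast; omega
              rw [this]; push_cast; ring
            have e2 : cut q j 0 = q 0 := cut_eq le_rfl (by omega)
            have e3 : cut q j (0 + 1) = q (0 + 1) := cut_eq (by omega) (by omega)
            rw [e1, e2, e3] at hLk'
            filter_upwards [hLk, hLk'] with y h1 h2 h3 h4
            rw [h1 h3]
            exact hc1.of_cut_left ((h2 (hoff' _ h4)).1 h4)
          · have e1 : cut q j ((k : ℤ) - 1) = q ((k : ℤ) - 1) := cut_eq (by omega) (by omega)
            have e2 : cut q j (k : ℤ) = q (k : ℤ) := cut_eq (by omega) (by omega)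
            have e3 : cut q j ((k : ℤ) + 1) = q ((k : ℤ) + 1) := cut_eq (by omega) (by omega)
            rw [e1, e2, e3] at hLk'
            filter_upwards [hLk, hLk'] with y h1 h2 h3 h4
            rw [h1 h3]
            exact (h2 (hoff' _ h4)).1 h4
        · have e0 : ((k : ℕ) : ℤ) = j := by omega
          rw [e0] at hLk hLk' ⊢
          have e1 : cut q j ((j : ℤ) - 1) = q ((j : ℤ) - 1) := cut_eq (by omega) (by omega)
          have e2 : cut q j (j : ℤ) = q (j : ℤ) := cut_eq (by omega) (by omega)
          have e3 : cut q j ((j : ℤ) + 1) = q 0 := cut_last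
          rw [e1, e2, e3] at hLk'
          filter_upwards [hLk, hLk'] with y h1 h2 h3 h4
          rw [h1 h3]
          exact hc2.of_cut_right ((h2 (hoff' _ h4)).1 h4)
        · have := hq.notMem_trace_cut hL hj hjm hch (k := k) (by omega) (by omega) hr.le le_rfl
            (Or.inr ⟨hr, rfl, by omega⟩)
          rw [zero_smul, add_zero] at this
          exact hout this ((hq.notMem_left_cut hL hj hjm hch hL' (k := k) (by omega)
            (by omega)).2 (by omega) r hr)
      obtain ⟨i, hi⟩ := mem_trace.1 hxt
      obtain ⟨k, e1, e2⟩ := hq.exists_fin i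
      rw [e1, e2] at hi
      obtain ⟨s, t, hs, ht, he⟩ := hi
      rcases eq_or_lt_of_le hs with h0 | hs0
      · obtain ⟨l, e3, -⟩ := hq.exists_fin ((k : ℤ) + 1)
        rw [← h0, zero_smul, zero_add, e3] at he
        rcases eq_or_lt_of_le ht with h0' | ht0
        · rw [← h0', zero_smul] at he; exact absurd he hx0
        · exact hvert l t ht0 he
      · rcases eq_or_lt_of_le ht with h0' | ht0
        · rw [← h0', zero_smul, add_zero] at he
          exact hvert k s hs0 he
        · subst he
          have hkm := k.2
          rcases lt_or_ge (k : ℕ) j with h | h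
          · have g1 : cut q j (k : ℤ) = q (k : ℤ) := cut_eq (by omega) (by omega)
            have g2 : cut q j ((k : ℤ) + 1) = q ((k : ℤ) + 1) := cut_eq (by omega) (by omega)
            have hLk' := hL'.edge k s t hs0 ht0
            rw [g1, g2] at hLk'
            filter_upwards [hL.edge k s t hs0 ht0, hLk'] with y h1 h2 _ h4
            exact h1.2 (h2.1 h4)
          · exact hout (hq.notMem_trace_cut hL hj hjm hch (by omega) (by omega) hs ht
              (Or.inl ⟨hs0, ht0⟩)) ((hq.notMem_left_cut hL hj hjm hch hL' (k := k) (by omega)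
              (by omega)).1 s t hs0 ht0)
    · by_cases hxt' : x ∈ trace (cut q j)
      -- A point of the new polygon that is not on the old one is in the interior of the chord.
      · have hxL : x ∈ L := by
          rw [hq.trace_cut hL hj hjm hch] at hxt'
          rcases hxt' with ⟨r, -, -, h⟩ | ⟨u, v, hu, hv, he⟩
          · exact absurd (mem_trace.2 ⟨r, h⟩) hxt
          · rcases eq_or_lt_of_le hu with h0 | hu
            · exact absurd (mem_trace.2 ⟨0, v, 0, hv, le_rfl, by rw [he, ← h0]; simp⟩) hxt
            · rcases eq_or_lt_of_le hv with h0 | hv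
              · exact absurd (mem_trace.2 ⟨j, u, 0, hu.le, le_rfl, by rw [he, ← h0]; simp⟩) hxt
              · rw [he, add_comm]; exact hch v u hv hu
        filter_upwards [hL.loc x hxt] with y hy
        exact propext ⟨fun h => absurd (hy.2 hxL) h.2.1, fun h => absurd hxL h.2.1⟩
      · filter_upwards [hL.loc x hxt, hL'.loc x hxt', hq.eventually_notMem_trace hxt] with y h1 h2 h3
        rw [h1, h2]
        simp [h3, hxt]
  have hconn : IsPreconnected ({0}ᶜ : Set E3) :=
    (isConnected_compl_singleton_of_one_lt_rank (by
      rw [← Module.finrank_eq_rank, finrank_euclideanSpace_fin]; norm_num) (0 : E3)).isPreconnected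
  have := eq_of_locally_eq hconn hloc (x := x) (y := q 0)
    (fun h => hoff' x hx (by rw [h]; exact zero_mem_trace _)) (hq.vertex_ne_zero 0)
  have h1 : q 0 ∉ trace q := ((iff_of_eq this).1 ⟨hx, hn⟩).2.2
  exact h1 (mem_trace.2 ⟨0, 1, 0, zero_le_one, le_rfl, by simp⟩)

end SimplePoly

end

end PolyhedralSurface

namespace PolyhedralSurface

noncomputable section

open Filter

/-! ### Convex polygons, and ears -/

theorem SimplePoly.exists_lt {m : ℕ} {q : ℤ → E3} (hq : SimplePoly m q) (c i : ℤ) :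
    ∃ k : ℤ, c ≤ k ∧ k < c + m ∧ ∀ l, q (i + l) = q (k + l) := by
  have hm : (0 : ℤ) < m := by have := hq.three_le; omega
  have h0 := Int.emod_nonneg (i - c) hm.ne'
  have h1 := Int.emod_lt_of_pos (i - c) hm
  refine ⟨c + (i - c) % m, by linarith, by linarith, fun l => ?_⟩
  rw [hq.eq_iff, Int.emod_def]
  exact ⟨-((i - c) / m), by ring⟩

/-- A simple polygon all of whose corners are convex is convex. -/
theorem SimplePoly.convex_of_corners : ∀ {m : ℕ} {q : ℤ → E3}, SimplePoly m q →
    (∀ i, 0 < det3 (q i) (q (i + 1)) (q (i + 1 + 1))) →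
    ∀ i k, q k ≠ q i → q k ≠ q (i + 1) → 0 < det3 (q i) (q (i + 1)) (q k) := by
  intro m
  induction m using Nat.strong_induction_on with
  | _ m ih =>
  intro q hq hc
  have h3 := hq.three_le
  rcases h3.eq_or_lt with hm | hm
  · intro i k h1 h2
    obtain ⟨l, hl1, hl2, hl⟩ := hq.exists_lt i k
    have hl := hl 0
    simp only [add_zero] at hl
    rw [hl] at h1 h2 ⊢
    have : l = i ∨ l = i + 1 ∨ l = i + 1 + 1 := by omega
    rcases this with rfl | rfl | rfl
    · exact absurd rfl h1
    · exact absurd rfl h2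
    · exact hc i
  obtain ⟨L, -, hL, -, -⟩ := hq.exists_isLeft
  have hweak : ∀ {j : ℕ} {p : ℤ → E3}, j < m → SimplePoly j p →
      (∀ i, 0 < det3 (p i) (p (i + 1)) (p (i + 1 + 1))) →
      ∀ i k, 0 ≤ det3 (p i) (p (i + 1)) (p k) := by
    intro j p hj hp hcp i k
    by_cases h1 : p k = p i
    · rw [h1]; simp
    by_cases h2 : p k = p (i + 1)
    · rw [h2]; simp
    exact (ih j hj hp hcp i k h1 h2).le
  -- At both ends of a chord in `L` the new angles are parts of convex ones. So the polygon that is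
  -- cut off has only convex corners again, and the induction hypothesis applies to it.
  have hcut : ∀ (c : ℤ) (j : ℕ), 2 ≤ j → j + 2 ≤ m →
      (∀ s t : ℝ, 0 < s → 0 < t → s • q c + t • q (j + c) ∈ L) →
      0 < det3 (q (c - 1)) (q c) (q (j + c)) ∧ 0 < det3 (q (j + c)) (q c) (q (1 + c)) ∧
      0 < det3 (q (j + c - 1)) (q (j + c)) (q c) ∧ 0 < det3 (q (j + c)) (q (1 + j + c)) (q c) ∧
      SimplePoly (j + 1) (cut (fun i => q (i + c)) j) ∧
      ∀ i, 0 < det3 (cut (fun i => q (i + c)) j i) (cut (fun i => q (i + c)) j (i + 1))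
        (cut (fun i => q (i + c)) j (i + 1 + 1)) := by
    intro c j h2 hjm hch
    have hs := hq.shift c
    have hch' : ∀ s t : ℝ, 0 < s → 0 < t → s • q (0 + c) + t • q (j + c) ∈ L := by
      simpa using hch
    obtain ⟨c1, c2⟩ := hs.cornerLeft_chord (hL.shift c) h2 hjm hch'
    have e1 : -1 + c = c - 1 := by ring
    have e2 : (0 : ℤ) + c = c := by ring
    have e3 : (j : ℤ) - 1 + c = j + c - 1 := by ring
    have e4 : (j : ℤ) + 1 + c = 1 + j + c := by ring
    simp only [e1, e2, e3, e4] at c1 c2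
    have k1 : 0 < det3 (q (c - 1)) (q c) (q (1 + c)) := by
      have := hc (c - 1); rwa [sub_add_cancel, add_comm c 1] at this
    have k2 : 0 < det3 (q (j + c - 1)) (q (j + c)) (q (1 + j + c)) := by
      have := hc (j + c - 1); rwa [sub_add_cancel, add_comm _ 1, ← add_assoc] at this
    have c1 : 0 < det3 (q (c - 1)) (q c) (q (j + c)) ∧ 0 < det3 (q c) (q (1 + c)) (q (j + c)) := by
      rcases c1 with ⟨-, h⟩ | ⟨h, -⟩
      · exact h
      · linarith
    have c2 : 0 < det3 (q (j + c - 1)) (q (j + c)) (q c) ∧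
        0 < det3 (q (j + c)) (q (1 + j + c)) (q c) := by
      rcases c2 with ⟨-, h⟩ | ⟨h, -⟩
      · exact h
      · linarith
    have c3 : 0 < det3 (q (j + c)) (q c) (q (1 + c)) := by rw [det3_rotate]; exact c1.2
    refine ⟨c1.1, c3, c2.1, c2.2, hs.simplePoly_cut (hL.shift c) h2 hjm hch', fun i => ?_⟩
    rcases cut_corner (fun i => q (i + c)) (j := j) (by omega) i with
      ⟨r, -, -, e5, e6, e7⟩ | ⟨e5, e6, e7⟩ | ⟨e5, e6, e7⟩ <;> rw [e5, e6, e7]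
    · have := hc (r + c)
      rwa [add_right_comm r c 1, add_right_comm (r + 1) c 1] at this
    · rw [e2, e3]; exact c2.1
    · rw [e2]; exact c3
  have hcutmem : ∀ (c : ℤ) (j : ℕ) (r : ℤ), 0 ≤ r → r ≤ j →
      cut (fun i => q (i + c)) j r = q (r + c) := fun c j r h0 h1 => cut_eq h0 h1
  -- A vertex in the triangle at the tip `q 1` would give a chord that cuts the polygon into two
  -- convex ones, and their inequalities contradict its position in the triangle. If there is none,
  -- the triangle is cut off and the rest is convex by induction.
  by_cases hT : ∃ j, q j ∈ openCone (q 0) (q (0 + 1)) (q (0 + 1 + 1))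
  · exfalso
    obtain ⟨j, hj, hch⟩ := hq.exists_chord hL (hc 0) hT
    obtain ⟨l, hl0, hl1, hlj⟩ := hq.exists_lt 0 j
    have hlj0 := hlj 0
    simp only [add_zero, zero_add] at hlj0 hj hch hl1
    rw [hlj0] at hj hch
    clear hlj hlj0
    have hj' := hj
    obtain ⟨α, β, γ, hα, hβ, hγ, he⟩ := hj'
    have e2 : (1 : ℤ) + 1 = 2 := rfl
    have h012 := hc 0
    simp only [zero_add, e2] at h012 he hj
    have d0 : det3 (q 0) (q 1) (q l) = γ * det3 (q 0) (q 1) (q 2) := by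
      rw [he]; simp [det3_add_right, det3_smul_right]
    have d1 : det3 (q 1) (q 2) (q l) = α * det3 (q 0) (q 1) (q 2) := by
      rw [he]; simp [det3_add_right, det3_smul_right, ← det3_rotate (q 0)]
    have d2 : det3 (q 0) (q l) (q 2) = β * det3 (q 0) (q 1) (q 2) := by
      rw [he]; simp [det3_add_mid, det3_smul_mid]
    have hl3 : 3 ≤ l := by
      by_contra! hlt
      have : l = 0 ∨ l = 1 ∨ l = 2 := by omega
      rcases this with rfl | rfl | rfl
      · rw [det3_self_outer] at d0; have := mul_pos hγ h012; linarith
      · rw [det3_self_right] at d0; have := mul_pos hγ h012; linarith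
      · rw [det3_self_right] at d1; have := mul_pos hα h012; linarith
    obtain ⟨j, rfl⟩ : ∃ j : ℕ, l = j + 1 := ⟨(l - 1).toNat, by omega⟩
    obtain ⟨-, -, b1, -, hp1, hc1⟩ := hcut 1 j (by omega) (by omega) hch
    have hwrap : q (((m - j : ℕ) : ℤ) + (j + 1)) = q 1 := by
      rw [← hq.per 1]; congr 1; omega
    obtain ⟨-, b2, -, -, hp2, hc2⟩ := hcut (j + 1) (m - j) (by omega) (by omega)
      (fun s t hs ht => by rw [hwrap, add_comm]; exact hch t s ht hs)
    have b3 := hc j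
    -- `c` lies on the left of the edge into the chord, and `a` on the left of the edge out of it
    have w1 := hweak (by omega) hp1 hc1 (j - 1) 1
    rw [sub_add_cancel, hcutmem 1 j _ (by omega) (by omega), hcutmem 1 j _ (by omega) le_rfl,
      hcutmem 1 j _ (by omega) (by omega), sub_add_cancel] at w1
    have w2 := hweak (by omega) hp2 hc2 0 ((m - j : ℕ) - 1)
    rw [hcutmem _ _ _ le_rfl (by omega), hcutmem _ _ _ (by omega) (by omega),
      hcutmem _ _ _ (by omega) (by omega)] at w2
    have hwrap0 : q ((m - j : ℕ) - 1 + (j + 1)) = q 0 := by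
      rw [← hq.per 0]; congr 1; omega
    rw [hwrap0] at w2
    rw [hwrap] at b2
    have e3 : (j : ℤ) + 1 - 1 = j := by ring
    have e4 : (0 : ℤ) + (j + 1) = j + 1 := by ring
    have e5 : (0 : ℤ) + 1 + (j + 1) = j + 1 + 1 := by ring
    have e6 : (1 : ℤ) + (j + 1) = j + 1 + 1 := by ring
    rw [e3] at b1
    rw [e4, e5] at w2
    rw [e6] at b2
    rw [e2] at w1
    -- The vertex `q (j + 1)` is a positive combination of `q 0`, `q 1`, `q 2`, so their
    -- determinants with the edge that ends in it have a vanishing weighted sum. Those of `q 1` and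
    -- `q 2` are positive and nonnegative, hence that of `q 0` is negative.
    have hz : α * det3 (q j) (q (j + 1)) (q 0) + β * det3 (q j) (q (j + 1)) (q 1) +
        γ * det3 (q j) (q (j + 1)) (q 2) = 0 := by
      rw [← det3_smul_right, ← det3_smul_right, ← det3_smul_right, ← det3_add_right,
        ← det3_add_right, ← he, det3_self_right]
    have hneg : det3 (q j) (q (j + 1)) (q 0) < 0 := by
      have := mul_pos hβ b1
      have := mul_nonneg hγ.le w1
      by_contra! hge
      have := mul_nonneg hα.le hge
      linarith
    -- A Plücker relation whose left-hand side is negative and whose right-hand side is positive.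
    have hid : det3 (q (j + 1)) (q (j + 1 + 1)) (q 1) * det3 (q j) (q (j + 1)) (q 0) =
        det3 (q (j + 1)) (q (j + 1 + 1)) (q 0) * det3 (q j) (q (j + 1)) (q 1) +
        det3 (q j) (q (j + 1)) (q (j + 1 + 1)) * det3 (q 0) (q 1) (q (j + 1)) := by
      simp only [det3]; ring
    have b4 : 0 < det3 (q 0) (q 1) (q (j + 1)) := by rw [d0]; positivity
    have b5 : 0 < det3 (q (j + 1)) (q (j + 1 + 1)) (q 1) := by
      rw [det3_rotate] at b2; exact b2
    have := mul_neg_of_pos_of_neg b5 hneg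
    have := mul_nonneg w2 b1.le
    have := mul_pos b3 b4
    linarith
  · push Not at hT
    have hch := fun s t => hq.chord_of_empty (s := s) (t := t) hm hL (hc 0) hT
    have e2 : (0 : ℤ) + 1 + 1 = 2 := rfl
    have hwrap : q (((m - 2 : ℕ) : ℤ) + 2) = q 0 := by
      rw [← hq.per 0]; congr 1; omega
    obtain ⟨-, -, -, -, hp, hcp⟩ := hcut 2 (m - 2) (by omega) (by omega)
      (fun s t hs ht => by rw [hwrap, add_comm, ← e2]; exact hch t s ht hs)
    have hlt : m - 2 + 1 < m := by omega
    have hw : ∀ i k : ℤ, 2 ≤ i → i < m → 2 ≤ k → k ≤ m → 0 ≤ det3 (q i) (q (i + 1)) (q k) := by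
      intro i k h1 h2 h3 h4
      have := hweak hlt hp hcp (i - 2) (k - 2)
      rw [hcutmem _ _ _ (by omega) (by omega), hcutmem _ _ _ (by omega) (by omega),
        hcutmem _ _ _ (by omega) (by omega)] at this
      have g1 : i - 2 + 2 = i := by ring
      have g2 : i - 2 + 1 + 2 = i + 1 := by ring
      have g3 : k - 2 + 2 = k := by ring
      rwa [g1, g2, g3] at this
    have hq0 : q m = q 0 := by rw [← hq.per 0, zero_add]
    have hbase : ∀ k : ℤ, 3 ≤ k → k < m → 0 < det3 (q 0) (q 2) (q k) := by
      intro k h1 h2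
      have := ih _ hlt hp hcp ((m - 2 : ℕ)) (k - 2)
      rw [hcutmem _ _ _ (by omega) le_rfl, cut_last, hcutmem _ _ _ (by omega) (by omega),
        hwrap] at this
      simp only [sub_add_cancel, zero_add] at this
      refine this (hq.ne_of_lt (by omega) (by omega)).symm (hq.ne_of_lt (by omega) (by omega)).symm
    have h012 := hc 0
    have h123 := hc 1
    have hl01 := hc (m - 1)
    have hl1 : q ((m : ℤ) - 1 + 1) = q 0 := by rw [sub_add_cancel]; exact hq0
    have hl2 : q ((m : ℤ) - 1 + 1 + 1) = q 1 := by
      rw [← hq.per 1]; congr 1; ring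
    rw [hl1, hl2] at hl01
    have g1 : (1 : ℤ) + 1 + 1 = 3 := rfl
    have g2 : (1 : ℤ) + 1 = 2 := rfl
    rw [g1, g2] at h123
    rw [e2, zero_add] at h012
    -- the coordinates of the tip
    have hdec : ∀ k : ℤ, 3 ≤ k → k < m → ∃ s t u : ℝ, 0 < s ∧ 0 < t ∧
        q 1 = s • q 0 + t • q 2 + u • q k := by
      intro k h1 h2
      have hb := hbase k h1 h2
      have hx := exists_coords hb.ne' (q 1)
      set s := det3 (q 1) (q 2) (q k) / det3 (q 0) (q 2) (q k)
      set t := det3 (q 0) (q 1) (q k) / det3 (q 0) (q 2) (q k)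
      have hu : det3 (q 0) (q 2) (q 1) / det3 (q 0) (q 2) (q k) < 0 := by
        refine div_neg_of_neg_of_pos ?_ hb
        rw [det3_swap_right]; linarith
      set u := det3 (q 0) (q 2) (q 1) / det3 (q 0) (q 2) (q k)
      -- Expand the convex corners at `q 0` and `q 2`. As the remaining polygon is convex and `u <
      -- 0`, they force `t > 0` and `s > 0`.
      have f1 : t * det3 (q (m - 1)) (q 0) (q 2) + u * det3 (q (m - 1)) (q 0) (q k) =
          det3 (q (m - 1)) (q 0) (q 1) := by
        rw [hx]; simp [det3_add_right, det3_smul_right]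
      have f2 : s * det3 (q 2) (q 3) (q 0) + u * det3 (q 2) (q 3) (q k) =
          det3 (q 2) (q 3) (q 1) := by
        rw [hx]; simp [det3_add_right, det3_smul_right]
      have f3 : 0 < det3 (q 2) (q 3) (q 1) := by rw [← det3_rotate]; exact h123
      have w1 := hw (m - 1) 2 (by omega) (by omega) (by omega) (by omega)
      have w2 := hw (m - 1) k (by omega) (by omega) (by omega) (by omega)
      have w3 := hw 2 m (by omega) (by omega) (by omega) (by omega)
      have w4 := hw 2 k (by omega) (by omega) (by omega) (by omega)
      rw [hl1] at w1 w2
      rw [hq0] at w3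
      have g3 : (2 : ℤ) + 1 = 3 := rfl
      rw [g3] at w3 w4
      refine ⟨s, t, u, ?_, ?_, hx⟩
      · by_contra! hs
        have := mul_nonneg (neg_nonneg.2 hs) w3
        have := mul_nonneg (neg_nonneg.2 hu.le) w4
        linarith
      · by_contra! hs
        have := mul_nonneg (neg_nonneg.2 hs) w1
        have := mul_nonneg (neg_nonneg.2 hu.le) w2
        linarith
    have hpos : ∀ i k : ℤ, 0 ≤ i → i < m → 0 ≤ k → k < m → q k ≠ q i → q k ≠ q (i + 1) →
        0 < det3 (q i) (q (i + 1)) (q k) := by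
      intro i k hi0 him hk0 hkm n1 n2
      rcases eq_or_ne i 0 with rfl | hi
      · rcases eq_or_ne k 2 with rfl | hk2
        · exact h012
        · have hk3 : 3 ≤ k := by
            by_contra! hlt
            have : k = 0 ∨ k = 1 := by omega
            rcases this with rfl | rfl
            · exact n1 rfl
            · exact n2 rfl
          obtain ⟨s, t, u, hs, ht, hx⟩ := hdec k hk3 hkm
          have : det3 (q 0) (q (0 + 1)) (q k) = t * det3 (q 0) (q 2) (q k) := by
            rw [zero_add, hx]; simp [det3_add_mid, det3_smul_mid]
          rw [this]; exact mul_pos ht (hbase k hk3 hkm)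
      rcases eq_or_ne i 1 with rfl | hi1
      · rw [g2] at n2 ⊢
        rcases eq_or_ne k 0 with rfl | hk2
        · rw [← det3_rotate]; exact h012
        · have hk3 : 3 ≤ k := by
            by_contra! hlt
            have : k = 1 ∨ k = 2 := by omega
            rcases this with rfl | rfl
            · exact n1 rfl
            · exact n2 rfl
          obtain ⟨s, t, u, hs, ht, hx⟩ := hdec k hk3 hkm
          have : det3 (q 1) (q 2) (q k) = s * det3 (q 0) (q 2) (q k) := by
            rw [hx]; simp [det3_add_left, det3_smul_left]
          rw [this]; exact mul_pos hs (hbase k hk3 hkm)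
      have hnn : ∀ k : ℤ, 2 ≤ k → k ≤ m → q k ≠ q i → q k ≠ q (i + 1) →
          0 < det3 (q i) (q (i + 1)) (q k) := by
        intro k h1 h2 h3 h4
        refine lt_of_le_of_ne (hw i k (by omega) him h1 h2) ?_
        exact (hq.gen _ _ _ (hq.ne_one i) (Ne.symm h4) (Ne.symm h3)).symm
      rcases eq_or_ne k 1 with rfl | hk1
      · rcases eq_or_ne i 2 with rfl | hi2
        · rw [← det3_rotate]; exact h123
        · obtain ⟨s, t, u, hs, ht, hx⟩ := hdec i (by omega) him
          have hd : det3 (q i) (q (i + 1)) (q 1) = s * det3 (q i) (q (i + 1)) (q m) +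
              t * det3 (q i) (q (i + 1)) (q 2) := by
            rw [hx, hq0]; simp [det3_add_right, det3_smul_right]
          rw [hd]
          have p2 := hnn 2 le_rfl (by omega) (hq.ne_of_lt (by omega) (by omega))
            (hq.ne_of_lt (by omega) (by omega))
          have p1 := hw i m (by omega) him (by omega) le_rfl
          have := mul_nonneg hs.le p1
          have := mul_pos ht p2
          linarith
      · rcases eq_or_ne k 0 with rfl | hk0
        · rw [← hq0] at n1 n2 ⊢
          exact hnn m (by omega) le_rfl n1 n2
        · exact hnn k (by omega) hkm.le n1 n2
    intro i k h1 h2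
    obtain ⟨i', hi0, hi1, hi⟩ := hq.exists_lt 0 i
    obtain ⟨k', hk0, hk1, hk⟩ := hq.exists_lt 0 k
    have hk := hk 0
    have hi' := hi 0
    have hi := hi 1
    simp only [add_zero] at hk hi'
    rw [hk] at h1 h2 ⊢
    rw [hi] at h2 ⊢
    rw [hi'] at h1 ⊢
    exact hpos i' k' hi0 (by omega) hk0 (by omega) h1 h2

end

end PolyhedralSurface

/-! ### Existence of ears -/

namespace PolyhedralSurface

noncomputable section

open Filter

/-- A set of vectors in general position. -/
def GenPos (V : Set E3) : Prop :=
  ∀ a ∈ V, ∀ b ∈ V, ∀ c ∈ V, a ≠ b → b ≠ c → a ≠ c → det3 a b c ≠ 0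

/-- If no vertex lies on the left, then some corner is convex, unless all vertices lie on one side
of a plane. -/
theorem SimplePoly.exists_convex_corner {m : ℕ} {q : ℤ → E3} (hq : SimplePoly m q) {L V : Set E3}
    (hL : IsLeft q L) (hV : ∀ v ∈ V, v ∉ L)
    (hhalf : ∀ a b : E3, cross a b ≠ 0 → ∃ v ∈ V, det3 a b v < 0) :
    ∃ i, 0 < det3 (q i) (q (i + 1)) (q (i + 1 + 1)) := by
  by_contra! hn
  have hneg : ∀ i, det3 (q i) (q (i + 1)) (q (i + 1 + 1)) < 0 := fun i =>
    lt_of_le_of_ne (hn i) (hq.det_ne i)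
  -- If all corners are reflex, the reversed polygon is convex, so the polygon is never on the left
  -- of the plane of an edge. The open half-space to the left of the first edge is then off the
  -- polygon and adjoins the left side, hence is contained in `L`; but it contains a point of `V`.
  have hconv := hq.reverse.convex_of_corners (fun i => by
    have := hneg (-(i + 1 + 1))
    have e1 : -(i + 1 + 1) + 1 = -(i + 1) := by ring
    have e2 : -(i + 1) + 1 = -i := by ring
    rw [e1, e2] at this
    rw [det3_reverse]; linarith)
  have hle : ∀ i k, det3 (q i) (q (i + 1)) (q k) ≤ 0 := by
    intro i k
    by_cases h1 : q k = q i
    · rw [h1]; simp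
    by_cases h2 : q k = q (i + 1)
    · rw [h2]; simp
    have := hconv (-(i + 1)) (-k)
    have e1 : -(-(i + 1)) = i + 1 := by ring
    have e2 : -(-(i + 1) + 1) = i := by ring
    simp only [e1, e2, neg_neg] at this
    have := this h2 h1
    rw [det3_swap]; linarith
  obtain ⟨v, hv, hlt⟩ := hhalf (q 1) (q 0) (by
    rw [cross_swap]; exact neg_ne_zero.2 (hq.cross_ne 0))
  have hpos : 0 < det3 (q 0) (q (0 + 1)) v := by
    rw [det3_swap, zero_add]; linarith
  have hoff : ∀ y ∈ {y | 0 < det3 (q 0) (q (0 + 1)) y}, y ∉ trace q := by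
    intro y hy h
    obtain ⟨j, s, t, hs, ht, rfl⟩ := mem_trace.1 h
    simp only [Set.mem_ofPred_eq, det3_add_right, det3_smul_right] at hy
    have := mul_nonneg hs (neg_nonneg.2 (hle 0 j))
    have := mul_nonneg ht (neg_nonneg.2 (hle 0 (j + 1)))
    linarith
  obtain ⟨y, hy, he⟩ := (frequently_det3 (hq.cross_ne 0)
    (by simp [det3_add_right]) (hL.edge 0 1 1 one_pos one_pos)).1
  exact hV v hv ((hL.iff_of_preconnected (convex_det3_pos _ _).isPreconnected hoff hpos hy).2
    (he.2 hy))

/-- A polygon on whose left there are no points of `V` has an ear without points of `V`, and one may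
prescribe an edge that is not part of this ear. -/
theorem SimplePoly.exists_ear_left {V : Set E3} (hV : GenPos V)
    (hhalf : ∀ a b : E3, cross a b ≠ 0 → ∃ v ∈ V, det3 a b v < 0) :
    ∀ {m : ℕ} {q : ℤ → E3}, SimplePoly m q → (∀ i, q i ∈ V) → ∀ {L : Set E3}, IsLeft q L →
    (∀ v ∈ V, v ∉ L) → ∃ i : ℤ, 0 ≤ i ∧ i + 3 ≤ m ∧
      ∀ v ∈ V, v ∉ openCone (q i) (q (i + 1)) (q (i + 1 + 1)) := by
  intro m
  induction m using Nat.strong_induction_on with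
  | _ m ih =>
  intro q hq hqV L hL hVL
  have h3 := hq.three_le
  have hempty : ∀ i, 0 < det3 (q i) (q (i + 1)) (q (i + 1 + 1)) →
      (∀ j, q j ∉ openCone (q i) (q (i + 1)) (q (i + 1 + 1))) →
      ∀ v ∈ V, v ∉ openCone (q i) (q (i + 1)) (q (i + 1 + 1)) := by
    intro i hD hv v hvV hmem
    have hsub := hq.openCone_subset hL hD (σ := 1) (μ := 0) (σ' := 1) (μ' := 0) one_pos le_rfl
      one_pos le_rfl (by simpa using hv)
    simp only [one_smul, zero_smul, add_zero] at hsub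
    exact hVL v hvV (hsub hmem)
  -- In the smaller polygon the chord is the edge from the last index to the first. The bounds on
  -- the index say that the ear does not use this edge, so it is an ear of the original polygon as
  -- well. No point of `V` gets on the left, by `left_cut_subset` and `vertex_notMem_left_cut`.
  have hchord : ∀ k l : ℤ, 0 ≤ k → k + 2 ≤ l → l < m → l + 2 ≤ k + m →
      (∀ s t : ℝ, 0 < s → 0 < t → s • q k + t • q l ∈ L) → ∃ i : ℤ, 0 ≤ i ∧ i + 3 ≤ m ∧
      ∀ v ∈ V, v ∉ openCone (q i) (q (i + 1)) (q (i + 1 + 1)) := by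
    intro k l hk hkl hlm hlk hch
    obtain ⟨j, rfl⟩ : ∃ j : ℕ, l = j + k := ⟨(l - k).toNat, by omega⟩
    have hs := hq.shift k
    have hLs := hL.shift k
    have hch' : ∀ s t : ℝ, 0 < s → 0 < t → s • q (0 + k) + t • q (j + k) ∈ L := by simpa using hch
    have hj2 : 2 ≤ j := by omega
    have hjm : j + 2 ≤ m := by omega
    have hp := hs.simplePoly_cut hLs hj2 hjm hch'
    obtain ⟨L', -, hL', -, -⟩ := hp.exists_isLeft
    obtain ⟨i, hi0, him, hi⟩ := ih (j + 1) (by omega) hp (fun i => hqV _) hL' (by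
      intro v hv hvL'
      rcases hs.left_cut_subset hLs hj2 hjm hch' hL' hvL' with h | h
      · exact hVL v hv h
      · obtain ⟨r, hr⟩ := mem_trace.1 h
        by_cases e1 : v = q (r + k)
        · exact hs.vertex_notMem_left_cut hLs hj2 hjm hch' hL' r (e1 ▸ hvL')
        by_cases e2 : v = q (r + 1 + k)
        · exact hs.vertex_notMem_left_cut hLs hj2 hjm hch' hL' (r + 1) (e2 ▸ hvL')
        refine hV _ (hqV (r + k)) _ (hqV (r + 1 + k)) v hv (hs.ne_one r) (Ne.symm e2) (Ne.symm e1) ?_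
        exact (det3_mem_sector_left (c := 0) hr).1)
    push_cast at him
    rw [cut_eq hi0 (by omega), cut_eq (by omega) (by omega), cut_eq (by omega) (by omega)] at hi
    refine ⟨i + k, by omega, by omega, ?_⟩
    have e1 : i + k + 1 = i + 1 + k := by ring
    have e2 : i + 1 + k + 1 = i + 1 + 1 + k := by ring
    rw [e1, e2]; exact hi
  obtain ⟨i, hD⟩ := hq.exists_convex_corner hL hVL hhalf
  -- With indices from -1 to m - 2, a corner uses the closing edge from `q (m - 1)` to `q 0` exactly
  -- for the first and the last index.
  obtain ⟨i', hi0, him, hi⟩ := hq.exists_lt (-1) i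
  have g0 := hi 0
  have g1 := hi 1
  have g2 := hi (1 + 1)
  simp only [add_zero] at g0
  rw [← add_assoc, ← add_assoc] at g2
  rw [g0, g1, g2] at hD
  clear hi g0 g1 g2
  rcases h3.eq_or_lt with hm | hm
  · have hD0 : 0 < det3 (q 0) (q (0 + 1)) (q (0 + 1 + 1)) := by
      have hp : ∀ i : ℤ, q (i + 1 + 1 + 1) = q i := fun i => by
        rw [← hq.per i]; congr 1; rw [← hm]; push_cast; ring
      have : i' = -1 ∨ i' = 0 ∨ i' = 1 := by omega
      rcases this with rfl | rfl | rfl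
      · rw [← hp (-1)] at hD
        simp only [Int.reduceNeg, neg_add_cancel] at hD
        rw [det3_rotate] at hD; exact hD
      · exact hD
      · have := hp 0
        simp only [zero_add] at this ⊢
        rw [this] at hD
        rw [det3_rotate]; exact hD
    refine ⟨0, le_rfl, by omega, hempty 0 hD0 fun j hj => ?_⟩
    obtain ⟨k, hk0, hk3, hk⟩ := hq.exists_lt 0 j
    have hk := hk 0
    simp only [add_zero] at hk
    rw [hk, mem_openCone_iff hD0.ne'] at hj
    have : k = 0 ∨ k = 1 ∨ k = 1 + 1 := by omega
    rcases this with rfl | rfl | rfl <;> simp at hj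
  · by_cases hT : ∃ j, q j ∈ openCone (q i') (q (i' + 1)) (q (i' + 1 + 1))
    · obtain ⟨j, hj, hch⟩ := hq.exists_chord hL hD hT
      obtain ⟨l, hl0, hlm, hl⟩ := hq.exists_lt 0 j
      have hl := hl 0
      simp only [add_zero] at hl
      rw [hl] at hj hch
      rw [mem_openCone_iff hD.ne'] at hj
      have n0 : q l ≠ q i' := fun e => by rw [e] at hj; simp at hj
      have n1 : q l ≠ q (i' + 1) := fun e => by rw [e] at hj; simp at hj
      have n2 : q l ≠ q (i' + 1 + 1) := fun e => by rw [e] at hj; simp at hj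
      have hl0' : ∀ c : ℤ, l = c ∨ l = c + m ∨ l + m = c → q l = q c := by
        rintro c (rfl | rfl | rfl)
        · rfl
        · exact hq.per c
        · exact (hq.per l).symm
      have m0 : ¬ (l = i' ∨ l = i' + m ∨ l + m = i') := fun h => n0 (hl0' _ h)
      have m1 : ¬ (l = i' + 1 ∨ l = i' + 1 + m ∨ l + m = i' + 1) := fun h => n1 (hl0' _ h)
      have m2 : ¬ (l = i' + 1 + 1 ∨ l = i' + 1 + 1 + m ∨ l + m = i' + 1 + 1) :=
        fun h => n2 (hl0' _ h)
      rcases lt_or_ge l (i' + 1) with h | h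
      · exact hchord l (i' + 1) hl0 (by omega) (by omega) (by omega)
          fun s t hs ht => by rw [add_comm]; exact hch t s ht hs
      · exact hchord (i' + 1) l (by omega) (by omega) (by omega) (by omega) hch
    · push Not at hT
      have hch := fun s t => hq.chord_of_empty (s := s) (t := t) hm hL hD hT
      -- If the empty corner uses the closing edge, its third side is a chord. Removing the tip
      -- leaves a polygon with one vertex less whose closing edge is this chord.
      rcases eq_or_ne i' (-1) with rfl | h1
      · have e : q (-1) = q (m - 1) := by rw [← hq.per (-1), neg_add_eq_sub]
        rw [e] at hch
        simp only [neg_add_cancel, zero_add] at hch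
        exact hchord 1 (m - 1) (by omega) (by omega) (by omega) (by omega)
          fun s t hs ht => by rw [add_comm]; exact hch t s ht hs
      · rcases eq_or_ne i' (m - 2) with rfl | h2
        · have e : q ((m : ℤ) - 2 + 1 + 1) = q 0 := by rw [← hq.per 0]; congr 1; ring
          rw [e] at hch
          exact hchord 0 (m - 2) (by omega) (by omega) (by omega) (by omega)
            fun s t hs ht => by rw [add_comm]; exact hch t s ht hs
        · exact ⟨i', by omega, by omega, hempty i' hD hT⟩

theorem openCone_comm {a b c x : E3} : x ∈ openCone a b c ↔ x ∈ openCone c b a := by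
  constructor <;> rintro ⟨r, s, t, hr, hs, ht, rfl⟩ <;>
    exact ⟨t, s, r, ht, hs, hr, by abel⟩

/-- A simple polygon in general position has an ear. -/
theorem SimplePoly.exists_ear {V : Set E3} (hV : GenPos V)
    (hhalf : ∀ a b : E3, cross a b ≠ 0 → ∃ v ∈ V, det3 a b v < 0) {m : ℕ} {q : ℤ → E3}
    (hq : SimplePoly m q) {z : E3} (hqV : ∀ i, q i ∈ V) (hz : ∀ v ∈ V, v = z ∨ ∃ i, v = q i) :
    ∃ i, ∀ j, q j ∉ openCone (q i) (q (i + 1)) (q (i + 1 + 1)) := by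
  obtain ⟨L, R, hL, hR, hLR⟩ := hq.exists_isLeft
  -- Only `z` can be a point of `V` off the polygon, and it is not on both sides. Use a side without
  -- `z`, after reversing the polygon if this is the right one.
  by_cases hzL : z ∈ L
  · have hzR := Set.disjoint_left.1 hLR hzL
    obtain ⟨i, -, -, h⟩ := hq.reverse.exists_ear_left hV hhalf (fun i => hqV _) hR (by
      intro v hv hvR
      rcases hz v hv with rfl | ⟨i, rfl⟩
      · exact hzR hvR
      · exact hR.disj _ hvR (mem_trace.2 ⟨-i, 1, 0, zero_le_one, le_rfl, by simp⟩))
    refine ⟨-(i + 1 + 1), fun j hj => h (q j) (hqV j) ?_⟩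
    have e1 : -(i + 1 + 1) + 1 = -(i + 1) := by ring
    have e2 : -(i + 1) + 1 = -i := by ring
    rw [e1, e2] at hj
    exact openCone_comm.1 hj
  · obtain ⟨i, -, -, h⟩ := hq.exists_ear_left hV hhalf hqV hL (by
      intro v hv hvL
      rcases hz v hv with rfl | ⟨i, rfl⟩
      · exact hzL hvL
      · exact hL.disj _ hvL (mem_trace.2 ⟨i, 1, 0, zero_le_one, le_rfl, by simp⟩))
    exact ⟨i, fun j => h (q j) (hqV j)⟩

/-- The polygon does not enter an empty triangle, nor does it cross the third side. -/
theorem SimplePoly.notMem_trace_of_ear {m : ℕ} {q : ℤ → E3} (hq : SimplePoly m q) (hm : 4 ≤ m)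
    {i : ℤ} (hv : ∀ j, q j ∉ openCone (q i) (q (i + 1)) (q (i + 1 + 1))) {r s t : ℝ} (hr : 0 < r)
    (hs : 0 ≤ s) (ht : 0 < t) : r • q i + s • q (i + 1) + t • q (i + 1 + 1) ∉ trace q := by
  rcases eq_or_lt_of_le hs with rfl | hs
  · rw [zero_smul, add_zero]
    obtain ⟨L, R, hL, hR, -⟩ := hq.exists_isLeft
    rcases (hq.det_ne i).lt_or_gt with hD | hD
    · have e0 : -(-(i + 1 + 1)) = i + 1 + 1 := by ring
      have e1 : -(-(i + 1 + 1) + 1) = i + 1 := by ring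
      have e2 : -(-(i + 1 + 1) + 1 + 1) = i := by ring
      have := hq.reverse.chord_of_empty hm hR (i := -(i + 1 + 1))
        (by simp only [e0, e1, e2]; rw [det3_reverse]; linarith)
        (fun j hj => by simp only [e0, e1, e2] at hj; exact hv _ (openCone_comm.1 hj)) ht hr
      simp only [e0, e2] at this
      rw [add_comm]
      intro h
      refine hR.disj _ this ?_
      obtain ⟨j, hj⟩ := mem_trace.1 h
      refine mem_trace.2 ⟨-(j + 1), mem_sector_comm.1 ?_⟩
      have e3 : -(-(j + 1)) = j + 1 := by ring
      have e4 : -(-(j + 1) + 1) = j := by ring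
      simp only [e3, e4]; exact hj
    · exact hL.disj _ (hq.chord_of_empty hm hL hD hv hr ht)
  · have := hq.notMem_trace_of_openCone (i := i) (σ := 1) (μ := 0) (σ' := 1) (μ' := 0) one_pos
      le_rfl one_pos le_rfl (by simpa using hv) (x := r • q i + s • q (i + 1) + t • q (i + 1 + 1))
    simp only [one_smul, zero_smul, add_zero] at this
    exact this ⟨r, s, t, hr, hs, ht, rfl⟩

end

end PolyhedralSurface

namespace PolyhedralSurface

noncomputable section

open Filter

/-! ### Deformations of stars -/

/-- The ray of a vector. -/
def ray (a : E3) : Set E3 := {x | ∃ r : ℝ, 0 ≤ r ∧ x = r • a}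

theorem zero_mem_ray (a : E3) : (0 : E3) ∈ ray a := ⟨0, le_rfl, by simp⟩

section

variable {n : ℕ} [NeZero n]

/-- The cone over a closed polygon of directions. -/
def coneOver (a : Fin n → E3) : Set E3 := ⋃ k, sector (a k) (a (k + 1))

/-- The edges of a star only meet in common endpoints. -/
theorem isStar_iff {a : Fin n → E3} : IsStar a ↔ 3 ≤ n ∧ (∀ k, cross (a k) (a (k + 1)) ≠ 0) ∧
    ∀ j k, j ≠ k → ∀ x, x ∈ sector (a j) (a (j + 1)) → x ∈ sector (a k) (a (k + 1)) →
      (k = j + 1 ∧ x ∈ ray (a k)) ∨ (j = k + 1 ∧ x ∈ ray (a j)) ∨ x = 0 := by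
  have hfold : ∀ {a : Fin n → E3}, IsStar a → ∀ j x, x ∈ sector (a j) (a (j + 1)) →
      x ∈ sector (a (j + 1)) (a (j + 1 + 1)) → x ∈ ray (a (j + 1)) := by
    rintro a h j x ⟨s, t, hs, ht, rfl⟩ ⟨s', t', hs', ht', he⟩
    rcases eq_or_lt_of_le hs with rfl | hs
    · exact ⟨t, ht, by simp⟩
    rcases eq_or_lt_of_le ht' with rfl | ht'
    · exact ⟨s', hs', by rw [he]; simp⟩
    · refine absurd ?_ (h.fold j s t' (t - s') hs ht')
      rw [sub_smul, ← add_sub_assoc, he]; abel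
  constructor
  · intro h
    refine ⟨h.three_le, h.cross_ne, fun j k hjk x hx hx' => ?_⟩
    by_cases h1 : k = j + 1
    · subst h1; exact Or.inl ⟨rfl, hfold h j x hx hx'⟩
    by_cases h2 : j = k + 1
    · subst h2; exact Or.inr (Or.inl ⟨rfl, hfold h k x hx' hx⟩)
    exact Or.inr (Or.inr (h.disj j k (fun e => hjk (h.inj e)) (fun e => h2 (h.inj e))
      (fun e => h1 (h.inj e).symm) (fun e => hjk (add_right_cancel (h.inj e))) x hx hx'))
  · rintro ⟨h3, hc, hm⟩
    have hinj : Function.Injective a := by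
      intro j k hjk
      by_contra hne
      have h0 := cross_ne_zero_left (hc j)
      have e1 : a j ∈ sector (a j) (a (j + 1)) := ⟨1, 0, zero_le_one, le_rfl, by simp⟩
      have e2 : a j ∈ sector (a k) (a (k + 1)) := ⟨1, 0, zero_le_one, le_rfl, by simp [hjk]⟩
      rcases hm j k hne _ e1 e2 with ⟨rfl, -⟩ | ⟨rfl, -⟩ | h
      · exact hc j (by rw [← hjk, cross_self_eq_zero])
      · exact hc k (by rw [← hjk, cross_self_eq_zero])
      · exact h0 h
    refine ⟨h3, hinj, hc, ?_, ?_⟩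
    · intro k s t r hs ht he
      set R := max 0 (-r) with hR
      have hR0 : 0 ≤ R := le_max_left _ _
      have hR1 : 0 ≤ r + R := by have := le_max_right 0 (-r); linarith
      have e1 : s • a k + (r + R) • a (k + 1) ∈ sector (a k) (a (k + 1)) :=
        ⟨s, r + R, hs.le, hR1, rfl⟩
      have e2 : s • a k + (r + R) • a (k + 1) ∈ sector (a (k + 1)) (a (k + 1 + 1)) :=
        ⟨R, t, hR0, ht.le, by rw [← he]; module⟩
      have key : ∀ ρ : ℝ, s • a k + (r + R) • a (k + 1) ≠ ρ • a (k + 1) := by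
        intro ρ h
        have h0 : s • a k + (r + R - ρ) • a (k + 1) = 0 := by
          rw [sub_smul, ← add_sub_assoc, h, sub_self]
        exact hs.ne' (eq_zero_of_combination (hc k) h0).1
      rcases hm k (k + 1) (EmbeddedStar.add_one_ne h3 k).symm _ e1 e2 with ⟨-, ρ, -, h⟩ | ⟨h, -⟩ | h
      · exact key ρ h
      · exact EmbeddedStar.add_two_ne h3 k h.symm
      · exact key 0 (by rw [h, zero_smul])
    · intro j k h1 h2 h3 h4 x hx hx'
      rcases hm j k (fun h => h1 (by rw [h])) x hx hx' with ⟨rfl, -⟩ | ⟨rfl, -⟩ | h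
      · exact absurd rfl h3
      · exact absurd rfl h2
      · exact h

/-- All conditions are visibly open except that sectors that are not adjacent only meet in 0. There
the coefficients can be normalized to lie in a compact simplex, on which having no common point is
an open condition. -/
theorem isOpen_isStar : IsOpen {a : Fin n → E3 | IsStar a} := by
  rw [isOpen_iff_mem_nhds]
  intro a ha
  have hcont : ∀ k, Continuous fun b : Fin n → E3 => b k := fun k => continuous_apply k
  have hc : ∀ᶠ b : Fin n → E3 in 𝓝 a, ∀ k, nrm b k ≠ 0 := eventually_all.2 fun k =>
    ((continuous_nrm k).tendsto a).eventually_ne (ha.cross_ne k)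
  have hi : ∀ᶠ b : Fin n → E3 in 𝓝 a, ∀ j k, j ≠ k → b j ≠ b k := by
    refine eventually_all.2 fun j => eventually_all.2 fun k => ?_
    by_cases hjk : j = k
    · exact Eventually.of_forall fun _ h => absurd hjk h
    · have hd : ∀ᶠ b : Fin n → E3 in 𝓝 a, b j - b k ≠ 0 :=
        (((hcont j).sub (hcont k)).tendsto a).eventually_ne
          (sub_ne_zero.2 fun e => hjk (ha.inj e))
      filter_upwards [hd] with b hb _
      exact sub_ne_zero.1 hb
  have hf : ∀ᶠ b : Fin n → E3 in 𝓝 a, ∀ k,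
      0 < ‖nrm b k‖ * ‖nrm b (k + 1)‖ + inner ℝ (nrm b k) (nrm b (k + 1)) := by
    refine eventually_all.2 fun k => ?_
    have h1 := continuous_nrm (n := n) k
    have h2 := continuous_nrm (n := n) (k + 1)
    have : Continuous fun b : Fin n → E3 =>
        ‖nrm b k‖ * ‖nrm b (k + 1)‖ + inner ℝ (nrm b k) (nrm b (k + 1)) :=
      (h1.norm.mul h2.norm).add (h1.inner h2)
    exact (this.tendsto a).eventually (lt_mem_nhds (ha.immersed.fold k))
  have hd : ∀ᶠ b : Fin n → E3 in 𝓝 a, ∀ j k, j ≠ k → j ≠ k + 1 → j + 1 ≠ k →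
      ∀ w ∈ stdSimplex ℝ (Fin 4), w 0 • b j + w 1 • b (j + 1) ≠ w 2 • b k + w 3 • b (k + 1) := by
    refine eventually_all.2 fun j => eventually_all.2 fun k => ?_
    by_cases h : j ≠ k ∧ j ≠ k + 1 ∧ j + 1 ≠ k
    · have hev : ∀ w ∈ stdSimplex ℝ (Fin 4), ∀ᶠ z : (Fin n → E3) × (Fin 4 → ℝ) in 𝓝 (a, w),
          z.2 0 • z.1 j + z.2 1 • z.1 (j + 1) - (z.2 2 • z.1 k + z.2 3 • z.1 (k + 1)) ≠ 0 := by
        intro w hw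
        have hcts : Continuous fun z : (Fin n → E3) × (Fin 4 → ℝ) =>
            z.2 0 • z.1 j + z.2 1 • z.1 (j + 1) - (z.2 2 • z.1 k + z.2 3 • z.1 (k + 1)) := by
          fun_prop
        refine (hcts.tendsto (a, w)).eventually_ne ?_
        simp only [ne_eq, sub_eq_zero]
        intro he
        have hz := ha.disj j k (fun e => h.1 (ha.inj e)) (fun e => h.2.1 (ha.inj e))
          (fun e => h.2.2 (ha.inj e)) (fun e => h.1 (add_right_cancel (ha.inj e)))
          (w 0 • a j + w 1 • a (j + 1)) ⟨_, _, hw.1 0, hw.1 1, rfl⟩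
          (by rw [he]; exact ⟨_, _, hw.1 2, hw.1 3, rfl⟩)
        obtain ⟨z0, z1⟩ := eq_zero_of_combination (ha.cross_ne j) hz
        rw [he] at hz
        obtain ⟨z2, z3⟩ := eq_zero_of_combination (ha.cross_ne k) hz
        have := hw.2
        rw [Fin.sum_univ_four, z0, z1, z2, z3] at this
        norm_num at this
      filter_upwards [(isCompact_stdSimplex ℝ (Fin 4)).eventually_forall_of_forall_eventually
        (P := fun (b : Fin n → E3) (w : Fin 4 → ℝ) =>
          w 0 • b j + w 1 • b (j + 1) - (w 2 • b k + w 3 • b (k + 1)) ≠ 0) hev]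
        with b hb _ _ _ w hw
      exact sub_ne_zero.1 (hb w hw)
    · exact Eventually.of_forall fun _ h1 h2 h3 => absurd ⟨h1, h2, h3⟩ h
  filter_upwards [hc, hi, hf, hd] with b hc hi hf hd
  refine ⟨ha.three_le, fun j k h => by_contra fun hjk => hi j k hjk h, hc, fun k =>
    (fold_iff (hc k) (hc (k + 1))).2 (hf k), ?_⟩
  rintro j k h1 h2 h3 - x ⟨s, t, hs, ht, rfl⟩ ⟨s', t', hs', ht', he⟩
  by_contra hx
  have hsum : 0 < s + t + s' + t' := by
    refine lt_of_le_of_ne (by positivity) fun h0 => hx ?_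
    have e1 : s = 0 := by linarith
    have e2 : t = 0 := by linarith
    simp [e1, e2]
  refine hd j k (fun e => h1 (by rw [e])) (fun e => h2 (by rw [e])) (fun e => h3 (by rw [e]))
    ![s / (s + t + s' + t'), t / (s + t + s' + t'), s' / (s + t + s' + t'),
      t' / (s + t + s' + t')] ⟨?_, ?_⟩ ?_
  · intro i
    fin_cases i <;> simp <;> positivity
  · rw [Fin.sum_univ_four]
    simp only [Matrix.cons_val]
    field_simp
  · simp only [Matrix.cons_val]
    have : ∀ p r : ℝ, ∀ x y : E3, (p / (s + t + s' + t')) • x + (r / (s + t + s' + t')) • y =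
        (s + t + s' + t')⁻¹ • (p • x + r • y) := by intro p r x y; module
    rw [this, this, he]

/-- The set of stars with `n` edges. -/
def starSet (n : ℕ) [NeZero n] : Set (Fin n → E3) := {a | IsStar a}

/-- A star in general position. -/
def StarGenPos (a : Fin n → E3) : Prop :=
  ∀ i j k, i ≠ j → j ≠ k → i ≠ k → det3 (a i) (a j) (a k) ≠ 0

theorem eventually_eval_ne_zero {p : Polynomial ℝ} (hp : p ≠ 0) :
    ∀ᶠ s : ℝ in 𝓝[>] 0, p.eval s ≠ 0 := by
  have hfin : ({x | p.eval x = 0} : Set ℝ).Finite :=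
    (p.roots.toFinset.finite_toSet).subset fun x hx => by
      simpa [Polynomial.mem_roots hp] using hx
  have h2 : ({x | p.eval x = 0} \ {0} : Set ℝ)ᶜ ∈ 𝓝 (0 : ℝ) :=
    (hfin.subset Set.sdiff_subset).isClosed.isOpen_compl.mem_nhds (by simp)
  filter_upwards [nhdsWithin_le_nhds h2, self_mem_nhdsWithin] with s hs hpos h0
  exact hs ⟨h0, ne_of_gt hpos⟩

/-- The star can be moved into general position. -/
theorem IsStar.exists_genPos {a : Fin n → E3} (ha : IsStar a) :
    ∃ b, StarGenPos b ∧ JoinedIn (starSet n) a b := by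
  -- Any three vectors on the moment curve are independent, by Vandermonde. So the determinants
  -- along `a + s • v` are polynomials in `s` with nonzero coefficient in degree 3, and they do not
  -- vanish for small `s > 0`.
  set v : Fin n → E3 := fun k => !₂[1, (k : ℝ), (k : ℝ) ^ 2] with hv
  have hdet : ∀ i j k : Fin n, det3 (v i) (v j) (v k) =
      ((j : ℝ) - i) * ((k : ℝ) - i) * ((k : ℝ) - j) := by
    intro i j k; simp [hv, det3]; ring
  have hcont : Continuous fun s : ℝ => a + s • v := by fun_prop
  obtain ⟨ε, hε, hB⟩ := Metric.isOpen_iff.1 (isOpen_isStar.preimage hcont) 0 (by simpa using ha)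
  have hgen : ∀ᶠ s : ℝ in 𝓝[>] 0, ∀ i j k, i ≠ j → j ≠ k → i ≠ k →
      det3 ((a + s • v) i) ((a + s • v) j) ((a + s • v) k) ≠ 0 := by
    refine eventually_all.2 fun i => eventually_all.2 fun j => eventually_all.2 fun k => ?_
    by_cases h : i ≠ j ∧ j ≠ k ∧ i ≠ k
    · set p : Polynomial ℝ := Polynomial.C (det3 (a i) (a j) (a k)) +
        Polynomial.C (det3 (v i) (a j) (a k) + det3 (a i) (v j) (a k) + det3 (a i) (a j) (v k)) *
          Polynomial.X +
        Polynomial.C (det3 (v i) (v j) (a k) + det3 (v i) (a j) (v k) + det3 (a i) (v j) (v k)) *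
          Polynomial.X ^ 2 + Polynomial.C (det3 (v i) (v j) (v k)) * Polynomial.X ^ 3 with hp
      have hp0 : p ≠ 0 := by
        intro h0
        have : p.coeff 3 = det3 (v i) (v j) (v k) := by
          simp only [hp, Polynomial.coeff_add, Polynomial.coeff_C_mul_X_pow,
            Polynomial.coeff_C_mul_X, Polynomial.coeff_C]
          norm_num
        rw [h0, Polynomial.coeff_zero, hdet] at this
        have hne : ∀ i j : Fin n, i ≠ j → (j : ℝ) - i ≠ 0 := fun i j hij =>
          sub_ne_zero.2 fun e => hij (Fin.ext (by exact_mod_cast e.symm))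
        exact mul_ne_zero (mul_ne_zero (hne _ _ h.1) (hne _ _ h.2.2)) (hne _ _ h.2.1) this.symm
      filter_upwards [eventually_eval_ne_zero hp0] with s hs _ _ _ h0
      apply hs
      rw [← h0]
      simp only [hp, Polynomial.eval_add, Polynomial.eval_mul, Polynomial.eval_C,
        Polynomial.eval_X, Polynomial.eval_pow, Pi.add_apply, Pi.smul_apply, det3_add_left,
        det3_add_mid, det3_add_right, det3_smul_left, det3_smul_mid, det3_smul_right]
      ring
    · exact Eventually.of_forall fun _ h1 h2 h3 => absurd ⟨h1, h2, h3⟩ h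
  obtain ⟨s, hs0, hs, hsB⟩ := (eventually_pos_nhdsGT.and (hgen.and
    (nhdsWithin_le_nhds (Metric.ball_mem_nhds (0 : ℝ) hε)))).exists
  refine ⟨a + s • v, hs, ?_⟩
  have : JoinedIn (Metric.ball (0 : ℝ) ε) 0 s :=
    ((convex_ball (0 : ℝ) ε).isPathConnected ⟨0, Metric.mem_ball_self hε⟩).joinedIn 0
      (Metric.mem_ball_self hε) s hsB
  have h2 := this.map_continuousOn (f := fun s : ℝ => a + s • v) hcont.continuousOn
  simp only [zero_smul, add_zero] at h2
  exact h2.mono (by rintro _ ⟨u, hu, rfl⟩; exact hB hu)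

end

end

end PolyhedralSurface

/-! ### Cyclic indices, and ears of stars -/

namespace PolyhedralSurface

noncomputable section

open Filter

section

variable {n : ℕ} [NeZero n]

/-- The residue of an integer as a cyclic index. -/
def cycIndex (n : ℕ) [NeZero n] (i : ℤ) : Fin n :=
  ⟨(i % n).toNat, by
    have h0 : (0 : ℤ) < n := by have := NeZero.pos n; omega
    have h1 := Int.emod_lt_of_pos i h0
    have h2 := Int.emod_nonneg i h0.ne'
    omega⟩

theorem cycIndex_val (i : ℤ) : ((cycIndex n i : ℕ) : ℤ) = i % n := by
  have h0 : (n : ℤ) ≠ 0 := by have := NeZero.pos n; omega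
  exact Int.toNat_of_nonneg (Int.emod_nonneg i h0)

theorem cycIndex_add_one (i : ℤ) : cycIndex n (i + 1) = cycIndex n i + 1 := by
  have h : ((cycIndex n (i + 1) : ℕ) : ℤ) = ((cycIndex n i + 1 : Fin n) : ℕ) := by
    rw [cycIndex_val, Fin.val_add, Int.natCast_mod, Nat.cast_add, cycIndex_val, Fin.val_one',
      Int.natCast_mod, Nat.cast_one, ← Int.add_emod]
  exact Fin.ext (by exact_mod_cast h)

theorem cycIndex_natCast (k : Fin n) : cycIndex n (k : ℕ) = k := by
  have h : ((cycIndex n (k : ℕ) : ℕ) : ℤ) = (k : ℕ) := by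
    rw [cycIndex_val, ← Int.natCast_mod, Nat.mod_eq_of_lt k.2]
  exact Fin.ext (by exact_mod_cast h)

theorem cycIndex_eq {i j : ℤ} (h : cycIndex n i = cycIndex n j) : (n : ℤ) ∣ j - i := by
  have h2 : i % n = j % n := by rw [← cycIndex_val, ← cycIndex_val, h]
  exact Int.ModEq.dvd h2

theorem IsStar.simplePoly {a : Fin n → E3} (ha : IsStar a) (hg : StarGenPos a) :
    SimplePoly n (fun i => a (cycIndex n i)) where
  three_le := ha.three_le
  per i := by
    congr 1
    refine Fin.ext ?_
    have h : ((cycIndex n (i + n) : ℕ) : ℤ) = (cycIndex n i : ℕ) := by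
      rw [cycIndex_val, cycIndex_val, Int.add_emod_right]
    exact_mod_cast h
  inj i j h := cycIndex_eq (ha.inj h)
  gen i j k h1 h2 h3 := hg _ _ _ (fun e => h1 (by simp only [e])) (fun e => h2 (by simp only [e]))
    (fun e => h3 (by simp only [e]))
  disj i j h1 h2 h3 h4 x hx hx' := by
    simp only [cycIndex_add_one] at h2 h3 h4 hx hx'
    exact ha.disj _ _ h1 h2 h3 h4 x hx hx'

/-- The vector `z` is minus a positive combination of three independent directions, so these four
vectors lie in no closed half-space. With weights 1, s, s² and small `s` it avoids every plane
through two directions, since no such plane contains all three. -/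
theorem exists_pos_spanning {a : Fin n → E3} (ha : IsStar a) (hg : StarGenPos a) :
    ∃ z, GenPos (insert z (Set.range a)) ∧
      ∀ p r : E3, cross p r ≠ 0 → ∃ v ∈ insert z (Set.range a), det3 p r v < 0 := by
  have h01 := (EmbeddedStar.add_one_ne ha.three_le 0).symm
  have h12 := (EmbeddedStar.add_one_ne ha.three_le (0 + 1)).symm
  have h02 := (EmbeddedStar.add_two_ne ha.three_le 0).symm
  have hD := hg _ _ _ h01 h12 h02
  set a₀ := a 0
  set a₁ := a (0 + 1)
  set a₂ := a (0 + 1 + 1)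
  have hspan : ∀ p r : E3, cross p r ≠ 0 →
      det3 p r a₀ ≠ 0 ∨ det3 p r a₁ ≠ 0 ∨ det3 p r a₂ ≠ 0 := by
    intro p r hpr
    by_contra! h0
    have hx := exists_coords hD (cross p r)
    have h1 : det3 p r (cross p r) = 0 := by
      rw [hx]
      simp only [det3_add_right, det3_smul_right, h0.1, h0.2.1, h0.2.2, mul_zero, add_zero]
    rw [← det3_rotate, ← inner_cross, real_inner_self_eq_norm_sq] at h1
    exact hpr (norm_eq_zero.1 (pow_eq_zero_iff two_ne_zero |>.1 h1))
  have hgen : ∀ᶠ s : ℝ in 𝓝[>] 0, ∀ i j, i ≠ j →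
      det3 (a i) (a j) (-(a₀ + s • a₁ + s ^ 2 • a₂)) ≠ 0 := by
    refine eventually_all.2 fun i => eventually_all.2 fun j => ?_
    by_cases h : i = j
    · exact Eventually.of_forall fun _ h1 => absurd h h1
    have hc : cross (a i) (a j) ≠ 0 := by
      by_cases h1 : a j = a (i + 1)
      · rw [h1]; exact ha.cross_ne i
      · exact cross_ne_zero_of_det3 (hg i j (i + 1) h (fun e => h1 (by rw [← e]))
          (EmbeddedStar.add_one_ne ha.three_le i).symm)
    set p : Polynomial ℝ := Polynomial.C (det3 (a i) (a j) a₀) +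
      Polynomial.C (det3 (a i) (a j) a₁) * Polynomial.X +
      Polynomial.C (det3 (a i) (a j) a₂) * Polynomial.X ^ 2 with hp
    have hp0 : p ≠ 0 := by
      intro h0
      have c0 : p.coeff 0 = det3 (a i) (a j) a₀ := by
        simp only [hp, Polynomial.coeff_add, Polynomial.coeff_C_mul_X_pow,
          Polynomial.coeff_C_mul_X, Polynomial.coeff_C]; norm_num
      have c1 : p.coeff 1 = det3 (a i) (a j) a₁ := by
        simp only [hp, Polynomial.coeff_add, Polynomial.coeff_C_mul_X_pow,
          Polynomial.coeff_C_mul_X, Polynomial.coeff_C]; norm_num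
      have c2 : p.coeff 2 = det3 (a i) (a j) a₂ := by
        simp only [hp, Polynomial.coeff_add, Polynomial.coeff_C_mul_X_pow,
          Polynomial.coeff_C_mul_X, Polynomial.coeff_C]; norm_num
      rw [h0, Polynomial.coeff_zero] at c0 c1 c2
      rcases hspan _ _ hc with h | h | h
      · exact h c0.symm
      · exact h c1.symm
      · exact h c2.symm
    filter_upwards [eventually_eval_ne_zero hp0] with s hs _ h0
    apply hs
    rw [det3_neg_right, neg_eq_zero] at h0
    rw [← h0]
    simp only [hp, Polynomial.eval_add, Polynomial.eval_mul, Polynomial.eval_C,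
      Polynomial.eval_X, Polynomial.eval_pow, det3_add_right, det3_smul_right]
    ring
  obtain ⟨s, hs0, hs⟩ := (eventually_pos_nhdsGT.and hgen).exists
  refine ⟨-(a₀ + s • a₁ + s ^ 2 • a₂), ?_, ?_⟩
  · rintro x (rfl | ⟨i, rfl⟩) y (rfl | ⟨j, rfl⟩) w (rfl | ⟨k, rfl⟩) h1 h2 h3
    · exact absurd rfl h1
    · exact absurd rfl h1
    · exact absurd rfl h3
    · rw [det3_rotate]; exact hs _ _ fun e => h2 (by rw [e])
    · exact absurd rfl h2
    · rw [← det3_rotate]; exact hs _ _ fun e => h3 (by rw [e])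
    · exact hs _ _ fun e => h1 (by rw [e])
    · exact hg _ _ _ (fun e => h1 (by rw [e])) (fun e => h2 (by rw [e])) (fun e => h3 (by rw [e]))
  · intro p r hpr
    by_contra! hn
    have hz := hn _ (Set.mem_insert _ _)
    have h0 := hn a₀ (Set.mem_insert_of_mem _ ⟨_, rfl⟩)
    have h1 := hn a₁ (Set.mem_insert_of_mem _ ⟨_, rfl⟩)
    have h2 := hn a₂ (Set.mem_insert_of_mem _ ⟨_, rfl⟩)
    rw [det3_neg_right, det3_add_right, det3_add_right, det3_smul_right, det3_smul_right] at hz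
    have m1 := mul_nonneg hs0.le h1
    have m2 := mul_nonneg (sq_nonneg s) h2
    have z0 : det3 p r a₀ = 0 := by linarith
    have z1 : s * det3 p r a₁ = 0 := by linarith
    have z2 : s ^ 2 * det3 p r a₂ = 0 := by linarith
    rcases hspan p r hpr with h | h | h
    · exact h z0
    · exact h ((mul_eq_zero.1 z1).resolve_left hs0.ne')
    · exact h ((mul_eq_zero.1 z2).resolve_left (by positivity))

/-- A star in general position with at least four edges has an ear. -/
theorem IsStar.exists_ear {a : Fin n → E3} (ha : IsStar a) (hg : StarGenPos a) (hn : 4 ≤ n) :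
    ∃ k, ∀ r s t : ℝ, 0 < r → 0 ≤ s → 0 < t → ∀ j,
      r • a k + s • a (k + 1) + t • a (k + 1 + 1) ∉ sector (a j) (a (j + 1)) := by
  obtain ⟨z, hz, hhalf⟩ := exists_pos_spanning ha hg
  obtain ⟨i, hi⟩ := (ha.simplePoly hg).exists_ear hz hhalf (z := z)
    (fun i => Set.mem_insert_of_mem _ ⟨_, rfl⟩) (by
      rintro v (rfl | ⟨k, rfl⟩)
      · exact Or.inl rfl
      · exact Or.inr ⟨(k : ℕ), by simp only [cycIndex_natCast]⟩)
  refine ⟨cycIndex n i, fun r s t hr hs ht j hj => ?_⟩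
  have := (ha.simplePoly hg).notMem_trace_of_ear hn hi hr hs ht
  apply this
  rw [mem_trace]
  refine ⟨(j : ℕ), ?_⟩
  simp only [cycIndex_add_one, cycIndex_natCast]
  exact hj

theorem IsStar.rotate {a : Fin n → E3} (ha : IsStar a) (r : Fin n) :
    IsStar fun i => a (i + r) where
  three_le := ha.three_le
  inj i j h := add_right_cancel (ha.inj h)
  cross_ne i := by rw [add_right_comm]; exact ha.cross_ne _
  fold i := by
    have := ha.fold (i + r)
    rwa [add_right_comm i r 1, add_right_comm (i + 1) r 1] at this
  disj i j := by
    have := ha.disj (i + r) (j + r)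
    rwa [add_right_comm i r 1, add_right_comm j r 1] at this

theorem coneOver_rotate (a : Fin n → E3) (r : Fin n) :
    coneOver (fun i => a (i + r)) = coneOver a := by
  ext x
  simp only [coneOver, Set.mem_iUnion]
  constructor
  · rintro ⟨i, hi⟩
    rw [add_right_comm] at hi
    exact ⟨i + r, hi⟩
  · rintro ⟨i, hi⟩
    refine ⟨i - r, ?_⟩
    rwa [add_right_comm, sub_add_cancel]

end

/-! ### Adding a direction to a star -/

section

variable {m : ℕ}

theorem castSucc_add_one' {i : Fin (m + 1)} (hi : i ≠ Fin.last m) :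
    i.castSucc + 1 = (i + 1).castSucc := by
  have h : (i : ℕ) < m := lt_of_le_of_ne (Nat.lt_succ_iff.1 i.2) fun e => hi (Fin.ext e)
  refine Fin.ext ?_
  rw [Fin.val_add_one_of_lt' (by simp; omega), Fin.val_castSucc, Fin.val_castSucc,
    Fin.val_add_one_of_lt' (by omega)]

theorem castSucc_last_add_one : (Fin.last m).castSucc + 1 = Fin.last (m + 1) := by
  refine Fin.ext ?_
  rw [Fin.val_add_one_of_lt' (by simp)]
  simp

theorem forall_fin_cases {P : Fin (m + 2) → Prop} (h1 : ∀ i : Fin (m + 1), i ≠ Fin.last m →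
    P i.castSucc) (h2 : P (Fin.last m).castSucc) (h3 : P (Fin.last (m + 1))) (k : Fin (m + 2)) :
    P k := by
  refine Fin.lastCases h3 (fun i => ?_) k
  by_cases hi : i = Fin.last m
  · rw [hi]; exact h2
  · exact h1 i hi

/-- Adding a direction to a closed polygon. -/
abbrev addDir (b : Fin (m + 1) → E3) (u : E3) : Fin (m + 2) → E3 := Fin.snoc (α := fun _ => E3) b u

theorem addDir_castSucc (b : Fin (m + 1) → E3) (u : E3) (i : Fin (m + 1)) :
    addDir b u i.castSucc = b i := Fin.snoc_castSucc (α := fun _ => E3) ..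

theorem addDir_last (b : Fin (m + 1) → E3) (u : E3) : addDir b u (Fin.last (m + 1)) = u :=
  Fin.snoc_last (α := fun _ => E3) ..

theorem addDir_succ (b : Fin (m + 1) → E3) (u : E3) {i : Fin (m + 1)} (hi : i ≠ Fin.last m) :
    addDir b u (i.castSucc + 1) = b (i + 1) := by
  rw [castSucc_add_one' hi, addDir_castSucc]

theorem addDir_succ_last (b : Fin (m + 1) → E3) (u : E3) :
    addDir b u ((Fin.last m).castSucc + 1) = u := by
  rw [castSucc_last_add_one, addDir_last]

theorem addDir_last_succ (b : Fin (m + 1) → E3) (u : E3) :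
    addDir b u (Fin.last (m + 1) + 1) = b 0 := by
  rw [Fin.last_add_one, ← Fin.castSucc_zero, addDir_castSucc]

/-- Separates the conditions that involve the new direction `u`; only these change when `u` moves.
The face from the last direction of `b` to `b 0` does not occur, so `b` itself need not be a star.
-/
theorem isStar_addDir_iff {b : Fin (m + 1) → E3} {u : E3} : IsStar (addDir b u) ↔ 1 ≤ m ∧
    (∀ i, i ≠ Fin.last m → cross (b i) (b (i + 1)) ≠ 0) ∧ cross (b (Fin.last m)) u ≠ 0 ∧
    cross u (b 0) ≠ 0 ∧
    (∀ i j, i ≠ Fin.last m → j ≠ Fin.last m → i ≠ j → ∀ x, x ∈ sector (b i) (b (i + 1)) →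
      x ∈ sector (b j) (b (j + 1)) →
      (j = i + 1 ∧ x ∈ ray (b j)) ∨ (i = j + 1 ∧ x ∈ ray (b i)) ∨ x = 0) ∧
    (∀ i, i ≠ Fin.last m → ∀ x, x ∈ sector (b i) (b (i + 1)) → x ∈ sector (b (Fin.last m)) u →
      (i + 1 = Fin.last m ∧ x ∈ ray (b (Fin.last m))) ∨ x = 0) ∧
    (∀ i, i ≠ Fin.last m → ∀ x, x ∈ sector (b i) (b (i + 1)) → x ∈ sector u (b 0) →
      (i = 0 ∧ x ∈ ray (b 0)) ∨ x = 0) ∧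
    ∀ x, x ∈ sector (b (Fin.last m)) u → x ∈ sector u (b 0) → x ∈ ray u := by
  rw [isStar_iff]
  have hc : ∀ i : Fin (m + 1), i.castSucc ≠ Fin.last (m + 1) := fun i => (Fin.castSucc_lt_last i).ne
  have hlz : ∀ i : Fin (m + 1), i.castSucc = Fin.last (m + 1) + 1 ↔ i = 0 := fun i => by
    rw [Fin.last_add_one, ← Fin.castSucc_zero, Fin.castSucc_inj]
  constructor
  · rintro ⟨h3, h4, h5⟩
    refine ⟨by omega, fun i hi => ?_, ?_, ?_, fun i j hi hj hij x hx hx' => ?_,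
      fun i hi x hx hx' => ?_, fun i hi x hx hx' => ?_, fun x hx hx' => ?_⟩
    · have := h4 i.castSucc
      rwa [addDir_succ b u hi, addDir_castSucc] at this
    · have := h4 (Fin.last m).castSucc
      rwa [addDir_succ_last, addDir_castSucc] at this
    · have := h4 (Fin.last (m + 1))
      rwa [addDir_last_succ, addDir_last] at this
    · have := h5 i.castSucc j.castSucc (fun e => hij (Fin.castSucc_injective _ e)) x
        (by rwa [addDir_succ b u hi, addDir_castSucc])
        (by rwa [addDir_succ b u hj, addDir_castSucc])
      rwa [addDir_castSucc, addDir_castSucc, castSucc_add_one' hi, castSucc_add_one' hj,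
        Fin.castSucc_inj, Fin.castSucc_inj] at this
    · have := h5 i.castSucc (Fin.last m).castSucc (fun e => hi (Fin.castSucc_injective _ e)) x
        (by rwa [addDir_succ b u hi, addDir_castSucc])
        (by rwa [addDir_succ_last, addDir_castSucc])
      rw [addDir_castSucc, addDir_castSucc, castSucc_add_one' hi, castSucc_last_add_one,
        Fin.castSucc_inj] at this
      rcases this with ⟨h, hr⟩ | ⟨h, -⟩ | h
      · exact Or.inl ⟨h.symm, hr⟩
      · exact absurd h (hc i)
      · exact Or.inr h
    · have := h5 i.castSucc (Fin.last (m + 1)) (hc i) x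
        (by rwa [addDir_succ b u hi, addDir_castSucc])
        (by rwa [addDir_last_succ, addDir_last])
      rw [addDir_castSucc, castSucc_add_one' hi, hlz] at this
      rcases this with ⟨h, -⟩ | ⟨h, hr⟩ | h
      · exact absurd h.symm (hc _)
      · exact Or.inl ⟨h, h ▸ hr⟩
      · exact Or.inr h
    · have := h5 (Fin.last m).castSucc (Fin.last (m + 1)) (hc _) x
        (by rwa [addDir_succ_last, addDir_castSucc])
        (by rwa [addDir_last_succ, addDir_last])
      rw [hlz, addDir_last] at this
      rcases this with ⟨-, hr⟩ | ⟨h, -⟩ | h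
      · exact hr
      · have := congrArg Fin.val h
        simp at this
        omega
      · rw [h]; exact zero_mem_ray u
  · rintro ⟨hm, c1, c2, c3, d1, d2, d3, d4⟩
    refine ⟨by omega, ?_, ?_⟩
    · refine forall_fin_cases (fun i hi => ?_) ?_ ?_
      · rw [addDir_succ b u hi, addDir_castSucc]; exact c1 i hi
      · rw [addDir_succ_last, addDir_castSucc]; exact c2
      · rw [addDir_last_succ, addDir_last]; exact c3
    · refine forall_fin_cases (fun i hi => ?_) ?_ ?_ <;>
        refine forall_fin_cases (fun j hj => ?_) ?_ ?_ <;> intro hij x hx hx'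
      · rw [addDir_succ b u hi, addDir_castSucc] at hx
        rw [addDir_succ b u hj, addDir_castSucc] at hx'
        rw [addDir_castSucc, addDir_castSucc, castSucc_add_one' hi, castSucc_add_one' hj,
          Fin.castSucc_inj, Fin.castSucc_inj]
        exact d1 i j hi hj (fun e => hij (by rw [e])) x hx hx'
      · rw [addDir_succ b u hi, addDir_castSucc] at hx
        rw [addDir_succ_last, addDir_castSucc] at hx'
        rw [addDir_castSucc, castSucc_add_one' hi, Fin.castSucc_inj]
        rcases d2 i hi x hx hx' with ⟨h, hr⟩ | h
        · exact Or.inl ⟨h.symm, hr⟩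
        · exact Or.inr (Or.inr h)
      · rw [addDir_succ b u hi, addDir_castSucc] at hx
        rw [addDir_last_succ, addDir_last] at hx'
        rw [addDir_castSucc, hlz]
        rcases d3 i hi x hx hx' with ⟨h, hr⟩ | h
        · exact Or.inr (Or.inl ⟨h, h ▸ hr⟩)
        · exact Or.inr (Or.inr h)
      · rw [addDir_succ_last, addDir_castSucc] at hx
        rw [addDir_succ b u hj, addDir_castSucc] at hx'
        rw [addDir_castSucc _ _ (Fin.last m), castSucc_add_one' hj, Fin.castSucc_inj]
        rcases d2 j hj x hx' hx with ⟨h, hr⟩ | h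
        · exact Or.inr (Or.inl ⟨h.symm, hr⟩)
        · exact Or.inr (Or.inr h)
      · exact absurd rfl hij
      · rw [addDir_succ_last, addDir_castSucc] at hx
        rw [addDir_last_succ, addDir_last] at hx'
        rw [addDir_last, castSucc_last_add_one]
        exact Or.inl ⟨rfl, d4 x hx hx'⟩
      · rw [addDir_last_succ, addDir_last] at hx
        rw [addDir_succ b u hj, addDir_castSucc] at hx'
        rw [addDir_castSucc, hlz]
        rcases d3 j hj x hx' hx with ⟨h, hr⟩ | h
        · exact Or.inl ⟨h, h ▸ hr⟩
        · exact Or.inr (Or.inr h)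
      · rw [addDir_last_succ, addDir_last] at hx
        rw [addDir_succ_last, addDir_castSucc] at hx'
        rw [addDir_last, castSucc_last_add_one]
        exact Or.inr (Or.inl ⟨rfl, d4 x hx' hx⟩)
      · exact absurd rfl hij

end

end

end PolyhedralSurface

/-! ### Flattening ears, and deforming stars to convex corners -/

namespace PolyhedralSurface

noncomputable section

open Filter

variable {m : ℕ}

theorem sector_add_left {a c x : E3} (h : x ∈ sector a (a + c)) : x ∈ sector a c := by
  obtain ⟨s, t, hs, ht, rfl⟩ := h
  exact ⟨s + t, t, by positivity, ht, by module⟩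

theorem sector_add_right {a c x : E3} (h : x ∈ sector (a + c) c) : x ∈ sector a c := by
  obtain ⟨s, t, hs, ht, rfl⟩ := h
  exact ⟨s, s + t, hs, by positivity, by module⟩

theorem sector_split {a c x : E3} (h : x ∈ sector a c) :
    x ∈ sector a (a + c) ∨ x ∈ sector (a + c) c := by
  obtain ⟨s, t, hs, ht, rfl⟩ := h
  rcases le_total t s with h | h
  · exact Or.inl ⟨s - t, t, by linarith, ht, by module⟩
  · exact Or.inr ⟨s, t - s, hs, by linarith, by module⟩

/-- A direction may be inserted in the middle of a face. -/
theorem IsStar.addDir_flat {b : Fin (m + 1) → E3} (hb : IsStar b) :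
    IsStar (addDir b (b (Fin.last m) + b 0)) := by
  obtain ⟨h3, hc, hmeet⟩ := isStar_iff.1 hb
  have hl := hc (Fin.last m)
  rw [Fin.last_add_one] at hl
  set a := b (Fin.last m)
  set c := b 0
  refine isStar_addDir_iff.2 ⟨by omega, fun i _ => hc i, ?_, ?_, fun i j _ _ => hmeet i j, ?_, ?_, ?_⟩
  · have : cross a (a + c) = cross a c := by refine ext_coords ?_ ?_ ?_ <;> simp <;> ring
    rwa [this]
  · have : cross (a + c) c = cross a c := by refine ext_coords ?_ ?_ ?_ <;> simp <;> ring
    rwa [this]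
  · intro i hi x hx hx'
    rcases hmeet i (Fin.last m) hi x hx (by rw [Fin.last_add_one]; exact sector_add_left hx') with
      ⟨h, hr⟩ | ⟨h, hr⟩ | h
    · exact Or.inl ⟨h.symm, hr⟩
    · right
      rw [h, Fin.last_add_one] at hr
      obtain ⟨r, hr0, hr⟩ := hr
      obtain ⟨s, t, hs, ht, he⟩ := hx'
      have h0 : (s + t) • a + (t - r) • c = 0 := by
        have : s • a + t • (a + c) - r • c = 0 := by rw [← he, ← hr, sub_self]
        rw [← this]; module
      have := eq_zero_of_combination hl h0
      have e : r = 0 := by linarith [this.1, this.2]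
      rw [hr, e, zero_smul]
    · exact Or.inr h
  · intro i hi x hx hx'
    rcases hmeet i (Fin.last m) hi x hx (by rw [Fin.last_add_one]; exact sector_add_right hx') with
      ⟨h, hr⟩ | ⟨h, hr⟩ | h
    · right
      obtain ⟨r, hr0, hr⟩ := hr
      obtain ⟨s, t, hs, ht, he⟩ := hx'
      have h0 : (s - r) • a + (s + t) • c = 0 := by
        have : s • (a + c) + t • c - r • a = 0 := by rw [← he, ← hr, sub_self]
        rw [← this]; module
      have := eq_zero_of_combination hl h0
      have e : r = 0 := by linarith [this.1, this.2]
      rw [hr, e, zero_smul]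
    · rw [Fin.last_add_one] at h
      exact Or.inl ⟨h, by rw [h] at hr; exact hr⟩
    · exact Or.inr h
  · rintro x ⟨s, t, hs, ht, rfl⟩ ⟨s', t', hs', ht', he⟩
    have h0 : (s + t - s') • a + (t - s' - t') • c = 0 := by
      have : s • a + t • (a + c) - (s' • (a + c) + t' • c) = 0 := by rw [← he, sub_self]
      rw [← this]; module
    have := eq_zero_of_combination hl h0
    have e : s = 0 := by linarith [this.1, this.2]
    exact ⟨t, ht, by rw [e, zero_smul, zero_add]⟩

/-- The new direction merely subdivides the last face. -/
theorem coneOver_addDir_flat (b : Fin (m + 1) → E3) :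
    coneOver (addDir b (b (Fin.last m) + b 0)) = coneOver b := by
  ext x
  simp only [coneOver, Set.mem_iUnion]
  constructor
  · rintro ⟨k, hk⟩
    revert hk
    refine forall_fin_cases
      (P := fun k => x ∈ sector (addDir b (b (Fin.last m) + b 0) k)
        (addDir b (b (Fin.last m) + b 0) (k + 1)) → ∃ i, x ∈ sector (b i) (b (i + 1)))
      (fun i hi => ?_) ?_ ?_ k
    · rw [addDir_succ _ _ hi, addDir_castSucc]
      exact fun h => ⟨i, h⟩
    · rw [addDir_succ_last, addDir_castSucc]
      exact fun h => ⟨Fin.last m, by rw [Fin.last_add_one]; exact sector_add_left h⟩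
    · rw [addDir_last_succ, addDir_last]
      exact fun h => ⟨Fin.last m, by rw [Fin.last_add_one]; exact sector_add_right h⟩
  · rintro ⟨i, hi⟩
    by_cases h : i = Fin.last m
    · rw [h, Fin.last_add_one] at hi
      rcases sector_split hi with h | h
      · exact ⟨(Fin.last m).castSucc, by rw [addDir_succ_last, addDir_castSucc]; exact h⟩
      · exact ⟨Fin.last (m + 1), by rw [addDir_last_succ, addDir_last]; exact h⟩
    · exact ⟨i.castSucc, by rw [addDir_succ _ _ h, addDir_castSucc]; exact hi⟩

/-- An ear can be flattened, and then be removed. -/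
theorem IsStar.flatten_ear (hm : 2 ≤ m) {b : Fin (m + 1) → E3} {t : E3}
    (ha : IsStar (addDir b t)) (hD : det3 (b (Fin.last m)) t (b 0) ≠ 0)
    (hear : ∀ r s u : ℝ, 0 < r → 0 ≤ s → 0 < u → ∀ j,
      r • b (Fin.last m) + s • t + u • b 0 ∉ sector (addDir b t j) (addDir b t (j + 1))) :
    IsStar b ∧ ∀ s : ℝ, 0 ≤ s → s ≤ 1 →
      IsStar (addDir b ((1 - s) • t + s • (b (Fin.last m) + b 0))) := by
  obtain ⟨-, c1, c2, c3, d1, d2, d3, d4⟩ := isStar_addDir_iff.1 ha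
  have hcl : cross (b (Fin.last m)) (b 0) ≠ 0 := by
    intro h0
    apply hD
    rw [det3_swap_right]
    rw [← det3_rotate, ← inner_cross, h0, inner_zero_right, neg_zero]
  -- A point of the closed triangle of the ear that lies on another edge is on the ray of an end of
  -- the third side. Along the two sides of the ear this is the star condition; elsewhere it is the
  -- emptiness of the ear.
  have hclean : ∀ i, i ≠ Fin.last m → ∀ x, x ∈ sector (b i) (b (i + 1)) → ∀ r s u : ℝ, 0 ≤ r →
      0 ≤ s → 0 ≤ u → x = r • b (Fin.last m) + s • t + u • b 0 →
      (i + 1 = Fin.last m ∧ x ∈ ray (b (Fin.last m))) ∨ (i = 0 ∧ x ∈ ray (b 0)) ∨ x = 0 := by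
    intro i hi x hx r s u hr hs hu he
    rcases eq_or_lt_of_le hr with rfl | hr
    · rw [zero_smul, zero_add] at he
      exact Or.inr (d3 i hi x hx ⟨s, u, hs, hu, he⟩)
    rcases eq_or_lt_of_le hu with rfl | hu
    · rw [zero_smul, add_zero] at he
      rcases d2 i hi x hx ⟨r, s, hr.le, hs, he⟩ with h | h
      · exact Or.inl h
      · exact Or.inr (Or.inr h)
    refine absurd ?_ (hear r s u hr hs hu i.castSucc)
    rw [addDir_succ _ _ hi, addDir_castSucc, ← he]
    exact hx
  have hbl : ∀ i, i ≠ Fin.last m → ∀ r : ℝ, 0 ≤ r → ∀ x, x = r • b (Fin.last m) → i = 0 →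
      x ∈ ray (b 0) → x = 0 := by
    rintro i - r hr x he - ⟨r', hr', he'⟩
    have h0 : r • b (Fin.last m) + (-r') • b 0 = 0 := by
      rw [neg_smul, ← he, ← he', add_neg_cancel]
    rw [he, (eq_zero_of_combination hcl h0).1, zero_smul]
  constructor
  · refine isStar_iff.2 ⟨by omega, fun i => ?_, fun i j hij x hx hx' => ?_⟩
    · by_cases hi : i = Fin.last m
      · rw [hi, Fin.last_add_one]; exact hcl
      · exact c1 i hi
    · have key : ∀ i, i ≠ Fin.last m → x ∈ sector (b i) (b (i + 1)) →
          x ∈ sector (b (Fin.last m)) (b 0) → (i + 1 = Fin.last m ∧ x ∈ ray (b (Fin.last m))) ∨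
          (i = 0 ∧ x ∈ ray (b 0)) ∨ x = 0 := by
        rintro i hi hx ⟨s, t, hs, ht, he⟩
        exact hclean i hi x hx s 0 t hs le_rfl ht (by rw [he, zero_smul, add_zero])
      by_cases hi : i = Fin.last m
      · rw [hi, Fin.last_add_one] at hx
        rw [hi, Fin.last_add_one]
        rcases key j (fun e => hij (hi.trans e.symm)) hx' hx with ⟨h, hr⟩ | ⟨h, hr⟩ | h
        · exact Or.inr (Or.inl ⟨h.symm, hr⟩)
        · exact Or.inl ⟨h, by rw [h]; exact hr⟩
        · exact Or.inr (Or.inr h)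
      · by_cases hj : j = Fin.last m
        · rw [hj, Fin.last_add_one] at hx'
          rw [hj, Fin.last_add_one]
          rcases key i hi hx hx' with ⟨h, hr⟩ | ⟨h, hr⟩ | h
          · exact Or.inl ⟨h.symm, hr⟩
          · exact Or.inr (Or.inl ⟨h, by rw [h]; exact hr⟩)
          · exact Or.inr (Or.inr h)
        · exact d1 i j hi hj hij x hx hx'
  · intro s hs0 hs1
    have hD1 : det3 (b (Fin.last m)) ((1 - s) • t + s • (b (Fin.last m) + b 0)) (b 0) =
        (1 - s) * det3 (b (Fin.last m)) t (b 0) := by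
      simp [det3_add_mid, det3_smul_mid]
    have hs1' : 0 ≤ 1 - s := by linarith
    refine isStar_addDir_iff.2 ⟨by omega, c1, ?_, ?_, d1, ?_, ?_, ?_⟩
    · rcases eq_or_lt_of_le hs1 with rfl | hlt
      · have : cross (b (Fin.last m)) ((1 - 1 : ℝ) • t + (1 : ℝ) • (b (Fin.last m) + b 0)) =
            cross (b (Fin.last m)) (b 0) := by refine ext_coords ?_ ?_ ?_ <;> simp <;> ring
        rwa [this]
      · refine cross_ne_zero_of_det3 (c := b 0) ?_
        rw [hD1]; exact mul_ne_zero (by linarith) hD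
    · rcases eq_or_lt_of_le hs1 with rfl | hlt
      · have : cross ((1 - 1 : ℝ) • t + (1 : ℝ) • (b (Fin.last m) + b 0)) (b 0) =
            cross (b (Fin.last m)) (b 0) := by refine ext_coords ?_ ?_ ?_ <;> simp <;> ring
        rwa [this]
      · refine cross_ne_zero_of_det3 (c := b (Fin.last m)) ?_
        rw [← det3_rotate, hD1]; exact mul_ne_zero (by linarith) hD
    · rintro i hi x hx ⟨p, r, hp, hr, he⟩
      -- The moving edge stays in the triangle of the ear.
      have he' : x = (p + r * s) • b (Fin.last m) + (r * (1 - s)) • t + (r * s) • b 0 := by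
        rw [he]; module
      rcases hclean i hi x hx _ _ _ (by positivity) (by positivity) (by positivity) he' with
        h | ⟨h, u, hu, hxu⟩ | h
      · exact Or.inl h
      · right
        have h0 : (p + r * s) * det3 (b (Fin.last m)) t (b 0) = 0 ∧
            (r * (1 - s)) * det3 (b (Fin.last m)) t (b 0) = 0 := by
          constructor
          · have : det3 x t (b 0) = 0 := by rw [hxu, det3_smul_left]; simp
            rw [← this, he']; simp [det3_add_left, det3_smul_left]
          · have : det3 (b (Fin.last m)) x (b 0) = 0 := by rw [hxu, det3_smul_mid]; simp
            rw [← this, he']; simp [det3_add_mid, det3_smul_mid]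
        have h1 := (mul_eq_zero.1 h0.1).resolve_right hD
        have h2 := (mul_eq_zero.1 h0.2).resolve_right hD
        have h3 : r * s = 0 := by nlinarith [mul_nonneg hr hs0]
        rw [he', h1, h2, h3]; simp
      · exact Or.inr h
    · rintro i hi x hx ⟨r, p, hr, hp, he⟩
      have he' : x = (r * s) • b (Fin.last m) + (r * (1 - s)) • t + (r * s + p) • b 0 := by
        rw [he]; module
      rcases hclean i hi x hx _ _ _ (by positivity) (by positivity) (by positivity) he' with
        ⟨h, u, hu, hxu⟩ | h | h
      · right
        have h0 : (r * s + p) * det3 (b (Fin.last m)) t (b 0) = 0 ∧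
            (r * (1 - s)) * det3 (b (Fin.last m)) t (b 0) = 0 := by
          constructor
          · have : det3 (b (Fin.last m)) t x = 0 := by rw [hxu, det3_smul_right]; simp
            rw [← this, he']; simp [det3_add_right, det3_smul_right]
          · have : det3 (b (Fin.last m)) x (b 0) = 0 := by rw [hxu, det3_smul_mid]; simp
            rw [← this, he']; simp [det3_add_mid, det3_smul_mid]
        have h1 := (mul_eq_zero.1 h0.1).resolve_right hD
        have h2 := (mul_eq_zero.1 h0.2).resolve_right hD
        have h3 : r * s = 0 := by nlinarith [mul_nonneg hr hs0]
        rw [he', h1, h2, h3]; simp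
      · exact Or.inl h
      · exact Or.inr h
    · rintro x ⟨p, r, hp, hr, he⟩ ⟨p', r', hp', hr', he'⟩
      have hpz : p = 0 := by
        rcases eq_or_lt_of_le hs1 with rfl | hlt
        · have h0 : (p + r - p') • b (Fin.last m) + (r - p' - r') • b 0 = 0 := by
            have : x - x = 0 := sub_self x
            nth_rewrite 1 [he] at this
            rw [he'] at this
            rw [← this]; module
          have := eq_zero_of_combination hcl h0
          linarith [this.1, this.2]
        · have e1 : det3 (b (Fin.last m)) x (b 0) =
              r * ((1 - s) * det3 (b (Fin.last m)) t (b 0)) := by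
            rw [he, det3_add_mid, det3_smul_mid, det3_smul_mid, hD1]; simp
          have e2 : det3 (b (Fin.last m)) x (b 0) =
              p' * ((1 - s) * det3 (b (Fin.last m)) t (b 0)) := by
            rw [he', det3_add_mid, det3_smul_mid, det3_smul_mid, hD1]; simp
          have e3 : r = p' := mul_right_cancel₀ (mul_ne_zero (by linarith) hD) (e1.symm.trans e2)
          have e4 : p • b (Fin.last m) + (-r') • b 0 = 0 := by
            have h5 : p • b (Fin.last m) = r' • b 0 := by
              have := he.symm.trans he'
              rw [← e3, add_comm] at this
              exact add_left_cancel this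
            rw [h5]; module
          exact (eq_zero_of_combination hcl e4).1
      exact ⟨r, hr, by rw [he, hpz, zero_smul, zero_add]⟩

/-- The set is the boundary of a convex set. -/
def IsConvexBoundary (K : Set E3) : Prop := ∃ C, Convex ℝ C ∧ frontier C = K

/-- The boundary of a simplicial cone. -/
theorem isConvexBoundary_simplicial {a : Fin 3 → E3} (hD : det3 (a 0) (a 1) (a 2) ≠ 0) :
    IsConvexBoundary (coneOver a) := by
  set p := a 0
  set q := a 1
  set r := a 2
  have hK : coneOver a = {x | x ∈ sector p q ∨ x ∈ sector q r ∨ x ∈ sector r p} := by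
    ext x
    simp only [coneOver, Set.mem_iUnion, Set.mem_ofPred_eq]
    constructor
    · rintro ⟨k, hk⟩
      fin_cases k
      · exact Or.inl hk
      · exact Or.inr (Or.inl hk)
      · exact Or.inr (Or.inr hk)
    · rintro (h | h | h)
      · exact ⟨0, h⟩
      · exact ⟨1, h⟩
      · exact ⟨2, h⟩
  rw [hK]
  set A : E3 → ℝ := fun x => det3 x q r / det3 p q r with hA
  set B : E3 → ℝ := fun x => det3 p x r / det3 p q r with hB
  set C : E3 → ℝ := fun x => det3 p q x / det3 p q r with hC
  have hco : ∀ x, x = A x • p + B x • q + C x • r := fun x => exists_coords hD x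
  have hAc : Continuous A := by simp only [hA]; fun_prop
  have hBc : Continuous B := by simp only [hB]; fun_prop
  have hCc : Continuous C := by simp only [hC]; fun_prop
  have hAl : ∀ s t : ℝ, ∀ y z, A (s • y + t • z) = s * A y + t * A z := by
    intro s t y z; simp only [hA, det3_add_left, det3_smul_left]; ring
  have hBl : ∀ s t : ℝ, ∀ y z, B (s • y + t • z) = s * B y + t * B z := by
    intro s t y z; simp only [hB, det3_add_mid, det3_smul_mid]; ring
  have hCl : ∀ s t : ℝ, ∀ y z, C (s • y + t • z) = s * C y + t * C z := by
    intro s t y z; simp only [hC, det3_add_right, det3_smul_right]; ring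
  have hAp : A p = 1 := div_self hD
  have hBq : B q = 1 := div_self hD
  have hCr : C r = 1 := div_self hD
  have hAq : A q = 0 := by simp [hA]
  have hAr : A r = 0 := by simp [hA]
  have hBp : B p = 0 := by simp [hB]
  have hBr : B r = 0 := by simp [hB]
  have hCp : C p = 0 := by simp [hC]
  have hCq : C q = 0 := by simp [hC]
  refine ⟨{x | 0 ≤ A x ∧ 0 ≤ B x ∧ 0 ≤ C x}, ?_, ?_⟩
  · rintro x ⟨h1, h2, h3⟩ y ⟨h4, h5, h6⟩ s t hs ht -
    refine ⟨?_, ?_, ?_⟩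
    · rw [hAl]; positivity
    · rw [hBl]; positivity
    · rw [hCl]; positivity
  · have hcl : IsClosed {x | 0 ≤ A x ∧ 0 ≤ B x ∧ 0 ≤ C x} :=
      (isClosed_le continuous_const hAc).inter ((isClosed_le continuous_const hBc).inter
        (isClosed_le continuous_const hCc))
    have hint : interior {x | 0 ≤ A x ∧ 0 ≤ B x ∧ 0 ≤ C x} = {x | 0 < A x ∧ 0 < B x ∧ 0 < C x} := by
      apply subset_antisymm
      · intro x hx
        have hmem := interior_subset hx
        have hnh := mem_interior_iff_mem_nhds.1 hx
        obtain ⟨τ, hτ, h⟩ := (eventually_pos_nhdsGT.and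
          ((tendsto_add_smul x (p + q + r) (-1)).eventually hnh)).exists
        have e : x + (-1 * τ) • (p + q + r) = (1 : ℝ) • x + (-τ) • ((1 : ℝ) • p + (1 : ℝ) •
          ((1 : ℝ) • q + (1 : ℝ) • r)) := by module
        rw [e] at h
        change 0 ≤ A _ ∧ 0 ≤ B _ ∧ 0 ≤ C _ at h
        simp only [hAl, hBl, hCl, hAp, hBq, hCr, hAq, hAr, hBp, hBr, hCp, hCq] at h
        refine ⟨?_, ?_, ?_⟩ <;> linarith [h.1, h.2.1, h.2.2]
      · refine interior_maximal (fun x hx => ⟨hx.1.le, hx.2.1.le, hx.2.2.le⟩) ?_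
        exact (isOpen_lt continuous_const hAc).inter ((isOpen_lt continuous_const hBc).inter
          (isOpen_lt continuous_const hCc))
    rw [hcl.frontier_eq, hint]
    ext x
    simp only [Set.mem_sdiff, Set.mem_ofPred_eq]
    constructor
    · rintro ⟨⟨h1, h2, h3⟩, h4⟩
      have hx := hco x
      rcases eq_or_lt_of_le h1 with h | h
      · right; left
        rw [← h, zero_smul, zero_add] at hx
        exact ⟨_, _, h2, h3, hx⟩
      · rcases eq_or_lt_of_le h2 with h' | h'
        · right; right
          rw [← h', zero_smul, add_zero, add_comm] at hx
          exact ⟨_, _, h3, h1, hx⟩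
        · rcases eq_or_lt_of_le h3 with h'' | h''
          · left
            rw [← h'', zero_smul, add_zero] at hx
            exact ⟨_, _, h1, h2, hx⟩
          · exact absurd ⟨h, h', h''⟩ h4
    · rintro (⟨s, t, hs, ht, rfl⟩ | ⟨s, t, hs, ht, rfl⟩ | ⟨s, t, hs, ht, rfl⟩) <;>
        simp only [hAl, hBl, hCl, hAp, hBq, hCr, hAq, hAr, hBp, hBr, hCp, hCq] <;>
        refine ⟨⟨by linarith, by linarith, by linarith⟩, ?_⟩ <;> rintro ⟨h1, h2, h3⟩ <;> linarith

/-- Every star can be deformed to the boundary of a convex cone. -/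
theorem IsStar.exists_joinedIn_convex (hm : 2 ≤ m) : ∀ {a : Fin (m + 1) → E3}, IsStar a →
    ∃ b, JoinedIn (starSet (m + 1)) a b ∧ IsConvexBoundary (coneOver b) := by
  induction m, hm using Nat.le_induction with
  | base =>
    intro a ha
    obtain ⟨b, hg, hj⟩ := ha.exists_genPos
    exact ⟨b, hj, isConvexBoundary_simplicial (hg _ _ _ (by decide) (by decide) (by decide))⟩
  | succ m hm ih =>
    intro a ha
    obtain ⟨a', hg, hj⟩ := ha.exists_genPos
    have ha' : IsStar a' := hj.target_mem
    obtain ⟨k, hk⟩ := ha'.exists_ear hg (by omega)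
    -- Rotates the indices so that the tip `k + 1` of the ear becomes the last direction.
    set r : Fin (m + 2) := k + 1 + 1 with hr
    set c : Fin (m + 2) → E3 := fun i => a' (i + r) with hc
    have hcs : IsStar c := ha'.rotate r
    set b : Fin (m + 1) → E3 := fun i => c i.castSucc with hb
    set t := c (Fin.last (m + 1)) with ht
    have hcb : addDir b t = c := Fin.snoc_init_self (α := fun _ => E3) c
    have hbl : b (Fin.last m) = a' k := by
      simp only [hb, hc, hr]
      congr 1
      have : (Fin.last m).castSucc + 1 + 1 = 0 := by rw [castSucc_last_add_one, Fin.last_add_one]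
      rw [← add_assoc, ← add_assoc, add_right_comm _ k 1, add_right_comm _ k 1, this, zero_add]
    have htk : t = a' (k + 1) := by
      simp only [ht, hc, hr]
      congr 1
      rw [show Fin.last (m + 1) + (k + 1 + 1) = Fin.last (m + 1) + 1 + (k + 1) by abel,
        Fin.last_add_one, zero_add]
    have hb0 : b 0 = a' (k + 1 + 1) := by simp [hb, hc, hr]
    have hD : det3 (b (Fin.last m)) t (b 0) ≠ 0 := by
      rw [hbl, htk, hb0]
      exact hg _ _ _ (EmbeddedStar.add_one_ne ha'.three_le k).symm
        (EmbeddedStar.add_one_ne ha'.three_le _).symm (EmbeddedStar.add_two_ne ha'.three_le k).symm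
    obtain ⟨hbs, hpath⟩ := IsStar.flatten_ear hm (b := b) (t := t) (by rw [hcb]; exact hcs) hD (by
      intro x y z hx hy hz j
      rw [hcb, hbl, htk, hb0]
      have := hk x y z hx hy hz (j + r)
      rwa [add_right_comm] at this)
    obtain ⟨d, hjd, hd⟩ := ih hbs
    -- Push the tip into the plane of its neighbours. Then deform the smaller star to a convex
    -- corner, carrying the sum of its last and first directions along. Finally the rotation of the
    -- indices is undone along the whole path.
    have j1 : JoinedIn (starSet (m + 2)) c (addDir b (b (Fin.last m) + b 0)) := by
      have hcv : JoinedIn (Set.Icc (0 : ℝ) 1) 0 1 :=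
        ((convex_Icc (0 : ℝ) 1).isPathConnected ⟨0, by simp⟩).joinedIn 0 (by simp) 1 (by simp)
      have hct : Continuous fun s : ℝ => addDir b ((1 - s) • t + s • (b (Fin.last m) + b 0)) := by
        refine Continuous.finSnoc (A := fun _ => E3) continuous_const ?_
        fun_prop
      have := (hcv.map_continuousOn hct.continuousOn).mono (V := starSet (m + 2)) (by
        rintro _ ⟨s, hs, rfl⟩; exact hpath s hs.1 hs.2)
      simpa [hcb] using this
    have j2 : JoinedIn (starSet (m + 2)) (addDir b (b (Fin.last m) + b 0))
        (addDir d (d (Fin.last m) + d 0)) := by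
      have hct : Continuous fun e : Fin (m + 1) → E3 => addDir e (e (Fin.last m) + e 0) := by
        refine Continuous.finSnoc (A := fun _ => E3) continuous_id ?_
        fun_prop
      exact (hjd.map_continuousOn hct.continuousOn).mono (V := starSet (m + 2)) (by
        rintro _ ⟨e, he, rfl⟩; exact IsStar.addDir_flat he)
    set e := addDir d (d (Fin.last m) + d 0) with he
    have j3 : JoinedIn (starSet (m + 2)) a' fun i => e (i - r) := by
      have hct : Continuous fun (f : Fin (m + 2) → E3) (i : Fin (m + 2)) => f (i - r) := by fun_prop
      have := ((j1.trans j2).map_continuousOn hct.continuousOn).mono (V := starSet (m + 2)) (by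
        rintro _ ⟨f, hf, rfl⟩
        have := IsStar.rotate hf (-r)
        simp only [← sub_eq_add_neg] at this
        exact this)
      simpa [hc] using this
    refine ⟨_, hj.trans j3, ?_⟩
    have : coneOver (fun i => e (i - r)) = coneOver d := by
      have := coneOver_rotate e (-r)
      simp only [← sub_eq_add_neg] at this
      rw [this, he, coneOver_addDir_flat]
    rw [this]; exact hd

end

end PolyhedralSurface

namespace PolyhedralSurface

noncomputable section

/-! ### Functions of stars that are determined by their values at convex corners -/

open Filter

variable {n : ℕ} [NeZero n]

/-- Successive normals may be parallel, namely when two faces are coplanar. They are not opposite,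
so the sector is then a ray. -/
theorem isClosed_sector_of_fold {a b : E3} (ha : a ≠ 0) (hab : 0 < ‖a‖ * ‖b‖ + inner ℝ a b) :
    IsClosed (sector a b) := by
  by_cases h : cross a b = 0
  · have hb := exists_smul_of_cross_eq_zero ha h
    set r := inner ℝ a b / ‖a‖ ^ 2 with hr
    have hn : 0 < ‖a‖ := norm_pos_iff.2 ha
    have hr0 : 0 ≤ r := by
      by_contra! hneg
      rw [hb, norm_smul, real_inner_smul_right, Real.norm_eq_abs, abs_of_neg hneg,
        real_inner_self_eq_norm_sq] at hab
      nlinarith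
    have : sector a b = {x | x = (inner ℝ a x / ‖a‖ ^ 2) • a} ∩ {x | 0 ≤ inner ℝ a x} := by
      ext x
      constructor
      · rintro ⟨s, t, hs, ht, rfl⟩
        have e : s • a + t • b = (s + t * r) • a := by rw [hb, smul_smul, add_smul]
        have e2 : inner ℝ a ((s + t * r) • a) = (s + t * r) * ‖a‖ ^ 2 := by
          rw [real_inner_smul_right, real_inner_self_eq_norm_sq]
        rw [e]
        refine ⟨?_, ?_⟩
        · change _ = (inner ℝ a _ / ‖a‖ ^ 2) • a
          rw [e2, mul_div_assoc, div_self (by positivity), mul_one]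
        · change 0 ≤ inner ℝ a _
          rw [e2]; positivity
      · rintro ⟨h1, h2⟩
        exact ⟨inner ℝ a x / ‖a‖ ^ 2, 0, div_nonneg h2 (by positivity), le_rfl, by
          rw [zero_smul, add_zero]; exact h1⟩
    rw [this]
    exact (isClosed_eq continuous_id (by fun_prop)).inter (isClosed_le continuous_const (by fun_prop))
  · exact isClosed_sector h

/-- The union of the sectors over the arcs of the Gauss image. -/
def normalCone (a : Fin n → E3) : Set E3 := ⋃ k, sector (nrm a k) (nrm a (k + 1))

theorem Immersed.isClosed_normalCone {a : Fin n → E3} (ha : Immersed a) :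
    IsClosed (normalCone a) :=
  isClosed_iUnion_of_finite fun k => isClosed_sector_of_fold (ha.cross_ne k) (ha.fold k)

theorem smul_mem_normalCone_iff {a : Fin n → E3} {r : ℝ} (hr : 0 < r) {x : E3} :
    r • x ∈ normalCone a ↔ x ∈ normalCone a := by
  simp only [normalCone, Set.mem_iUnion]
  refine exists_congr fun k => ?_
  have := smul_mem_sector_iff (x := x) (a := nrm a k) (b := nrm a (k + 1)) hr one_pos one_pos
  rwa [one_smul, one_smul] at this

theorem zero_mem_normalCone (a : Fin n → E3) : (0 : E3) ∈ normalCone a :=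
  Set.mem_iUnion.2 ⟨0, 0, 0, le_rfl, le_rfl, by simp⟩

/-- A vector in the cone over the Gauss image is orthogonal to some edge. -/
theorem exists_inner_eq_zero_of_mem_normalCone {a : Fin n → E3} {x : E3} (h : x ∈ normalCone a) :
    ∃ k, inner ℝ x (a k) = 0 := by
  obtain ⟨k, s, t, -, -, rfl⟩ := Set.mem_iUnion.1 h
  refine ⟨k + 1, ?_⟩
  rw [inner_add_left, real_inner_smul_left, real_inner_smul_left, real_inner_comm,
    real_inner_comm _ (nrm a (k + 1)), nrm, nrm, inner_cross_right, inner_cross_left]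
  simp

theorem EmbeddedStar.mem_sphere_diff_iff {S : EmbeddedStar n} {x : E3} :
    x ∈ unitSphere \ S.gaussImage ↔ ‖x‖ = 1 ∧ x ∉ normalCone S.dir := by
  simp only [Set.mem_sdiff, mem_sphere_zero_iff_norm, S.mem_gaussImage_iff, normalCone,
    Set.mem_iUnion]
  tauto

theorem dense_inner_ne_zero {v : E3} (hv : v ≠ 0) : Dense {x : E3 | inner ℝ x v ≠ 0} := by
  intro x
  rw [mem_closure_iff_frequently]
  by_cases hx : inner ℝ x v = 0
  · have h : Tendsto (fun τ : ℝ => x + (1 * τ) • v) (𝓝[>] 0) (𝓝 x) := tendsto_add_smul x v 1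
    refine h.frequently (Eventually.frequently ?_)
    filter_upwards [eventually_pos_nhdsGT] with τ hτ
    rw [one_mul, inner_add_left, real_inner_smul_left, hx, zero_add, real_inner_self_eq_norm_sq]
    have := norm_pos_iff.2 hv
    positivity
  · have : ∀ᶠ y in 𝓝 x, y ∈ {x : E3 | inner ℝ x v ≠ 0} :=
      (isOpen_ne_fun (by fun_prop) continuous_const).mem_nhds hx
    exact this.frequently

/-- The complement of finitely many planes is dense, so an open condition can be met off all of
them. -/
theorem exists_forall_inner_ne_zero {ι : Type*} [Finite ι] {v : ι → E3} (hv : ∀ i, v i ≠ 0)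
    {x : E3} {P : E3 → Prop} (hP : ∀ᶠ y in 𝓝 x, P y) : ∃ y, P y ∧ ∀ i, inner ℝ y (v i) ≠ 0 := by
  have hd : Dense (⋂ i, {x : E3 | inner ℝ x (v i) ≠ 0}) :=
    dense_iInter_of_isOpen (fun i => isOpen_ne_fun (by fun_prop) continuous_const)
      fun i => dense_inner_ne_zero (hv i)
  obtain ⟨y, hy, hyd⟩ := ((mem_closure_iff_frequently.1 (hd x)).and_eventually hP).exists
  exact ⟨y, hyd, fun i => Set.mem_iInter.1 hy i⟩

/-- A function on the line that is locally constant off a discrete set, and does not jump there. -/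
theorem eq_of_no_jump {X : Type*} {Φ : ℝ → X} {T : Set ℝ}
    (h1 : ∀ t ∉ T, ∀ᶠ s in 𝓝 t, Φ s = Φ t) (h2 : ∀ t, ∀ᶠ s in 𝓝[≠] t, s ∉ T)
    (h3 : ∀ t, ∃ᶠ h in 𝓝[>] (0 : ℝ), Φ (t + h) = Φ (t - h)) {s t : ℝ} (hs : s ∉ T) (ht : t ∉ T) :
    Φ s = Φ t := by
  -- The values on the two sides of `t` agree, so `Φ` has a locally constant modification `Ψ` that
  -- differs from it only on `T`.
  have key : ∀ t, ∃ c, ∃ δ > 0, ∀ s, s ≠ t → |s - t| < δ → Φ s = c := by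
    intro t
    obtain ⟨δ, hδ, hT⟩ := Metric.mem_nhdsWithin_iff.1 (h2 t)
    have hT' : ∀ s, s ≠ t → |s - t| < δ → s ∉ T := fun s hst hs =>
      hT ⟨by rwa [Metric.mem_ball, Real.dist_eq], hst⟩
    have hright : ∀ s ∈ Set.Ioo t (t + δ), ∀ s' ∈ Set.Ioo t (t + δ), Φ s = Φ s' := by
      intro s hs s' hs'
      refine eq_of_locally_eq isPreconnected_Ioo (fun r hr => h1 r (hT' r hr.1.ne' ?_)) hs hs'
      rw [abs_lt]; constructor <;> linarith [hr.1, hr.2]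
    have hleft : ∀ s ∈ Set.Ioo (t - δ) t, ∀ s' ∈ Set.Ioo (t - δ) t, Φ s = Φ s' := by
      intro s hs s' hs'
      refine eq_of_locally_eq isPreconnected_Ioo (fun r hr => h1 r (hT' r hr.2.ne ?_)) hs hs'
      rw [abs_lt]; constructor <;> linarith [hr.1, hr.2]
    obtain ⟨h, hh, hpos, hlt⟩ := ((h3 t).and_eventually (eventually_pos_nhdsGT.and
      (nhdsWithin_le_nhds (eventually_lt_nhds hδ)))).exists
    refine ⟨Φ (t + h), δ, hδ, fun s hst hs => ?_⟩
    rw [abs_lt] at hs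
    rcases lt_or_gt_of_ne hst with h' | h'
    · rw [hh]
      exact hleft _ ⟨by linarith, h'⟩ _ ⟨by linarith, by linarith⟩
    · exact hright _ ⟨h', by linarith⟩ _ ⟨by linarith, by linarith⟩
  choose Ψ hΨ using key
  have heq : ∀ t ∉ T, Ψ t = Φ t := by
    intro t ht
    obtain ⟨δ, hδ, h⟩ := hΨ t
    have h4 : ∀ᶠ s in 𝓝[>] t, Φ s = Φ t := nhdsWithin_le_nhds (h1 t ht)
    have h5 : ∀ᶠ s in 𝓝[>] t, t < s := self_mem_nhdsWithin
    have h6 : ∀ᶠ s in 𝓝[>] t, s < t + δ :=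
      nhdsWithin_le_nhds (eventually_lt_nhds (show t < t + δ by linarith))
    obtain ⟨s, h', hpos, hlt⟩ := (h4.and (h5.and h6)).exists
    rw [← h', h s (ne_of_gt hpos)]
    rw [abs_lt]; constructor <;> linarith
  rw [← heq s hs, ← heq t ht]
  refine eq_of_locally_eq isPreconnected_univ (fun r _ => ?_) trivial trivial
  obtain ⟨δ, hδ, h⟩ := hΨ r
  filter_upwards [Metric.ball_mem_nhds r hδ] with s hs
  rw [Metric.mem_ball, Real.dist_eq] at hs
  by_cases hsr : s = r
  · rw [hsr]
  · obtain ⟨δ', hδ', h'⟩ := hΨ s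
    have h4 : ∀ᶠ y in 𝓝[≠] s, Φ y = Ψ s := by
      filter_upwards [self_mem_nhdsWithin, nhdsWithin_le_nhds (Metric.ball_mem_nhds s hδ')]
        with y hy hy'
      exact h' y hy (by rwa [Metric.mem_ball, Real.dist_eq] at hy')
    have h5 : ∀ᶠ y in 𝓝[≠] s, y ≠ r ∧ |y - r| < δ :=
      nhdsWithin_le_nhds ((eventually_ne_nhds hsr).and
        ((isOpen_lt (by fun_prop) continuous_const).mem_nhds hs))
    obtain ⟨y, hy1, hy2, hy3⟩ := (h4.and h5).exists
    rw [← hy1, h y hy2 hy3]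

/-- The properties of winding numbers that concern a single star, up to jumps. -/
structure NoJump {X : Type*} (S : EmbeddedStar n) (d : E3 → X) : Prop where
  const : ∀ ξ η : E3, ξ ∈ unitSphere \ S.gaussImage → η ∈ S.component ξ → d η = d ξ
  crossing : ∀ p u : E3, ‖p‖ = 1 → ‖u‖ = 1 → inner ℝ p u = 0 → (∀ k, p ≠ S.normal k) →
    (∀ k, p ∈ S.arc k → inner ℝ u (cross (S.normal k) (S.normal (k + 1))) ≠ 0) →
    ∀ᶠ t : ℝ in 𝓝[>] 0,
      d (Real.cos t • p + Real.sin t • u) = d (Real.cos t • p - Real.sin t • u)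

theorem EmbeddedStar.normalize_mem {S : EmbeddedStar n} {x : E3} (hx : x ∉ normalCone S.dir) :
    (‖x‖⁻¹ : ℝ) • x ∈ unitSphere \ S.gaussImage := by
  have h0 : x ≠ 0 := fun h => hx (h ▸ zero_mem_normalCone _)
  rw [mem_sphere_diff_iff, smul_mem_normalCone_iff (inv_pos.2 (norm_pos_iff.2 h0))]
  exact ⟨norm_normalize h0, hx⟩

/-- Points of a convex set off the normal cone project to a single component. -/
theorem EmbeddedStar.normalize_mem_component {S : EmbeddedStar n} {B : Set E3} (hB : IsPreconnected B)
    (hd : ∀ x ∈ B, x ∉ normalCone S.dir) {x y : E3} (hx : x ∈ B) (hy : y ∈ B) :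
    (‖y‖⁻¹ : ℝ) • y ∈ S.component ((‖x‖⁻¹ : ℝ) • x) := by
  have h0 : ∀ x ∈ B, x ≠ 0 := fun x hx h => hd x hx (h ▸ zero_mem_normalCone _)
  have hc : ContinuousOn (fun z : E3 => (‖z‖⁻¹ : ℝ) • z) B :=
    (continuous_norm.continuousOn.inv₀ fun z hz => norm_ne_zero_iff.2 (h0 z hz)).smul
      continuousOn_id
  refine (hB.image _ hc).subset_connectedComponentIn ⟨x, hx, rfl⟩ ?_ ⟨y, hy, rfl⟩
  rintro _ ⟨z, hz, rfl⟩
  exact normalize_mem (hd z hz)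

variable {X : Type*} {S : EmbeddedStar n} {d : E3 → X}

theorem NoJump.eventually_eq (hd : NoJump S d) {x : E3} (hx : x ∉ normalCone S.dir) :
    ∀ᶠ y in 𝓝 x, d ((‖y‖⁻¹ : ℝ) • y) = d ((‖x‖⁻¹ : ℝ) • x) := by
  obtain ⟨ε, hε, hB⟩ := Metric.isOpen_iff.1 S.isStar_dir.immersed.isClosed_normalCone.isOpen_compl
    x hx
  filter_upwards [Metric.ball_mem_nhds x hε] with y hy
  exact hd.const _ _ (EmbeddedStar.normalize_mem hx) (EmbeddedStar.normalize_mem_component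
    (convex_ball x ε).isPreconnected hB (Metric.mem_ball_self hε) hy)

theorem norm_cos_sin {p u : E3} (hp : ‖p‖ = 1) (hu : ‖u‖ = 1) (hpu : inner ℝ p u = 0) (t : ℝ) :
    ‖Real.cos t • p + Real.sin t • u‖ = 1 := by
  have : ‖Real.cos t • p + Real.sin t • u‖ ^ 2 = 1 := by
    rw [norm_add_sq_real, norm_smul, norm_smul, real_inner_smul_left, real_inner_smul_right, hpu,
      hp, hu, Real.norm_eq_abs, Real.norm_eq_abs, mul_one, mul_one, sq_abs, sq_abs]
    linarith [Real.cos_sq_add_sin_sq t]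
  exact (pow_eq_one_iff_of_nonneg (norm_nonneg _) two_ne_zero).1 this

/-- A great circle that avoids the vertices of the Gauss image crosses its arcs transversally. -/
theorem det3_ne_zero_of_mem_sector {a : Fin n → E3} (ha : Immersed a) {m p u : E3}
    (hp0 : p ≠ 0) (hpu : cross p u ≠ 0) (hp : inner ℝ m p = 0) (hu : inner ℝ m u = 0)
    (hm : ∀ k, inner ℝ m (nrm a k) ≠ 0) {k : Fin n}
    (h : p ∈ sector (nrm a k) (nrm a (k + 1))) : det3 u (nrm a k) (nrm a (k + 1)) ≠ 0 := by
  intro h0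
  have hcr : cross (nrm a k) (nrm a (k + 1)) ≠ 0 := by
    intro hc
    obtain ⟨s, t, -, -, he⟩ := h
    rw [exists_smul_of_cross_eq_zero (ha.cross_ne k) hc, smul_smul, ← add_smul] at he
    rw [he, real_inner_smul_right] at hp
    rcases mul_eq_zero.1 hp with h1 | h1
    · exact hp0 (by rw [he, h1, zero_smul])
    · exact hm k h1
  obtain ⟨s, t, -, -, he⟩ := h
  have hp1 : det3 (nrm a k) (nrm a (k + 1)) p = 0 := by
    rw [he]; simp [det3_add_right, det3_smul_right]
  have hN : det3 p u (nrm a k) = 0 := by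
    obtain ⟨s', t', he'⟩ := exists_combination hcr (x := u) (by rw [← det3_rotate]; exact h0)
    rw [he, he']
    simp only [det3]
    simp
    ring
  obtain ⟨r, r', hr⟩ := exists_combination hpu hN
  apply hm k
  rw [hr, inner_add_right, real_inner_smul_right, real_inner_smul_right, hp, hu]
  simp

/-- A great circle without vertices of the Gauss image crosses all arcs transversally, so the
exceptional parameters are isolated, and there is no jump at any of them. -/
theorem NoJump.eq_on_circle (hd : NoJump S d) {e f : E3} (he : ‖e‖ = 1) (hf : ‖f‖ = 1)
    (hef : inner ℝ e f = 0) (hm : ∀ k, inner ℝ (cross e f) (nrm S.dir k) ≠ 0) {s t : ℝ}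
    (hs : Real.cos s • e + Real.sin s • f ∉ normalCone S.dir)
    (ht : Real.cos t • e + Real.sin t • f ∉ normalCone S.dir) :
    d (Real.cos s • e + Real.sin s • f) = d (Real.cos t • e + Real.sin t • f) := by
  set x : ℝ → E3 := fun t => Real.cos t • e + Real.sin t • f with hx
  set u : ℝ → E3 := fun t => Real.cos t • f - Real.sin t • e with hu
  have hxn : ∀ t, ‖x t‖ = 1 := norm_cos_sin he hf hef
  have hux : ∀ t, u t = Real.cos t • f + Real.sin t • (-e) := fun t => by simp only [hu]; module
  have hun : ∀ t, ‖u t‖ = 1 := fun t => by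
    rw [hux]; exact norm_cos_sin hf (by rwa [norm_neg])
      (by rw [inner_neg_right, real_inner_comm, hef, neg_zero]) t
  have hxc : Continuous x := by fun_prop
  have hxu : ∀ t, inner ℝ (x t) (u t) = 0 := fun t => by
    simp only [hx, hu, inner_add_left, inner_sub_right, real_inner_smul_left, real_inner_smul_right,
      hef, real_inner_comm e f, real_inner_self_eq_norm_sq, he, hf]
    ring
  have hadd : ∀ t h, x (t + h) = Real.cos h • x t + Real.sin h • u t := fun t h => by
    simp only [hx, hu, Real.cos_add, Real.sin_add]; module
  have hsub : ∀ t h, x (t - h) = Real.cos h • x t - Real.sin h • u t := fun t h => by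
    simp only [hx, hu, Real.cos_sub, Real.sin_sub]; module
  have hcr : ∀ t, cross (x t) (u t) = cross e f := fun t => by
    have h1 := Real.cos_sq_add_sin_sq t
    refine ext_coords ?_ ?_ ?_ <;> simp [hx, hu]
    · linear_combination (e 1 * f 2 - e 2 * f 1) * h1
    · linear_combination (e 2 * f 0 - e 0 * f 2) * h1
    · linear_combination (e 0 * f 1 - e 1 * f 0) * h1
  have hx0 : ∀ t, x t ≠ 0 := fun t h => by simpa [h] using hxn t
  have hmx : ∀ t, inner ℝ (cross e f) (x t) = 0 := fun t => by
    rw [← hcr t, real_inner_comm, inner_cross_left]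
  have hmu : ∀ t, inner ℝ (cross e f) (u t) = 0 := fun t => by
    rw [← hcr t, real_inner_comm, inner_cross_right]
  have hef0 : cross e f ≠ 0 := fun h => hm 0 (by rw [h, inner_zero_left])
  have htr : ∀ t k, x t ∈ sector (nrm S.dir k) (nrm S.dir (k + 1)) →
      det3 (u t) (nrm S.dir k) (nrm S.dir (k + 1)) ≠ 0 := fun t k h =>
    det3_ne_zero_of_mem_sector S.isStar_dir.immersed (hx0 t) (by rw [hcr]; exact hef0) (hmx t)
      (hmu t) hm h
  refine eq_of_no_jump (Φ := fun t => d (x t)) (T := {t | x t ∈ normalCone S.dir}) ?_ ?_ ?_ hs ht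
  · intro t ht
    filter_upwards [hxc.continuousAt.eventually (hd.eventually_eq (x := x t) ht)] with s hs
    simpa only [hxn, inv_one, one_smul] using hs
  · intro t
    have : ∀ᶠ s in 𝓝[≠] t, ∀ k, x s ∉ sector (nrm S.dir k) (nrm S.dir (k + 1)) := by
      refine eventually_all.2 fun k => ?_
      have him := S.isStar_dir.immersed
      by_cases h : x t ∈ sector (nrm S.dir k) (nrm S.dir (k + 1))
      · have hdv : HasDerivAt (fun s => det3 (x s) (nrm S.dir k) (nrm S.dir (k + 1)))
            (det3 (u t) (nrm S.dir k) (nrm S.dir (k + 1))) t := by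
          have h1 : HasDerivAt (fun s => Real.cos s * det3 e (nrm S.dir k) (nrm S.dir (k + 1)) +
              Real.sin s * det3 f (nrm S.dir k) (nrm S.dir (k + 1)))
              (-Real.sin t * det3 e (nrm S.dir k) (nrm S.dir (k + 1)) +
              Real.cos t * det3 f (nrm S.dir k) (nrm S.dir (k + 1))) t :=
            ((Real.hasDerivAt_cos t).mul_const _).add ((Real.hasDerivAt_sin t).mul_const _)
          convert h1 using 1
          · funext s; simp only [hx, det3_add_left, det3_smul_left]
          · rw [hux]; simp only [det3_add_left, det3_smul_left, det3_neg_left]; ring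
        filter_upwards [hdv.eventually_ne (c := 0) (htr t k h)] with s hs hmem
        apply hs
        obtain ⟨r, r', -, -, hr⟩ := hmem
        rw [hr]; simp [det3_add_left, det3_smul_left]
      · exact nhdsWithin_le_nhds (hxc.continuousAt.eventually
          ((isClosed_sector_of_fold (him.cross_ne k) (him.fold k)).isOpen_compl.mem_nhds h))
    filter_upwards [this] with s hs hmem
    obtain ⟨k, hk⟩ := Set.mem_iUnion.1 hmem
    exact hs k hk
  · intro t
    refine Eventually.frequently ?_
    have hpos := S.norm_nrm_pos
    have hv : ∀ k, x t ≠ S.normal k := fun k hk => by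
      apply hm k
      have := hmx t
      rw [hk, S.normal_eq, real_inner_smul_right] at this
      exact (mul_eq_zero.1 this).resolve_left (inv_pos.2 (hpos k)).ne'
    have hi : ∀ k, x t ∈ S.arc k → inner ℝ (u t) (cross (S.normal k) (S.normal (k + 1))) ≠ 0 :=
      fun k hk => by
        rw [S.normal_eq, S.normal_eq, cross_smul_smul, real_inner_smul_right, inner_cross]
        exact mul_ne_zero (mul_pos (inv_pos.2 (hpos _)) (inv_pos.2 (hpos _))).ne'
          (htr t k (S.mem_arc_iff.1 hk).2)
    filter_upwards [hd.crossing (x t) (u t) (hxn t) (hun t) (hxu t) hv hi] with h hh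
    simpa only [hadd, hsub] using hh

/-- A function without jumps is constant off the Gauss image. -/
theorem NoJump.eq (hd : NoJump S d) {x y : E3} (hx : x ∉ normalCone S.dir)
    (hy : y ∉ normalCone S.dir) : d ((‖x‖⁻¹ : ℝ) • x) = d ((‖y‖⁻¹ : ℝ) • y) := by
  have hop := S.isStar_dir.immersed.isClosed_normalCone.isOpen_compl
  -- First `x` is moved off the planes orthogonal to the edges, so that it is parallel to no normal;
  -- then `y` is moved off the planes through `x'` and a normal. The great circle through the new
  -- points avoids all normals.
  obtain ⟨x', ⟨hxx, hx'⟩, hxn⟩ := exists_forall_inner_ne_zero (v := S.dir) S.dir_ne_zero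
    ((hd.eventually_eq hx).and (hop.mem_nhds hx))
  obtain ⟨y', ⟨hyy, hy'⟩, hyn⟩ := exists_forall_inner_ne_zero
    (v := fun k => cross (nrm S.dir k) x') (fun k h => by
      have := exists_smul_of_cross_eq_zero (S.cross_dir_ne k) h
      apply hxn k
      rw [this, real_inner_smul_left, real_inner_comm (S.dir k)]
      exact mul_eq_zero_of_right _ (inner_cross_left _ _))
    ((hd.eventually_eq hy).and (hop.mem_nhds hy))
  rw [← hxx, ← hyy]
  have hx0 : x' ≠ 0 := fun h => hx' (h ▸ zero_mem_normalCone _)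
  have hy0 : y' ≠ 0 := fun h => hy' (h ▸ zero_mem_normalCone _)
  have hnx := norm_pos_iff.2 hx0
  have hny := norm_pos_iff.2 hy0
  set e : E3 := (‖x'‖⁻¹ : ℝ) • x' with he
  have hen : ‖e‖ = 1 := norm_normalize hx0
  set c : ℝ := inner ℝ e y' with hc
  set f0 : E3 := y' - c • e with hf0
  have hdet : ∀ k, inner ℝ (cross e f0) (nrm S.dir k) =
      ‖x'‖⁻¹ * inner ℝ y' (cross (nrm S.dir k) x') := fun k => by
    rw [real_inner_comm, inner_cross, inner_cross, hf0, he]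
    simp only [det3]
    simp
    ring
  have hf00 : f0 ≠ 0 := fun h => by
    have := hdet 0
    have h2 : cross e (0 : E3) = 0 := by refine ext_coords ?_ ?_ ?_ <;> simp
    rw [h, h2, inner_zero_left] at this
    exact (mul_ne_zero (inv_pos.2 hnx).ne' (hyn 0)) this.symm
  have hnf := norm_pos_iff.2 hf00
  set f : E3 := (‖f0‖⁻¹ : ℝ) • f0 with hf
  have hfn : ‖f‖ = 1 := norm_normalize hf00
  have hef0 : inner ℝ e f0 = 0 := by
    rw [hf0, inner_sub_right, real_inner_smul_right, real_inner_self_eq_norm_sq, hen, ← hc]; ring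
  have hef : inner ℝ e f = 0 := by rw [hf, real_inner_smul_right, hef0, mul_zero]
  have hyd : y' = c • e + ‖f0‖ • f := by
    have h1 : ‖f0‖ • f = f0 := by rw [hf, smul_smul, mul_inv_cancel₀ hnf.ne', one_smul]
    rw [h1, hf0]; module
  have hys : ‖y'‖ ^ 2 = c ^ 2 + ‖f0‖ ^ 2 := by
    have h1 : y' = c • e + f0 := by rw [hf0]; module
    rw [h1, norm_add_sq_real, norm_smul, hen, real_inner_smul_left, hef0, Real.norm_eq_abs, mul_one,
      sq_abs]
    ring
  -- Its argument is the parameter of `y'` on the great circle.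
  set z : ℂ := ⟨c, ‖f0‖⟩ with hz
  have hzn : ‖z‖ = ‖y'‖ := by
    rw [← abs_of_pos hny, ← abs_of_nonneg (norm_nonneg z), ← sq_eq_sq_iff_abs_eq_abs, hys,
      ← Complex.normSq_eq_norm_sq, Complex.normSq_apply]
    simp only [hz]; ring
  have hz0 : z ≠ 0 := fun h => hny.ne' (by rw [← hzn, h, norm_zero])
  have hy1 : (‖y'‖⁻¹ : ℝ) • y' = Real.cos z.arg • e + Real.sin z.arg • f := by
    rw [Complex.cos_arg hz0, Complex.sin_arg, hzn]
    conv_lhs => rw [hyd]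
    simp only [hz, smul_add, smul_smul, div_eq_inv_mul]
    rw [← hyd]
  have hm : ∀ k, inner ℝ (cross e f) (nrm S.dir k) ≠ 0 := fun k => by
    have : cross e f = ‖f0‖⁻¹ • cross e f0 := by
      have := cross_smul_smul e f0 1 ‖f0‖⁻¹
      rwa [one_smul, one_mul] at this
    rw [this, real_inner_smul_left, hdet]
    exact mul_ne_zero (inv_pos.2 hnf).ne' (mul_ne_zero (inv_pos.2 hnx).ne' (hyn k))
  have h0 : e = Real.cos 0 • e + Real.sin 0 • f := by simp
  have hemem : Real.cos 0 • e + Real.sin 0 • f ∉ normalCone S.dir := by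
    rw [← h0, he, smul_mem_normalCone_iff (inv_pos.2 hnx)]; exact hx'
  have hymem : Real.cos z.arg • e + Real.sin z.arg • f ∉ normalCone S.dir := by
    rw [← hy1, smul_mem_normalCone_iff (inv_pos.2 hny)]; exact hy'
  have := hd.eq_on_circle hen hfn hef hm hemem hymem
  rwa [← h0, ← hy1] at this

/-- A quantity that is attached to stars and points off their Gauss images, and that has no jumps
and is invariant under deformations, is determined by its values at convex corners. -/
theorem exists_convex_eq {d : EmbeddedStar n → E3 → X} (hd : ∀ S, NoJump S (d S))
    (hdef : ∀ S : unitInterval → EmbeddedStar n,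
      Continuous (fun t => (S t).apex) → (∀ k, Continuous fun t => (S t).nbr k) →
      ∀ ξ ∈ unitSphere, (∀ t, ξ ∉ (S t).gaussImage) → d (S 0) ξ = d (S 1) ξ) (S : EmbeddedStar n) :
    ∃ S' : EmbeddedStar n, S'.apex = 0 ∧ IsConvexBoundary (coneOver S'.dir) ∧
      ∀ ξ ∈ unitSphere \ S.gaussImage, ∀ ξ' ∈ unitSphere \ S'.gaussImage, d S ξ = d S' ξ' := by
  obtain ⟨m, hm, rfl⟩ : ∃ m, 2 ≤ m ∧ n = m + 1 := ⟨n - 1, by have := S.three_le; omega, by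
    have := S.three_le; omega⟩
  obtain ⟨b, ⟨γ, hγ⟩, hb⟩ := IsStar.exists_joinedIn_convex hm (a := S.dir) S.isStar_dir
  have hst : ∀ t, IsStar (γ.extend t) := fun t => hγ _
  -- The apex travels to the origin, where the final cone `coneOver b` has its apex.
  set T : ℝ → EmbeddedStar (m + 1) := fun t => (hst t).toEmbedded ((1 - t) • S.apex) with hT
  have hdir : ∀ t, (T t).dir = γ.extend t := fun t => EmbeddedStar.dir_toEmbedded _ _
  have hconst : ∀ S : EmbeddedStar (m + 1), ∀ ξ ∈ unitSphere \ S.gaussImage,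
      ∀ ξ' ∈ unitSphere \ S.gaussImage, d S ξ = d S ξ' := by
    intro S ξ hξ ξ' hξ'
    rw [EmbeddedStar.mem_sphere_diff_iff] at hξ hξ'
    simpa only [hξ.1, hξ'.1, inv_one, one_smul] using (hd S).eq hξ.2 hξ'.2
  -- There is one value per star. The default `d (T t) 0` only serves the case that no point is left
  -- off the Gauss image.
  have hex : ∀ t, ∃ c, (∀ ξ ∈ unitSphere \ (T t).gaussImage, d (T t) ξ = c) := by
    intro t
    by_cases h : ∃ ξ, ξ ∈ unitSphere \ (T t).gaussImage
    · obtain ⟨ξ, hξ⟩ := h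
      exact ⟨d (T t) ξ, fun η hη => hconst _ _ hη _ hξ⟩
    · exact ⟨d (T t) 0, fun η hη => absurd ⟨η, hη⟩ h⟩
  choose D hD using hex
  have hloc : ∀ t ∈ (Set.univ : Set ℝ), ∀ᶠ s in 𝓝 t, D s = D t := by
    intro t _
    -- A vector that is orthogonal to no edge is off the Gauss image, also for nearby parameters.
    -- Deformation invariance at this fixed point makes `D` locally constant.
    obtain ⟨y, -, hy⟩ := exists_forall_inner_ne_zero (v := γ.extend t)
      (fun k => cross_ne_zero_left ((hst t).cross_ne k)) (x := 0) (P := fun _ => True)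
      (Eventually.of_forall fun _ => trivial)
    have hy0 : y ≠ 0 := fun h => hy 0 (by rw [h, inner_zero_left])
    have hnear : ∀ᶠ s in 𝓝 t, ∀ k, inner ℝ y (γ.extend s k) ≠ 0 := by
      refine eventually_all.2 fun k => ?_
      have : Continuous fun s => inner ℝ y (γ.extend s k) :=
        continuous_const.inner ((continuous_apply k).comp γ.continuous_extend)
      exact this.continuousAt.eventually_ne (hy k)
    obtain ⟨δ, hδ, hball⟩ := Metric.eventually_nhds_iff_ball.1 hnear
    have hoff : ∀ s ∈ Metric.ball t δ, (‖y‖⁻¹ : ℝ) • y ∈ unitSphere \ (T s).gaussImage := by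
      intro s hs
      refine EmbeddedStar.normalize_mem fun hmem => ?_
      obtain ⟨k, hk⟩ := exists_inner_eq_zero_of_mem_normalCone hmem
      rw [hdir] at hk
      exact hball s hs k hk
    filter_upwards [Metric.ball_mem_nhds t hδ] with s hs
    have hc : Continuous fun r : unitInterval => t + (r : ℝ) * (s - t) := by fun_prop
    have hr : ∀ r : unitInterval, t + (r : ℝ) * (s - t) ∈ Metric.ball t δ := by
      intro r
      rw [Metric.mem_ball, Real.dist_eq] at hs ⊢
      rw [add_sub_cancel_left, abs_mul, abs_of_nonneg r.2.1]
      exact (mul_le_of_le_one_left (abs_nonneg _) r.2.2).trans_lt hs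
    have := hdef (fun r => T (t + (r : ℝ) * (s - t)))
      (by
        change Continuous fun r : unitInterval => (1 - (t + (r : ℝ) * (s - t))) • S.apex
        fun_prop)
      (fun k => by
        change Continuous fun r : unitInterval =>
          (1 - (t + (r : ℝ) * (s - t))) • S.apex + γ.extend (t + (r : ℝ) * (s - t)) k
        have h1 : Continuous fun r : unitInterval => γ.extend (t + (r : ℝ) * (s - t)) k :=
          (continuous_apply k).comp (γ.continuous_extend.comp hc)
        fun_prop)
      _ (hoff t (Metric.mem_ball_self hδ)).1 (fun r => (hoff _ (hr r)).2)
    simp only [Set.Icc.coe_zero, zero_mul, add_zero, Set.Icc.coe_one, one_mul,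
      add_sub_cancel] at this
    rw [← hD t _ (hoff t (Metric.mem_ball_self hδ)), ← hD s _ (hoff s hs), this]
  have h01 : D 0 = D 1 := eq_of_locally_eq isPreconnected_univ hloc trivial trivial
  have h0 : T 0 = S := by
    refine EmbeddedStar.ext' ?_ ?_
    · change (1 - (0 : ℝ)) • S.apex = _
      simp
    · funext k
      change (1 - (0 : ℝ)) • S.apex + γ.extend 0 k = _
      rw [γ.extend_zero, S.nbr_eq]; simp
  refine ⟨T 1, ?_, ?_, fun ξ hξ ξ' hξ' => ?_⟩
  · change (1 - (1 : ℝ)) • S.apex = _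
    simp
  · rw [hdir, γ.extend_one]; exact hb
  · rw [hD 1 ξ' hξ', ← h01, ← hD 0 ξ (by rwa [h0]), h0]

theorem EmbeddedStar.cone_eq (S : EmbeddedStar n) (h : S.apex = 0) : S.cone = coneOver S.dir := by
  simp only [cone, coneOver, sector, dir, h, zero_add]

end

end PolyhedralSurface

namespace PolyhedralSurface

noncomputable section

/-! ### The surface measure of the sphere -/

open Filter

open scoped Pointwise

/-- A linear isometry as a map of the sphere. -/
def sphereMap (L : E3 ≃ₗᵢ[ℝ] E3) (x : Metric.sphere (0 : E3) 1) : Metric.sphere (0 : E3) 1 :=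
  ⟨L x, by rw [mem_sphere_zero_iff_norm, L.norm_map]; exact mem_sphere_zero_iff_norm.1 x.2⟩

theorem continuous_sphereMap (L : E3 ≃ₗᵢ[ℝ] E3) : Continuous (sphereMap L) :=
  (L.continuous.comp continuous_subtype_val).subtype_mk _

/-- The area of a set is a multiple of the volume of the truncated cone over it, and a linear
isometry maps such cones to each other. -/
theorem measurePreserving_sphereMap (L : E3 ≃ₗᵢ[ℝ] E3) :
    MeasurePreserving (sphereMap L) sphereArea sphereArea := by
  have hm := (continuous_sphereMap L).measurable
  refine ⟨hm, Measure.ext fun s hs => ?_⟩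
  rw [Measure.map_apply hm hs, sphereArea, Measure.toSphere_apply' _ (hm hs),
    Measure.toSphere_apply' _ hs]
  congr 1
  have : (Set.Ioo (0 : ℝ) 1 • (Subtype.val '' (sphereMap L ⁻¹' s)) : Set E3) =
      L ⁻¹' (Set.Ioo (0 : ℝ) 1 • (Subtype.val '' s)) := by
    ext x
    simp only [Set.mem_smul, Set.mem_image, Set.mem_preimage]
    constructor
    · rintro ⟨r, hr, _, ⟨y, hy, rfl⟩, rfl⟩
      exact ⟨r, hr, _, ⟨_, hy, rfl⟩, (L.map_smul r y).symm⟩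
    · rintro ⟨r, hr, _, ⟨y, hy, rfl⟩, h⟩
      have e : sphereMap L (sphereMap L.symm y) = y := Subtype.ext (L.apply_symm_apply _)
      refine ⟨r, hr, _, ⟨sphereMap L.symm y, by rwa [e], rfl⟩, L.injective ?_⟩
      rw [← h, L.map_smul]
      exact congrArg (fun z => r • z) (L.apply_symm_apply _)
  rw [this]
  exact L.measurePreserving.measure_preimage_equiv (f := L.toMeasurableEquiv) _

theorem sphereArea_univ : sphereArea Set.univ = ENNReal.ofReal (4 * Real.pi) := by
  rw [sphereArea, Measure.toSphere_apply_univ, EuclideanSpace.volume_ball_fin_three]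
  simp only [finrank_euclideanSpace, Fintype.card_fin, ENNReal.ofReal_one, one_pow, one_mul]
  rw [← ENNReal.ofReal_natCast, ← ENNReal.ofReal_mul (by positivity)]
  congr 1
  push_cast; ring

/-- Great circles have area zero. -/
theorem sphereArea_inner_eq_zero {v : E3} (hv : v ≠ 0) :
    sphereArea {x : Metric.sphere (0 : E3) 1 | inner ℝ (x : E3) v = 0} = 0 := by
  have hm : MeasurableSet {x : Metric.sphere (0 : E3) 1 | inner ℝ (x : E3) v = 0} :=
    (isClosed_eq (by fun_prop) continuous_const).measurableSet
  rw [sphereArea, Measure.toSphere_apply' _ hm]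
  refine mul_eq_zero_of_right _ (measure_mono_null (t := ((Submodule.span ℝ {v})ᗮ : Submodule ℝ E3))
    ?_ (Measure.addHaar_submodule _ _ ?_))
  · rintro _ ⟨r, -, _, ⟨x, hx, rfl⟩, rfl⟩
    change inner ℝ (x : E3) v = 0 at hx
    simp only [SetLike.mem_coe, Submodule.mem_orthogonal_singleton_iff_inner_left]
    rw [real_inner_smul_left, hx, mul_zero]
  · intro h
    have : v ∈ (Submodule.span ℝ {v})ᗮ := by rw [h]; trivial
    rw [Submodule.mem_orthogonal_singleton_iff_inner_left] at this
    exact hv (inner_self_eq_zero.1 this)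

/-- The area of an open hemisphere. -/
theorem sphereArea_hemisphere {v : E3} (hv : v ≠ 0) :
    sphereArea {x : Metric.sphere (0 : E3) 1 | inner ℝ (x : E3) v < 0} =
      ENNReal.ofReal (2 * Real.pi) := by
  set A := {x : Metric.sphere (0 : E3) 1 | inner ℝ (x : E3) v < 0} with hA
  set B := {x : Metric.sphere (0 : E3) 1 | 0 < inner ℝ (x : E3) v} with hB
  set Z := {x : Metric.sphere (0 : E3) 1 | inner ℝ (x : E3) v = 0} with hZ
  have hAm : MeasurableSet A := (isOpen_lt (by fun_prop) continuous_const).measurableSet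
  have hBm : MeasurableSet B := (isOpen_lt continuous_const (by fun_prop)).measurableSet
  have hAB : sphereArea A = sphereArea B := by
    have := (measurePreserving_sphereMap (LinearIsometryEquiv.neg ℝ)).measure_preimage
      hBm.nullMeasurableSet
    rw [← this]
    congr 1
    ext x
    change inner ℝ (x : E3) v < 0 ↔ 0 < inner ℝ (-(x : E3)) v
    rw [inner_neg_left, neg_pos]
  have hU : (Set.univ : Set (Metric.sphere (0 : E3) 1)) = A ∪ B ∪ Z := by
    ext x
    simp only [Set.mem_univ, true_iff]
    rcases lt_trichotomy (inner ℝ (x : E3) v) 0 with h | h | h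
    · exact Or.inl (Or.inl h)
    · exact Or.inr h
    · exact Or.inl (Or.inr h)
  have h4 : sphereArea A + sphereArea A = ENNReal.ofReal (4 * Real.pi) := by
    have hZm : MeasurableSet Z := (isClosed_eq (by fun_prop) continuous_const).measurableSet
    have d1 : Disjoint A B := Set.disjoint_left.2 fun x h1 h2 =>
      lt_asymm (show inner ℝ (x : E3) v < 0 from h1) h2
    have d2 : Disjoint (A ∪ B) Z := Set.disjoint_left.2 fun x h1 h2 => h1.elim
      (fun h => (show inner ℝ (x : E3) v < 0 from h).ne h2)
      fun h => (show 0 < inner ℝ (x : E3) v from h).ne' h2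
    rw [← sphereArea_univ, hU, measure_union d2 hZm, sphereArea_inner_eq_zero hv,
      measure_union d1 hBm, ← hAB, add_zero]
  have hfin : sphereArea A ≠ ⊤ := measure_ne_top _ _
  rw [← ENNReal.ofReal_toReal hfin] at h4 ⊢
  rw [← ENNReal.ofReal_add (by positivity) (by positivity),
    ENNReal.ofReal_eq_ofReal_iff (by positivity) (by positivity)] at h4
  congr 1; linarith

/-! ### The integral of the winding number -/

variable {n : ℕ} [NeZero n]

theorem measurable_solid (a b : E3) :
    Measurable fun x : Metric.sphere (0 : E3) 1 => (solid (-(x : E3)) a b).arg := by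
  have : Continuous fun x : Metric.sphere (0 : E3) 1 => solid (-(x : E3)) a b := by
    exact Continuous.solid (by fun_prop) (by fun_prop) (by fun_prop)
  exact Complex.measurable_arg.comp this.measurable

theorem integrable_arg_solid (a b : E3) :
    Integrable (fun x : Metric.sphere (0 : E3) 1 => (solid (-(x : E3)) a b).arg) sphereArea :=
  Integrable.of_bound (measurable_solid a b).aestronglyMeasurable Real.pi
    (Eventually.of_forall fun x => by rw [Real.norm_eq_abs]; exact Complex.abs_arg_le_pi _)

/-- The reflection in the plane orthogonal to `v` fixes `a` and `b`, keeps lengths and inner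
products and reverses the determinant. So it conjugates `solid` and changes the sign of its
argument, except for the argument π, which is excluded almost everywhere. -/
theorem integral_arg_solid {a b v : E3} (hv : v ≠ 0) (ha : inner ℝ v a = 0) (hb : inner ℝ v b = 0)
    (h : ∀ᵐ x : Metric.sphere (0 : E3) 1 ∂sphereArea, solid (-(x : E3)) a b ∈ Complex.slitPlane) :
    ∫ x : Metric.sphere (0 : E3) 1, (solid (-(x : E3)) a b).arg ∂sphereArea = 0 := by
  set R := (Submodule.span ℝ {v})ᗮ.reflection with hR
  have hRa : R a = a := Submodule.reflection_mem_subspace_eq_self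
    ((Submodule.mem_orthogonal_singleton_iff_inner_right).2 ha)
  have hRb : R b = b := Submodule.reflection_mem_subspace_eq_self
    ((Submodule.mem_orthogonal_singleton_iff_inner_right).2 hb)
  have hRv : R v = -v := Submodule.reflection_orthogonalComplement_singleton_eq_neg v
  have hcr : cross v (cross a b) = 0 := by
    have h1 := ha; have h2 := hb
    rw [inner_eq_coords] at h1 h2
    refine ext_coords ?_ ?_ ?_ <;> simp
    · linear_combination a 0 * h2 - b 0 * h1
    · linear_combination a 1 * h2 - b 1 * h1
    · linear_combination a 2 * h2 - b 2 * h1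
  have hc : R (cross a b) = -cross a b := by
    rw [exists_smul_of_cross_eq_zero hv hcr, R.map_smul, hRv, smul_neg]
  have hsol : ∀ x : E3, solid (-(R x)) a b = (starRingEnd ℂ) (solid (-x) a b) := by
    intro x
    have i1 : inner ℝ (R x) a = inner ℝ x a := by
      conv_lhs => rw [← hRa]
      exact R.inner_map_map _ _
    have i2 : inner ℝ b (R x) = inner ℝ b x := by
      conv_lhs => rw [← hRb]
      exact R.inner_map_map _ _
    have i3 : det3 (R x) a b = -det3 x a b := by
      have h1 : inner ℝ (R x) (-cross a b) = inner ℝ x (cross a b) := by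
        rw [← hc, R.inner_map_map]
      rw [inner_neg_right, inner_cross, inner_cross] at h1
      linarith
    apply Complex.ext
    · simp only [solid, norm_neg, inner_neg_left, inner_neg_right, R.norm_map, i1, i2,
        Complex.conj_re]
    · simp only [solid, Complex.conj_im, det3_neg_left, i3]
  have hmp := measurePreserving_sphereMap R
  have e1 : ∫ x : Metric.sphere (0 : E3) 1, (solid (-(sphereMap R x : E3)) a b).arg ∂sphereArea =
      ∫ x : Metric.sphere (0 : E3) 1, (solid (-(x : E3)) a b).arg ∂sphereArea := by
    conv_rhs => rw [← hmp.map_eq]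
    rw [integral_map hmp.measurable.aemeasurable (by
      rw [hmp.map_eq]; exact (measurable_solid a b).aestronglyMeasurable)]
  have e2 : ∫ x : Metric.sphere (0 : E3) 1, (solid (-(sphereMap R x : E3)) a b).arg ∂sphereArea =
      ∫ x : Metric.sphere (0 : E3) 1, -(solid (-(x : E3)) a b).arg ∂sphereArea := by
    refine integral_congr_ae ?_
    filter_upwards [h] with x hx
    change (solid (-(R x)) a b).arg = _
    rw [hsol, Complex.arg_conj, if_neg (Complex.mem_slitPlane_iff_arg.1 hx).1]
  rw [integral_neg, e1] at e2
  linarith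

theorem EmbeddedStar.gaussImage_null (S : EmbeddedStar n) :
    sphereArea {x : Metric.sphere (0 : E3) 1 | (x : E3) ∈ normalCone S.dir} = 0 := by
  refine measure_mono_null (t := ⋃ k, {x : Metric.sphere (0 : E3) 1 | inner ℝ (x : E3) (S.dir k) = 0})
    (fun x hx => ?_) (measure_iUnion_null fun k => sphereArea_inner_eq_zero (S.dir_ne_zero k))
  exact Set.mem_iUnion.2 (exists_inner_eq_zero_of_mem_normalCone hx)

theorem integrable_wind (a : Fin n → E3) :
    Integrable (fun x : Metric.sphere (0 : E3) 1 => wind a x) sphereArea := by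
  unfold wind
  exact (((integrable_const _).sub ((integrable_finsetSum _ fun k _ =>
    integrable_arg_solid _ _).const_mul _)).div_const _)

/-- The winding number of the Gauss image integrates to the curvature. -/
theorem EmbeddedStar.integral_wind (S : EmbeddedStar n) :
    ∫ x : Metric.sphere (0 : E3) 1, wind S.dir x ∂sphereArea = S.angleDeficit := by
  have hI : ∀ k, ∫ x : Metric.sphere (0 : E3) 1,
      (solid (-(x : E3)) (nrm S.dir k) (nrm S.dir (k + 1))).arg ∂sphereArea = 0 := by
    intro k
    -- The edge between two faces is orthogonal to both normals and serves as the normal of the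
    -- mirror.
    refine integral_arg_solid (S.dir_ne_zero (k + 1)) (inner_cross_right _ _) (inner_cross_left _ _) ?_
    have hn : ∀ᵐ x : Metric.sphere (0 : E3) 1 ∂sphereArea, (x : E3) ∉ normalCone S.dir := by
      rw [ae_iff]; simpa using S.gaussImage_null
    filter_upwards [hn] with x hx
    have him := S.isStar_dir.immersed
    refine solid_mem_slitPlane (him.cross_ne k) (him.cross_ne (k + 1)) ?_ (him.fold k) fun h =>
      hx (Set.mem_iUnion.2 ⟨k, h⟩)
    rintro h0
    have := mem_sphere_zero_iff_norm.1 x.2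
    rw [h0, norm_zero] at this
    exact zero_ne_one this
  unfold wind
  rw [integral_div, integral_sub (integrable_const _) ((integrable_finsetSum _ fun k _ =>
    integrable_arg_solid _ _).const_mul _), integral_const_mul, integral_finsetSum _ fun k _ =>
    integrable_arg_solid _ _, S.angleDeficit_eq]
  simp only [hI, integral_const, Finset.sum_const_zero, mul_zero, sub_zero, measureReal_def,
    sphereArea_univ, smul_eq_mul]
  rw [ENNReal.toReal_ofReal (by positivity)]
  have := Real.pi_pos
  field_simp

end

end PolyhedralSurface

namespace PolyhedralSurface

noncomputable section

/-! ### Convex corners -/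

open Filter

/-- Supporting planes at the points of the frontier of a convex set. -/
theorem exists_supporting {C : Set E3} (hC : Convex ℝ C) {x : E3} (hx : x ∈ frontier C) :
    ∃ v : E3, v ≠ 0 ∧ ∀ y ∈ closure C, inner ℝ v y ≤ inner ℝ v x := by
  by_cases hi : (interior C).Nonempty
  · obtain ⟨f, hf, h⟩ := geometric_hahn_banach_of_nonempty_interior_point hC hx.2 hi
    refine ⟨(InnerProductSpace.toDual ℝ E3).symm f, by simpa using hf, ?_⟩
    have hcl : IsClosed {y | f y ≤ f x} := isClosed_le f.continuous continuous_const
    intro y hy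
    rw [InnerProductSpace.toDual_symm_apply, InnerProductSpace.toDual_symm_apply]
    exact closure_minimal h hcl hy
  -- Without interior points `C` lies in a plane, and the product with a normal vector of this plane
  -- is constant on the closure.
  · rw [hC.interior_nonempty_iff_affineSpan_eq_top] at hi
    obtain ⟨x0, hx0⟩ : C.Nonempty := closure_nonempty_iff.1 ⟨x, hx.1⟩
    have hx0' := subset_affineSpan ℝ C hx0
    have hdir : (affineSpan ℝ C).direction ≠ ⊤ := fun h =>
      hi ((AffineSubspace.direction_eq_top_iff_of_nonempty ⟨x0, hx0'⟩).1 h)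
    obtain ⟨v, hv, hv0⟩ := Submodule.exists_mem_ne_zero_of_ne_bot
      (mt (Submodule.orthogonal_eq_bot_iff (K := (affineSpan ℝ C).direction)).1 hdir)
    refine ⟨v, hv0, ?_⟩
    have hcl : IsClosed {y | inner ℝ v y = inner ℝ v x0} :=
      isClosed_eq (by fun_prop) continuous_const
    have hsub : closure C ⊆ {y | inner ℝ v y = inner ℝ v x0} := by
      refine closure_minimal (fun y hy => ?_) hcl
      have := (Submodule.mem_orthogonal' _ _).1 hv (y - x0)
        (AffineSubspace.vsub_mem_direction (subset_affineSpan ℝ C hy) hx0')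
      rw [inner_sub_right, sub_eq_zero] at this
      exact this
    intro y hy
    have h1 : inner ℝ v y = inner ℝ v x0 := hsub hy
    have h2 : inner ℝ v x = inner ℝ v x0 := hsub hx.1
    rw [h1, h2]

variable {n : ℕ} [NeZero n]

/-- All faces lie in supporting planes, and their normals point inwards. -/
def FacesSupport (a : Fin n → E3) : Prop := ∀ k j, 0 ≤ inner ℝ (nrm a k) (a j)

theorem nrm_neg (a : Fin n → E3) : nrm (fun k => -a k) = nrm a := by
  funext k
  refine ext_coords ?_ ?_ ?_ <;> simp [nrm]

theorem angleSum_neg (a : Fin n → E3) : angleSum (fun k => -a k) = angleSum a := by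
  simp [angleSum, InnerProductGeometry.angle_neg_neg]

theorem wind_neg (a : Fin n → E3) : wind (fun k => -a k) = wind a := by
  funext x; rw [wind, wind, angleSum_neg, nrm_neg]

theorem IsStar.neg {a : Fin n → E3} (ha : IsStar a) : IsStar fun k => -a k := by
  have hs : ∀ a b x : E3, x ∈ sector (-a) (-b) ↔ -x ∈ sector a b := by
    intro a b x
    refine exists_congr fun s => exists_congr fun t => and_congr_right fun _ =>
      and_congr_right fun _ => ?_
    rw [neg_eq_iff_eq_neg]
    rw [show -(s • a + t • b) = s • -a + t • -b by module]
  have hr : ∀ a x : E3, x ∈ ray (-a) ↔ -x ∈ ray a := by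
    intro a x
    refine exists_congr fun r => and_congr_right fun _ => ?_
    rw [neg_eq_iff_eq_neg, smul_neg]
  rw [isStar_iff] at ha ⊢
  refine ⟨ha.1, fun k => ?_, fun j k hjk x hx hx' => ?_⟩
  · have := congrFun (nrm_neg a) k
    rw [nrm, nrm] at this
    rw [this]; exact ha.2.1 k
  · simpa only [hr, neg_eq_zero] using ha.2.2 j k hjk (-x) ((hs _ _ _).1 hx) ((hs _ _ _).1 hx')

theorem inner_nrm_self (a : Fin n → E3) (k : Fin n) : inner ℝ (nrm a k) (a k) = 0 := by
  rw [real_inner_comm]; exact inner_cross_left _ _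

theorem inner_nrm_succ (a : Fin n → E3) (k : Fin n) : inner ℝ (nrm a k) (a (k + 1)) = 0 := by
  rw [real_inner_comm]; exact inner_cross_right _ _

/-- If three successive edges are coplanar, then the two normals are positively proportional. -/
theorem Immersed.exists_pos_smul {a : Fin n → E3} (ha : Immersed a) {k : Fin n}
    (h : inner ℝ (nrm a k) (a (k + 1 + 1)) = 0) : ∃ r : ℝ, 0 < r ∧ nrm a (k + 1) = r • nrm a k := by
  have hk := ha.cross_ne k
  have hcc : cross (nrm a k) (nrm a (k + 1)) = 0 := by
    have e : det3 (a k) (a (k + 1)) (a (k + 1 + 1)) = 0 := by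
      rw [← h, real_inner_comm, nrm, inner_cross, ← det3_rotate]
    rw [nrm, nrm, cross_cross, e]
    have e2 : det3 (a k) (a (k + 1)) (a (k + 1)) = 0 := by simp
    rw [e2]; simp
  have hr := exists_smul_of_cross_eq_zero hk hcc
  refine ⟨_, ?_, hr⟩
  have hf := ha.fold k
  set r := inner ℝ (nrm a k) (nrm a (k + 1)) / ‖nrm a k‖ ^ 2
  have hn : 0 < ‖nrm a k‖ := norm_pos_iff.2 hk
  rw [hr, norm_smul, real_inner_smul_right, real_inner_self_eq_norm_sq, Real.norm_eq_abs] at hf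
  have h2 : 0 < (|r| + r) * ‖nrm a k‖ ^ 2 := by nlinarith
  have h3 : 0 < |r| + r := (mul_pos_iff_of_pos_right (by positivity)).1 h2
  by_contra! h4
  rw [abs_of_nonpos h4] at h3
  linarith

/-- Induction around the cycle: `j` is reached from `k` in `j + n - k` steps. -/
theorem forall_of_succ {P : Fin n → Prop} {k : Fin n} (h0 : P k) (h : ∀ k, P k → P (k + 1))
    (j : Fin n) : P j := by
  have : ∀ i : ℕ, P (cycIndex n ((k : ℕ) + (i : ℤ))) := by
    intro i
    induction i with
    | zero => simpa [cycIndex_natCast] using h0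
    | succ i ih =>
      have := h _ ih
      rw [← cycIndex_add_one] at this
      push_cast
      rwa [← add_assoc]
  have hj := this ((j : ℕ) + (n - (k : ℕ)))
  have hk := k.2
  have : cycIndex n ((k : ℕ) + (((j : ℕ) + (n - (k : ℕ)) : ℕ) : ℤ)) = j := by
    refine Fin.ext ?_
    have e : ((cycIndex n ((k : ℕ) + (((j : ℕ) + (n - (k : ℕ)) : ℕ) : ℤ)) : ℕ) : ℤ) = (j : ℕ) := by
      rw [cycIndex_val, show ((k : ℕ) : ℤ) + (((j : ℕ) + (n - (k : ℕ)) : ℕ) : ℤ) = (j : ℕ) + n by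
        omega, Int.add_emod_right, ← Int.natCast_mod, Nat.mod_eq_of_lt j.2]
    exact_mod_cast e
  rwa [this] at hj

/-- Each face lies in a supporting plane, so all edges are on one side of it, and the signs for
neighbouring faces agree. If the normals point outwards, negating the edges helps, since this does
not change the normals. -/
theorem EmbeddedStar.IsConvex.facesSupport {S : EmbeddedStar n} (h : S.IsConvex) :
    FacesSupport S.dir ∨ FacesSupport fun k => -S.dir k := by
  obtain ⟨C, hC, hF⟩ := h
  have him := S.isStar_dir.immersed
  have hmem : ∀ k, ∀ s t : ℝ, 0 ≤ s → 0 ≤ t →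
      S.apex + s • S.dir k + t • S.dir (k + 1) ∈ frontier C := by
    intro k s t hs ht
    rw [hF]
    exact Set.mem_iUnion.2 ⟨k, s, t, hs, ht, rfl⟩
  -- A supporting functional at a point inside the face is bounded above on the cone, hence
  -- nonpositive on all edges, and it vanishes on the two edges of the face. So it is a multiple of
  -- the normal, and `σ` is minus the factor.
  have hsgn : ∀ k, ∃ σ : ℝ, σ ≠ 0 ∧ ∀ j, 0 ≤ σ * inner ℝ (nrm S.dir k) (S.dir j) := by
    intro k
    obtain ⟨v, hv, hsup⟩ := exists_supporting hC (hmem k 1 1 zero_le_one zero_le_one)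
    have hle : ∀ j, ∀ s t : ℝ, 0 ≤ s → 0 ≤ t → s * inner ℝ v (S.dir j) + t * inner ℝ v (S.dir (j + 1)) ≤
        inner ℝ v (S.dir k) + inner ℝ v (S.dir (k + 1)) := by
      intro j s t hs ht
      have := hsup _ (frontier_subset_closure (hmem j s t hs ht))
      simp only [inner_add_right, real_inner_smul_right] at this
      linarith
    have hle0 : ∀ j, inner ℝ v (S.dir j) ≤ 0 := by
      intro j
      by_contra! hp
      obtain ⟨N, hN⟩ := exists_nat_gt ((inner ℝ v (S.dir k) + inner ℝ v (S.dir (k + 1))) /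
        inner ℝ v (S.dir j))
      rw [div_lt_iff₀ hp] at hN
      have := hle j N 0 (by positivity) le_rfl
      linarith
    have h00 := hle 0 0 0 le_rfl le_rfl
    have e1 : inner ℝ v (S.dir k) = 0 := by linarith [hle0 k, hle0 (k + 1)]
    have e2 : inner ℝ v (S.dir (k + 1)) = 0 := by linarith [hle0 k, hle0 (k + 1)]
    have hcr : cross (nrm S.dir k) v = 0 := by
      rw [inner_eq_coords] at e1 e2
      refine ext_coords ?_ ?_ ?_ <;> simp [nrm]
      · linear_combination S.dir (k + 1) 0 * e1 - S.dir k 0 * e2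
      · linear_combination S.dir (k + 1) 1 * e1 - S.dir k 1 * e2
      · linear_combination S.dir (k + 1) 2 * e1 - S.dir k 2 * e2
    have hvs := exists_smul_of_cross_eq_zero (him.cross_ne k) hcr
    set r := inner ℝ (nrm S.dir k) v / ‖nrm S.dir k‖ ^ 2
    refine ⟨-r, fun h0 => hv (by rw [hvs, neg_eq_zero.1 h0, zero_smul]), fun j => ?_⟩
    have := hle0 j
    rw [hvs, real_inner_smul_left] at this
    linarith
  -- Neighbouring faces share the number ⟨N_k, a_{k+2}⟩ = ⟨N_{k+1}, a_k⟩. If it is nonzero, it fixes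
  -- both signs; if it vanishes, the normals are positively proportional.
  have hstep : ∀ σ : ℝ, σ ≠ 0 → ∀ k, (∀ j, 0 ≤ σ * inner ℝ (nrm S.dir k) (S.dir j)) →
      ∀ j, 0 ≤ σ * inner ℝ (nrm S.dir (k + 1)) (S.dir j) := by
    intro σ hσ k hk j
    by_cases hD : inner ℝ (nrm S.dir k) (S.dir (k + 1 + 1)) = 0
    · obtain ⟨r, hr, he⟩ := him.exists_pos_smul hD
      rw [he, real_inner_smul_left]
      nlinarith [hk j]
    · obtain ⟨σ', hσ', hk'⟩ := hsgn (k + 1)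
      have e : inner ℝ (nrm S.dir (k + 1)) (S.dir k) =
          inner ℝ (nrm S.dir k) (S.dir (k + 1 + 1)) := by
        rw [real_inner_comm, real_inner_comm _ (nrm S.dir k), nrm, nrm, inner_cross, inner_cross,
          ← det3_rotate]
      have h1 := hk (k + 1 + 1)
      have h2 := hk' k
      rw [e] at h2
      have h3 := hk' j
      set D := inner ℝ (nrm S.dir k) (S.dir (k + 1 + 1))
      have h4 : 0 < σ * σ' := by
        have : 0 ≤ σ * σ' * D ^ 2 := by nlinarith [mul_nonneg h1 h2]
        have hD2 : 0 < D ^ 2 := by positivity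
        exact lt_of_le_of_ne (nonneg_of_mul_nonneg_left this hD2) (mul_ne_zero hσ hσ').symm
      refine nonneg_of_mul_nonneg_right ?_ h4
      nlinarith [mul_nonneg (sq_nonneg σ) h3]
  obtain ⟨σ, hσ, h0⟩ := hsgn 0
  have hall := forall_of_succ (P := fun k => ∀ j, 0 ≤ σ * inner ℝ (nrm S.dir k) (S.dir j)) h0
    (hstep σ hσ)
  rcases lt_or_gt_of_ne hσ with hlt | hlt
  · right
    intro k j
    rw [nrm_neg, inner_neg_right]
    nlinarith [hall k j]
  · left
    intro k j
    exact nonneg_of_mul_nonneg_right (hall k j) hlt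

/-! ### Polygons in a plane -/

/-- The position of a vector in an oriented plane as a complex number. -/
def planar (c u x : E3) : ℂ := ⟨‖c‖ * inner ℝ u x, det3 c u x⟩

/-- The argument of `planar c x u` is the oriented angle from `x` to `u` in the plane orthogonal to
`c`; successive angles add up, so the numbers multiply up to a positive factor. -/
theorem planar_mul {c x u w : E3} (hu : inner ℝ c u = 0)
    (hw : inner ℝ c w = 0) :
    planar c x u * planar c u w = ((‖c‖ * ‖u‖ ^ 2 : ℝ) : ℂ) * planar c x w := by
  have hc := norm_sq_eq_coords c
  have hu2 := norm_sq_eq_coords u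
  have gram : det3 c x u * det3 c u w = (inner ℝ c c * (inner ℝ x u * inner ℝ u w -
      inner ℝ x w * inner ℝ u u) - inner ℝ c u * (inner ℝ x c * inner ℝ u w - inner ℝ x w * inner ℝ u c) +
      inner ℝ c w * (inner ℝ x c * inner ℝ u u - inner ℝ x u * inner ℝ u c)) := by
    simp only [inner_eq_coords, det3]; ring
  have gram2 : inner ℝ x u * det3 c u w + det3 c x u * inner ℝ u w =
      inner ℝ u u * det3 c x w + det3 x u w * inner ℝ c u := by
    simp only [inner_eq_coords, det3]; ring
  rw [hu, hw, real_inner_self_eq_norm_sq, real_inner_self_eq_norm_sq] at gram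
  rw [hu, real_inner_self_eq_norm_sq] at gram2
  apply Complex.ext
  · rw [Complex.re_ofReal_mul, Complex.mul_re]
    simp only [planar]
    linear_combination -gram
  · rw [Complex.im_ofReal_mul, Complex.mul_im]
    simp only [planar]
    linear_combination ‖c‖ * gram2

theorem arg_planar {c a b : E3} (hc : c ≠ 0) {r : ℝ} (hr : 0 < r) (h : cross a b = r • c) :
    (planar c a b).arg = InnerProductGeometry.angle a b := by
  have hn := norm_pos_iff.2 hc
  have h0 : cross a b ≠ 0 := by rw [h]; exact smul_ne_zero hr.ne' hc
  rw [← arg_turn h0, h]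
  have : planar c a b = (‖c‖ : ℂ) * ⟨inner ℝ a b, det3 (r • c) a b / ‖r • c‖⟩ := by
    apply Complex.ext
    · rw [Complex.re_ofReal_mul]; rfl
    · rw [Complex.im_ofReal_mul, det3_smul_left, norm_smul, Real.norm_eq_abs, abs_of_pos hr]
      simp only [planar]
      field_simp
  rw [this, Complex.arg_real_mul _ hn]

theorem solid_smul_smul (c : E3) {r s : ℝ} (hr : 0 ≤ r) (hs : 0 ≤ s) :
    solid c (r • c) (s • c) = ((r * s * (4 * ‖c‖ ^ 3) : ℝ) : ℂ) := by
  have hcc : solid c c c = ((4 * ‖c‖ ^ 3 : ℝ) : ℂ) := by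
    apply Complex.ext
    · simp only [solid, real_inner_self_eq_norm_sq, Complex.ofReal_re]; ring
    · rw [Complex.ofReal_im, solid_im, det3_self_right]
  have := solid_smul zero_le_one hr hs c c c
  rw [one_smul, one_mul] at this
  rw [this, hcc, ← Complex.ofReal_mul]

/-- The Gauss image is a single point, and the base point of the solid angles is that same point, so
all triangles degenerate. -/
theorem wind_planar {a : Fin n → E3} {c : E3} (h : ∀ k, ∃ r : ℝ, 0 < r ∧ nrm a k = r • c)
    (hc : c ≠ 0) : wind a (-c) = (2 * Real.pi - angleSum a) / (4 * Real.pi) := by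
  have : ∀ k, (solid (- -c) (nrm a k) (nrm a (k + 1))).arg = 0 := by
    intro k
    obtain ⟨r, hr, h1⟩ := h k
    obtain ⟨s, hs, h2⟩ := h (k + 1)
    rw [neg_neg, h1, h2, solid_smul_smul c hr.le hs.le]
    exact Complex.arg_ofReal_of_nonneg (by positivity)
  rw [wind]
  simp only [this, Finset.sum_const_zero, mul_zero, sub_zero]

/-- The angles at a vertex in the plane sum up to `2π` if the edges are in cyclic order. -/
theorem angleSum_eq_two_pi {b : Fin n → E3} {c : E3} (hc : c ≠ 0)
    (h : ∀ k, ∃ r : ℝ, 0 < r ∧ nrm b k = r • c)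
    (h0 : ∀ k, b 0 ∈ sector (b k) (b (k + 1)) → k = 0 ∨ k + 1 = 0) :
    angleSum b = 2 * Real.pi := by
  have hpi := Real.pi_pos
  have hcn := norm_pos_iff.2 hc
  have hne : ∀ k, nrm b k ≠ 0 := fun k => by
    obtain ⟨r, hr, h1⟩ := h k
    rw [h1]; exact smul_ne_zero hr.ne' hc
  have hb : ∀ k, b k ≠ 0 := fun k => cross_ne_zero_left (hne k)
  have hperp : ∀ k, inner ℝ c (b k) = 0 := fun k => by
    obtain ⟨r, hr, h1⟩ := h k
    have := inner_nrm_self b k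
    rw [h1, real_inner_smul_left] at this
    exact (mul_eq_zero.1 this).resolve_left hr.ne'
  have hdet : ∀ k, 0 < det3 c (b k) (b (k + 1)) := fun k => by
    obtain ⟨r, hr, h1⟩ := h k
    rw [← inner_cross]
    change 0 < inner ℝ c (nrm b k)
    rw [h1, real_inner_smul_right, real_inner_self_eq_norm_sq]; positivity
  set B : ℕ → E3 := fun i => b (cycIndex n i) with hB
  have hBs : ∀ i, B (i + 1) = b (cycIndex n i + 1) := fun i => by
    simp only [hB]; push_cast; rw [cycIndex_add_one]
  have hB0 : B 0 = b 0 := by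
    have := cycIndex_natCast (n := n) 0
    simp only [hB]; simpa using congrArg b this
  -- The partial sums lift the polar angles of the edges, measured from `b 0`, to the line.
  set θ : ℕ → ℝ := fun i => ∑ j ∈ Finset.range i, InnerProductGeometry.angle (B j) (B (j + 1))
    with hθ
  have hθn : θ n = angleSum b := by
    simp only [hθ, angleSum, Finset.sum_range]
    refine Finset.sum_congr rfl fun k _ => ?_
    rw [hBs]; simp only [hB, cycIndex_natCast]
  have hθs : ∀ i, θ (i + 1) = θ i + InnerProductGeometry.angle (B i) (B (i + 1)) := fun i =>
    Finset.sum_range_succ _ _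
  have hzeta : ∀ i, ∃ ρ : ℝ, 0 < ρ ∧ planar c (b 0) (B i) = ρ * Complex.exp (θ i * Complex.I) := by
    intro i
    induction i with
    | zero =>
      refine ⟨‖c‖ * ‖b 0‖ ^ 2, by have := norm_pos_iff.2 (hb 0); positivity, ?_⟩
      have hθ0 : θ 0 = 0 := Finset.sum_range_zero _
      rw [hB0, hθ0, Complex.ofReal_zero, zero_mul, Complex.exp_zero, mul_one]
      apply Complex.ext
      · rw [Complex.ofReal_re, planar, real_inner_self_eq_norm_sq]
      · rw [Complex.ofReal_im, planar, det3_self_right]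
    | succ i ih =>
      obtain ⟨ρ, hρ, hi⟩ := ih
      obtain ⟨r, hr, h1⟩ := h (cycIndex n i)
      have hmul := planar_mul (c := c) (x := b 0) (u := B i) (w := B (i + 1)) (hperp _) (hperp _)
      have harg : (planar c (B i) (B (i + 1))).arg = InnerProductGeometry.angle (B i) (B (i + 1)) :=
        arg_planar hc hr (by rw [hBs]; exact h1)
      have hnz : 0 < ‖planar c (B i) (B (i + 1))‖ := by
        rw [norm_pos_iff]
        intro h2
        have h3 := congrArg Complex.im h2
        have h4 := hdet (cycIndex n i)
        rw [← hBs] at h4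
        exact h4.ne' h3
      have hBi : 0 < ‖B i‖ := norm_pos_iff.2 (hb _)
      have hpos : 0 < ‖c‖ * ‖B i‖ ^ 2 := by positivity
      refine ⟨(‖c‖ * ‖B i‖ ^ 2)⁻¹ * (ρ * ‖planar c (B i) (B (i + 1))‖), by positivity, ?_⟩
      have hpol := Complex.norm_mul_exp_arg_mul_I (planar c (B i) (B (i + 1)))
      rw [harg] at hpol
      rw [hi, ← hpol] at hmul
      have hne' : ((‖c‖ * ‖B i‖ ^ 2 : ℝ) : ℂ) ≠ 0 := by exact_mod_cast hpos.ne'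
      have e : planar c (b 0) (B (i + 1)) = (((‖c‖ * ‖B i‖ ^ 2 : ℝ) : ℂ))⁻¹ *
          (((‖c‖ * ‖B i‖ ^ 2 : ℝ) : ℂ) * planar c (b 0) (B (i + 1))) := by
        rw [← mul_assoc, inv_mul_cancel₀ hne', one_mul]
      rw [e, ← hmul, hθs]
      push_cast
      rw [add_mul, Complex.exp_add]
      ring
  have hα0 : ∀ i, 0 < InnerProductGeometry.angle (B i) (B (i + 1)) := fun i => by
    obtain ⟨r, hr, h1⟩ := h (cycIndex n i)
    refine lt_of_le_of_ne (InnerProductGeometry.angle_nonneg _ _) fun h2 => ?_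
    rw [← arg_planar hc hr (by rw [hBs]; exact h1)] at h2
    have h3 := hdet (cycIndex n i)
    rw [← hBs] at h3
    exact h3.ne' (Complex.arg_eq_zero_iff.1 h2.symm).2
  have hαpi : ∀ i, InnerProductGeometry.angle (B i) (B (i + 1)) ≤ Real.pi := fun i =>
    InnerProductGeometry.angle_le_pi _ _
  have hmono : StrictMono θ := strictMono_nat_of_lt_succ fun i => by rw [hθs]; linarith [hα0 i]
  have him : ∀ i, ∃ ρ : ℝ, 0 < ρ ∧ det3 c (b 0) (B i) = ρ * Real.sin (θ i) := by
    intro i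
    obtain ⟨ρ, hρ, e⟩ := hzeta i
    refine ⟨ρ, hρ, ?_⟩
    have := congrArg Complex.im e
    rwa [Complex.im_ofReal_mul, Complex.exp_ofReal_mul_I_im] at this
  -- Otherwise take the first step that passes 2π. It ends before the last index, since a single
  -- angle is at most π. The signs of the sines at its ends put `b 0` into the corresponding sector,
  -- contrary to the cyclic order.
  have hlt : angleSum b < 4 * Real.pi := by
    by_contra! hge
    rw [← hθn] at hge
    have hex : ∃ i, 2 * Real.pi < θ i := ⟨n, by linarith⟩
    classical
    obtain ⟨k, hk⟩ : ∃ k, Nat.find hex = k + 1 := by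
      refine Nat.exists_eq_succ_of_ne_zero fun h1 => ?_
      have := Nat.find_spec hex
      rw [h1] at this
      simp only [hθ, Finset.range_zero, Finset.sum_empty] at this
      linarith
    have h1 : 2 * Real.pi < θ (k + 1) := by rw [← hk]; exact Nat.find_spec hex
    have h2 : θ k ≤ 2 * Real.pi := not_lt.1 (Nat.find_min hex (by omega))
    have h3 := hθs k
    have h4 := hαpi k
    have hkn : k + 1 < n := hmono.lt_iff_lt.1 (by linarith)
    have hk0 : k ≠ 0 := by
      rintro rfl
      simp only [hθ, Finset.range_zero, Finset.sum_empty] at h3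
      simp only [hθ] at h1
      linarith
    obtain ⟨ρ, hρ, e1⟩ := him k
    obtain ⟨ρ', hρ', e2⟩ := him (k + 1)
    have s1 : Real.sin (θ k) ≤ 0 := by
      rw [← Real.sin_sub_two_pi]
      exact Real.sin_nonpos_of_nonpos_of_neg_pi_le (by linarith) (by linarith)
    have s2 : 0 ≤ Real.sin (θ (k + 1)) := by
      rw [← Real.sin_sub_two_pi]
      exact Real.sin_nonneg_of_nonneg_of_le_pi (by linarith) (by linarith)
    set j := cycIndex n k with hj
    have hjv : (j : ℕ) = k := by
      have := cycIndex_val (n := n) (k : ℤ)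
      rw [← Int.natCast_mod, Nat.mod_eq_of_lt (by omega)] at this
      exact_mod_cast this
    have hmem : b 0 ∈ sector (b j) (b (j + 1)) := by
      rw [mem_sector_iff (hne j)]
      obtain ⟨r, hr, hN⟩ := h j
      have hN' : cross (b j) (b (j + 1)) = r • c := hN
      rw [hBs] at e2
      change det3 c (b 0) (b j) = _ at e1
      refine ⟨?_, ?_, ?_⟩
      · rw [← det3_rotate, ← inner_cross, hN', real_inner_smul_right, real_inner_comm, hperp,
          mul_zero]
      · rw [hN', real_inner_smul_right, real_inner_comm, inner_cross, e2]; positivity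
      · rw [hN', real_inner_smul_right, real_inner_comm, inner_cross, det3_swap_right, e1]
        nlinarith [mul_nonneg hr.le hρ.le]
    rcases h0 j hmem with h5 | h5
    · rw [h5] at hjv; simp at hjv; exact hk0 hjv.symm
    · have h6 : ((cycIndex n (k + 1 : ℕ) : ℕ) : ℤ) = (k + 1 : ℕ) := by
        rw [cycIndex_val, ← Int.natCast_mod, Nat.mod_eq_of_lt hkn]
      push_cast at h6
      rw [cycIndex_add_one, ← hj, h5] at h6
      simp at h6
      omega
  have hpos : 0 < angleSum b := by
    rw [← hθn]
    have := hmono (NeZero.pos n)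
    simpa [hθ] using this
  -- Integrality makes the angle sum a multiple of 2π, and the bounds 0 and 4π leave only 2π itself.
  obtain ⟨j, hj⟩ := exists_int_wind (a := b) hne (x := -c) (neg_ne_zero.2 hc) (fun k => by
    obtain ⟨r, hr, h1⟩ := h k
    obtain ⟨s, hs, h2⟩ := h (k + 1)
    rw [neg_neg, h1, h2, solid_smul_smul c hr.le hs.le]
    exact_mod_cast (by positivity : r * s * (4 * ‖c‖ ^ 3) ≠ 0))
  rw [wind_planar h hc] at hj
  have hj2 : angleSum b = 2 * Real.pi * (1 - j) := by
    field_simp at hj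
    linarith
  have : j = 0 := by
    have l1 : (0 : ℝ) < 1 - j := by
      by_contra! hn
      nlinarith
    have l2 : (1 : ℝ) - j < 2 := by
      by_contra! hn
      nlinarith
    have m1 : j < 1 := by exact_mod_cast (by linarith : (j : ℝ) < 1)
    have m2 : -1 < j := by exact_mod_cast (by push_cast; linarith : ((-1 : ℤ) : ℝ) < j)
    omega
  rw [hj2, this]; simp

end

end PolyhedralSurface

namespace PolyhedralSurface

noncomputable section

/-! ### The winding number of the Gauss image of a convex corner -/

open Filter

variable {n : ℕ} [NeZero n]

/-- Vectors strictly on the same side of a plane are not opposite. -/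
theorem fold_of_inner_pos {a b c : E3} (ha : 0 < inner ℝ a c) (hb : 0 < inner ℝ b c) :
    0 < ‖a‖ * ‖b‖ + inner ℝ a b := by
  have ha0 : 0 < ‖a‖ := norm_pos_iff.2 fun h => by simp [h] at ha
  have hb0 : 0 < ‖b‖ := norm_pos_iff.2 fun h => by simp [h] at hb
  by_contra! hle
  have h1 : ‖‖b‖ • a + ‖a‖ • b‖ ^ 2 ≤ 0 := by
    rw [norm_add_sq_real, norm_smul, norm_smul, real_inner_smul_left, real_inner_smul_right,
      norm_norm, norm_norm]
    nlinarith [mul_pos ha0 hb0]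
  have h2 : ‖b‖ • a + ‖a‖ • b = 0 := by
    rw [← norm_eq_zero]
    exact pow_eq_zero_iff two_ne_zero |>.1 (le_antisymm h1 (sq_nonneg _))
  have h3 := congrArg (fun x => inner ℝ x c) h2
  simp only [inner_add_left, real_inner_smul_left, inner_zero_left] at h3
  nlinarith [mul_pos hb0 ha, mul_pos ha0 hb]

theorem Immersed.wind_eq_of_isPreconnected {a : Fin n → E3} (ha : Immersed a) {B : Set E3}
    (hB : IsPreconnected B) (hd : ∀ x ∈ B, x ∉ normalCone a) {x y : E3} (hx : x ∈ B) (hy : y ∈ B) :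
    wind a x = wind a y := by
  refine eq_of_locally_eq hB (fun z hz => ?_) hx hy
  have hz0 : z ≠ 0 := fun h => hd z hz (h ▸ zero_mem_normalCone a)
  have := eventually_wind_eq ha hz0 fun k hk => hd z hz (Set.mem_iUnion.2 ⟨k, hk⟩)
  exact (Continuous.prodMk_right a).continuousAt.eventually this

theorem Immersed.exists_pos_smul_of_coplanar {a : Fin n → E3} (ha : Immersed a) {k : Fin n}
    (h : ∀ j, inner ℝ (nrm a k) (a j) = 0) (j : Fin n) :
    ∃ r : ℝ, 0 < r ∧ nrm a j = r • nrm a k := by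
  refine forall_of_succ (P := fun j => ∃ r : ℝ, 0 < r ∧ nrm a j = r • nrm a k)
    ⟨1, one_pos, (one_smul _ _).symm⟩ (fun i hi => ?_) j
  obtain ⟨r, hr, he⟩ := hi
  obtain ⟨s, hs, he'⟩ := ha.exists_pos_smul (k := i) (by
    rw [he, real_inner_smul_left, h, mul_zero])
  exact ⟨s * r, mul_pos hs hr, by rw [he', he, smul_smul]⟩

/-- The sum of the edges is strictly on the inner side of every face, unless all edges lie in the
plane of one face. In that case all normals are positive multiples of its normal, which then serves
as the axis. -/
theorem FacesSupport.exists_axis {a : Fin n → E3} (hs : FacesSupport a) (ha : Immersed a) :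
    ∃ c, ∀ k, 0 < inner ℝ (nrm a k) c := by
  by_cases h : ∀ k, ∃ j, inner ℝ (nrm a k) (a j) ≠ 0
  · refine ⟨∑ j, a j, fun k => ?_⟩
    rw [inner_sum]
    obtain ⟨j, hj⟩ := h k
    exact Finset.sum_pos' (fun i _ => hs k i) ⟨j, Finset.mem_univ _, (hs k j).lt_of_ne hj.symm⟩
  · push Not at h
    obtain ⟨k, hk⟩ := h
    refine ⟨nrm a k, fun j => ?_⟩
    obtain ⟨r, hr, he⟩ := ha.exists_pos_smul_of_coplanar hk j
    have := norm_pos_iff.2 (ha.cross_ne k)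
    rw [he, real_inner_smul_left, real_inner_self_eq_norm_sq]
    positivity

theorem notMem_normalCone {a : Fin n → E3} {v x : E3} (hv : ∀ k, 0 ≤ inner ℝ (nrm a k) v)
    (hx : inner ℝ x v < 0) : x ∉ normalCone a := by
  intro h
  obtain ⟨k, s, t, hs, ht, rfl⟩ := Set.mem_iUnion.1 h
  rw [inner_add_left, real_inner_smul_left, real_inner_smul_left] at hx
  nlinarith [mul_nonneg hs (hv k), mul_nonneg ht (hv (k + 1))]

/-- The projection of the edges along an axis. -/
def flatten (a : Fin n → E3) (c : E3) (s : ℝ) (k : Fin n) : E3 :=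
  a k - (s * (inner ℝ c (a k) / ‖c‖ ^ 2)) • c

/-- Edges change only by multiples of `c`, which drop out of the determinant with `c`. So the
normals keep to one side of a plane, and the faces stay immersed during the projection. -/
theorem inner_nrm_flatten (a : Fin n → E3) (c : E3) (s : ℝ) (k : Fin n) :
    inner ℝ (nrm (flatten a c s) k) c = inner ℝ (nrm a k) c := by
  rw [real_inner_comm, real_inner_comm c (nrm a k), nrm, nrm, inner_cross, inner_cross, flatten, flatten]
  simp only [det3]
  simp
  ring

/-- During the projection along `c` the point `-c` stays off the Gauss image, so the value is that
of a planar star of angle sum 2π. -/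
theorem IsStar.wind_axis {a : Fin n → E3} (ha : IsStar a) (hs : FacesSupport a) {c : E3}
    (hc : ∀ k, 0 < inner ℝ (nrm a k) c) : wind a (-c) = 0 := by
  have hc0 : c ≠ 0 := fun h => by simpa [h] using hc 0
  have hcn := norm_pos_iff.2 hc0
  have hN : ∀ s k, 0 < inner ℝ (nrm (flatten a c s) k) c := fun s k => by
    rw [inner_nrm_flatten]; exact hc k
  have him : ∀ s, Immersed (flatten a c s) := fun s =>
    ⟨fun k h => by simpa [h] using hN s k, fun k => fold_of_inner_pos (hN s k) (hN s (k + 1))⟩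
  have hcont : Continuous fun s => (flatten a c s, -c) := by
    refine Continuous.prodMk (continuous_pi fun k => ?_) continuous_const
    unfold flatten; fun_prop
  have hconst : wind (flatten a c 0) (-c) = wind (flatten a c 1) (-c) := by
    refine eq_of_locally_eq (f := fun s => wind (flatten a c s) (-c)) isPreconnected_univ
      (fun s _ => ?_) trivial trivial
    have hoff : -c ∉ normalCone (flatten a c s) := notMem_normalCone (fun k => (hN s k).le) (by
      rw [inner_neg_left, real_inner_self_eq_norm_sq, neg_lt_zero]; positivity)
    exact hcont.continuousAt.eventually (eventually_wind_eq (him s) (neg_ne_zero.2 hc0) fun k hk =>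
      hoff (Set.mem_iUnion.2 ⟨k, hk⟩))
  have h0 : flatten a c 0 = a := by funext k; simp [flatten]
  rw [h0] at hconst
  set b := flatten a c 1 with hb
  have hperp : ∀ k, inner ℝ c (b k) = 0 := fun k => by
    rw [hb, flatten, inner_sub_right, real_inner_smul_right, real_inner_self_eq_norm_sq]
    field_simp
    ring
  have hbN : ∀ k, ∃ r : ℝ, 0 < r ∧ nrm b k = r • c := fun k => by
    have hcr : cross c (nrm b k) = 0 := by
      have e1 := hperp k; have e2 := hperp (k + 1)
      rw [inner_eq_coords] at e1 e2
      refine ext_coords ?_ ?_ ?_ <;> simp [nrm]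
      · linear_combination b k 0 * e2 - b (k + 1) 0 * e1
      · linear_combination b k 1 * e2 - b (k + 1) 1 * e1
      · linear_combination b k 2 * e2 - b (k + 1) 2 * e1
    refine ⟨_, ?_, exists_smul_of_cross_eq_zero hc0 hcr⟩
    have := hN 1 k
    rw [real_inner_comm] at this
    positivity
  have hang : angleSum b = 2 * Real.pi := by
    -- If the projection of `a 0` falls into that of face `k`, then `a 0` differs from a point of
    -- this face by `μ • c`. Since `a 0` is on the inner side of face `k`, μ ≥ 0; since that point
    -- is on the inner side of face 0, μ ≤ 0. So `a 0` is on face `k`, and embeddedness leaves only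
    -- the faces that contain `a 0` as an edge.
    refine angleSum_eq_two_pi hc0 hbN fun k hk => ?_
    obtain ⟨s, t, hs', ht', he⟩ := hk
    set β : Fin n → ℝ := fun k => inner ℝ c (a k) / ‖c‖ ^ 2 with hβ
    have hbk : ∀ k, b k = a k - β k • c := fun k => by simp [hb, flatten, hβ]
    set μ := β 0 - s * β k - t * β (k + 1) with hμ
    have h1 : a 0 = s • a k + t • a (k + 1) + μ • c := by
      rw [hbk, hbk, hbk, sub_eq_iff_eq_add] at he
      rw [he, hμ]; module
    have hμ0 : 0 ≤ μ := by
      have h2 := hs k 0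
      rw [h1, inner_add_right, inner_add_right, real_inner_smul_right, real_inner_smul_right,
        real_inner_smul_right, inner_nrm_self, inner_nrm_succ] at h2
      have h3 := hc k
      by_contra! hneg
      nlinarith
    have hμ1 : μ = 0 := by
      have h2 := inner_nrm_self a 0
      rw [h1, inner_add_right, inner_add_right, real_inner_smul_right, real_inner_smul_right,
        real_inner_smul_right] at h2
      have e1 := mul_nonneg hs' (hs 0 k)
      have e2 := mul_nonneg ht' (hs 0 (k + 1))
      have e3 := hc 0
      refine le_antisymm ?_ hμ0
      by_contra! hpos
      nlinarith [mul_pos hpos e3]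
    rw [hμ1, zero_smul, add_zero] at h1
    by_contra! hk
    rcases (isStar_iff.1 ha).2.2 0 k hk.1.symm (a 0) ⟨1, 0, zero_le_one, le_rfl, by simp⟩
      ⟨s, t, hs', ht', h1⟩ with ⟨h2, r, -, hr⟩ | ⟨h2, -⟩ | h2
    · apply ha.cross_ne 0
      rw [h2] at hr
      have := cross_smul_smul (a (0 + 1)) (a (0 + 1)) r 1
      rw [one_smul, cross_self_eq_zero, smul_zero] at this
      rw [hr, this]
    · exact hk.2 h2.symm
    · exact cross_ne_zero_left (ha.cross_ne 0) h2
  rw [hconst, wind_planar hbN hc0, hang, sub_self, zero_div]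

theorem convex_inner_neg (v : E3) : Convex ℝ {x : E3 | inner ℝ x v < 0} :=
  convex_halfSpace_lt (f := fun x : E3 => inner ℝ x v)
    ⟨fun x y => inner_add_left x y v, fun r x => real_inner_smul_left x v r⟩ 0

/-- The winding number vanishes on the hemispheres that do not contain normals. -/
theorem IsStar.wind_eq_zero {a : Fin n → E3} (ha : IsStar a) (hs : FacesSupport a) {v x : E3}
    (hv : ∀ k, 0 ≤ inner ℝ (nrm a k) v) (hx : inner ℝ x v < 0) : wind a x = 0 := by
  obtain ⟨c, hc⟩ := hs.exists_axis ha.immersed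
  have hv0 : v ≠ 0 := fun h => by simp [h] at hx
  have hc0 : c ≠ 0 := fun h => by simpa [h] using hc 0
  have hvn := norm_pos_iff.2 hv0
  have hcn := norm_pos_iff.2 hc0
  -- A normal has positive product with `c` and nonnegative product with `v`, so `v` and `c` are not
  -- opposite. The hemispheres opposite to them meet, for instance in `y` below, and the value 0 at
  -- `-c` spreads to both.
  have hvc : 0 < ‖v‖ * ‖c‖ + inner ℝ v c := by
    by_contra! hle
    have h1 : ‖‖c‖ • v + ‖v‖ • c‖ ^ 2 ≤ 0 := by
      rw [norm_add_sq_real, norm_smul, norm_smul, real_inner_smul_left, real_inner_smul_right,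
        norm_norm, norm_norm]
      nlinarith [mul_pos hvn hcn]
    have h2 : ‖c‖ • v + ‖v‖ • c = 0 := by
      rw [← norm_eq_zero]
      exact pow_eq_zero_iff two_ne_zero |>.1 (le_antisymm h1 (sq_nonneg _))
    have h3 := congrArg (fun x => inner ℝ (nrm a 0) x) h2
    simp only [inner_add_right, real_inner_smul_right, inner_zero_right] at h3
    nlinarith [mul_nonneg hcn.le (hv 0), mul_pos hvn (hc 0)]
  set y : E3 := -(‖c‖ • v + ‖v‖ • c) with hy
  have hyv : inner ℝ y v < 0 := by
    rw [hy, inner_neg_left, inner_add_left, real_inner_smul_left, real_inner_smul_left,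
      real_inner_self_eq_norm_sq, real_inner_comm v c, neg_lt_zero]
    nlinarith [mul_pos hvn hvc]
  have hyc : inner ℝ y c < 0 := by
    rw [hy, inner_neg_left, inner_add_left, real_inner_smul_left, real_inner_smul_left,
      real_inner_self_eq_norm_sq, neg_lt_zero]
    nlinarith [mul_pos hcn hvc]
  have hcc : inner ℝ (-c) c < 0 := by
    rw [inner_neg_left, real_inner_self_eq_norm_sq, neg_lt_zero]; positivity
  rw [ha.immersed.wind_eq_of_isPreconnected (convex_inner_neg v).isPreconnected
    (fun z hz => notMem_normalCone hv hz) hx hyv,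
    ha.immersed.wind_eq_of_isPreconnected (convex_inner_neg c).isPreconnected
    (fun z hz => notMem_normalCone (fun k => (hc k).le) hz) hyc hcc, ha.wind_axis hs hc]

theorem sub_one_add_one (j : Fin n) : j - 1 + 1 = j := sub_add_cancel j 1

/-- A vector that is in the dual cone but not in its interior is on the Gauss image. -/
theorem FacesSupport.inner_pos {a : Fin n → E3} (hs : FacesSupport a) (ha : Immersed a) {x : E3}
    (hx : x ∉ normalCone a) (h : ∀ v, (∀ k, 0 ≤ inner ℝ (nrm a k) v) → 0 ≤ inner ℝ x v) (j : Fin n) :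
    0 < inner ℝ x (a j) := by
  obtain ⟨c, hc⟩ := hs.exists_axis ha
  have hxa : ∀ j, 0 ≤ inner ℝ x (a j) := fun j => h _ fun k => hs k j
  refine (hxa j).lt_of_ne fun h0 => hx ?_
  obtain ⟨k, rfl⟩ : ∃ k, j = k + 1 := ⟨j - 1, (sub_one_add_one j).symm⟩
  refine Set.mem_iUnion.2 ⟨k, ?_⟩
  set D := det3 (a k) (a (k + 1)) (a (k + 1 + 1)) with hD
  have e1 : inner ℝ (nrm a k) (a (k + 1 + 1)) = D := by
    rw [real_inner_comm, nrm, inner_cross, det3_rotate]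
  have e2 : inner ℝ (nrm a (k + 1)) (a k) = D := by
    rw [real_inner_comm, nrm, inner_cross]
  have hD0 : 0 ≤ D := by rw [← e1]; exact hs _ _
  -- If the two faces are coplanar, `x` turns out to be a nonnegative multiple of their normal.
  -- Otherwise the normals span the plane orthogonal to the common edge, and the products with `a k`
  -- and `a (k + 2)` give the signs of the coefficients.
  rcases hD0.eq_or_lt with hz | hpos
  · obtain ⟨r, hr, he⟩ := ha.exists_pos_smul (e1.trans hz.symm)
    have h1 : inner ℝ x (a k) = 0 := by
      have hz' : det3 (a (k + 1)) (a k) (a (k + 1 + 1)) = 0 := by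
        rw [det3_swap, ← hD, ← hz, neg_zero]
      have hcr : cross (a (k + 1)) (a k) ≠ 0 := by
        rw [cross_swap]; exact neg_ne_zero.2 (ha.cross_ne k)
      obtain ⟨p, q, hpq⟩ := exists_combination hcr hz'
      have hq : nrm a (k + 1) = (-q) • nrm a k := by
        rw [nrm, nrm, hpq]
        refine ext_coords ?_ ?_ ?_ <;> simp <;> ring
      rw [he] at hq
      have hrq : r = -q := smul_left_injective ℝ (ha.cross_ne k) hq
      have h2 := hxa (k + 1 + 1)
      rw [hpq, inner_add_right, real_inner_smul_right, real_inner_smul_right, ← h0] at h2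
      refine le_antisymm ?_ (hxa k)
      by_contra! h3
      nlinarith
    have hcr : cross (nrm a k) x = 0 := by
      have h2 := h1; have h3 := h0.symm
      rw [inner_eq_coords] at h2 h3
      refine ext_coords ?_ ?_ ?_ <;> simp [nrm]
      · linear_combination a (k + 1) 0 * h2 - a k 0 * h3
      · linear_combination a (k + 1) 1 * h2 - a k 1 * h3
      · linear_combination a (k + 1) 2 * h2 - a k 2 * h3
    have hxs := exists_smul_of_cross_eq_zero (ha.cross_ne k) hcr
    set ν := inner ℝ (nrm a k) x / ‖nrm a k‖ ^ 2
    refine ⟨ν, 0, ?_, le_rfl, by rw [zero_smul, add_zero]; exact hxs⟩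
    have h2 := h c fun k => (hc k).le
    rw [hxs, real_inner_smul_left] at h2
    exact nonneg_of_mul_nonneg_left h2 (hc k)
  · have hNN : cross (nrm a k) (nrm a (k + 1)) = D • a (k + 1) := by
      rw [nrm, nrm, cross_cross, det3_self_right, zero_smul, sub_zero]
    have hcr : cross (nrm a k) (nrm a (k + 1)) ≠ 0 := by
      rw [hNN]; exact smul_ne_zero hpos.ne' (cross_ne_zero_right (ha.cross_ne k))
    obtain ⟨s, t, hst⟩ := exists_combination hcr (x := x) (by
      rw [← det3_rotate, ← inner_cross, hNN, real_inner_smul_right, ← h0, mul_zero])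
    refine ⟨s, t, ?_, ?_, hst⟩
    · have := hxa (k + 1 + 1)
      rw [hst, inner_add_left, real_inner_smul_left, real_inner_smul_left, e1, inner_nrm_succ,
        mul_zero, add_zero] at this
      exact nonneg_of_mul_nonneg_left this hpos
    · have := hxa k
      rw [hst, inner_add_left, real_inner_smul_left, real_inner_smul_left, e2, inner_nrm_self,
        mul_zero, zero_add] at this
      exact nonneg_of_mul_nonneg_left this hpos

/-- The edges of a planar vertex star are not contained in an open half-space. -/
theorem Immersed.false_of_coplanar {a : Fin n → E3} (ha : Immersed a)
    (h : ∀ k, inner ℝ (nrm a k) (a (k + 1 + 1)) = 0) {x : E3} (hx : ∀ j, 0 < inner ℝ x (a j)) :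
    False := by
  set N := nrm a 0 with hN
  have hpar : ∀ j, ∃ r : ℝ, 0 < r ∧ nrm a j = r • N :=
    forall_of_succ (k := (0 : Fin n)) ⟨1, one_pos, (one_smul _ _).symm⟩ fun k hk => by
      obtain ⟨r, hr, he⟩ := hk
      obtain ⟨s, hs, he'⟩ := ha.exists_pos_smul (h k)
      exact ⟨s * r, mul_pos hs hr, by rw [he', he, smul_smul]⟩
  have hN0 : N ≠ 0 := ha.cross_ne 0
  set y := cross N x with hy
  have hy0 : 0 < ‖y‖ := by
    rw [norm_pos_iff]
    intro h0
    have h1 := hx 0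
    rw [exists_smul_of_cross_eq_zero hN0 h0, real_inner_smul_left, inner_nrm_self] at h1
    simp at h1
  -- The quotient is the slope of an edge with respect to `x` and `y`. All edges turn in the same
  -- direction in one plane, so the slope increases strictly from each edge to the next, which is
  -- impossible at a maximum.
  obtain ⟨k, hk⟩ := Finite.exists_max fun j => inner ℝ (a j) y / inner ℝ x (a j)
  obtain ⟨r, hr, he⟩ := hpar k
  have h1 : inner ℝ x (a k) * inner ℝ (a (k + 1)) y - inner ℝ (a k) y * inner ℝ x (a (k + 1)) =
      r * ‖y‖ ^ 2 := by
    have e1 : inner ℝ x (a k) * inner ℝ (a (k + 1)) y - inner ℝ (a k) y * inner ℝ x (a (k + 1)) =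
        inner ℝ (nrm a k) (cross x y) := by
      simp only [nrm, inner_eq_coords]; simp; ring
    have e2 : inner ℝ N (cross x y) = ‖y‖ ^ 2 := by
      rw [norm_sq_eq_coords, inner_eq_coords, hy]; simp; ring
    rw [e1, he, real_inner_smul_left, e2]
  have h2 := hk (k + 1)
  rw [div_le_div_iff₀ (hx _) (hx _)] at h2
  have : 0 < r * ‖y‖ ^ 2 := by positivity
  linarith

/-- The winding number is one in the interior of the dual cone. -/
theorem IsStar.wind_eq_one {a : Fin n → E3} (ha : IsStar a) (hs : FacesSupport a) {x : E3}
    (hx : ∀ j, 0 < inner ℝ x (a j)) : wind a x = 1 := by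
  have him := ha.immersed
  obtain ⟨k, hk⟩ : ∃ k, inner ℝ (nrm a k) (a (k + 1 + 1)) ≠ 0 := by
    by_contra! hall
    exact him.false_of_coplanar hall hx
  -- Cross the Gauss image in the middle of the arc of a genuine edge, in the direction of this
  -- edge. It is the only arc through `p`; behind it the value is 0 by `wind_eq_zero`, and ahead
  -- lies the interior of the dual cone.
  set p := nrm a k + nrm a (k + 1) with hp
  set w := a (k + 1) with hw
  set D := det3 (a k) (a (k + 1)) (a (k + 1 + 1)) with hD
  have e1 : inner ℝ (nrm a k) (a (k + 1 + 1)) = D := by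
    rw [real_inner_comm, nrm, inner_cross, det3_rotate]
  have hDpos : 0 < D := (e1 ▸ hs k (k + 1 + 1)).lt_of_ne (e1 ▸ hk).symm
  have hw0 : w ≠ 0 := cross_ne_zero_right (ha.cross_ne k)
  have hwn := norm_pos_iff.2 hw0
  have hNN : cross (nrm a k) (nrm a (k + 1)) = D • w := by
    rw [nrm, nrm, cross_cross, det3_self_right, zero_smul, sub_zero]
  have hpw : inner ℝ p w = 0 := by
    rw [hp, inner_add_left, inner_nrm_succ, inner_nrm_self, add_zero]
  -- An edge orthogonal to `p` is orthogonal to both normals, hence a multiple of `a (k + 1)`, and a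
  -- positive one because both have positive product with `x`. No other edge of an embedded star has
  -- this direction.
  have hpi : ∀ i, i ≠ k + 1 → 0 < inner ℝ p (a i) := by
    intro i hi
    rw [hp, inner_add_left]
    refine (add_nonneg (hs k i) (hs (k + 1) i)).lt_of_ne fun h0 => ?_
    have h1 : inner ℝ (nrm a k) (a i) = 0 := by linarith [hs k i, hs (k + 1) i]
    have h2 : inner ℝ (nrm a (k + 1)) (a i) = 0 := by linarith [hs k i, hs (k + 1) i]
    have hcr : cross w (a i) = 0 := by
      have h3 : cross (cross (nrm a k) (nrm a (k + 1))) (a i) = 0 := by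
        have h4 := h1; have h5 := h2
        rw [inner_eq_coords] at h4 h5
        refine ext_coords ?_ ?_ ?_ <;> simp only [cross_apply_zero, cross_apply_one, cross_apply_two,
          PiLp.zero_apply]
        · linear_combination nrm a (k + 1) 0 * h4 - nrm a k 0 * h5
        · linear_combination nrm a (k + 1) 1 * h4 - nrm a k 1 * h5
        · linear_combination nrm a (k + 1) 2 * h4 - nrm a k 2 * h5
      have h4 := cross_smul_smul w (a i) D 1
      rw [← hNN, one_smul, h3, mul_one] at h4
      exact (smul_eq_zero.1 h4.symm).resolve_left hDpos.ne'
    have hai := exists_smul_of_cross_eq_zero hw0 hcr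
    set r := inner ℝ w (a i) / ‖w‖ ^ 2
    have hr : 0 < r := by
      have h3 := hx i
      rw [hai, real_inner_smul_right] at h3
      exact (mul_pos_iff_of_pos_right (hx (k + 1))).1 h3
    have hww : cross w w = 0 := cross_self_eq_zero w
    rcases (isStar_iff.1 ha).2.2 i (k + 1) hi (a i) ⟨1, 0, zero_le_one, le_rfl, by simp⟩
      ⟨r, 0, hr.le, le_rfl, by rw [zero_smul, add_zero]; exact hai⟩ with ⟨h3, -⟩ | ⟨h3, -⟩ | h3
    · apply ha.cross_ne i
      rw [← h3, ← hw, hai]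
      have h4 := cross_smul_smul w w r 1
      rwa [one_smul, hww, smul_zero] at h4
    · apply ha.cross_ne (k + 1)
      rw [← h3, ← hw, hai]
      have h4 := cross_smul_smul w w 1 r
      rwa [one_smul, hww, smul_zero] at h4
    · exact cross_ne_zero_left (ha.cross_ne i) h3
  set u : E3 := (‖w‖⁻¹ : ℝ) • w with hu
  have hp0 : p ≠ 0 := by
    have := hpi k (EmbeddedStar.add_one_ne ha.three_le k).symm
    rintro h; simp [h] at this
  have hmem : ∀ j, p ∈ sector (nrm a j) (nrm a (j + 1)) ↔ j = k := by
    intro j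
    constructor
    · rintro ⟨s, t, -, -, he⟩
      by_contra hjk
      have := hpi (j + 1) fun h => hjk (add_right_cancel h)
      rw [he, inner_add_left, real_inner_smul_left, real_inner_smul_left, inner_nrm_succ,
        inner_nrm_self] at this
      simp at this
    · rintro rfl
      exact ⟨1, 1, zero_le_one, zero_le_one, by simp [hp]⟩
  have hdu : 0 < det3 u (nrm a k) (nrm a (k + 1)) := by
    rw [← inner_cross, hNN, hu, real_inner_smul_left, real_inner_smul_right,
      real_inner_self_eq_norm_sq]
    positivity
  classical
  have hcross := eventually_wind_crossing him (p := p) (u := u) hp0 (fun j s hs' he => by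
      by_cases hjk : j = k + 1
      · have := hpi (j + 1) (by rw [← hjk]; exact EmbeddedStar.add_one_ne ha.three_le j)
        rw [he, real_inner_smul_left, inner_nrm_succ] at this
        simp at this
      · have := hpi j hjk
        rw [he, real_inner_smul_left, inner_nrm_self] at this
        simp at this)
    (fun j hj => by rw [(hmem j).1 hj]; exact hdu.ne')
  have hsum : (∑ j, if p ∈ sector (nrm a j) (nrm a (j + 1)) then
      ((SignType.sign (det3 u (nrm a j) (nrm a (j + 1))) : SignType) : ℤ) else 0) = 1 := by
    simp only [hmem, Finset.sum_ite_eq', Finset.mem_univ, if_true, sign_pos hdu, SignType.coe_one]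
  rw [hsum] at hcross
  have huw : inner ℝ u w = ‖w‖ := by
    rw [hu, real_inner_smul_left, real_inner_self_eq_norm_sq]; field_simp
  have hsin : ∀ᶠ t : ℝ in 𝓝[>] 0, 0 < Real.sin t := by
    filter_upwards [eventually_pos_nhdsGT, nhdsWithin_le_nhds (eventually_lt_nhds Real.pi_pos)]
      with t h1 h2
    exact Real.sin_pos_of_pos_of_lt_pi h1 h2
  have hin : ∀ᶠ t : ℝ in 𝓝[>] 0, ∀ i, 0 < inner ℝ (Real.cos t • p + Real.sin t • u) (a i) := by
    refine eventually_all.2 fun i => ?_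
    by_cases hi : i = k + 1
    · filter_upwards [hsin] with t ht
      rw [hi, ← hw, inner_add_left, real_inner_smul_left, real_inner_smul_left, hpw, huw]
      simp only [mul_zero, zero_add]; positivity
    · have hc : Continuous fun t : ℝ => inner ℝ (Real.cos t • p + Real.sin t • u) (a i) := by
        fun_prop
      refine nhdsWithin_le_nhds (hc.continuousAt.eventually (lt_mem_nhds ?_))
      simpa using hpi i hi
  obtain ⟨t, ht, hts, hti⟩ := (hcross.and (hsin.and hin)).exists
  have h0 : wind a (Real.cos t • p - Real.sin t • u) = 0 :=
    ha.wind_eq_zero hs (v := w) (fun j => hs j (k + 1)) (by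
      rw [inner_sub_left, real_inner_smul_left, real_inner_smul_left, hpw, huw]
      simp only [mul_zero, zero_sub, neg_lt_zero]; positivity)
  rw [h0] at ht
  have hB : Convex ℝ {y : E3 | ∀ j, 0 < inner ℝ y (a j)} := by
    have : {y : E3 | ∀ j, 0 < inner ℝ y (a j)} = ⋂ j, {y : E3 | 0 < inner ℝ y (a j)} := by
      ext y; simp
    rw [this]
    exact convex_iInter fun j => convex_halfSpace_gt (f := fun x : E3 => inner ℝ x (a j))
      ⟨fun x y => inner_add_left x y _, fun r x => real_inner_smul_left x _ r⟩ 0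
  rw [him.wind_eq_of_isPreconnected hB.isPreconnected (fun y hy hmem => by
    obtain ⟨j, hj⟩ := exists_inner_eq_zero_of_mem_normalCone hmem
    exact (hy j).ne' hj) hx hti, ht]
  simp

end

end PolyhedralSurface

namespace PolyhedralSurface

noncomputable section

/-! ### The winding number -/

open Filter

variable {n : ℕ} [NeZero n]

namespace EmbeddedStar

variable {S : EmbeddedStar n}

theorem wind_eq_of_mem_component {ξ η : E3} (h : η ∈ S.component ξ) :
    wind S.dir η = wind S.dir ξ := by
  have hξ : ξ ∈ unitSphere \ S.gaussImage := by
    by_contra hn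
    rw [component, connectedComponentIn_eq_empty hn] at h
    exact h
  exact S.isStar_dir.immersed.wind_eq_of_isPreconnected isPreconnected_connectedComponentIn
    (fun x hx => (mem_sphere_diff_iff.1 (connectedComponentIn_subset _ _ hx)).2) h
    (mem_connectedComponentIn hξ)

theorem wind_crossing {p u : E3} (hp : ‖p‖ = 1) (hv : ∀ k, p ≠ S.normal k)
    (hu : ∀ k, p ∈ S.arc k → inner ℝ u (cross (S.normal k) (S.normal (k + 1))) ≠ 0) :
    ∀ᶠ t : ℝ in 𝓝[>] 0, wind S.dir (Real.cos t • p + Real.sin t • u) =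
      wind S.dir (Real.cos t • p - Real.sin t • u) + (S.crossingNumber p u : ℤ) := by
  classical
  have hp0 : p ≠ 0 := fun h => by simp [h] at hp
  have hdet : ∀ k, ∃ r : ℝ, 0 < r ∧ inner ℝ u (cross (S.normal k) (S.normal (k + 1))) =
      r * det3 u (nrm S.dir k) (nrm S.dir (k + 1)) := fun k =>
    ⟨_, mul_pos (inv_pos.2 (S.norm_nrm_pos k)) (inv_pos.2 (S.norm_nrm_pos (k + 1))), by
      rw [S.normal_eq, S.normal_eq, cross_smul_smul, real_inner_smul_right, inner_cross]⟩
  have harc : ∀ k, p ∈ S.arc k ↔ p ∈ sector (nrm S.dir k) (nrm S.dir (k + 1)) := fun k => by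
    rw [S.mem_arc_iff, and_iff_right hp]
  have := eventually_wind_crossing S.isStar_dir.immersed (p := p) (u := u) hp0
    (fun k s hs he => by
      have hn := S.norm_nrm_pos k
      apply hv k
      rw [he, norm_smul, Real.norm_eq_abs, abs_of_nonneg hs] at hp
      rw [he, S.normal_eq, eq_inv_of_mul_eq_one_left hp])
    (fun k hk h0 => by
      obtain ⟨r, -, hr⟩ := hdet k
      exact hu k ((harc k).2 hk) (by rw [hr, h0, mul_zero]))
  have hsum : S.crossingNumber p u = ∑ k, if p ∈ sector (nrm S.dir k) (nrm S.dir (k + 1)) then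
      ((SignType.sign (det3 u (nrm S.dir k) (nrm S.dir (k + 1))) : SignType) : ℤ) else 0 := by
    refine Finset.sum_congr rfl fun k _ => ?_
    obtain ⟨r, hr, he⟩ := hdet k
    simp only [harc, he, sign_mul, sign_pos hr, one_mul]
  rw [hsum]
  exact this

theorem wind_deformation {S : unitInterval → EmbeddedStar n}
    (ha : Continuous fun t => (S t).apex) (hn : ∀ k, Continuous fun t => (S t).nbr k) {ξ : E3}
    (hξ : ξ ∈ unitSphere) (h : ∀ t, ξ ∉ (S t).gaussImage) :
    wind (S 0).dir ξ = wind (S 1).dir ξ := by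
  refine eq_of_locally_eq (f := fun t => wind (S t).dir ξ) isPreconnected_univ (fun t _ => ?_)
    trivial trivial
  have hc : Continuous fun t => ((S t).dir, ξ) :=
    (continuous_pi fun k => (hn k).sub ha).prodMk continuous_const
  have hoff := mem_sphere_diff_iff.1 ⟨hξ, h t⟩
  have hξ0 : ξ ≠ 0 := fun h0 => hoff.2 (h0 ▸ zero_mem_normalCone _)
  exact hc.continuousAt.eventually (eventually_wind_eq (S t).isStar_dir.immersed hξ0 fun k hk =>
    hoff.2 (Set.mem_iUnion.2 ⟨k, hk⟩))

/-- Negating the edges changes neither normals nor `wind`, so the normals may be assumed to point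
inwards. -/
theorem IsConvex.exists_isStar (h : S.IsConvex) : ∃ b : Fin n → E3, IsStar b ∧ FacesSupport b ∧
    nrm b = nrm S.dir ∧ wind b = wind S.dir := by
  rcases h.facesSupport with h | h
  · exact ⟨_, S.isStar_dir, h, rfl, rfl⟩
  · exact ⟨_, S.isStar_dir.neg, h, nrm_neg _, wind_neg _⟩

theorem subset_component {ξ v : E3} (hξ : ‖ξ‖ = 1) (hv : ∀ k, 0 ≤ inner ℝ (nrm S.dir k) v)
    (h : inner ℝ ξ v < 0) {η : E3} (hη : ‖η‖ = 1) (h' : inner ℝ η v < 0) : η ∈ S.component ξ := by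
  have := normalize_mem_component (S := S) (convex_inner_neg v).isPreconnected
    (fun x hx => notMem_normalCone hv hx) h h'
  simpa only [hξ, hη, inv_one, one_smul] using this

/-- The winding number for a convex corner, and the areas of the components. -/
theorem IsConvex.wind_componentArea (h : S.IsConvex) {ξ : E3} (hξ : ξ ∈ unitSphere \ S.gaussImage) :
    (wind S.dir ξ = 0 ∧ ENNReal.ofReal (2 * Real.pi) ≤ S.componentArea ξ) ∨
      (wind S.dir ξ = 1 ∧ S.componentArea ξ ≤ ENNReal.ofReal (2 * Real.pi)) := by
  obtain ⟨b, hb, hs, hN, hW⟩ := h.exists_isStar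
  -- A point with nonzero value is in no hemisphere of `wind_eq_zero`, hence in the dual cone, and
  -- in its interior since it is off the Gauss image. This confines the component with value 1 to a
  -- hemisphere.
  have key : ∀ η ∈ unitSphere \ S.gaussImage, wind S.dir η ≠ 0 → ∀ j, 0 < inner ℝ η (b j) := by
    intro η hη h0
    refine hs.inner_pos hb.immersed ?_ fun v hv => ?_
    · rw [normalCone, hN]; exact (mem_sphere_diff_iff.1 hη).2
    · by_contra! hneg
      exact h0 (by rw [← hW]; exact hb.wind_eq_zero hs hv hneg)
  by_cases hv : ∃ v, (∀ k, 0 ≤ inner ℝ (nrm b k) v) ∧ inner ℝ ξ v < 0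
  · left
    obtain ⟨v, hv, hneg⟩ := hv
    refine ⟨by rw [← hW]; exact hb.wind_eq_zero hs hv hneg, ?_⟩
    rw [hN] at hv
    have hv0 : v ≠ 0 := fun h => by simp [h] at hneg
    rw [← sphereArea_hemisphere hv0]
    exact measure_mono fun η hη => subset_component (mem_sphere_diff_iff.1 hξ).1 hv hneg
      (mem_sphere_zero_iff_norm.1 η.2) hη
  · right
    push Not at hv
    have hpos := hs.inner_pos hb.immersed
      (by rw [normalCone, hN]; exact (mem_sphere_diff_iff.1 hξ).2) hv
    have h1 : wind S.dir ξ = 1 := by rw [← hW]; exact hb.wind_eq_one hs hpos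
    refine ⟨h1, ?_⟩
    have hb0 : -b 0 ≠ 0 := neg_ne_zero.2 (cross_ne_zero_left (hb.cross_ne 0))
    rw [← sphereArea_hemisphere hb0]
    refine measure_mono fun η hη => ?_
    have := key η (connectedComponentIn_subset _ _ hη) (by
      rw [wind_eq_of_mem_component hη, h1]; exact one_ne_zero) 0
    change inner ℝ (η : E3) (-b 0) < 0
    rw [inner_neg_right]; linarith

/-- Values at convex corners are prescribed only for components of area different from 2π, so such a
component has to be exhibited. Two neighbouring edges give two different hemispheres off the Gauss
image that overlap in `ξ`; their union is larger than a hemisphere. -/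
theorem IsConvex.exists_componentArea_gt (h : S.IsConvex) :
    ∃ ξ ∈ unitSphere \ S.gaussImage, ENNReal.ofReal (2 * Real.pi) < S.componentArea ξ := by
  obtain ⟨b, hb, hs, hN, -⟩ := h.exists_isStar
  have hv : ∀ j k, 0 ≤ inner ℝ (nrm S.dir k) (b j) := fun j k => by rw [← hN]; exact hs k j
  have hc := hb.cross_ne 0
  set p := b 0 with hp
  set q := b (0 + 1) with hq
  have hp0 := cross_ne_zero_left hc
  have hq0 := cross_ne_zero_right hc
  have hL := norm_cross_sq p q
  have hLp : 0 < ‖cross p q‖ := norm_pos_iff.2 hc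
  have hpn := norm_pos_iff.2 hp0
  have hqn := norm_pos_iff.2 hq0
  have hlt : |inner ℝ p q| < ‖p‖ * ‖q‖ := by
    refine abs_lt_of_sq_lt_sq ?_ (by positivity)
    nlinarith [pow_pos hLp 2]
  rw [abs_lt] at hlt
  set x : E3 := -(‖q‖ • p + ‖p‖ • q) with hx
  set z : E3 := ‖q‖ • p - ‖p‖ • q with hz
  have hqp : inner ℝ q p = inner ℝ p q := real_inner_comm _ _
  have hxp : inner ℝ x p < 0 := by
    rw [hx, inner_neg_left, inner_add_left, real_inner_smul_left, real_inner_smul_left,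
      real_inner_self_eq_norm_sq, hqp, neg_lt_zero]
    nlinarith
  have hxq : inner ℝ x q < 0 := by
    rw [hx, inner_neg_left, inner_add_left, real_inner_smul_left, real_inner_smul_left,
      real_inner_self_eq_norm_sq, neg_lt_zero]
    nlinarith
  have hzp : 0 < inner ℝ z p := by
    rw [hz, inner_sub_left, real_inner_smul_left, real_inner_smul_left,
      real_inner_self_eq_norm_sq, hqp]
    nlinarith
  have hzq : inner ℝ z q < 0 := by
    rw [hz, inner_sub_left, real_inner_smul_left, real_inner_smul_left,
      real_inner_self_eq_norm_sq]
    nlinarith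
  have hnorm : ∀ {y v : E3}, y ≠ 0 → (inner ℝ ((‖y‖⁻¹ : ℝ) • y) v < 0 ↔ inner ℝ y v < 0) := by
    intro y v hy
    rw [real_inner_smul_left, mul_neg_iff]
    have := inv_pos.2 (norm_pos_iff.2 hy)
    constructor
    · rintro (h | h)
      · exact h.2
      · linarith [h.1]
    · exact fun h => Or.inl ⟨this, h⟩
  have hx0 : x ≠ 0 := fun h => by simp [h] at hxp
  have hz0 : z ≠ 0 := fun h => by simp [h] at hzp
  set ξ : E3 := (‖x‖⁻¹ : ℝ) • x with hξ
  have hξn : ‖ξ‖ = 1 := norm_normalize hx0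
  have hξp : inner ℝ ξ p < 0 := (hnorm hx0).2 hxp
  have hξq : inner ℝ ξ q < 0 := (hnorm hx0).2 hxq
  refine ⟨ξ, mem_sphere_diff_iff.2 ⟨hξn, notMem_normalCone (hv 0) hξp⟩, ?_⟩
  set A := {η : Metric.sphere (0 : E3) 1 | inner ℝ (η : E3) p < 0}
  set U := {η : Metric.sphere (0 : E3) 1 | inner ℝ (η : E3) (-p) < 0 ∧ inner ℝ (η : E3) q < 0}
  have hc' : ∀ v : E3, Continuous fun η : Metric.sphere (0 : E3) 1 => inner ℝ (η : E3) v :=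
    fun v => by fun_prop
  have hUo : IsOpen U := (isOpen_lt (hc' (-p)) continuous_const).inter
    (isOpen_lt (hc' q) continuous_const)
  have hU : 0 < sphereArea U := by
    refine hUo.measure_pos _ ⟨⟨(‖z‖⁻¹ : ℝ) • z, mem_sphere_zero_iff_norm.2 (norm_normalize hz0)⟩, ?_, ?_⟩
    · exact (hnorm hz0).2 (by rw [inner_neg_right]; linarith)
    · exact (hnorm hz0).2 hzq
  have hAU : Disjoint A U := Set.disjoint_left.2 fun η h1 h2 => by
    have h3 : inner ℝ (η : E3) p < 0 := h1
    have h4 : inner ℝ (η : E3) (-p) < 0 := h2.1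
    rw [inner_neg_right] at h4
    linarith
  have hsub : A ∪ U ⊆ {η : Metric.sphere (0 : E3) 1 | (η : E3) ∈ S.component ξ} := by
    rintro η (h | h)
    · exact subset_component hξn (hv 0) hξp (mem_sphere_zero_iff_norm.1 η.2) h
    · exact subset_component hξn (hv (0 + 1)) hξq (mem_sphere_zero_iff_norm.1 η.2) h.2
  refine lt_of_lt_of_le ?_ (measure_mono hsub)
  rw [measure_union hAU hUo.measurableSet, sphereArea_hemisphere hp0]
  exact ENNReal.lt_add_right ENNReal.ofReal_ne_top hU.ne'

/-- The winding number is an integer off the Gauss image. -/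
theorem exists_int_wind_eq (S : EmbeddedStar n) {ξ : E3} (hξ : ξ ∈ unitSphere \ S.gaussImage) :
    ∃ j : ℤ, wind S.dir ξ = j := by
  -- Since `wind` jumps by integers, its fractional part has no jumps. It therefore agrees with that
  -- of a convex corner, which is 0; this rules out proper half-integers.
  obtain ⟨S', h0, hc, hd⟩ := exists_convex_eq (d := fun S ξ => Int.fract (wind S.dir ξ))
    (fun S => ⟨fun ξ η _ hη => by simp only [wind_eq_of_mem_component hη],
      fun p u hp _ _ hv hi => by
        filter_upwards [wind_crossing hp hv hi] with t ht
        rw [ht, Int.fract_add_intCast]⟩)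
    (fun S ha hn ξ hξ h => by simp only [wind_deformation ha hn hξ h]) S
  have hconv : S'.IsConvex := by
    obtain ⟨C, hC, hF⟩ := hc
    exact ⟨C, hC, by rw [hF, S'.cone_eq h0]⟩
  obtain ⟨ξ', hξ', hlt⟩ := hconv.exists_componentArea_gt
  have hw : wind S'.dir ξ' = 0 := by
    rcases hconv.wind_componentArea hξ' with h | h
    · exact h.1
    · exact absurd h.2 (not_le.2 hlt)
  have := hd ξ hξ ξ' hξ'
  simp only [hw, Int.fract_zero] at this
  exact ⟨⌊wind S.dir ξ⌋, by rw [← Int.self_sub_fract, this, sub_zero]⟩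

/-- The winding number of the Gauss image around a point off the Gauss image. -/
def winding (n : ℕ) [NeZero n] (S : EmbeddedStar n) (ξ : E3) : ℤ := ⌊wind S.dir ξ⌋

theorem winding_eq {ξ : E3} (hξ : ξ ∈ unitSphere \ S.gaussImage) :
    (winding n S ξ : ℝ) = wind S.dir ξ := by
  obtain ⟨j, hj⟩ := S.exists_int_wind_eq hξ
  rw [winding, hj, Int.floor_intCast]

end EmbeddedStar

open EmbeddedStar

theorem isWindingNumber_winding : IsWindingNumber winding where
  const_on_components n _ S ξ η _ hη := by rw [winding, winding, wind_eq_of_mem_component hη]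
  crossing n _ S p u hp _ _ hv hi := by
    filter_upwards [wind_crossing hp hv hi] with t ht
    rw [winding, winding, ht, Int.floor_add_intCast]
  deformation n _ S ha hn ξ hξ h := by rw [winding, winding, wind_deformation ha hn hξ h]
  convex n _ S hS ξ hξ := by
    rcases hS.wind_componentArea hξ with h | h
    · refine ⟨fun h' => absurd h.2 (not_le.2 h'), fun _ => ?_⟩
      rw [winding, h.1, Int.floor_zero]
    · refine ⟨fun _ => ?_, fun h' => absurd h.2 (not_le.2 h')⟩
      rw [winding, h.1, Int.floor_one]

/-- The difference of two winding numbers has no jumps, and at a convex corner it vanishes on the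
component of large area. -/
theorem IsWindingNumber.eq {w w' : ∀ (n : ℕ) [NeZero n], EmbeddedStar n → E3 → ℤ}
    (hw : IsWindingNumber w) (hw' : IsWindingNumber w') (S : EmbeddedStar n) {ξ : E3}
    (hξ : ξ ∈ unitSphere \ S.gaussImage) : w' n S ξ = w n S ξ := by
  obtain ⟨S', h0, hc, hd⟩ := exists_convex_eq (d := fun S ξ => w' n S ξ - w n S ξ)
    (fun S => ⟨fun ξ η hξ hη => by
        simp only [hw.const_on_components n S ξ η hξ hη, hw'.const_on_components n S ξ η hξ hη],
      fun p u hp hu hpu hv hi => by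
        filter_upwards [hw.crossing n S p u hp hu hpu hv hi, hw'.crossing n S p u hp hu hpu hv hi]
          with t h1 h2
        rw [h1, h2, add_sub_add_right_eq_sub]⟩)
    (fun S ha hn ξ hξ h => by
      simp only [hw.deformation n S ha hn ξ hξ h, hw'.deformation n S ha hn ξ hξ h]) S
  have hconv : S'.IsConvex := by
    obtain ⟨C, hC, hF⟩ := hc
    exact ⟨C, hC, by rw [hF, S'.cone_eq h0]⟩
  obtain ⟨ξ', hξ', hlt⟩ := hconv.exists_componentArea_gt
  have := hd ξ hξ ξ' hξ'
  simp only [(hw.convex n S' hconv ξ' hξ').2 hlt, (hw'.convex n S' hconv ξ' hξ').2 hlt,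
    sub_self] at this
  exact sub_eq_zero.1 this

namespace EmbeddedStar

theorem measurableSet_notMem_gaussImage (S : EmbeddedStar n) :
    MeasurableSet {ξ : Metric.sphere (0 : E3) 1 | (ξ : E3) ∉ S.gaussImage} := by
  have : {ξ : Metric.sphere (0 : E3) 1 | (ξ : E3) ∉ S.gaussImage} =
      Subtype.val ⁻¹' (normalCone S.dir)ᶜ := by
    ext ξ
    have := mem_sphere_diff_iff (S := S) (x := (ξ : E3))
    have h1 := mem_sphere_zero_iff_norm.1 ξ.2
    exact ⟨fun h => (this.1 ⟨ξ.2, h⟩).2, fun h => (this.2 ⟨h1, h⟩).2⟩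
  rw [this]
  exact (S.isStar_dir.immersed.isClosed_normalCone.isOpen_compl.preimage
    continuous_subtype_val).measurableSet

theorem integrableOn_winding (S : EmbeddedStar n) :
    IntegrableOn (fun ξ : Metric.sphere (0 : E3) 1 => (winding n S (ξ : E3) : ℝ))
      {ξ : Metric.sphere (0 : E3) 1 | (ξ : E3) ∉ S.gaussImage} sphereArea :=
  (integrable_wind S.dir).integrableOn.congr_fun
    (fun ξ hξ => (winding_eq ⟨ξ.2, hξ⟩).symm) S.measurableSet_notMem_gaussImage

/-- The Gauss image lies on finitely many great circles, so the integral may be taken over the whole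
sphere, where `winding` can be replaced by `wind`. -/
theorem algebraicArea_winding (S : EmbeddedStar n) : algebraicArea winding S = S.angleDeficit := by
  rw [algebraicArea, ← S.integral_wind, setIntegral_congr_fun S.measurableSet_notMem_gaussImage
    (fun ξ hξ => winding_eq (S := S) ⟨ξ.2, hξ⟩), Measure.restrict_eq_self_of_ae_mem]
  rw [ae_iff]
  refine measure_mono_null (fun ξ hξ => ?_) S.gaussImage_null
  by_contra h
  exact hξ (mem_sphere_diff_iff.2 ⟨mem_sphere_zero_iff_norm.1 ξ.2, h⟩).2

end EmbeddedStar

end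

end PolyhedralSurface

theorem theorem2p3 :
    ∃ w : ∀ (n : ℕ) [NeZero n], PolyhedralSurface.EmbeddedStar n → PolyhedralSurface.E3 → ℤ,
      PolyhedralSurface.IsWindingNumber w ∧
      (∀ w' : ∀ (n : ℕ) [NeZero n], PolyhedralSurface.EmbeddedStar n → PolyhedralSurface.E3 → ℤ,
        PolyhedralSurface.IsWindingNumber w' →
        ∀ (n : ℕ) [NeZero n] (S : PolyhedralSurface.EmbeddedStar n),
          ∀ ξ ∈ PolyhedralSurface.unitSphere \ S.gaussImage, w' n S ξ = w n S ξ) ∧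
      ∀ P : Geometry.SimplicialComplex ℝ PolyhedralSurface.E3,
        PolyhedralSurface.IsClosedSimplicialSurface P →
        ∀ v ∈ P.vertices, ∀ (n : ℕ) [NeZero n] (r : Fin n → PolyhedralSurface.E3)
          (h : PolyhedralSurface.IsVertexCycle P v r),
          MeasureTheory.IntegrableOn
            (fun ξ : Metric.sphere (0 : PolyhedralSurface.E3) 1 =>
              (w n h.star (ξ : PolyhedralSurface.E3) : ℝ))
            {ξ : Metric.sphere (0 : PolyhedralSurface.E3) 1 |
              (ξ : PolyhedralSurface.E3) ∉ h.star.gaussImage}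
            PolyhedralSurface.sphereArea ∧
          PolyhedralSurface.algebraicArea w h.star = h.star.angleDeficit := by
  refine ⟨PolyhedralSurface.EmbeddedStar.winding, PolyhedralSurface.isWindingNumber_winding,
    fun w' hw' n _ S ξ hξ => PolyhedralSurface.isWindingNumber_winding.eq hw' S hξ,
    fun P _ v _ n _ r h => ⟨h.star.integrableOn_winding, h.star.algebraicArea_winding⟩⟩
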